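/- **Setting.** A *weight function* is a continuous increasing (in the wide sense) function $\omega:[0,\infty)\to[0,\infty)$ with $\omega=0$ on $[0,1]$ such that: there is $L\ge 1$ with $\omega(2t)\le L(\omega(t)+1)$ for all $t\ge 0$; $\int_1^\infty \omega(t)t^{-2}\,dt<\infty$; $\log t=o(\omega(t))$ as $t\to\infty$; and $\varphi(s)=\omega(e^s)$ is convex on $\mathbb R$. Put $\varphi^*(t)=\sup_{s\ge 0}(st-\varphi(s))$ for $t\ge0$, $\omega(x)=\omega(|x|)$ and $\langle x\rangle=(1+|x|^2)^{1/2}$ for $x$ in any $\mathbb R^k$ (Euclidean norm), and $D=-i\partial$. Let $\mathbb N=\{1,2,\dots\}$ and $\mathbb N_0=\mathbb N\cup\{0\}$. $\mathcal S_\omega(\mathbb R^k)$ is the set of $u\in L^1(\mathbb R^k)$ such that $u$ and $\hat u(\xi)=\int u(x)e^{-i\langle x,\xi\rangle}dx$ are $C^\infty$ and $\sup e^{\lambda\omega}|D^\alpha u|<\infty$, $\sup e^{\lambda\omega}|D^\alpha\hat u|<\infty$ for all $\lambda>0$ and all $\alpha\in\mathbb N_0^k$. Let $m\in\mathbb R$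 and $0<\rho\le 1$. * $\mathrm{GS}^{m,\omega}_\rho$ is the set of $p\in C^\infty(\mathbb R^{2d})$ such that for every $n\in\mathbb N$ there is $C_n>0$ with $$|D_x^\alpha D_\xi^\beta p(x,\xi)|\le C_n\langle(x,\xi)\rangle^{-\rho|\alpha+\beta|}e^{n\rho\varphi^*(|\alpha+\beta|/n)}e^{m\omega(x)}e^{m\omega(\xi)}\quad\text{for all }x,\xi,\alpha,\beta.$$ * $\mathrm{GA}^{m,\omega}_\rho$ is the set of $a\in C^\infty(\mathbb R^{3d})$ such that for every $n\in\mathbb N$ there is $C_n>0$ with $$|D_x^\alpha D_y^\beta D_\xi^\gamma a(x,y,\xi)|\le C_n\Big(\frac{\langle x-y\rangle}{\langle(x,y,\xi)\rangle}\Big)^{\rho|\alpha+\beta+\gamma|}e^{n\rho\varphi^*(|\alpha+\beta+\gamma|/n)}e^{m(\omega(x)+\omega(y)+\omega(\xi))}\quad\text{for all }x,y,\xi,\alpha,\beta,\gamma.$$ * The pseudodifferential operator of an amplitude $a$ is $Af(x)=\int\big(\int e^{i\langle x-y,\xi\rangle}a(x,y,\xi)f(y)\,dy\big)d\xi$ for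 $f\in\mathcal S_\omega(\mathbb R^d)$; for a symbol $p$, $P(x,D)$ is the operator of the amplitude $(x,y,\xi)\mapsto p(x,\xi)$. * An operator $T$ on $\mathcal S_\omega(\mathbb R^d)$ is *$\omega$-regularizing* if it is the pseudodifferential operator of an amplitude in some $\mathrm{GA}^{m',\omega}_\rho$, $m'\in\mathbb R$, and there is $K\in\mathcal S_\omega(\mathbb R^{2d})$ with $Tf(x)=\int K(x,y)f(y)\,dy$ for all $f\in\mathcal S_\omega(\mathbb R^d)$. * $\mathrm{FGS}^{m,\omega}_\rho$ is the set of formal sums $\sum_{j\ge0}a_j$ with $a_j\in C^\infty(\mathbb R^{2d})$ for which there is $R\ge 1$ such that for every $n\in\mathbb N$ there is $D_n>0$ with $$|D_x^\alpha D_\xi^\beta a_j(x,\xi)|\le D_n\langle(x,\xi)\rangle^{-\rho(|\alpha+\beta|+j)}e^{n\rho\varphi^*((|\alpha+\beta|+j)/n)}e^{m\omega(x)}e^{m\omega(\xi)}$$ for all $j,\alpha,\beta$ and all $(x,\xi)$ with $\log(\langle(x,\xi)\rangle/R)\ge\frac nj\varphi^*(\frac jn)$ (the right side is read as $0$ for $j=0$).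 * For $\sum a_j,\sum b_j\in\mathrm{FGS}^{m,\omega}_\rho$, one writes $\sum a_j\sim\sum b_j$ in $\mathrm{FGS}^{m,\omega}_\rho$ if there is $R\ge1$ such that for every $n\in\mathbb N$ there are $D_n>0$ and $N_n\in\mathbb N$ with $$\Big|D_x^\alpha D_\xi^\beta\sum_{j<N}(a_j-b_j)(x,\xi)\Big|\le D_n\langle(x,\xi)\rangle^{-\rho(|\alpha+\beta|+N)}e^{n\rho\varphi^*((|\alpha+\beta|+N)/n)}e^{m\omega(x)}e^{m\omega(\xi)}$$ for all $N\ge N_n$, all $\alpha,\beta$ and all $(x,\xi)$ with $\log(\langle(x,\xi)\rangle/R)\ge\frac nN\varphi^*(\frac Nn)$. A symbol $p$ is identified with the formal sum $p+0+0+\cdots$. **Theorem.** Let $\omega$ be a weight function, $m\in\mathbb R$ and $0<\rho\le1$, and suppose that there is a weight function $\sigma$ with $\omega(t^{1/\rho})=O(\sigma(t))$ as $t\to\infty$. Let $a\in\mathrm{GA}^{m,\omega}_\rho$ and let $A$ be its pseudodifferential operator. Put $M=\max(m,2m)$, so that $M=2m$ if $m\ge0$. Then there are a symbol $p\in\mathrm{GS}^{M,\omega}_\rho$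 and an $\omega$-regularizing operator $\widetilde R$ such that $$Au=P(x,D)u+\widetilde Ru\qquad\text{for all }u\in\mathcal S_\omega(\mathbb R^d),$$ and, in $\mathrm{FGS}^{M,\omega}_\rho$ (in particular, the right-hand side belongs to this class), $$p\sim\sum_{j=0}^\infty p_j,\qquad p_j(x,\xi)=\sum_{|\alpha|=j}\frac1{\alpha!}D_\xi^\alpha\partial_y^\alpha a(x,y,\xi)\Big|_{y=x}.$$ -/

import Mathlib

noncomputable section

/-- `ℝ^n` with its Euclidean norm. -/
abbrev Eucl (n : ℕ) : Type := EuclideanSpace ℝ (Fin n)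

/-- Non-quasianalytic weight functions `ω : [0,∞) → [0,∞)` in the sense of Braun, Meise and Taylor,
normalized by `ω = 0` on `[0,1]`.  Only the values at nonnegative arguments matter
(nonnegativity there follows from `zero_of_le_one` and `mono`). -/
structure IsWeightFunction (ω : ℝ → ℝ) : Prop where
  cont : ContinuousOn ω (Set.Ici 0)
  mono : MonotoneOn ω (Set.Ici 0)
  zero_of_le_one : ∀ t : ℝ, 0 ≤ t → t ≤ 1 → ω t = 0
  doubling : ∃ L : ℝ, 1 ≤ L ∧ ∀ t : ℝ, 0 ≤ t → ω (2 * t) ≤ L * (ω t + 1)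
  nonquasianalytic : MeasureTheory.IntegrableOn (fun t : ℝ => ω t / t ^ 2) (Set.Ioi 1)
  log_isLittleO : Real.log =o[Filter.atTop] ω
  convex_exp : ConvexOn ℝ Set.univ (fun t : ℝ => ω (Real.exp t))

/-- The Young conjugate `φ*(t) = sup_{s ≥ 0} (s t - φ(s))` of `φ(s) = ω(e^s)`. -/
def youngConj (ω : ℝ → ℝ) (t : ℝ) : ℝ :=
  sSup {r : ℝ | ∃ s : ℝ, 0 ≤ s ∧ r = s * t - ω (Real.exp s)}

/-- The derivative `∂_v f` in the direction `v`. -/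
def dirDeriv {F : Type*} [NormedAddCommGroup F] [NormedSpace ℝ F] (v : F) (f : F → ℂ) : F → ℂ :=
  fun z => fderiv ℝ f z v

/-- The multi-index derivative `∂_{v_1}^{α_1} ⋯ ∂_{v_n}^{α_n} f`. -/
def multiDeriv {F : Type*} [NormedAddCommGroup F] [NormedSpace ℝ F] {n : ℕ}
    (v : Fin n → F) (α : Fin n → ℕ) (f : F → ℂ) : F → ℂ :=
  (List.finRange n).foldr (fun i g => (dirDeriv (v i))^[α i] g) f

/-- The standard basis vectors of `ℝ^n`. -/
def stdVec (n : ℕ) (i : Fin n) : Eucl n := EuclideanSpace.single i (1 : ℝ)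

/-- The length `|α|` of a multi-index. -/
def mlen {n : ℕ} (α : Fin n → ℕ) : ℕ := ∑ i, α i

/-- `α! = α_1! ⋯ α_n!`. -/
def mfact {n : ℕ} (α : Fin n → ℕ) : ℕ := ∏ i, (α i).factorial

/-- The Fourier transform `û(ξ) = ∫ u(x) e^{-i⟨x,ξ⟩} dx`. -/
def fourierHat {n : ℕ} (u : Eucl n → ℂ) (ξ : Eucl n) : ℂ :=
  ∫ x : Eucl n, u x * Complex.exp (-(Complex.I * ((inner ℝ x ξ : ℝ) : ℂ)))

/-- Björck's space `S_ω(ℝ^n)`.  As `|D^α u| = |∂^α u|`, the estimates are written with `∂^α`. -/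
def SOmega (ω : ℝ → ℝ) (n : ℕ) : Set (Eucl n → ℂ) :=
  {u | MeasureTheory.Integrable u ∧ ContDiff ℝ (⊤ : ℕ∞) u ∧ ContDiff ℝ (⊤ : ℕ∞) (fourierHat u) ∧
    (∀ l : ℝ, 0 < l → ∀ α : Fin n → ℕ, ∃ C : ℝ, ∀ x : Eucl n,
      Real.exp (l * ω ‖x‖) * ‖multiDeriv (stdVec n) α u x‖ ≤ C) ∧
    (∀ l : ℝ, 0 < l → ∀ α : Fin n → ℕ, ∃ C : ℝ, ∀ ξ : Eucl n,
      Real.exp (l * ω ‖ξ‖) * ‖multiDeriv (stdVec n) α (fourierHat u) ξ‖ ≤ C)}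

/-- `⟨x⟩ = (1 + |x|²)^{1/2}`. -/
def jap {d : ℕ} (x : Eucl d) : ℝ := Real.sqrt (1 + ‖x‖ ^ 2)

/-- `⟨(x,ξ)⟩ = (1 + |x|² + |ξ|²)^{1/2}`. -/
def jap2 {d : ℕ} (x ξ : Eucl d) : ℝ := Real.sqrt (1 + ‖x‖ ^ 2 + ‖ξ‖ ^ 2)

/-- `⟨(x,y,ξ)⟩ = (1 + |x|² + |y|² + |ξ|²)^{1/2}`. -/
def jap3 {d : ℕ} (x y ξ : Eucl d) : ℝ := Real.sqrt (1 + ‖x‖ ^ 2 + ‖y‖ ^ 2 + ‖ξ‖ ^ 2)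

/-- `∂_x^α ∂_ξ^β b` for a function `b(x,ξ)`. -/
def symDeriv {d : ℕ} (α β : Fin d → ℕ) (b : Eucl d × Eucl d → ℂ) : Eucl d × Eucl d → ℂ :=
  multiDeriv (fun i => (stdVec d i, 0)) α (multiDeriv (fun i => (0, stdVec d i)) β b)

/-- `∂_x^α ∂_y^β ∂_ξ^γ a` for a function `a(x,y,ξ)`. -/
def ampDeriv {d : ℕ} (α β γ : Fin d → ℕ) (a : Eucl d × Eucl d × Eucl d → ℂ) :
    Eucl d × Eucl d × Eucl d → ℂ :=
  multiDeriv (fun i => (stdVec d i, 0, 0)) α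
    (multiDeriv (fun i => (0, stdVec d i, 0)) β
      (multiDeriv (fun i => (0, 0, stdVec d i)) γ a))

/-- Global symbols: the class `GS^{m,ω}_ρ`. -/
def IsSymbol {d : ℕ} (ω : ℝ → ℝ) (m ρ : ℝ) (p : Eucl d × Eucl d → ℂ) : Prop :=
  ContDiff ℝ (⊤ : ℕ∞) p ∧
  ∀ n : ℕ, 0 < n → ∃ C : ℝ, 0 < C ∧ ∀ (α β : Fin d → ℕ) (x ξ : Eucl d),
    ‖symDeriv α β p (x, ξ)‖ ≤
      C * (1 / jap2 x ξ ^ (ρ * (mlen (α + β) : ℝ))) *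
        Real.exp (n * ρ * youngConj ω ((mlen (α + β) : ℝ) / n)) *
        Real.exp (m * ω ‖x‖) * Real.exp (m * ω ‖ξ‖)

/-- Global amplitudes: the class `GA^{m,ω}_ρ`. -/
def IsAmplitude {d : ℕ} (ω : ℝ → ℝ) (m ρ : ℝ) (a : Eucl d × Eucl d × Eucl d → ℂ) : Prop :=
  ContDiff ℝ (⊤ : ℕ∞) a ∧
  ∀ n : ℕ, 0 < n → ∃ C : ℝ, 0 < C ∧ ∀ (α β γ : Fin d → ℕ) (x y ξ : Eucl d),
    ‖ampDeriv α β γ a (x, y, ξ)‖ ≤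
      C * (jap (x - y) ^ (ρ * (mlen (α + β + γ) : ℝ)) /
            jap3 x y ξ ^ (ρ * (mlen (α + β + γ) : ℝ))) *
        Real.exp (n * ρ * youngConj ω ((mlen (α + β + γ) : ℝ) / n)) *
        Real.exp (m * (ω ‖x‖ + ω ‖y‖ + ω ‖ξ‖))

/-- The operator of an amplitude, `A f(x) = ∫ (∫ e^{i(x-y)ξ} a(x,y,ξ) f(y) dy) dξ`. -/
def opAmp {d : ℕ} (a : Eucl d × Eucl d × Eucl d → ℂ) (f : Eucl d → ℂ) (x : Eucl d) : ℂ :=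
  ∫ ξ : Eucl d, ∫ y : Eucl d,
    Complex.exp (Complex.I * ((inner ℝ (x - y) ξ : ℝ) : ℂ)) * a (x, y, ξ) * f y

/-- The operator `P(x,D)` of a symbol `p(x,ξ)`: the operator of the amplitude
`(x,y,ξ) ↦ p(x,ξ)`. -/
def opSymbol {d : ℕ} (p : Eucl d × Eucl d → ℂ) : (Eucl d → ℂ) → Eucl d → ℂ :=
  opAmp (fun z => p (z.1, z.2.2))

/-- The point `(x,y)` of `ℝ^{2d}`. -/
def pairVec {d : ℕ} (x y : Eucl d) : Eucl (d + d) :=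
  WithLp.toLp 2 (Fin.append (fun i => x i) (fun i => y i))

/-- `ω`-regularizing operators on `S_ω(ℝ^d)`: pseudodifferential operators (here, with an amplitude
in some class `GA^{m,ω}_ρ`) which are integral operators with a kernel in `S_ω(ℝ^{2d})`. -/
def IsRegularizing {d : ℕ} (ω : ℝ → ℝ) (ρ : ℝ) (T : (Eucl d → ℂ) → Eucl d → ℂ) : Prop :=
  (∃ (m : ℝ) (b : Eucl d × Eucl d × Eucl d → ℂ), IsAmplitude ω m ρ b ∧
    ∀ f ∈ SOmega ω d, ∀ x : Eucl d, T f x = opAmp b f x) ∧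
  ∃ K ∈ SOmega ω (d + d), ∀ f ∈ SOmega ω d, ∀ x : Eucl d,
    T f x = ∫ y : Eucl d, K (pairVec x y) * f y

/-- The region `log(⟨(x,ξ)⟩/R) ≥ (n/j) φ*(j/n)`.  For `j = 0` the right side is `0`,
so that the region is `⟨(x,ξ)⟩ ≥ R`. -/
def InRegion {d : ℕ} (ω : ℝ → ℝ) (R : ℝ) (n j : ℕ) (x ξ : Eucl d) : Prop :=
  (n : ℝ) / (j : ℝ) * youngConj ω ((j : ℝ) / n) ≤ Real.log (jap2 x ξ / R)

/-- Formal sums: the class `FGS^{m,ω}_ρ`. -/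
def IsFormalSum {d : ℕ} (ω : ℝ → ℝ) (m ρ : ℝ) (b : ℕ → Eucl d × Eucl d → ℂ) : Prop :=
  (∀ j, ContDiff ℝ (⊤ : ℕ∞) (b j)) ∧
  ∃ R : ℝ, 1 ≤ R ∧ ∀ n : ℕ, 0 < n → ∃ D : ℝ, 0 < D ∧
    ∀ (j : ℕ) (α β : Fin d → ℕ) (x ξ : Eucl d), InRegion ω R n j x ξ →
      ‖symDeriv α β (b j) (x, ξ)‖ ≤
        D * (1 / jap2 x ξ) ^ (ρ * ((mlen (α + β) : ℝ) + j)) *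
          Real.exp (n * ρ * youngConj ω (((mlen (α + β) : ℝ) + j) / n)) *
          Real.exp (m * ω ‖x‖) * Real.exp (m * ω ‖ξ‖)

/-- Equivalence `∑ a_j ∼ ∑ b_j` of two formal sums in `FGS^{m,ω}_ρ`. -/
def FormalEquiv {d : ℕ} (ω : ℝ → ℝ) (m ρ : ℝ) (a b : ℕ → Eucl d × Eucl d → ℂ) : Prop :=
  IsFormalSum ω m ρ a ∧ IsFormalSum ω m ρ b ∧
  ∃ R : ℝ, 1 ≤ R ∧ ∀ n : ℕ, 0 < n → ∃ (D : ℝ) (N₀ : ℕ), 0 < D ∧ 0 < N₀ ∧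
    ∀ N : ℕ, N₀ ≤ N → ∀ (α β : Fin d → ℕ) (x ξ : Eucl d), InRegion ω R n N x ξ →
      ‖symDeriv α β (fun z => ∑ j ∈ Finset.range N, (a j z - b j z)) (x, ξ)‖ ≤
        D * (1 / jap2 x ξ) ^ (ρ * ((mlen (α + β) : ℝ) + N)) *
          Real.exp (n * ρ * youngConj ω (((mlen (α + β) : ℝ) + N) / n)) *
          Real.exp (m * ω ‖x‖) * Real.exp (m * ω ‖ξ‖)

/-- A symbol `p` as the formal sum `p + 0 + 0 + ⋯`. -/
def symbolSum {d : ℕ} (p : Eucl d × Eucl d → ℂ) : ℕ → Eucl d × Eucl d → ℂ :=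
  fun j => if j = 0 then p else 0

/-- `p_j(x,ξ) = ∑_{|α| = j} (1/α!) D_ξ^α ∂_y^α a(x,y,ξ)|_{y=x}`, where `D = -i∂`. -/
def diagTerm {d : ℕ} (a : Eucl d × Eucl d × Eucl d → ℂ) (j : ℕ) : Eucl d × Eucl d → ℂ :=
  fun z => ∑ α ∈ (Finset.univ : Finset (Fin d)).piAntidiag j,
    (1 / (mfact α : ℂ)) * ((-Complex.I) ^ mlen α * ampDeriv 0 α α a (z.1, z.1, z.2))

end

/-! The symbol comes from the Taylor expansion of the amplitude along the diagonal. The kernel of A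
is, formally, the oscillating integral ∫ e^{i⟨x-y,ξ⟩} a(x,y,ξ) dξ. Replace y by x + t(y-x) in the
amplitude only, and differentiate in t: a factor y - x appears, and on the phase such a factor is a
derivative in ξ, so that integration by parts turns d/dt into the operator Σ D_{ξ_i} ∂_{y_i}
(`hasDerivAt_oscSeg`). Taylor's formula from t = 0 to t = 1 therefore has exactly the terms p_j
(`diagTerm_eq`, `osc_taylor`), and a remainder with N derivatives in y and N in ξ.

The series Σ p_j need not converge. The amplitude is therefore cut into dyadic pieces, located at
⟨(x,ξ)⟩ of size about 2^ν, and the piece of index ν is expanded to a finite order N_ν; p is the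
locally finite sum of these truncated expansions (`symSeries`). The order is supplied by
`Adm.exists_scale`: it is essentially the last one for which the bounds for i derivatives, i ≤ 2N_ν,
stay below 2^{νρi}. This choice balances three needs. The terms that are kept are dominated by a
geometric series, so p satisfies symbol estimates. At every scale met by the region attached to a
large M one has M < N_ν, so p has the expansion Σ p_j. And the remainder of order N_ν is bounded by
a constant times e^{-nω(2^ν)}, for every n.

The cutoff functions of the partition must themselves satisfy estimates of type (ω, ρ). This is
where σ enters: infinitely many averagings, with summable widths adapted to σ, yield compactly
supported bumps with such estimates (`exists_widths`, `exists_bump`, `exists_cutoff`).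

The kernel of the operator of a - p lies in S_ω. Within distance one of the diagonal, this is the
smallness of the Taylor remainder (`exists_norm_osc_le_near`). Farther away, one integrates by parts
in ξ an optimal number M of times; the growth in x - y that the amplitude class allows for M
derivatives is compensated by the division by |x-y|^M (`exists_norm_osc_le_far`). Both bounds
contain a factor 2^{-ν}, so the kernels of the pieces can be summed. To identify the sum with the
operator, one shows that the inner integral in y decays like e^{-ω(ξ)}, uniformly over amplitudes
with the same constants (`exists_norm_integral_amp_le`); dominated convergence then reduces a - p to
finite sums of pieces, for which Fubini's theorem holds.

Throughout, the phrase "for every n there is C_n" is replaced by a single sequence of constants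
(`Adm`). Such sequences absorb geometric factors and Leibniz sums, can be split as V_{k+l} ≤ U_k U_l
(`Adm.exists_split`), and give decay when the number of derivatives is optimized (`Adm.decay`). -/

noncomputable section

/-! ### Weight functions and their Young conjugates -/

namespace IsWeightFunction

variable {ω : ℝ → ℝ} (hω : IsWeightFunction ω)
include hω

lemma nonneg {t : ℝ} (ht : 0 ≤ t) : 0 ≤ ω t := by
  rcases le_total t 1 with h | h
  · exact (hω.zero_of_le_one t ht h).ge
  · rw [← hω.zero_of_le_one 1 zero_le_one le_rfl]
    exact hω.mono (Set.mem_Ici.2 zero_le_one) (Set.mem_Ici.2 ht) h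

lemma le_of_le {s t : ℝ} (hs : 0 ≤ s) (h : s ≤ t) : ω s ≤ ω t :=
  hω.mono hs (hs.trans h) h

/-- The form in which log t = o(ω(t)) is used: e^ω dominates every power. The constant covers the
bounded range of t where the asymptotic bound is not yet available. -/
lemma mul_log_le (A : ℝ) : ∃ C : ℝ, 0 ≤ C ∧ ∀ t : ℝ, 1 ≤ t → A * Real.log t ≤ ω t + C := by
  have h := hω.log_isLittleO.def (c := 1 / (|A| + 1)) (by positivity)
  obtain ⟨x, hx⟩ := Filter.eventually_atTop.1 h
  refine ⟨|A| * |Real.log (max x 1)|, by positivity, fun t ht => ?_⟩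
  have hl : 0 ≤ Real.log t := Real.log_nonneg ht
  have hw := hω.nonneg (zero_le_one.trans ht)
  rcases le_total x t with hxt | hxt
  · have h1 := hx t hxt
    rw [Real.norm_of_nonneg hl, Real.norm_of_nonneg hw, div_mul_eq_mul_div, one_mul,
      le_div_iff₀ (by positivity)] at h1
    have h2 : A * Real.log t ≤ |A| * Real.log t := by gcongr; exact le_abs_self A
    have h3 : 0 ≤ |A| * |Real.log (max x 1)| := by positivity
    nlinarith
  · have h1 : Real.log t ≤ |Real.log (max x 1)| :=
      (Real.log_le_log (by linarith) (hxt.trans (le_max_left _ _))).trans (le_abs_self _)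
    have h2 : A * Real.log t ≤ |A| * |Real.log (max x 1)| :=
      mul_le_mul (le_abs_self A) h1 hl (abs_nonneg A)
    linarith

/-- Doubling iterated q times, where B < 2^q. The alternative `B < 0` only replaces a hypothesis,
and `scale` discards it. -/
lemma scale_le (B : ℝ) : ∃ L : ℝ, 1 ≤ L ∧ ∀ t : ℝ, 0 ≤ t → ω (B * t) ≤ L * (ω t + 1) ∨ B < 0 := by
  obtain ⟨L, hL, h⟩ := hω.doubling
  have key : ∀ q : ℕ, ∃ M : ℝ, 1 ≤ M ∧ ∀ t : ℝ, 0 ≤ t → ω (2 ^ q * t) ≤ M * (ω t + 1) := by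
    intro q
    induction q with
    | zero => exact ⟨1, le_rfl, fun t ht => by simp⟩
    | succ q ih =>
      obtain ⟨M, hM, h'⟩ := ih
      refine ⟨L * (M + 1), by nlinarith, fun t ht => ?_⟩
      have h1 := h (2 ^ q * t) (by positivity)
      have h2 := h' t ht
      have h3 := hω.nonneg ht
      rw [pow_succ', mul_assoc]
      calc _ ≤ L * (ω (2 ^ q * t) + 1) := h1
        _ ≤ L * (M * (ω t + 1) + 1) := by gcongr
        _ ≤ L * ((M + 1) * (ω t + 1)) := by gcongr; nlinarith
        _ = _ := by ring
  obtain ⟨q, hq⟩ := pow_unbounded_of_one_lt B (one_lt_two (α := ℝ))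
  obtain ⟨M, hM, h'⟩ := key q
  refine ⟨M, hM, fun t ht => ?_⟩
  rcases lt_or_ge B 0 with hB | hB
  · exact Or.inr hB
  · exact Or.inl ((hω.le_of_le (by positivity) (by gcongr)).trans (h' t ht))

lemma scale {B : ℝ} (hB : 0 ≤ B) :
    ∃ L : ℝ, 1 ≤ L ∧ ∀ t : ℝ, 0 ≤ t → ω (B * t) ≤ L * (ω t + 1) := by
  obtain ⟨L, hL, h⟩ := hω.scale_le B
  exact ⟨L, hL, fun t ht => (h t ht).resolve_right (not_lt.2 hB)⟩

/-- A convex function lies above the line whose slope is its right derivative, and the slope is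
nonnegative because φ is increasing. These slopes later tell how many derivatives to use at the
scale e^s. -/
lemma subgradient (s : ℝ) : ∃ y : ℝ, 0 ≤ y ∧
    ∀ s' : ℝ, ω (Real.exp s) + y * (s' - s) ≤ ω (Real.exp s') := by
  set φ : ℝ → ℝ := fun t => ω (Real.exp t) with hφ
  have hc : ConvexOn ℝ Set.univ φ := hω.convex_exp
  have key : ∀ s' : ℝ, φ s + derivWithin φ (Set.Ioi s) s * (s' - s) ≤ φ s' := by
    intro s'
    rcases lt_trichotomy s s' with h | h | h
    · have := hc.rightDeriv_le_slope_of_mem_interior (x := s) (y := s') (by simp) (by simp) h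
      rw [slope_def_field, le_div_iff₀ (by linarith)] at this
      linarith
    · simp [h]
    · have := (hc.slope_le_leftDeriv_of_mem_interior (x := s') (y := s) (by simp) (by simp) h).trans
        (hc.leftDeriv_le_rightDeriv_of_mem_interior (x := s) (by simp))
      rw [slope_def_field, div_le_iff₀ (by linarith)] at this
      linarith
  refine ⟨_, ?_, key⟩
  have h1 := key (s - 1)
  have h2 : φ (s - 1) ≤ φ s :=
    hω.le_of_le (Real.exp_pos _).le (Real.exp_le_exp.2 (by linarith))
  linarith

/-- The contribution of a dyadic block to the integral in the nonquasianalyticity condition. -/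
lemma block_le {t : ℝ} (ht : 1 ≤ t) : ω t / (4 * t) ≤ ∫ s in t..2 * t, ω s / s ^ 2 := by
  have hint : IntervalIntegrable (fun s => ω s / s ^ 2) MeasureTheory.volume t (2 * t) := by
    rw [intervalIntegrable_iff_integrableOn_Ioc_of_le (by linarith)]
    exact hω.nonquasianalytic.mono_set fun s hs => lt_of_le_of_lt ht hs.1
  have h : ∫ s in t..2 * t, ω t / (4 * t ^ 2) ≤ ∫ s in t..2 * t, ω s / s ^ 2 := by
    refine intervalIntegral.integral_mono_on (by linarith) (by simp) hint fun s hs => ?_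
    have h0 := hω.nonneg (zero_le_one.trans ht)
    have : s ^ 2 ≤ 4 * t ^ 2 := by nlinarith [hs.1, hs.2]
    have hs0 : 0 < s ^ 2 := by nlinarith [hs.1]
    have := hω.le_of_le (by linarith) hs.1
    have hs' : 0 ≤ ω s := h0.trans this
    gcongr
  refine le_trans (le_of_eq ?_) h
  rw [intervalIntegral.integral_const, smul_eq_mul]
  field_simp
  ring

/-- Convergence of the integral makes its blocks over [t, 2t] tend to zero, while such a block is at
least ω(t)/(4t). Hence ω(t) = o(t). -/
lemma le_linear {ε : ℝ} (hε : 0 < ε) : ∃ C : ℝ, 0 ≤ C ∧ ∀ t : ℝ, 0 ≤ t → ω t ≤ ε * t + C := by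
  have h1 := MeasureTheory.intervalIntegral_tendsto_integral_Ioi (f := fun s => ω s / s ^ 2) 1
    hω.nonquasianalytic Filter.tendsto_id
  have h2 := MeasureTheory.intervalIntegral_tendsto_integral_Ioi (f := fun s => ω s / s ^ 2) 1
    hω.nonquasianalytic (Filter.tendsto_id.const_mul_atTop (zero_lt_two (α := ℝ)))
  have h3 := h2.sub h1
  rw [sub_self] at h3
  obtain ⟨T, hT⟩ := Filter.eventually_atTop.1 (h3.eventually (gt_mem_nhds
    (show (0 : ℝ) < ε / 4 by positivity)))
  set S := max T 1
  have hS : 0 ≤ S := le_trans zero_le_one (le_max_right _ _)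
  refine ⟨ω S, hω.nonneg hS, fun t ht => ?_⟩
  rcases le_total t S with h | h
  · have := hω.le_of_le ht h
    nlinarith
  · have ht1 : 1 ≤ t := (le_max_right _ _).trans h
    have hi : ∀ u : ℝ, 1 ≤ u →
        IntervalIntegrable (fun s => ω s / s ^ 2) MeasureTheory.volume 1 u := fun u hu => by
      rw [intervalIntegrable_iff_integrableOn_Ioc_of_le hu]
      exact hω.nonquasianalytic.mono_set fun s hs => hs.1
    have h4 := hT t ((le_max_left _ _).trans h)
    simp only [id] at h4
    rw [intervalIntegral.integral_interval_sub_left (hi _ (by linarith)) (hi _ ht1)] at h4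
    have h5 := (hω.block_le ht1).trans h4.le
    rw [div_le_iff₀ (by linarith)] at h5
    have := hω.nonneg hS
    nlinarith

/-- Finiteness of φ* rests on log t = o(ω(t)). Without it, `sSup` would take its default value 0. -/
lemma bddAbove_youngConj (t : ℝ) :
    BddAbove {r : ℝ | ∃ s : ℝ, 0 ≤ s ∧ r = s * t - ω (Real.exp s)} := by
  obtain ⟨C, -, hC⟩ := hω.mul_log_le t
  refine ⟨C, ?_⟩
  rintro r ⟨s, hs, rfl⟩
  have := hC (Real.exp s) (Real.one_le_exp hs)
  rw [Real.log_exp] at this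
  linarith

lemma le_youngConj {s : ℝ} (hs : 0 ≤ s) (t : ℝ) : s * t - ω (Real.exp s) ≤ youngConj ω t :=
  le_csSup (hω.bddAbove_youngConj t) ⟨s, hs, rfl⟩

omit hω in
lemma youngConj_le {t b : ℝ} (h : ∀ s : ℝ, 0 ≤ s → s * t - ω (Real.exp s) ≤ b) :
    youngConj ω t ≤ b :=
  csSup_le ⟨_, 0, le_rfl, rfl⟩ (by rintro r ⟨s, hs, rfl⟩; exact h s hs)

lemma youngConj_nonneg (t : ℝ) : 0 ≤ youngConj ω t := by
  have := hω.le_youngConj le_rfl t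
  simpa [hω.zero_of_le_one 1] using this

lemma youngConj_zero : youngConj ω 0 = 0 :=
  le_antisymm (youngConj_le fun s _ => by
    have := hω.nonneg (Real.exp_pos s).le
    simpa using this) (hω.youngConj_nonneg 0)

/-- Termwise s(ct) - φ(s) ≤ c(st - φ(s)), because φ ≥ 0. Superadditivity of φ* and the monotonicity
in n of the weight sequences follow. -/
lemma youngConj_mul_le {c : ℝ} (h0 : 0 ≤ c) (h1 : c ≤ 1) (t : ℝ) :
    youngConj ω (c * t) ≤ c * youngConj ω t :=
  youngConj_le fun s hs => by
    have h2 := mul_le_mul_of_nonneg_left (hω.le_youngConj hs t) h0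
    have h3 := hω.nonneg (Real.exp_pos s).le
    nlinarith

lemma youngConj_mono {s t : ℝ} (h : s ≤ t) : youngConj ω s ≤ youngConj ω t :=
  youngConj_le fun u hu => by
    have := hω.le_youngConj hu t
    nlinarith

lemma youngConj_add_le {x y : ℝ} (hx : 0 ≤ x) (hy : 0 ≤ y) :
    youngConj ω x + youngConj ω y ≤ youngConj ω (x + y) := by
  rcases (add_nonneg hx hy).eq_or_lt with h | h
  · have hx0 : x = 0 := by linarith
    have hy0 : y = 0 := by linarith
    simp [hx0, hy0, hω.youngConj_zero]
  · have h1 := hω.youngConj_mul_le (c := x / (x + y)) (by positivity)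
      ((div_le_one h).2 (by linarith)) (x + y)
    have h2 := hω.youngConj_mul_le (c := y / (x + y)) (by positivity)
      ((div_le_one h).2 (by linarith)) (x + y)
    rw [div_mul_cancel₀ _ h.ne'] at h1 h2
    have h3 : x / (x + y) * youngConj ω (x + y) + y / (x + y) * youngConj ω (x + y)
        = youngConj ω (x + y) := by field_simp
    linarith

lemma two_mul_youngConj_le (x y : ℝ) :
    2 * youngConj ω ((x + y) / 2) ≤ youngConj ω x + youngConj ω y := by
  have : youngConj ω ((x + y) / 2) ≤ (youngConj ω x + youngConj ω y) / 2 :=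
    youngConj_le fun s hs => by
      have h1 := hω.le_youngConj hs x
      have h2 := hω.le_youngConj hs y
      linarith
  linarith

end IsWeightFunction

/-! ### Weight sequences and admissible sequences of constants -/

/-- The sequences `k ↦ e^{n r φ*(k/n)}`. -/
def wt (ω : ℝ → ℝ) (r : ℝ) (n k : ℕ) : ℝ := Real.exp (n * r * youngConj ω ((k : ℝ) / n))

/-- Nonnegative sequences bounded by every `wt ω r n`, up to constants. -/
def Adm (ω : ℝ → ℝ) (r : ℝ) (V : ℕ → ℝ) : Prop :=
  (∀ k, 0 ≤ V k) ∧ ∀ n : ℕ, 0 < n → ∃ C : ℝ, 0 < C ∧ ∀ k, V k ≤ C * wt ω r n k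

lemma wt_pos (ω : ℝ → ℝ) (r : ℝ) (n k : ℕ) : 0 < wt ω r n k := Real.exp_pos _

section
variable {ω : ℝ → ℝ} (hω : IsWeightFunction ω) {r : ℝ} (hr : 0 < r)
include hω hr

lemma one_le_wt (n k : ℕ) : 1 ≤ wt ω r n k :=
  Real.one_le_exp (by have := hω.youngConj_nonneg ((k : ℝ) / n); positivity)

lemma wt_mono_right (n : ℕ) {k l : ℕ} (h : k ≤ l) : wt ω r n k ≤ wt ω r n l := by
  refine Real.exp_le_exp.2 ?_
  have := hω.youngConj_mono (show (k : ℝ) / n ≤ (l : ℝ) / n by gcongr)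
  gcongr

/-- Since φ*(k/n') ≤ (n/n') φ*(k/n), estimates with a larger index are stronger. -/
lemma wt_anti_left {n n' : ℕ} (hn : 0 < n) (h : n ≤ n') (k : ℕ) : wt ω r n' k ≤ wt ω r n k := by
  refine Real.exp_le_exp.2 ?_
  have hn' : (0 : ℝ) < n := by exact_mod_cast hn
  have hn2 : (n : ℝ) ≤ n' := by exact_mod_cast h
  have hn3 : (0 : ℝ) < n' := by linarith
  have h1 := hω.youngConj_mul_le (c := n / n') (by positivity) ((div_le_one hn3).2 hn2) (k / n)
  rw [show (n : ℝ) / n' * (k / n) = k / n' by field_simp] at h1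
  calc (n' : ℝ) * r * youngConj ω (k / n') ≤ n' * r * (n / n' * youngConj ω (k / n)) := by gcongr
    _ = _ := by field_simp

lemma wt_mul_le {n : ℕ} (hn : 0 < n) (k l : ℕ) : wt ω r n k * wt ω r n l ≤ wt ω r n (k + l) := by
  rw [wt, wt, wt, ← Real.exp_add, ← mul_add]
  have h := hω.youngConj_add_le (x := (k : ℝ) / n) (y := (l : ℝ) / n) (by positivity) (by positivity)
  rw [← add_div] at h
  push_cast
  gcongr

/-- Convexity of φ* gives a converse of `wt_mul_le`, at the price of doubling the index. -/
lemma wt_split {n : ℕ} (k l : ℕ) : wt ω r (2 * n) (k + l) ≤ wt ω r n k * wt ω r n l := by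
  rw [wt, wt, wt, ← Real.exp_add, ← mul_add]
  have h := hω.two_mul_youngConj_le ((k : ℝ) / n) ((l : ℝ) / n)
  rw [show ((k : ℝ) / n + l / n) / 2 = ((k + l : ℕ) : ℝ) / (2 * n : ℕ) by
    push_cast; rw [← add_div, div_div, mul_comm (n : ℝ) 2]] at h
  refine Real.exp_le_exp.2 ?_
  calc ((2 * n : ℕ) : ℝ) * r * youngConj ω (((k + l : ℕ) : ℝ) / (2 * n : ℕ))
      = n * r * (2 * youngConj ω (((k + l : ℕ) : ℝ) / (2 * n : ℕ))) := by push_cast; ring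
    _ ≤ _ := by gcongr

/-- Geometric factors are harmless. Doubling says φ(s + log 2) ≤ L(φ(s) + 1); under conjugation the
shift by log 2 becomes a factor 2^{rk}, and the factor L becomes the passage from m to mL. Iteration
reaches any base B. -/
lemma pow_mul_wt_le (B : ℝ) (hB : 0 ≤ B) {n : ℕ} (hn : 0 < n) :
    ∃ n' : ℕ, 0 < n' ∧ ∃ C : ℝ, 0 < C ∧ ∀ k, B ^ k * wt ω r n' k ≤ C * wt ω r n k := by
  obtain ⟨L₀, hL₀, hd⟩ := hω.doubling
  obtain ⟨L, hL⟩ := exists_nat_ge L₀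
  have hL1 : (1 : ℝ) ≤ L := hL₀.trans hL
  have hLpos : 0 < L := by exact_mod_cast (zero_lt_one.trans_le hL1)
  have step : ∀ {m : ℕ}, 0 < m → ∀ k, ((2 : ℝ) ^ r) ^ k * wt ω r (m * L) k
      ≤ Real.exp (m * r * L) * wt ω r m k := by
    intro m hm k
    have hm' : (0 : ℝ) < m := by exact_mod_cast hm
    rw [← Real.rpow_mul_natCast zero_le_two, Real.rpow_def_of_pos zero_lt_two, wt, wt,
      ← Real.exp_add, ← Real.exp_add]
    refine Real.exp_le_exp.2 ?_
    have : youngConj ω ((k : ℝ) / (m * L : ℕ)) ≤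
        (1 / L) * (youngConj ω ((k : ℝ) / m) + L - (k / m) * Real.log 2) := by
      refine IsWeightFunction.youngConj_le fun s hs => ?_
      have h1 := hω.le_youngConj (add_nonneg hs (Real.log_nonneg one_le_two)) ((k : ℝ) / m)
      have h2 := hd (Real.exp s) (Real.exp_pos s).le
      rw [Real.exp_add, Real.exp_log zero_lt_two, mul_comm (Real.exp s)] at h1
      have h3 := hω.nonneg (Real.exp_pos s).le
      have h4 : L₀ * (ω (Real.exp s) + 1) ≤ L * (ω (Real.exp s) + 1) := by gcongr
      rw [one_div, ← div_eq_inv_mul, le_div_iff₀ (by positivity)]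
      push_cast
      have : (s * (k / (m * L)) - ω (Real.exp s)) * L = s * (k / m) - L * ω (Real.exp s) := by
        field_simp
      rw [this]
      linarith
    have h5 := mul_le_mul_of_nonneg_left this (show (0 : ℝ) ≤ (m * L : ℕ) * r by positivity)
    have h6 : ((m * L : ℕ) : ℝ) * r * ((1 / L) * (youngConj ω ((k : ℝ) / m) + L -
        (k / m) * Real.log 2)) = m * r * youngConj ω (k / m) + m * r * L - r * k * Real.log 2 := by
      push_cast; field_simp
    linarith
  have iter : ∀ q : ℕ, ∀ n : ℕ, 0 < n → ∃ n' : ℕ, 0 < n' ∧ ∃ C : ℝ, 0 < C ∧ ∀ k,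
      (((2 : ℝ) ^ r) ^ q) ^ k * wt ω r n' k ≤ C * wt ω r n k := by
    intro q
    induction q with
    | zero => exact fun n hn => ⟨n, hn, 1, one_pos, fun k => by simp⟩
    | succ q ih =>
      intro n hn
      obtain ⟨n', hn', C, hC, h⟩ := ih n hn
      refine ⟨n' * L, by positivity, C * Real.exp (n' * r * L), by positivity, fun k => ?_⟩
      have w1 := wt_pos ω r (n' * L) k
      have w2 := wt_pos ω r n' k
      calc (((2 : ℝ) ^ r) ^ (q + 1)) ^ k * wt ω r (n' * L) k
          = (((2 : ℝ) ^ r) ^ q) ^ k * (((2 : ℝ) ^ r) ^ k * wt ω r (n' * L) k) := by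
            rw [pow_succ, mul_pow]; ring
        _ ≤ (((2 : ℝ) ^ r) ^ q) ^ k * (Real.exp (n' * r * L) * wt ω r n' k) := by
            exact mul_le_mul_of_nonneg_left (step hn' k) (by positivity)
        _ = Real.exp (n' * r * L) * ((((2 : ℝ) ^ r) ^ q) ^ k * wt ω r n' k) := by ring
        _ ≤ Real.exp (n' * r * L) * (C * wt ω r n k) := mul_le_mul_of_nonneg_left (h k) (by positivity)
        _ = _ := by ring
  obtain ⟨q, hq⟩ := pow_unbounded_of_one_lt B (Real.one_lt_rpow one_lt_two hr)
  obtain ⟨n', hn', C, hC, h⟩ := iter q n hn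
  refine ⟨n', hn', C, hC, fun k => le_trans ?_ (h k)⟩
  have := (wt_pos ω r n' k).le
  gcongr

end

namespace Adm
variable {ω : ℝ → ℝ} {r : ℝ} {V V' : ℕ → ℝ}

lemma nonneg (hV : Adm ω r V) (k : ℕ) : 0 ≤ V k := hV.1 k

lemma const_mul (hV : Adm ω r V) {c : ℝ} (hc : 0 ≤ c) : Adm ω r (fun k => c * V k) :=
  ⟨fun k => mul_nonneg hc (hV.1 k), fun n hn => by
    obtain ⟨C, hC, h⟩ := hV.2 n hn
    refine ⟨(c + 1) * C, by positivity, fun k => ?_⟩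
    have := wt_pos ω r n k
    calc c * V k ≤ c * (C * wt ω r n k) := mul_le_mul_of_nonneg_left (h k) (by positivity)
      _ ≤ (c + 1) * (C * wt ω r n k) := by gcongr; linarith
      _ = _ := by ring⟩

lemma add (hV : Adm ω r V) (hV' : Adm ω r V') : Adm ω r (fun k => V k + V' k) :=
  ⟨fun k => add_nonneg (hV.1 k) (hV'.1 k), fun n hn => by
    obtain ⟨C, hC, h⟩ := hV.2 n hn
    obtain ⟨C', hC', h'⟩ := hV'.2 n hn
    exact ⟨C + C', by positivity, fun k => by rw [add_mul]; exact add_le_add (h k) (h' k)⟩⟩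

section
variable (hω : IsWeightFunction ω) (hr : 0 < r)
include hω hr

lemma const {c : ℝ} (hc : 0 ≤ c) : Adm ω r (fun _ => c) :=
  ⟨fun _ => hc, fun n _ => ⟨c + 1, by positivity, fun k => by
    have := one_le_wt hω hr n k
    nlinarith⟩⟩

lemma pow_mul (hV : Adm ω r V) {B : ℝ} (hB : 0 ≤ B) : Adm ω r (fun k => B ^ k * V k) :=
  ⟨fun k => mul_nonneg (by positivity) (hV.1 k), fun n hn => by
    obtain ⟨n', hn', C, hC, h⟩ := pow_mul_wt_le hω hr B hB hn
    obtain ⟨C', hC', h'⟩ := hV.2 n' hn'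
    refine ⟨C' * C, by positivity, fun k => ?_⟩
    have w := wt_pos ω r n' k
    calc B ^ k * V k ≤ B ^ k * (C' * wt ω r n' k) := by gcongr; exact h' k
      _ = C' * (B ^ k * wt ω r n' k) := by ring
      _ ≤ C' * (C * wt ω r n k) := mul_le_mul_of_nonneg_left (h k) (by positivity)
      _ = _ := by ring⟩

/-- The sequence of bounds for the derivatives of a product. -/
lemma leibniz (hV : Adm ω r V) (hV' : Adm ω r V') :
    Adm ω r (fun k => ∑ i ∈ Finset.range (k + 1), (k.choose i : ℝ) * V i * V' (k - i)) := by
  refine ⟨fun k => Finset.sum_nonneg fun i _ => mul_nonneg (mul_nonneg (by positivity) (hV.1 i))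
    (hV'.1 _), fun n hn => ?_⟩
  obtain ⟨n', hn', C₀, hC₀, h₀⟩ := pow_mul_wt_le hω hr 2 zero_le_two hn
  obtain ⟨C, hC, h⟩ := hV.2 n' hn'
  obtain ⟨C', hC', h'⟩ := hV'.2 n' hn'
  refine ⟨C * C' * C₀, by positivity, fun k => ?_⟩
  have w := wt_pos ω r n' k
  calc _ ≤ ∑ i ∈ Finset.range (k + 1), (k.choose i : ℝ) * (C * C' * wt ω r n' k) := by
        refine Finset.sum_le_sum fun i hi => ?_
        rw [mul_assoc]
        refine mul_le_mul_of_nonneg_left ?_ (by positivity)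
        calc V i * V' (k - i) ≤ (C * wt ω r n' i) * (C' * wt ω r n' (k - i)) :=
              mul_le_mul (h _) (h' _) (hV'.1 _) (mul_nonneg hC.le (wt_pos _ _ _ _).le)
          _ = C * C' * (wt ω r n' i * wt ω r n' (k - i)) := by ring
          _ ≤ C * C' * wt ω r n' (i + (k - i)) := by
              gcongr; exact wt_mul_le hω hr hn' _ _
          _ = _ := by rw [Nat.add_sub_cancel' (Nat.lt_succ_iff.1 (Finset.mem_range.1 hi))]
    _ = C * C' * (2 ^ k * wt ω r n' k) := by
        rw [← Finset.sum_mul, ← Nat.cast_sum, Nat.sum_range_choose]; push_cast; ring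
    _ ≤ C * C' * (C₀ * wt ω r n k) := mul_le_mul_of_nonneg_left (h₀ k) (by positivity)
    _ = _ := by ring

/-- Taking U_k as the infimum over n of c_n e^{nrφ*(k/n)} keeps U admissible, and `wt_split` bounds
V_{k+l} by a product of two such expressions. This allows derivatives to be assigned to different
tasks while the constants form one sequence. -/
lemma exists_split (hV : Adm ω r V) : ∃ U : ℕ → ℝ, Adm ω r U ∧ (∀ k, 1 ≤ U k) ∧
    ∀ k l, V (k + l) ≤ U k * U l := by
  choose! C hC h using hV.2
  set c : ℕ → ℝ := fun n => max 1 (C (2 * n)) with hc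
  have hc1 : ∀ n, 1 ≤ c n := fun n => le_max_left _ _
  set U : ℕ → ℝ := fun k => ⨅ n : ℕ, c (n + 1) * wt ω r (n + 1) k with hU
  have hge : ∀ n k, 1 ≤ c n * wt ω r n k := fun n k =>
    one_le_mul_of_one_le_of_one_le (hc1 n) (one_le_wt hω hr n k)
  have hbdd : ∀ k, BddBelow (Set.range fun n : ℕ => c (n + 1) * wt ω r (n + 1) k) := fun k =>
    ⟨1, by rintro _ ⟨n, rfl⟩; exact hge _ _⟩
  have hU1 : ∀ k, 1 ≤ U k := fun k => le_ciInf fun n => hge _ _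
  refine ⟨U, ⟨fun k => zero_le_one.trans (hU1 k), fun n hn => ⟨c n, by linarith [hc1 n],
    fun k => ?_⟩⟩, hU1, fun k l => ?_⟩
  · obtain ⟨m, rfl⟩ := Nat.exists_eq_succ_of_ne_zero hn.ne'
    exact ciInf_le (hbdd k) m
  -- The indices attached to k and l must be independent for the two infima to be taken separately.
  -- The bound on V is used at twice the larger index, and the other factor is then enlarged by
  -- monotonicity.
  · have aux : ∀ k l n m : ℕ, 0 < n → n ≤ m →
        V (k + l) ≤ (c n * wt ω r n k) * (c m * wt ω r m l) := by
      intro k l n m hn hnm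
      have hm : 0 < m := hn.trans_le hnm
      have w1 := wt_pos ω r n k
      have w2 := wt_pos ω r m k
      have w3 := wt_pos ω r m l
      have c1 := hc1 n
      have c2 := hc1 m
      calc V (k + l) ≤ C (2 * m) * wt ω r (2 * m) (k + l) := h _ (by omega) _
        _ ≤ c m * (wt ω r m k * wt ω r m l) := by
            refine mul_le_mul (le_max_right _ _) (wt_split hω hr _ _) (wt_pos _ _ _ _).le (by linarith)
        _ ≤ c m * (wt ω r n k * wt ω r m l) := by
            gcongr; exact wt_anti_left hω hr hn hnm k
        _ = 1 * (c m * (wt ω r n k * wt ω r m l)) := by ring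
        _ ≤ c n * (c m * (wt ω r n k * wt ω r m l)) := by gcongr
        _ = _ := by ring
    have all : ∀ n m : ℕ, V (k + l) ≤ (c (n + 1) * wt ω r (n + 1) k) *
        (c (m + 1) * wt ω r (m + 1) l) := by
      intro n m
      rcases le_total n m with hnm | hnm
      · exact aux k l _ _ (by omega) (by omega)
      · rw [add_comm k l, mul_comm]
        exact aux l k _ _ (by omega) (by omega)
    have h1 : ∀ m : ℕ, V (k + l) ≤ U k * (c (m + 1) * wt ω r (m + 1) l) := by
      intro m
      have hp : 0 < c (m + 1) * wt ω r (m + 1) l := zero_lt_one.trans_le (hge _ _)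
      rw [← div_le_iff₀ hp]
      exact le_ciInf fun n => (div_le_iff₀ hp).2 (all n m)
    have hp : 0 < U k := zero_lt_one.trans_le (hU1 k)
    rw [← div_le_iff₀' hp]
    exact le_ciInf fun m => (div_le_iff₀' hp).2 (h1 m)

end
end Adm

/-! ### Optimal numbers of derivatives and truncation orders -/

section
variable {ω : ℝ → ℝ} (hω : IsWeightFunction ω) {r : ℝ} (hr : 0 < r)
include hω

/-- Young's inequality at s = log t. -/
lemma pow_le_wt {n : ℕ} (hn : 0 < n) (k : ℕ) {t : ℝ} (ht : 1 ≤ t) :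
    t ^ k ≤ wt ω 1 n k * Real.exp (n * ω t) := by
  have hn' : (0 : ℝ) < n := by exact_mod_cast hn
  have h := hω.le_youngConj (Real.log_nonneg ht) ((k : ℝ) / n)
  rw [Real.exp_log (by linarith)] at h
  have h2 := mul_le_mul_of_nonneg_left h hn'.le
  rw [show (n : ℝ) * (Real.log t * (k / n) - ω t) = k * Real.log t - n * ω t by field_simp] at h2
  rw [wt, ← Real.exp_add, ← Real.exp_log (show 0 < t ^ k by positivity), Real.log_pow]
  exact Real.exp_le_exp.2 (by linarith)

/-- One has k! ≤ k^k ≤ e^{nφ*(k/n)} e^{nω(k)}, and ω(t) = o(t) makes the last factor at most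
geometric. It is needed for the derivatives of (x_i - y_i)^{-N}. -/
lemma Adm.factorial : Adm ω 1 (fun k => (k.factorial : ℝ)) := by
  refine ⟨fun k => by positivity, fun n hn => ?_⟩
  obtain ⟨n', hn', C₀, hC₀, h₀⟩ := pow_mul_wt_le hω one_pos (Real.exp 1) (Real.exp_pos _).le hn
  have hn0 : (0 : ℝ) < n' := by exact_mod_cast hn'
  obtain ⟨C, hC, h⟩ := hω.le_linear (ε := 1 / n') (by positivity)
  refine ⟨Real.exp (n' * C) * C₀, by positivity, fun k => ?_⟩
  have key : (k.factorial : ℝ) ≤ Real.exp (n' * C) * (Real.exp 1 ^ k * wt ω 1 n' k) := by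
    rcases Nat.eq_zero_or_pos k with rfl | hk
    · have h1 := one_le_wt hω one_pos n' 0
      have h2 : 1 ≤ Real.exp (n' * C) := Real.one_le_exp (by positivity)
      simp only [Nat.factorial_zero, Nat.cast_one, pow_zero, one_mul]
      nlinarith
    · have hk1 : (1 : ℝ) ≤ k := by exact_mod_cast hk
      have h1 : (k.factorial : ℝ) ≤ (k : ℝ) ^ k := by exact_mod_cast Nat.factorial_le_pow k
      have h2 := pow_le_wt hω hn' k hk1
      have h3 := mul_le_mul_of_nonneg_left (h k (by positivity)) hn0.le
      rw [show (n' : ℝ) * (1 / n' * k + C) = k + n' * C by field_simp] at h3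
      have h4 : Real.exp (n' * ω k) ≤ Real.exp (n' * C) * Real.exp 1 ^ k := by
        rw [← Real.exp_nat_mul, ← Real.exp_add]
        exact Real.exp_le_exp.2 (by linarith)
      have w := wt_pos ω 1 n' k
      calc _ ≤ (k : ℝ) ^ k := h1
        _ ≤ _ := h2
        _ ≤ wt ω 1 n' k * (Real.exp (n' * C) * Real.exp 1 ^ k) :=
            mul_le_mul_of_nonneg_left h4 w.le
        _ = _ := by ring
  refine key.trans ?_
  rw [mul_assoc]
  exact mul_le_mul_of_nonneg_left (h₀ k) (by positivity)

include hr

omit hr in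
lemma Adm.of_le_one {V : ℕ → ℝ} (hr1 : r ≤ 1) (hV : Adm ω r V) : Adm ω 1 V :=
  ⟨hV.1, fun n hn => by
    obtain ⟨C, hC, h⟩ := hV.2 n hn
    refine ⟨C, hC, fun k => (h k).trans (mul_le_mul_of_nonneg_left ?_ hC.le)⟩
    have := hω.youngConj_nonneg ((k : ℝ) / n)
    exact Real.exp_le_exp.2 (by gcongr)⟩

omit hr in
/-- The Young conjugate at a slope not exceeding that of a supporting line. -/
lemma youngConj_floor_le {s y : ℝ} (hs : 0 ≤ s) (hy : 0 ≤ y)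
    (h : ∀ s' : ℝ, ω (Real.exp s) + y * (s' - s) ≤ ω (Real.exp s')) {n : ℕ} (hn : 0 < n) :
    n * youngConj ω ((⌊n * y⌋₊ : ℝ) / n) ≤ (⌊n * y⌋₊ + 1) * s - n * ω (Real.exp s) ∧
    youngConj ω ((⌊n * y⌋₊ : ℝ) / n) ≤ (⌊n * y⌋₊ : ℝ) / n * s := by
  have hn' : (0 : ℝ) < n := by exact_mod_cast hn
  have h1 : (⌊n * y⌋₊ : ℝ) ≤ n * y := Nat.floor_le (by positivity)
  have h2 : n * y < (⌊n * y⌋₊ : ℝ) + 1 := Nat.lt_floor_add_one _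
  have h1' : (⌊n * y⌋₊ : ℝ) / n ≤ y := by rw [div_le_iff₀ hn']; linarith
  have h0 : 0 ≤ (⌊n * y⌋₊ : ℝ) / n := by positivity
  constructor
  · have : youngConj ω ((⌊n * y⌋₊ : ℝ) / n) ≤ y * s - ω (Real.exp s) :=
      IsWeightFunction.youngConj_le fun s' hs' => by
        have := h s'
        nlinarith
    have h3 := mul_le_mul_of_nonneg_left this hn'.le
    nlinarith
  -- Up to s it suffices that φ ≥ 0; beyond s the supporting line, whose slope is at least that of
  -- the conjugate variable, takes over.
  · refine IsWeightFunction.youngConj_le fun s' hs' => ?_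
    have h3 := hω.nonneg (Real.exp_pos s').le
    rcases le_total s' s with hss | hss
    · nlinarith
    · have h4 := h s'
      have h5 := hω.nonneg (Real.exp_pos s).le
      nlinarith

omit hω in
lemma wt_le_rpow {n k : ℕ} {s : ℝ} (h : n * youngConj ω ((k : ℝ) / n) ≤ s) :
    wt ω r n k ≤ Real.exp (r * s) :=
  Real.exp_le_exp.2 (by nlinarith)

/-- One additional multiple of rω absorbs the power t^r, which is the loss caused by rounding the
number of derivatives to an integer. -/
lemma exists_exp_mul_le (n : ℕ) : ∃ n' : ℕ, 0 < n' ∧ ∃ C : ℝ, 0 < C ∧ ∀ t : ℝ, 1 ≤ t →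
    t ^ r * Real.exp (-(n' * r * ω t)) ≤ C * Real.exp (-(n * ω t)) := by
  obtain ⟨C, hC, h⟩ := hω.mul_log_le 1
  obtain ⟨m, hm⟩ := exists_nat_ge ((n : ℝ) / r)
  refine ⟨m + 1, by omega, Real.exp (r * C), by positivity, fun t ht => ?_⟩
  have h1 := h t ht
  have h2 := hω.nonneg (zero_le_one.trans ht)
  rw [div_le_iff₀ hr] at hm
  rw [Real.rpow_def_of_pos (by linarith), ← Real.exp_add, ← Real.exp_add]
  refine Real.exp_le_exp.2 ?_
  push_cast
  nlinarith

/-- Optimizing the number of derivatives gives decay. -/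
lemma Adm.decay {V : ℕ → ℝ} (hV : Adm ω r V) (n : ℕ) : ∃ C : ℝ, 0 < C ∧ ∀ t : ℝ, 1 ≤ t →
    ∃ k : ℕ, V k ≤ C * Real.exp (-(n * ω t)) * t ^ (r * k) := by
  obtain ⟨n', hn', C₁, hC₁, h₁⟩ := exists_exp_mul_le hω hr n
  obtain ⟨C, hC, h⟩ := hV.2 n' hn'
  refine ⟨C * C₁, by positivity, fun t ht => ?_⟩
  have ht0 : 0 < t := by linarith
  have hs := Real.log_nonneg ht
  obtain ⟨y, hy, hsub⟩ := hω.subgradient (Real.log t)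
  obtain ⟨h2, -⟩ := youngConj_floor_le hω hs hy hsub hn'
  rw [Real.exp_log ht0] at h2
  -- The best number of derivatives is n' times the slope of φ at log t, where the supremum in φ*(y)
  -- is attained. Rounding down costs at most t^r.
  refine ⟨⌊n' * y⌋₊, (h _).trans ?_⟩
  have h3 : wt ω r n' ⌊n' * y⌋₊ ≤ t ^ r * Real.exp (-(n' * r * ω t)) * t ^ (r * ⌊n' * y⌋₊) := by
    rw [Real.rpow_def_of_pos ht0, Real.rpow_def_of_pos ht0, ← Real.exp_add, ← Real.exp_add]
    refine (wt_le_rpow hr h2).trans (Real.exp_le_exp.2 ?_)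
    apply le_of_eq; ring
  calc C * wt ω r n' ⌊n' * y⌋₊ ≤ C * (C₁ * Real.exp (-(n * ω t)) * t ^ (r * ⌊n' * y⌋₊)) := by
        gcongr
        exact h3.trans (mul_le_mul_of_nonneg_right (h₁ t ht) (by positivity))
    _ = _ := by ring

omit hr in
-- φ*(t)/t tends to infinity because φ is finite everywhere: test the supremum at the fixed point s
-- = B.
lemma eventually_youngConj_ge (n : ℕ) (hn : 0 < n) (A : ℝ) :
    ∃ N₀ : ℕ, 1 ≤ N₀ ∧ ∀ N : ℕ, N₀ ≤ N → A ≤ (n : ℝ) / N * youngConj ω ((N : ℝ) / n) := by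
  set B := |A| + 1
  have hn' : (0 : ℝ) < n := by exact_mod_cast hn
  have hB : 0 ≤ B := by positivity
  obtain ⟨N₀, hN₀⟩ := exists_nat_ge (n * ω (Real.exp B))
  refine ⟨N₀ + 1, by omega, fun N hN => ?_⟩
  have hN' : ((N₀ + 1 : ℕ) : ℝ) ≤ N := by exact_mod_cast hN
  push_cast at hN'
  have hN0 : (0 : ℝ) < N := by linarith [(Nat.cast_nonneg N₀ : (0 : ℝ) ≤ N₀)]
  have h := hω.le_youngConj hB ((N : ℝ) / n)
  have h2 := mul_le_mul_of_nonneg_left h (show (0 : ℝ) ≤ n / N by positivity)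
  rw [show (n : ℝ) / N * (B * (N / n) - ω (Real.exp B)) = B - n * ω (Real.exp B) / N by
    field_simp] at h2
  have h3 : n * ω (Real.exp B) / N ≤ 1 := (div_le_one hN0).2 (by linarith)
  have : A ≤ |A| := le_abs_self A
  have hBd : B = |A| + 1 := rfl
  linarith

set_option maxHeartbeats 1000000 in
/-- The number of terms of the asymptotic expansion to be used at the dyadic scale `2^ν`. -/
lemma Adm.exists_scale {V : ℕ → ℝ} (hV : Adm ω r V) : ∃ N : ℕ → ℕ, (∀ ν, 1 ≤ N ν) ∧
    (∀ ν j i, j < N ν → 1 ≤ i → i ≤ 2 * j → V i ≤ ((2 : ℝ) ^ ν) ^ (r * i)) ∧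
    (∀ n : ℕ, ∃ C : ℝ, 0 < C ∧ ∀ ν,
      V (2 * N ν) ≤ C * Real.exp (-(n * ω (2 ^ ν))) * ((2 : ℝ) ^ ν) ^ (r * (2 * N ν : ℕ))) ∧
    ∃ R : ℝ, 1 ≤ R ∧ ∀ n : ℕ, 0 < n → ∃ N₀ : ℕ, 0 < N₀ ∧ ∀ M, N₀ ≤ M → ∀ ν : ℕ,
      (n : ℝ) / M * youngConj ω ((M : ℝ) / n) ≤ Real.log (2 ^ ν / R) → M < N ν := by
  -- Two successive splittings: U will carry the derivatives that produce decay, and P those that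
  -- are controlled by the choice of the truncation order.
  obtain ⟨U, hU, hU1, hUV⟩ := hV.exists_split hω hr
  obtain ⟨P, hP, hP1, hPU⟩ := hU.exists_split hω hr
  have hU0 : ∀ k, 0 < U k := fun k => zero_lt_one.trans_le (hU1 k)
  have hP0 : ∀ k, 0 < P k := fun k => zero_lt_one.trans_le (hP1 k)
  set c : ℝ := P 0 * U 0 with hc
  have hc1 : 1 ≤ c := one_le_mul_of_one_le_of_one_le (hP1 0) (hU1 0)
  set T : ℕ → ℝ := fun i => c * P i with hT
  have hTadm : Adm ω r T := hP.const_mul (by linarith)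
  have hPT : ∀ i, P i ≤ T i := fun i => le_mul_of_one_le_left (hP0 i).le hc1
  have hT1 : ∀ i, 1 ≤ T i := fun i => (hP1 i).trans (hPT i)
  have hVT : ∀ i, V i ≤ T i := fun i => by
    have h1 := hUV i 0
    have h2 := hPU i 0
    simp only [add_zero] at h1 h2
    calc V i ≤ U i * U 0 := h1
      _ ≤ (P i * P 0) * U 0 := mul_le_mul_of_nonneg_right h2 (hU0 0).le
      _ = T i := by simp only [hT, hc]; ring
  set cond : ℕ → ℕ → Prop := fun ν j => ∀ i, 1 ≤ i → i ≤ 2 * j → T i ≤ ((2 : ℝ) ^ ν) ^ (r * i)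
    with hcond
  set cap : ℕ → ℕ := fun ν => ⌈ν * (ω (2 ^ ν) + 1)⌉₊ with hcap
  classical
  -- The largest order up to which the terms stay small at scale 2^ν. The range i ≤ 2j reflects the
  -- 2j derivatives in the j-th term. The cap is needed since the condition may hold for every j.
  set F : ℕ → ℕ := fun ν => Nat.findGreatest (cond ν) (cap ν) with hF
  have hF0 : ∀ ν, cond ν (F ν) := fun ν =>
    Nat.findGreatest_spec (m := 0) (Nat.zero_le _) (fun i h1 h2 => by omega)
  -- The factor 2^{1/r} makes R^r ≥ 2, a gain of 2^{-i} that beats constants. The factor e leaves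
  -- room to use s + 1 in place of s when M is compared with the cap.
  set R : ℝ := (2 : ℝ) ^ (1 / r) * Real.exp 1 with hR
  have h2r : (1 : ℝ) ≤ (2 : ℝ) ^ (1 / r) := Real.one_le_rpow one_le_two (by positivity)
  have hRe : Real.exp 1 ≤ R := le_mul_of_one_le_left (Real.exp_pos _).le h2r
  have hR1 : 1 ≤ R := (Real.one_le_exp zero_le_one).trans hRe
  have hRr : (2 : ℝ) ≤ R ^ r := by
    calc (2 : ℝ) = ((2 : ℝ) ^ (1 / r)) ^ r := by
          rw [← Real.rpow_mul zero_le_two, one_div_mul_cancel hr.ne', Real.rpow_one]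
      _ ≤ R ^ r := by
          gcongr
          exact le_mul_of_one_le_right (by positivity) (Real.one_le_exp zero_le_one)
  have region : ∀ n : ℕ, 0 < n → ∃ N₀ : ℕ, 0 < N₀ ∧ ∀ M, N₀ ≤ M → ∀ ν : ℕ,
      (n : ℝ) / M * youngConj ω ((M : ℝ) / n) ≤ Real.log (2 ^ ν / R) → M ≤ F ν := by
    intro n hn
    have hn' : (0 : ℝ) < n := by exact_mod_cast hn
    obtain ⟨C, hC, hCT⟩ := hTadm.2 (2 * n) (by omega)
    obtain ⟨i₀, hi₀⟩ := pow_unbounded_of_one_lt C (one_lt_two (α := ℝ))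
    set S : ℝ := ∑ i ∈ Finset.range i₀, T i with hS
    have hS0 : 0 ≤ S := Finset.sum_nonneg fun i _ => zero_le_one.trans (hT1 i)
    -- The threshold forces s ≥ n, used for the cap, and rs ≥ S + 1, used for the finitely many
    -- orders i < i₀.
    obtain ⟨N₀, hN₀, hlarge⟩ := eventually_youngConj_ge hω n hn (n + (S + 1) / r)
    refine ⟨N₀, hN₀, fun M hM ν hreg => ?_⟩
    have hM0 : 0 < M := by omega
    have hM' : (0 : ℝ) < M := by exact_mod_cast hM0
    set s := Real.log (2 ^ ν / R) with hs
    have hsA := (hlarge M hM).trans hreg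
    have hSr : 0 ≤ (S + 1) / r := by positivity
    have hs0 : 0 < s := by linarith
    have hRpos : 0 < R := by linarith
    have hexp : Real.exp s = 2 ^ ν / R := Real.exp_log (by positivity)
    have hlog : s ≤ ν * Real.log 2 := by
      rw [hs, Real.log_div (by positivity) hRpos.ne', Real.log_pow]
      linarith [Real.log_nonneg hR1]
    have hl2 : Real.log 2 ≤ 1 := by linarith [Real.log_two_lt_d9]
    have hsν : s ≤ ν := hlog.trans (mul_le_of_le_one_right (by positivity) hl2)
    refine Nat.le_findGreatest ?_ ?_
    · have h1 := hω.le_youngConj (s := s + 1) (by linarith) ((M : ℝ) / n)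
      have h2 : youngConj ω ((M : ℝ) / n) ≤ M / n * s := by
        have := mul_le_mul_of_nonneg_left hreg (show (0 : ℝ) ≤ M / n by positivity)
        rwa [← mul_assoc, div_mul_div_cancel₀ hn'.ne', div_self hM'.ne', one_mul] at this
      have h3 : ω (Real.exp (s + 1)) ≤ ω (2 ^ ν) := by
        refine hω.le_of_le (Real.exp_pos _).le ?_
        rw [Real.exp_add, hexp, div_mul_eq_mul_div, div_le_iff₀ hRpos]
        gcongr
      have h4 : (M : ℝ) / n ≤ ω (2 ^ ν) := by linarith
      rw [div_le_iff₀ hn'] at h4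
      have h5 : (M : ℝ) ≤ ν * (ω (2 ^ ν) + 1) := by
        have := hω.nonneg (show (0 : ℝ) ≤ 2 ^ ν by positivity)
        have : (n : ℝ) ≤ ν := by linarith
        nlinarith
      exact Nat.cast_le.1 (h5.trans (Nat.le_ceil _))
    · intro i hi1 hi2
      have hpos : (0 : ℝ) < 2 ^ ν := by positivity
      rcases lt_or_ge i i₀ with hi | hi
      · have h1 : T i ≤ S := Finset.single_le_sum (f := T)
          (fun i _ => zero_le_one.trans (hT1 i)) (Finset.mem_range.2 hi)
        have h2 : S ≤ (2 ^ ν : ℝ) ^ (r * i) := by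
          rw [Real.rpow_def_of_pos hpos, Real.log_pow]
          have h3 : S + 1 ≤ r * s := by
            have h8 : (S + 1) / r ≤ s := by linarith
            rwa [div_le_iff₀' hr] at h8
          have hi1' : (1 : ℝ) ≤ i := by exact_mod_cast hi1
          have h4 : r * s ≤ ν * Real.log 2 * (r * i) := by
            calc r * s ≤ r * (ν * Real.log 2) := by gcongr
              _ ≤ r * (ν * Real.log 2) * i := by
                  apply le_mul_of_one_le_right _ hi1'
                  have := Real.log_nonneg one_le_two (x := 2)
                  positivity
              _ = _ := by ring
          linarith [Real.add_one_le_exp ((ν : ℝ) * Real.log 2 * (r * i))]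
        exact h1.trans h2
      -- As i ≤ 2M, one has 2nφ*(i/(2n)) ≤ i(n/M)φ*(M/n) ≤ is. This is why the constant C was taken
      -- at the index 2n.
      · have h1 : T i ≤ C * Real.exp (r * (i * s)) := by
          refine (hCT i).trans (mul_le_mul_of_nonneg_left (wt_le_rpow hr ?_) hC.le)
          have hi2' : (i : ℝ) ≤ 2 * M := by exact_mod_cast hi2
          have h5 := hω.youngConj_mul_le (c := (i : ℝ) / (2 * M)) (by positivity)
            ((div_le_one (by positivity)).2 hi2') ((M : ℝ) / n)
          rw [show (i : ℝ) / (2 * M) * (M / n) = i / (2 * n : ℕ) by push_cast; field_simp] at h5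
          calc ((2 * n : ℕ) : ℝ) * youngConj ω (i / (2 * n : ℕ))
              ≤ (2 * n : ℕ) * (i / (2 * M) * youngConj ω ((M : ℝ) / n)) := by gcongr
            _ = i * ((n : ℝ) / M * youngConj ω ((M : ℝ) / n)) := by push_cast; field_simp
            _ ≤ i * s := by gcongr
        have h2 : Real.exp (r * (i * s)) = (2 ^ ν : ℝ) ^ (r * i) / (R ^ r) ^ i := by
          rw [← Real.rpow_mul_natCast hRpos.le, ← Real.div_rpow hpos.le hRpos.le, ← hexp,
            ← Real.exp_mul]
          congr 1; ring
        refine h1.trans ?_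
        rw [h2, ← mul_div_assoc, div_le_iff₀ (by positivity), mul_comm]
        refine mul_le_mul_of_nonneg_left ?_ (by positivity)
        calc C ≤ 2 ^ i₀ := hi₀.le
          _ ≤ 2 ^ i := pow_le_pow_right₀ one_le_two hi
          _ ≤ _ := by gcongr
  refine ⟨fun ν => F ν + 1, fun ν => Nat.le_add_left _ _, fun ν j i hj h1 h2 => ?_, fun n => ?_,
    R, hR1, fun n hn => ?_⟩
  · exact (hVT i).trans (hF0 ν i h1 (h2.trans
      (Nat.mul_le_mul_left 2 (Nat.lt_succ_iff.1 hj))))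
  · -- decay of the remainder
    have hRpos : 0 < R := by linarith
    obtain ⟨L, hL, hLω⟩ := hω.scale hRpos.le
    obtain ⟨q, hq⟩ := exists_nat_ge (n * L)
    obtain ⟨n', hn', C₁, hC₁, h₁⟩ := exists_exp_mul_le hω hr q
    have hn'' : (0 : ℝ) < n' := by exact_mod_cast hn'
    obtain ⟨C, hC, hCU⟩ := hU.2 n' hn'
    obtain ⟨N₀, hN₀, hreg⟩ := region n' hn'
    obtain ⟨D, hD, hDω⟩ := hω.mul_log_le ((N₀ : ℝ) / n' + 1)
    set E : ℝ := T 0 * P 2 with hE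
    have hE0 : 0 < E := mul_pos (by linarith [hT1 0]) (hP0 2)
    -- splitting off `k` derivatives
    have split : ∀ ν k, k ≤ F ν → V (2 * (F ν + 1)) ≤ U k * (E *
        ((2 : ℝ) ^ ν) ^ (r * ((2 * (F ν + 1) : ℕ) - k))) := by
      intro ν k hk
      have e1 : 2 * (F ν + 1) = k + ((2 * F ν - k) + 2) := by omega
      have e2 : (((2 * (F ν + 1) : ℕ) : ℝ) - k) = ((2 * F ν - k : ℕ) : ℝ) + 2 := by
        rw [Nat.cast_sub (by omega)]; push_cast; ring
      have h1 : (1 : ℝ) ≤ 2 ^ ν := one_le_pow₀ one_le_two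
      have h2 : P (2 * F ν - k) ≤ T 0 * ((2 : ℝ) ^ ν) ^ (r * (2 * F ν - k : ℕ)) := by
        rcases Nat.eq_zero_or_pos (2 * F ν - k) with h | h
        · rw [h]; simpa using hPT 0
        · exact (hPT _).trans ((hF0 ν _ h (by omega)).trans
            (le_mul_of_one_le_left (by positivity) (hT1 0)))
      have hT0 : 0 < T 0 := by linarith [hT1 0]
      calc V (2 * (F ν + 1)) = V (k + ((2 * F ν - k) + 2)) := by rw [e1]
        _ ≤ U k * U ((2 * F ν - k) + 2) := hUV _ _
        _ ≤ U k * (P (2 * F ν - k) * P 2) := mul_le_mul_of_nonneg_left (hPU _ _) (hU0 k).le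
        _ ≤ U k * (T 0 * ((2 : ℝ) ^ ν) ^ (r * (2 * F ν - k : ℕ)) * P 2) :=
            mul_le_mul_of_nonneg_left (mul_le_mul_of_nonneg_right h2 (hP0 2).le) (hU0 k).le
        _ ≤ U k * (T 0 * ((2 : ℝ) ^ ν) ^ (r * (((2 * (F ν + 1) : ℕ) : ℝ) - k)) * P 2) := by
            refine mul_le_mul_of_nonneg_left (mul_le_mul_of_nonneg_right
              (mul_le_mul_of_nonneg_left ?_ hT0.le) (hP0 2).le) (hU0 k).le
            refine Real.rpow_le_rpow_of_exponent_le h1 ?_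
            rw [e2]; nlinarith
        _ = _ := by simp only [hE]; ring
    set C₂ : ℝ := E * (C * C₁ * Real.exp q) with hC₂
    set C₃ : ℝ := U 0 * E * Real.exp (n * ω (R * Real.exp D)) with hC₃
    have hC₂0 : 0 < C₂ := by positivity
    have hC₃0 : 0 < C₃ := mul_pos (mul_pos (hU0 0) hE0) (Real.exp_pos _)
    clear_value C₂ C₃ E R T c
    refine ⟨C₂ + C₃, by positivity, fun ν => ?_⟩
    have hpos : (0 : ℝ) < 2 ^ ν := by positivity
    -- A bounded range of scales only requires a larger constant.
    have bad : (2 : ℝ) ^ ν ≤ R * Real.exp D → V (2 * (F ν + 1)) ≤ (C₂ + C₃) *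
        Real.exp (-(n * ω (2 ^ ν))) * ((2 : ℝ) ^ ν) ^ (r * (2 * (F ν + 1) : ℕ)) := by
      intro hb
      have h1 := split ν 0 (Nat.zero_le _)
      rw [Nat.cast_zero, sub_zero] at h1
      have h2 : 1 ≤ Real.exp (n * ω (R * Real.exp D)) * Real.exp (-(n * ω (2 ^ ν))) := by
        rw [← Real.exp_add]
        refine Real.one_le_exp ?_
        have := hω.le_of_le hpos.le hb
        have : (n : ℝ) * ω (2 ^ ν) ≤ n * ω (R * Real.exp D) := by gcongr
        linarith
      calc _ ≤ _ := h1
        _ = U 0 * E * ((2 : ℝ) ^ ν) ^ (r * (2 * (F ν + 1) : ℕ)) * 1 := by ring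
        _ ≤ U 0 * E * ((2 : ℝ) ^ ν) ^ (r * (2 * (F ν + 1) : ℕ)) *
            (Real.exp (n * ω (R * Real.exp D)) * Real.exp (-(n * ω (2 ^ ν)))) :=
            mul_le_mul_of_nonneg_left h2
              (mul_nonneg (mul_pos (hU0 0) hE0).le (by positivity))
        _ = C₃ * Real.exp (-(n * ω (2 ^ ν))) * ((2 : ℝ) ^ ν) ^ (r * (2 * (F ν + 1) : ℕ)) := by
            simp only [hC₃]; ring
        _ ≤ _ := mul_le_mul_of_nonneg_right (mul_le_mul_of_nonneg_right
            (by linarith) (Real.exp_pos _).le) (by positivity)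
    set s := Real.log (2 ^ ν / R) with hs
    have hexp : Real.exp s = 2 ^ ν / R := Real.exp_log (by positivity)
    have hback : ∀ u, s ≤ u → (2 : ℝ) ^ ν ≤ R * Real.exp u := fun u hu => by
      rw [← div_le_iff₀' hRpos, ← hexp]; exact Real.exp_le_exp.2 hu
    rcases lt_or_ge s 0 with hs0 | hs0
    · exact bad (hback D (by linarith))
    -- As in `Adm.decay`, k derivatives chosen from the slope at s give the decay. Of the other 2F +
    -- 2 - k, all but two are controlled by the definition of F, and these two cost the constant `P
    -- 2`.
    obtain ⟨y, hy, hsub⟩ := hω.subgradient s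
    obtain ⟨g1, g2⟩ := youngConj_floor_le hω hs0 hy hsub hn'
    set k := ⌊n' * y⌋₊ with hk
    rcases lt_or_ge k N₀ with hkN | hkN
    -- A small k means a bounded slope y; then φ(s) ≤ ys, and since φ outgrows every linear
    -- function, s is bounded.
    · refine bad (hback D ?_)
      have h1 : n' * y < N₀ := (Nat.floor_lt (by positivity)).1 hkN
      have h2 := hsub 0
      rw [Real.exp_zero, hω.zero_of_le_one 1 zero_le_one le_rfl] at h2
      have h3 := hDω (Real.exp s) (Real.one_le_exp hs0)
      rw [Real.log_exp] at h3
      have h4 : y ≤ N₀ / n' := by rw [le_div_iff₀ hn'']; linarith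
      nlinarith
    · have hk0 : (0 : ℝ) < k := by exact_mod_cast (hN₀.trans_le hkN)
      have hkF : k ≤ F ν := hreg k hkN ν (by
        calc (n' : ℝ) / k * youngConj ω (k / n') ≤ n' / k * (k / n' * s) := by gcongr
          _ = s := by field_simp)
      have h1 := split ν k hkF
      have h2 : U k ≤ C * Real.exp (r * ((k + 1) * s - n' * ω (Real.exp s))) :=
        (hCU k).trans (mul_le_mul_of_nonneg_left (wt_le_rpow hr g1) hC.le)
      have h3 : Real.exp (r * ((k + 1) * s - n' * ω (Real.exp s))) ≤
          ((2 : ℝ) ^ ν) ^ (r * k) * (C₁ * Real.exp q * Real.exp (-(n * ω (2 ^ ν)))) := by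
        have e : r * ((k + 1) * s - n' * ω (Real.exp s))
            = s * (r * k) + (s * r + -(n' * r * ω (Real.exp s))) := by ring
        rw [e, Real.exp_add, Real.exp_mul s (r * k), Real.exp_add (s * r), Real.exp_mul s r]
        refine mul_le_mul ?_ ?_ (by positivity) (by positivity)
        · refine Real.rpow_le_rpow (Real.exp_pos _).le ?_ (by positivity)
          rw [hexp]; exact div_le_self hpos.le hR1
        · refine (h₁ _ (Real.one_le_exp hs0)).trans ?_
          rw [mul_assoc, ← Real.exp_add]
          refine mul_le_mul_of_nonneg_left (Real.exp_le_exp.2 ?_) hC₁.le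
          have h5 := hLω (Real.exp s) (Real.exp_pos _).le
          rw [hexp, mul_div_cancel₀ _ hRpos.ne', ← hexp] at h5
          have h6 := hω.nonneg (Real.exp_pos s).le
          have h7 : (n : ℝ) * ω (2 ^ ν) ≤ n * (L * (ω (Real.exp s) + 1)) := by gcongr
          nlinarith
      calc _ ≤ _ := h1
        _ ≤ (C * (((2 : ℝ) ^ ν) ^ (r * k) * (C₁ * Real.exp q * Real.exp (-(n * ω (2 ^ ν)))))) *
            (E * ((2 : ℝ) ^ ν) ^ (r * ((2 * (F ν + 1) : ℕ) - k))) := by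
            refine mul_le_mul_of_nonneg_right (h2.trans ?_) (by positivity)
            gcongr
        _ = C₂ * Real.exp (-(n * ω (2 ^ ν))) * (((2 : ℝ) ^ ν) ^ (r * k) *
            ((2 : ℝ) ^ ν) ^ (r * ((2 * (F ν + 1) : ℕ) - k))) := by simp only [hC₂]; ring
        _ = C₂ * Real.exp (-(n * ω (2 ^ ν))) * ((2 : ℝ) ^ ν) ^ (r * (2 * (F ν + 1) : ℕ)) := by
            rw [← Real.rpow_add hpos]; congr 2; ring
        _ ≤ _ := mul_le_mul_of_nonneg_right (mul_le_mul_of_nonneg_right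
            (by linarith) (Real.exp_pos _).le) (by positivity)
  · obtain ⟨N₀, hN₀, h⟩ := region n hn
    exact ⟨N₀, hN₀, fun M hM ν hν => Nat.lt_succ_of_le (h M hM ν hν)⟩

end

/-! ### Summable widths from nonquasianalyticity -/

/-- A summable sequence stays summable after multiplication by some unbounded sequence. -/
lemma exists_tendsto_summable_mul {s : ℕ → ℝ} (h0 : ∀ l, 0 < s l) (hs : Summable s) :
    ∃ h : ℕ → ℝ, (∀ l, 0 ≤ h l) ∧ Filter.Tendsto h Filter.atTop Filter.atTop ∧
      Summable fun l => h l * s l := by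
  set r : ℕ → ℝ := fun l => ∑' i, s (i + l) with hr
  have hsl : ∀ l, Summable fun i => s (i + l) := fun l => (summable_nat_add_iff l).2 hs
  have hr0 : ∀ l, 0 < r l := fun l => (hsl l).tsum_pos (fun i => (h0 _).le) 0 (h0 _)
  have hrec : ∀ l, r l = s l + r (l + 1) := fun l => by
    simp only [hr]
    rw [(hsl l).tsum_eq_zero_add, zero_add]
    congr 2; ext i; congr 1; ring
  have hlim : Filter.Tendsto r Filter.atTop (nhds 0) := tendsto_sum_nat_add s
  -- With r_l the tails, s_l/√r_l ≤ 2(√r_l - √r_{l+1}), which telescopes.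
  refine ⟨fun l => (Real.sqrt (r l))⁻¹, fun l => by positivity, ?_, ?_⟩
  · refine Filter.Tendsto.inv_tendsto_nhdsGT_zero ?_
    refine tendsto_nhdsWithin_iff.2 ⟨?_, Filter.Eventually.of_forall fun l => Real.sqrt_pos.2 (hr0 l)⟩
    simpa using hlim.sqrt
  · refine summable_of_sum_range_le (c := 2 * Real.sqrt (r 0))
      (fun l => mul_nonneg (by positivity) (h0 l).le) fun n => ?_
    have key : ∀ l, (Real.sqrt (r l))⁻¹ * s l ≤ 2 * (Real.sqrt (r l) - Real.sqrt (r (l + 1))) := by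
      intro l
      have h1 : s l = r l - r (l + 1) := by rw [hrec l]; ring
      have h2 := Real.sq_sqrt (hr0 l).le
      have h3 := Real.sq_sqrt (hr0 (l + 1)).le
      have h4 := Real.sqrt_pos.2 (hr0 l)
      have h5 := Real.sqrt_pos.2 (hr0 (l + 1))
      rw [inv_mul_eq_div, div_le_iff₀ h4, h1, ← h2, ← h3]
      rw [h2, h3]
      nlinarith [sq_nonneg (Real.sqrt (r l) - Real.sqrt (r (l + 1)))]
    have h6 : ∀ n, ∑ l ∈ Finset.range n, (Real.sqrt (r l))⁻¹ * s l ≤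
        2 * (Real.sqrt (r 0) - Real.sqrt (r n)) := by
      intro n
      induction n with
      | zero => simp
      | succ n ih => rw [Finset.sum_range_succ]; linarith [key n]
    linarith [h6 n, Real.sqrt_nonneg (r n)]

namespace IsWeightFunction
variable {σ : ℝ → ℝ}

lemma summable_dyadic (hσ : IsWeightFunction σ) :
    Summable fun l : ℕ => σ (2 ^ (l + 2)) / 2 ^ l := by
  have h : Summable fun l : ℕ => σ (2 ^ l) / (4 * 2 ^ l) := by
    have hi : ∀ u v : ℝ, 1 ≤ u → u ≤ v →
        IntervalIntegrable (fun s => σ s / s ^ 2) MeasureTheory.volume u v := fun u v hu hv => by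
      rw [intervalIntegrable_iff_integrableOn_Ioc_of_le hv]
      exact hσ.nonquasianalytic.mono_set fun s hs => lt_of_le_of_lt hu hs.1
    have h1 : ∀ l : ℕ, (1 : ℝ) ≤ 2 ^ l := fun l => one_le_pow₀ one_le_two
    refine summable_of_sum_range_le (c := ∫ s in Set.Ioi 1, σ s / s ^ 2)
      (fun l => div_nonneg (hσ.nonneg (by positivity)) (by positivity)) fun n => ?_
    have h2 : ∑ l ∈ Finset.range n, σ (2 ^ l) / (4 * 2 ^ l) ≤
        ∫ s in (1 : ℝ)..2 ^ n, σ s / s ^ 2 := by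
      induction n with
      | zero => simp
      | succ n ih =>
        rw [Finset.sum_range_succ, ← intervalIntegral.integral_add_adjacent_intervals
          (hi 1 (2 ^ n) le_rfl (h1 n)) (hi (2 ^ n) (2 ^ (n + 1)) (h1 n)
            (pow_le_pow_right₀ one_le_two (Nat.le_succ n)))]
        refine add_le_add ih ?_
        rw [pow_succ' (2 : ℝ) n]
        exact hσ.block_le (h1 n)
    refine h2.trans ?_
    rw [intervalIntegral.integral_of_le (h1 n)]
    refine MeasureTheory.setIntegral_mono_set hσ.nonquasianalytic ?_
      (Set.Ioc_subset_Ioi_self).eventuallyLE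
    refine (MeasureTheory.ae_restrict_iff' measurableSet_Ioi).2 (Filter.Eventually.of_forall
      fun s hs => ?_)
    have hs' : (1 : ℝ) < s := hs
    exact div_nonneg (hσ.nonneg (by linarith)) (by positivity)
  have h2 := ((summable_nat_add_iff 2).2 h).mul_left 16
  refine h2.congr fun l => ?_
  rw [pow_add]; field_simp; ring

/-- The sum must be finite although σ(2/a_i) = o(i). Level l contributes 2^{-l} to each of the first
b_l widths, where b_l is a slowly growing multiple of σ(2^{l+2}), up to a term of order l. The total
Σ b_l 2^{-l} is finite by nonquasianalyticity of σ. -/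
lemma exists_widths (hσ : IsWeightFunction σ) : ∃ a : ℕ → ℝ, (∀ i, 0 < a i) ∧ Summable a ∧
    ∀ n : ℕ, ∃ c : ℝ, 0 ≤ c ∧ ∀ i : ℕ, n * σ (2 / a i) ≤ i + c := by
  have hs := hσ.summable_dyadic.add (summable_geometric_two)
  have hσ0 : ∀ l : ℕ, 0 ≤ σ (2 ^ l) := fun l => hσ.nonneg (by positivity)
  obtain ⟨h, h0, hlim, hsum⟩ := exists_tendsto_summable_mul
    (fun l => add_pos_of_nonneg_of_pos (div_nonneg (hσ0 (l + 2)) (by positivity))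
      (by positivity)) hs
  set b : ℕ → ℕ := fun l => ⌈h l * σ (2 ^ (l + 2))⌉₊ + l + 1 with hb
  have hbs : Summable fun l => (b l : ℝ) * (1 / 2) ^ l := by
    have h1 : Summable fun l : ℕ => ((l : ℝ) ^ 1 * (1 / 2) ^ l) :=
      summable_pow_mul_geometric_of_norm_lt_one 1 (by norm_num)
    have h2 := (hsum.add h1).add (summable_geometric_two.mul_left 2)
    refine Summable.of_nonneg_of_le (fun l => by positivity) (fun l => ?_) h2
    have h3 : (b l : ℝ) ≤ h l * σ (2 ^ (l + 2)) + l + 2 := by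
      have := Nat.ceil_lt_add_one (mul_nonneg (h0 l) (hσ0 (l + 2)))
      simp only [hb]; push_cast; linarith
    have h4 : (0 : ℝ) < (1 / 2) ^ l := by positivity
    have h5 : h l * σ (2 ^ (l + 2)) * (1 / 2) ^ l ≤
        h l * (σ (2 ^ (l + 2)) / 2 ^ l + (1 / 2) ^ l) := by
      rw [mul_assoc]
      refine mul_le_mul_of_nonneg_left ?_ (h0 l)
      rw [one_div, inv_pow, ← div_eq_mul_inv]
      have : (0 : ℝ) ≤ (2 ^ l)⁻¹ := by positivity
      linarith
    calc (b l : ℝ) * (1 / 2) ^ l ≤ (h l * σ (2 ^ (l + 2)) + l + 2) * (1 / 2) ^ l := by gcongr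
      _ = h l * σ (2 ^ (l + 2)) * (1 / 2) ^ l + (l : ℝ) ^ 1 * (1 / 2) ^ l + 2 * (1 / 2) ^ l := by
          ring
      _ ≤ _ := by gcongr
  set f : ℕ × ℕ → ℝ := fun p => if p.2 < b p.1 then (1 / 2) ^ p.1 else 0 with hf
  have hf0 : 0 ≤ f := fun p => by simp only [hf, Pi.zero_apply]; split_ifs <;> positivity
  have hrow : ∀ l, HasSum (fun i => f (l, i)) (b l * (1 / 2) ^ l) := fun l => by
    have := hasSum_sum_of_ne_finset_zero (L := .unconditional ℕ) (f := fun i => f (l, i))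
      (s := Finset.range (b l))
      (fun i hi => by simp only [hf]; rw [if_neg (by simpa using hi)])
    convert this using 1
    rw [Finset.sum_congr rfl (fun i hi => by
      simp only [hf]; rw [if_pos (by simpa using hi)]), Finset.sum_const, Finset.card_range,
      nsmul_eq_mul]
  have hfs : Summable f := by
    refine (summable_prod_of_nonneg hf0).2 ⟨fun l => (hrow l).summable, ?_⟩
    simpa only [(hrow _).tsum_eq] using hbs
  have hfs' : Summable fun p : ℕ × ℕ => f p.swap := hfs.prod_symm
  have hcol : ∀ i, Summable fun l => f (l, i) := fun i => hfs'.prod_factor i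
  have hge : ∀ i l, i < b l → (1 / 2 : ℝ) ^ l ≤ ∑' l, f (l, i) := fun i l hil => by
    have := (hcol i).le_tsum l (fun j _ => hf0 (j, i))
    simpa only [hf, if_pos hil] using this
  have hex : ∀ i, ∃ l, i < b l := fun i => ⟨i, by simp only [hb]; omega⟩
  refine ⟨fun i => ∑' l, f (l, i), fun i => ?_, hfs'.prod, fun n => ?_⟩
  · obtain ⟨l, hl⟩ := hex i
    exact lt_of_lt_of_le (by positivity) (hge i l hl)
  · obtain ⟨l₀, hl₀⟩ := Filter.eventually_atTop.1 (hlim.eventually_ge_atTop (n : ℝ))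
    refine ⟨n * σ (2 ^ (l₀ + 1)), mul_nonneg (by positivity) (hσ0 _), fun i => ?_⟩
    classical
    -- The first level l reaching i gives a_i ≥ 2^{-l}. If l > 0, level l - 1 does not reach i, so i
    -- ≥ b_{l-1} ≥ h_{l-1} σ(2^{l+1}), and h exceeds n for large l.
    set l := Nat.find (hex i) with hl
    have h1 := hge i l (Nat.find_spec (hex i))
    have hpos : (0 : ℝ) < (1 / 2) ^ l := by positivity
    have h2 : 2 / (∑' l, f (l, i)) ≤ 2 ^ (l + 1) := by
      rw [div_le_iff₀ (hpos.trans_le h1)]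
      calc (2 : ℝ) = 2 ^ (l + 1) * (1 / 2) ^ l := by
            rw [pow_succ, one_div, inv_pow]; field_simp
        _ ≤ _ := by gcongr
    have h3 := hσ.le_of_le (div_nonneg zero_le_two (hpos.le.trans h1)) h2
    rcases le_or_gt l l₀ with hle | hgt
    · have h4 : σ (2 ^ (l + 1)) ≤ σ (2 ^ (l₀ + 1)) :=
        hσ.le_of_le (by positivity) (pow_le_pow_right₀ one_le_two (by omega))
      have : (n : ℝ) * σ (2 / ∑' l, f (l, i)) ≤ n * σ (2 ^ (l₀ + 1)) := by
        gcongr; exact h3.trans h4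
      have : (0 : ℝ) ≤ i := by positivity
      linarith
    · obtain ⟨k, hk⟩ := Nat.exists_eq_succ_of_ne_zero (show l ≠ 0 by omega)
      have h5 : b k ≤ i := not_lt.1 (Nat.find_min (hex i) (m := k) (by omega))
      have h6 : h k * σ (2 ^ (k + 2)) ≤ i := by
        have h7 := Nat.le_ceil (h k * σ (2 ^ (k + 2)))
        have h8 : (⌈h k * σ (2 ^ (k + 2))⌉₊ : ℝ) ≤ i := by
          exact_mod_cast (show ⌈h k * σ (2 ^ (k + 2))⌉₊ ≤ i by simp only [hb] at h5; omega)
        linarith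
      rw [hk, Nat.succ_eq_add_one] at h3
      have h9 : (n : ℝ) * σ (2 / ∑' l, f (l, i)) ≤ h k * σ (2 ^ (k + 2)) :=
        mul_le_mul (hl₀ k (by omega)) h3
          (hσ.nonneg (div_nonneg zero_le_two (hpos.le.trans h1))) (h0 k)
      have := mul_nonneg (Nat.cast_nonneg (α := ℝ) n) (hσ0 (l₀ + 1))
      linarith

end IsWeightFunction

/-- The products of the reciprocal widths are admissible. -/
lemma adm_prod_widths {ω σ : ℝ → ℝ} {ρ : ℝ} (hω : IsWeightFunction ω) (hσ : IsWeightFunction σ)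
    (hρ : 0 < ρ) (hωσ : (fun t : ℝ => ω (t ^ (1 / ρ))) =O[Filter.atTop] σ) {a : ℕ → ℝ}
    (ha : ∀ i, 0 < a i) (h : ∀ n : ℕ, ∃ c : ℝ, 0 ≤ c ∧ ∀ i : ℕ, n * σ (2 / a i) ≤ i + c) :
    Adm ω ρ fun k => ∏ i ∈ Finset.range k, (a i)⁻¹ := by
  refine ⟨fun k => Finset.prod_nonneg fun i _ => (inv_pos.2 (ha i)).le, fun n hn => ?_⟩
  have hn' : (0 : ℝ) < n := by exact_mod_cast hn
  obtain ⟨A, hA, hAb⟩ := hωσ.exists_nonneg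
  obtain ⟨t₀, ht₀⟩ := Filter.eventually_atTop.1 hAb.bound
  set T₀ := max t₀ 1
  have hT₀1 : 1 ≤ T₀ := le_max_right _ _
  set D := ω (T₀ ^ (1 / ρ)) with hD
  have hD0 : 0 ≤ D := hω.nonneg (by positivity)
  have hbound : ∀ t : ℝ, 1 ≤ t → ω (t ^ (1 / ρ)) ≤ A * σ t + D := by
    intro t ht
    have hσt := hσ.nonneg (zero_le_one.trans ht)
    rcases le_total t T₀ with hle | hle
    · have := hω.le_of_le (s := t ^ (1 / ρ)) (t := T₀ ^ (1 / ρ)) (by positivity) (by gcongr)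
      have : 0 ≤ A * σ t := by positivity
      linarith
    · have := ht₀ t ((le_max_left _ _).trans hle)
      rw [Real.norm_of_nonneg hσt] at this
      linarith [le_abs_self (ω (t ^ (1 / ρ))), Real.norm_eq_abs (ω (t ^ (1 / ρ)))]
  -- With this m the growth e^{ρnAσ(T)} is at most 2^{k+c}, and the factor 2^{-k} in (T/2)^k
  -- compensates it.
  obtain ⟨m, hm⟩ := exists_nat_ge (ρ * n * A / Real.log 2)
  have hl2 := Real.log_pos one_lt_two
  rw [div_le_iff₀ hl2] at hm
  obtain ⟨c, hc, hcσ⟩ := h m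
  refine ⟨Real.exp (Real.log 2 * c + ρ * n * D), by positivity, fun k => ?_⟩
  -- the largest reciprocal width
  have hT : ∃ T : ℝ, 1 ≤ T ∧ (∀ i < k, (a i)⁻¹ ≤ T / 2) ∧ m * σ T ≤ k + c := by
    induction k with
    | zero => exact ⟨1, le_rfl, by simp, by
        rw [hσ.zero_of_le_one 1 zero_le_one le_rfl]; simpa using hc⟩
    | succ k ih =>
      obtain ⟨T, hT1, hT2, hT3⟩ := ih
      rcases le_total T (2 / a k) with hle | hle
      · refine ⟨2 / a k, hT1.trans hle, fun i hi => ?_, (hcσ k).trans (by push_cast; linarith)⟩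
        rcases Nat.lt_succ_iff_lt_or_eq.1 hi with h | rfl
        · exact (hT2 i h).trans (by linarith)
        · rw [div_div, mul_comm, ← div_div, div_self two_ne_zero, one_div]
      · refine ⟨T, hT1, fun i hi => ?_, by push_cast; linarith⟩
        rcases Nat.lt_succ_iff_lt_or_eq.1 hi with h | rfl
        · exact hT2 i h
        · rw [le_div_iff₀ two_pos, mul_comm, ← div_eq_mul_inv]; exact hle
  obtain ⟨T, hT1, hT2, hT3⟩ := hT
  have hT0 : 0 < T := by linarith
  have h1 : ∏ i ∈ Finset.range k, (a i)⁻¹ ≤ (T / 2) ^ k := by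
    calc _ ≤ ∏ i ∈ Finset.range k, (T / 2) :=
          Finset.prod_le_prod (fun i _ => (inv_pos.2 (ha i)).le)
            fun i hi => hT2 i (Finset.mem_range.1 hi)
      _ = _ := by rw [Finset.prod_const, Finset.card_range]
  -- Young's inequality at e^s = T^{1/ρ}; the exponent 1/ρ cancels the factor ρ in the weight
  -- sequence and leaves T^k.
  have h2 : Real.exp (k * Real.log T - ρ * n * ω (T ^ (1 / ρ))) ≤ wt ω ρ n k := by
    have h3 := hω.le_youngConj (s := Real.log T / ρ) (div_nonneg (Real.log_nonneg hT1) hρ.le)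
      ((k : ℝ) / n)
    have h4 : Real.exp (Real.log T / ρ) = T ^ (1 / ρ) := by
      rw [Real.rpow_def_of_pos hT0, mul_one_div]
    rw [h4] at h3
    refine Real.exp_le_exp.2 ?_
    have h5 := mul_le_mul_of_nonneg_left h3 (show (0 : ℝ) ≤ n * ρ by positivity)
    have h6 : (n : ℝ) * ρ * (Real.log T / ρ * (k / n) - ω (T ^ (1 / ρ))) =
      k * Real.log T - ρ * n * ω (T ^ (1 / ρ)) := by field_simp
    linarith
  have h7 : (T / 2) ^ k ≤ Real.exp (Real.log 2 * c + ρ * n * D) *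
      Real.exp (k * Real.log T - ρ * n * ω (T ^ (1 / ρ))) := by
    rw [← Real.exp_log (show 0 < (T / 2) ^ k by positivity), Real.log_pow,
      Real.log_div hT0.ne' two_ne_zero, ← Real.exp_add]
    refine Real.exp_le_exp.2 ?_
    have h8 := mul_le_mul_of_nonneg_left (hbound T hT1) (show 0 ≤ ρ * n by positivity)
    have h9 := mul_le_mul_of_nonneg_right hm (hσ.nonneg hT0.le)
    have h10 := mul_le_mul_of_nonneg_left hT3 hl2.le
    nlinarith
  exact h1.trans (h7.trans (mul_le_mul_of_nonneg_left h2 (Real.exp_pos _).le))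

/-! ### Bumps and cutoff functions by iterated averaging -/

/-- The average of `u` over `[x - a, x + a]`. -/
def movingAvg (a : ℝ) (u : ℝ → ℝ) (x : ℝ) : ℝ := (2 * a)⁻¹ * ∫ t in -a..a, u (x + t)

section movingAvg
variable {a : ℝ} (ha : 0 < a) {u v : ℝ → ℝ} (hu : Continuous u)

lemma movingAvg_const (ha : 0 < a) (c : ℝ) : (2 * a)⁻¹ * ∫ _t in -a..a, c = c := by
  rw [intervalIntegral.integral_const, smul_eq_mul]; field_simp; ring

include ha hu

lemma movingAvg_le_of_le {x C : ℝ} (h : ∀ y, |y - x| ≤ a → u y ≤ C) : movingAvg a u x ≤ C := by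
  rw [movingAvg, ← movingAvg_const ha C]
  refine mul_le_mul_of_nonneg_left ?_ (by positivity)
  refine intervalIntegral.integral_mono_on (by linarith)
    ((hu.comp (by fun_prop)).intervalIntegrable _ _) (by simp) fun t ht => h _ ?_
  rw [add_sub_cancel_left]; exact abs_le.2 ht

lemma le_movingAvg_of_le {x C : ℝ} (h : ∀ y, |y - x| ≤ a → C ≤ u y) : C ≤ movingAvg a u x := by
  rw [movingAvg, ← movingAvg_const ha C]
  refine mul_le_mul_of_nonneg_left ?_ (by positivity)
  refine intervalIntegral.integral_mono_on (by linarith) (by simp)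
    ((hu.comp (by fun_prop)).intervalIntegrable _ _) fun t ht => h _ ?_
  rw [add_sub_cancel_left]; exact abs_le.2 ht

lemma abs_movingAvg_sub_le (hv : Continuous v) {x y C : ℝ}
    (h : ∀ t, |u (x + t) - v (y + t)| ≤ C) : |movingAvg a u x - movingAvg a v y| ≤ C := by
  have hi : ∀ w : ℝ → ℝ, Continuous w → ∀ z, IntervalIntegrable (fun t => w (z + t))
    MeasureTheory.volume (-a) a := fun w hw z => (hw.comp (by fun_prop)).intervalIntegrable _ _
  rw [movingAvg, movingAvg, ← mul_sub, ← intervalIntegral.integral_sub (hi u hu x) (hi v hv y),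
    abs_mul, abs_of_pos (by positivity : 0 < (2 * a)⁻¹)]
  have := intervalIntegral.norm_integral_le_of_norm_le_const (a := -a) (b := a) (C := C)
    (f := fun t => u (x + t) - v (y + t)) fun t _ => h t
  rw [Real.norm_eq_abs, show |a - -a| = 2 * a by rw [abs_of_pos (by linarith)]; ring] at this
  rw [inv_mul_le_iff₀ (by positivity)]
  linarith

omit ha in
-- An averaging of width a yields one more derivative, a difference quotient bounded by sup|u|/a.
-- Hence iterated averages have derivatives bounded by products of reciprocal widths.
lemma hasDerivAt_movingAvg (x : ℝ) :
    HasDerivAt (movingAvg a u) ((2 * a)⁻¹ * (u (x + a) - u (x - a))) x := by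
  have h1 : movingAvg a u = fun x => (2 * a)⁻¹ *
      ((∫ t in (0 : ℝ)..(x + a), u t) - ∫ t in (0 : ℝ)..(x - a), u t) := by
    ext x
    rw [movingAvg, intervalIntegral.integral_comp_add_left, intervalIntegral.integral_interval_sub_left
      (hu.intervalIntegrable _ _) (hu.intervalIntegrable _ _), sub_eq_add_neg]
  rw [h1]
  refine HasDerivAt.const_mul _ (HasDerivAt.sub ?_ ?_)
  · have := (hu.integral_hasStrictDerivAt 0 (x + a)).hasDerivAt.comp_add_const x a
    exact this
  · have := (hu.integral_hasStrictDerivAt 0 (x - a)).hasDerivAt.comp_sub_const x a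
    exact this

end movingAvg

/-- A trapezoid function. -/
def trapezoid (x : ℝ) : ℝ := max 0 (min 1 ((7 / 4 - |x|) * 2))

lemma abs_trapezoid_sub_le (x y : ℝ) : |trapezoid x - trapezoid y| ≤ 2 * |x - y| := by
  have h1 := abs_max_sub_max_le_abs (min 1 ((7 / 4 - |x|) * 2)) (min 1 ((7 / 4 - |y|) * 2)) 0
  have h2 := abs_min_sub_min_le_max 1 ((7 / 4 - |x|) * 2) 1 ((7 / 4 - |y|) * 2)
  rw [sub_self, abs_zero, max_eq_right (abs_nonneg _)] at h2
  rw [max_comm _ (0 : ℝ), max_comm _ (0 : ℝ)] at h1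
  refine h1.trans (h2.trans ?_)
  rw [show (7 / 4 - |x|) * 2 - (7 / 4 - |y|) * 2 = 2 * (|y| - |x|) by ring, abs_mul, abs_two]
  have := abs_abs_sub_abs_le_abs_sub y x
  rw [abs_sub_comm y x] at this
  linarith

/-- Iterated moving averages of a trapezoid function. -/
def avgIter (a : ℕ → ℝ) : ℕ → ℕ → ℝ → ℝ
  | 0, _ => trapezoid
  | J + 1, m => movingAvg (a m) (avgIter a J (m + 1))

section avgIter
variable {a : ℕ → ℝ} (ha : ∀ i, 0 < a i)
include ha

lemma avgIter_lip (J m : ℕ) : ∀ x y, |avgIter a J m x - avgIter a J m y| ≤ 2 * |x - y| := by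
  induction J generalizing m with
  | zero => exact abs_trapezoid_sub_le
  | succ J ih =>
    intro x y
    have hc : Continuous (avgIter a J (m + 1)) :=
      (LipschitzWith.of_dist_le_mul (K := 2) fun x y => ih (m + 1) x y).continuous
    refine abs_movingAvg_sub_le (ha m) hc hc fun t => ?_
    have := ih (m + 1) (x + t) (y + t)
    rwa [add_sub_add_right_eq_sub] at this

lemma avgIter_cont (J m : ℕ) : Continuous (avgIter a J m) :=
  (LipschitzWith.of_dist_le_mul (K := 2) fun x y => avgIter_lip ha J m x y).continuous

lemma avgIter_mem (J m : ℕ) (x : ℝ) : 0 ≤ avgIter a J m x ∧ avgIter a J m x ≤ 1 := by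
  induction J generalizing m x with
  | zero => exact ⟨le_max_left _ _, max_le zero_le_one (min_le_left _ _)⟩
  | succ J ih =>
    exact ⟨le_movingAvg_of_le (ha m) (avgIter_cont ha _ _) fun y _ => (ih _ y).1,
      movingAvg_le_of_le (ha m) (avgIter_cont ha _ _) fun y _ => (ih _ y).2⟩

/-- Going from J to J + 1 inserts one averaging, of width a_{m+J}, next to the trapezoid, which has
Lipschitz constant 2; the outer averagings do not increase the difference. Summable widths thus give
convergence. -/
lemma abs_avgIter_succ_sub_le (J m : ℕ) (x : ℝ) :
    |avgIter a (J + 1) m x - avgIter a J m x| ≤ 2 * a (m + J) := by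
  induction J generalizing m x with
  | zero =>
    have hc := avgIter_cont ha 0 m
    have h := abs_movingAvg_sub_le (ha m) hc hc (x := x) (y := x) (C := 0) (by simp)
    refine abs_le.2 ⟨?_, ?_⟩
    · rw [neg_le_sub_iff_le_add, ← sub_le_iff_le_add]
      refine le_movingAvg_of_le (ha m) hc fun y hy => ?_
      have := avgIter_lip ha 0 m x y
      rw [abs_sub_comm x y] at this
      have := (abs_le.1 this).2
      simp only [add_zero]; linarith
    · rw [sub_le_iff_le_add]
      refine movingAvg_le_of_le (ha m) hc fun y hy => ?_
      have := avgIter_lip ha 0 m y x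
      have := (abs_le.1 this).2
      simp only [add_zero]; linarith
  | succ J ih =>
    refine abs_movingAvg_sub_le (ha m) (avgIter_cont ha _ _) (avgIter_cont ha _ _) fun t => ?_
    rw [show m + (J + 1) = m + 1 + J by ring]
    exact ih (m + 1) (x + t)

lemma avgIter_eq_one (J m : ℕ) (x : ℝ) (h : |x| ≤ 5 / 4 - ∑ i ∈ Finset.range J, a (m + i)) :
    avgIter a J m x = 1 := by
  induction J generalizing m x with
  | zero =>
    simp only [Finset.range_zero, Finset.sum_empty, sub_zero] at h
    rw [avgIter, trapezoid, min_eq_left (by linarith), max_eq_right zero_le_one]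
  | succ J ih =>
    refine le_antisymm (avgIter_mem ha _ _ _).2 ?_
    refine le_movingAvg_of_le (ha m) (avgIter_cont ha _ _) fun y hy => (ih _ _ ?_).ge
    rw [Finset.sum_range_succ', add_zero] at h
    have : |y| ≤ |x| + a m := by linarith [abs_sub_abs_le_abs_sub y x]
    have e : ∑ i ∈ Finset.range J, a (m + 1 + i) = ∑ i ∈ Finset.range J, a (m + (i + 1)) :=
      Finset.sum_congr rfl fun i _ => by congr 1; ring
    rw [e]; linarith

lemma avgIter_eq_zero (J m : ℕ) (x : ℝ) (h : 7 / 4 + ∑ i ∈ Finset.range J, a (m + i) ≤ |x|) :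
    avgIter a J m x = 0 := by
  induction J generalizing m x with
  | zero =>
    simp only [Finset.range_zero, Finset.sum_empty, add_zero] at h
    rw [avgIter, trapezoid, max_eq_left]
    exact (min_le_right _ _).trans (by linarith)
  | succ J ih =>
    refine le_antisymm ?_ (avgIter_mem ha _ _ _).1
    refine movingAvg_le_of_le (ha m) (avgIter_cont ha _ _) fun y hy => (ih _ _ ?_).le
    rw [Finset.sum_range_succ', add_zero] at h
    have : |x| - a m ≤ |y| := by linarith [abs_sub_abs_le_abs_sub x y, abs_sub_comm x y]
    have e : ∑ i ∈ Finset.range J, a (m + 1 + i) = ∑ i ∈ Finset.range J, a (m + (i + 1)) :=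
      Finset.sum_congr rfl fun i _ => by congr 1; ring
    rw [e]; linarith

/-- Infinite iterated averages have derivatives controlled by the reciprocals of the widths. -/
lemma exists_bump_of_widths (hs : Summable a) (hsum : ∑' i, a i ≤ 1 / 4) :
    ∃ u : ℝ → ℝ, ContDiff ℝ (⊤ : ℕ∞) u ∧ (∀ x, |x| ≤ 1 → u x = 1) ∧ (∀ x, 2 ≤ |x| → u x = 0) ∧
      (∀ x, 0 ≤ u x ∧ u x ≤ 1) ∧
      ∀ k x, |iteratedDeriv k u x| ≤ ∏ i ∈ Finset.range k, (a i)⁻¹ := by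
  have hcauchy : ∀ m x, ∃ l, Filter.Tendsto (fun J => avgIter a J m x) Filter.atTop (nhds l) := by
    intro m x
    refine cauchySeq_tendsto_of_complete (cauchySeq_of_summable_dist ?_)
    refine Summable.of_nonneg_of_le (fun _ => dist_nonneg) (fun J => ?_)
      (((summable_nat_add_iff m).2 hs).mul_left 2)
    rw [dist_comm, Real.dist_eq, add_comm J m]
    exact abs_avgIter_succ_sub_le ha J m x
  choose v hv using hcauchy
  have hmem : ∀ m x, 0 ≤ v m x ∧ v m x ≤ 1 := fun m x =>
    ⟨ge_of_tendsto' (hv m x) fun J => (avgIter_mem ha J m x).1,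
      le_of_tendsto' (hv m x) fun J => (avgIter_mem ha J m x).2⟩
  have hcont : ∀ m, Continuous (v m) := fun m =>
    (LipschitzWith.of_dist_le_mul (K := 2) fun x y =>
      le_of_tendsto' (((hv m x).sub (hv m y)).abs) fun J => avgIter_lip ha J m x y).continuous
  -- The limits inherit the recursion, so a derivative of the limit for one sequence of widths is
  -- expressed by the limit for the shifted sequence.
  have hrec : ∀ m, v m = movingAvg (a m) (v (m + 1)) := by
    intro m
    ext x
    refine tendsto_nhds_unique ((Filter.tendsto_add_atTop_iff_nat 1).2 (hv m x)) ?_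
    refine Filter.Tendsto.const_mul _ ?_
    refine intervalIntegral.tendsto_integral_filter_of_dominated_convergence (fun _ => 1)
      (Filter.Eventually.of_forall fun J =>
        ((avgIter_cont ha J (m + 1)).comp (by fun_prop)).aestronglyMeasurable)
      (Filter.Eventually.of_forall fun J => Filter.Eventually.of_forall fun t _ => ?_)
      (by simp) (Filter.Eventually.of_forall fun t _ => hv (m + 1) (x + t))
    rw [Real.norm_eq_abs, abs_of_nonneg (avgIter_mem ha _ _ _).1]
    exact (avgIter_mem ha _ _ _).2
  have hder : ∀ m x, HasDerivAt (v m)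
      ((2 * a m)⁻¹ * (v (m + 1) (x + a m) - v (m + 1) (x - a m))) x := fun m x => by
    have := hasDerivAt_movingAvg (a := a m) (hcont (m + 1)) x
    rwa [← hrec] at this
  have hdiff : ∀ k : ℕ, ∀ m, ContDiff ℝ k (v m) := by
    intro k
    induction k with
    | zero => exact fun m => by simpa using contDiff_zero (𝕜 := ℝ).2 (hcont m)
    | succ k ih =>
      intro m
      have hd : deriv (v m) = fun x => (2 * a m)⁻¹ * (v (m + 1) (x + a m) - v (m + 1) (x - a m)) :=
        funext fun x => (hder m x).deriv
      push_cast
      rw [contDiff_succ_iff_deriv]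
      refine ⟨fun x => (hder m x).differentiableAt, by simp, ?_⟩
      rw [hd]
      exact contDiff_const.mul (((ih (m + 1)).comp (contDiff_id.add contDiff_const)).sub
        ((ih (m + 1)).comp (contDiff_id.sub contDiff_const)))
  have hbd : ∀ k m x, |iteratedDeriv k (v m) x| ≤ ∏ i ∈ Finset.range k, (a (m + i))⁻¹ := by
    intro k
    induction k with
    | zero =>
      intro m x
      rw [iteratedDeriv_zero, Finset.range_zero, Finset.prod_empty, abs_of_nonneg (hmem m x).1]
      exact (hmem m x).2
    | succ k ih =>
      intro m x
      have hd : deriv (v m) = fun x => (2 * a m)⁻¹ * (v (m + 1) (x + a m) - v (m + 1) (x - a m)) :=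
        funext fun x => (hder m x).deriv
      have c1 : ContDiff ℝ k fun x => v (m + 1) (x + a m) :=
        (hdiff k (m + 1)).comp (contDiff_id.add contDiff_const)
      have c2 : ContDiff ℝ k fun x => v (m + 1) (x - a m) :=
        (hdiff k (m + 1)).comp (contDiff_id.sub contDiff_const)
      have e : iteratedDeriv (k + 1) (v m) x = (2 * a m)⁻¹ *
          (iteratedDeriv k (v (m + 1)) (x + a m) - iteratedDeriv k (v (m + 1)) (x - a m)) := by
        rw [iteratedDeriv_succ', hd, iteratedDeriv_const_mul_field, iteratedDeriv_fun_sub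
          c1.contDiffAt c2.contDiffAt, iteratedDeriv_comp_add_const, iteratedDeriv_comp_sub_const]
      have h1 := ih (m + 1) (x + a m)
      have h2 := ih (m + 1) (x - a m)
      have e2 : ∏ i ∈ Finset.range k, (a (m + 1 + i))⁻¹ = ∏ i ∈ Finset.range k, (a (m + (i + 1)))⁻¹ :=
        Finset.prod_congr rfl fun i _ => by congr 2; ring
      rw [e2] at h1 h2
      have ham := ha m
      rw [e, abs_mul, abs_of_pos (by positivity), Finset.prod_range_succ', add_zero, mul_comm _ (a m)⁻¹]
      have h3 := abs_sub (iteratedDeriv k (v (m + 1)) (x + a m))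
        (iteratedDeriv k (v (m + 1)) (x - a m))
      calc _ ≤ (2 * a m)⁻¹ * (2 * ∏ i ∈ Finset.range k, (a (m + (i + 1)))⁻¹) := by
            gcongr; linarith
        _ = _ := by field_simp
  have hpart : ∀ J, ∑ i ∈ Finset.range J, a (0 + i) ≤ 1 / 4 := fun J => by
    simp only [zero_add]
    exact (hs.sum_le_tsum _ fun i _ => (ha i).le).trans hsum
  refine ⟨v 0, contDiff_infty.2 fun k => hdiff k 0, fun x hx => ?_, fun x hx => ?_, hmem 0,
    fun k x => by simpa using hbd k 0 x⟩
  · refine tendsto_nhds_unique (hv 0 x) (tendsto_const_nhds.congr fun J => ?_)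
    exact (avgIter_eq_one ha J 0 x (by linarith [hpart J])).symm
  · refine tendsto_nhds_unique (hv 0 x) (tendsto_const_nhds.congr fun J => ?_)
    exact (avgIter_eq_zero ha J 0 x (by linarith [hpart J])).symm

end avgIter

section
variable {ω σ : ℝ → ℝ} {ρ : ℝ} (hω : IsWeightFunction ω) (hσ : IsWeightFunction σ)
  (hρ : 0 < ρ) (hωσ : (fun t : ℝ => ω (t ^ (1 / ρ))) =O[Filter.atTop] σ)
include hω hσ hρ hωσ

lemma exists_bump : ∃ u : ℝ → ℝ, ContDiff ℝ (⊤ : ℕ∞) u ∧ (∀ x, |x| ≤ 1 → u x = 1) ∧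
    (∀ x, 2 ≤ |x| → u x = 0) ∧ (∀ x, 0 ≤ u x ∧ u x ≤ 1) ∧
    ∃ V, Adm ω ρ V ∧ ∀ k x, |iteratedDeriv k u x| ≤ V k := by
  obtain ⟨a, ha, hs, hc⟩ := hσ.exists_widths
  have hV := adm_prod_widths hω hσ hρ hωσ ha hc
  set S := ∑' i, a i with hS
  have hS0 : 0 ≤ S := tsum_nonneg fun i => (ha i).le
  -- Total width at most 1/4 keeps the averages equal to 1 on [-1, 1] and to 0 off [-2, 2]. The
  -- rescaling costs ε^{-k} in order k, which admissibility absorbs.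
  set ε := 1 / (4 * (S + 1)) with hε
  have hε0 : 0 < ε := by positivity
  obtain ⟨u, h1, h2, h3, h4, h5⟩ := exists_bump_of_widths (a := fun i => ε * a i)
    (fun i => mul_pos hε0 (ha i)) (hs.mul_left ε) (by
      rw [tsum_mul_left, ← hS, hε, div_mul_eq_mul_div, div_le_div_iff₀ (by positivity) (by norm_num)]
      linarith)
  refine ⟨u, h1, h2, h3, h4, _, hV.pow_mul hω hρ (inv_pos.2 hε0).le, fun k x => (h5 k x).trans ?_⟩
  simp only [mul_inv, Finset.prod_mul_distrib, Finset.prod_const, Finset.card_range]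
  exact le_rfl

variable {F : Type*} [NormedAddCommGroup F] [NormedSpace ℝ F]

lemma exists_tensor_bump {ι : Type*} (s : Finset ι) (ℓ : ι → F →L[ℝ] ℝ) (hℓ : ∀ i, ‖ℓ i‖ ≤ 1) :
    ∃ Φ : F → ℂ, ContDiff ℝ (⊤ : ℕ∞) Φ ∧ (∀ w, (∀ i ∈ s, |ℓ i w| ≤ 1) → Φ w = 1) ∧
      (∀ w, (∃ i ∈ s, 2 ≤ |ℓ i w|) → Φ w = 0) ∧ (∀ w, ‖Φ w‖ ≤ 1) ∧
      ∃ V, Adm ω ρ V ∧ ∀ k w, ‖iteratedFDeriv ℝ k Φ w‖ ≤ V k := by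
  classical
  obtain ⟨u, hu, h1, h2, h3, V, hV, hVb⟩ := exists_bump hω hσ hρ hωσ
  set g : ι → F → ℂ := fun i w => ((u (ℓ i w) : ℝ) : ℂ) with hg
  have hgs : ∀ i, ContDiff ℝ (⊤ : ℕ∞) (g i) := fun i =>
    Complex.ofRealCLM.contDiff.comp (hu.comp (ℓ i).contDiff)
  have hgn : ∀ i w, ‖g i w‖ ≤ 1 := fun i w => by
    simp only [hg, Complex.norm_real, Real.norm_eq_abs, abs_of_nonneg (h3 _).1]
    exact (h3 _).2
  have hgb : ∀ i k w, ‖iteratedFDeriv ℝ k (g i) w‖ ≤ V k := fun i k w => by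
    have e : ‖iteratedFDeriv ℝ k (g i) w‖ = ‖iteratedFDeriv ℝ k (u ∘ ℓ i) w‖ :=
      Complex.ofRealLI.norm_iteratedFDeriv_comp_left (f := u ∘ ℓ i)
        ((hu.comp (ℓ i).contDiff).contDiffAt) (i := k) (by exact_mod_cast le_top)
    rw [e, (ℓ i).iteratedFDeriv_comp_right hu w (i := k) (by exact_mod_cast le_top)]
    refine (ContinuousMultilinearMap.norm_compContinuousLinearMap_le _ _).trans ?_
    rw [norm_iteratedFDeriv_eq_norm_iteratedDeriv, Real.norm_eq_abs]
    refine (mul_le_of_le_one_right (abs_nonneg _) ?_).trans (hVb k _)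
    exact Finset.prod_le_one (fun _ _ => norm_nonneg _) fun _ _ => hℓ i
  refine ⟨fun w => ∏ i ∈ s, g i w, contDiff_prod fun i _ => hgs i, fun w hw => ?_, fun w hw => ?_,
    fun w => ?_, ?_⟩
  · refine Finset.prod_eq_one fun i hi => ?_
    simp only [hg, h1 _ (hw i hi), Complex.ofReal_one]
  · obtain ⟨i, hi, h⟩ := hw
    refine Finset.prod_eq_zero hi ?_
    simp only [hg, h2 _ h, Complex.ofReal_zero]
  · rw [norm_prod]
    exact Finset.prod_le_one (fun _ _ => norm_nonneg _) fun i _ => hgn i w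
  · induction s using Finset.induction_on with
    | empty =>
      refine ⟨_, Adm.const hω hρ zero_le_one, fun k w => ?_⟩
      simp only [Finset.prod_empty]
      rcases Nat.eq_zero_or_pos k with rfl | hk
      · simp
      · rw [iteratedFDeriv_const_of_ne hk.ne']; simp
    | insert i s his ih =>
      obtain ⟨V', hV', hb⟩ := ih
      refine ⟨_, hV.leibniz hω hρ hV', fun k w => ?_⟩
      simp only [Finset.prod_insert his]
      refine (norm_iteratedFDeriv_mul_le (hgs i) (contDiff_prod fun i _ => hgs i) w
        (n := k) (by exact_mod_cast le_top)).trans (Finset.sum_le_sum fun j _ => ?_)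
      have := hV.nonneg j
      have := hV'.nonneg (k - j)
      gcongr
      · exact hgb i j w
      · exact hb (k - j) w

end

/-- A cutoff function on `ℝ^d × ℝ^d` with admissible derivatives. -/
lemma exists_cutoff {ω σ : ℝ → ℝ} {ρ : ℝ} (hω : IsWeightFunction ω) (hσ : IsWeightFunction σ)
    (hρ : 0 < ρ) (hωσ : (fun t : ℝ => ω (t ^ (1 / ρ))) =O[Filter.atTop] σ) (d : ℕ) :
    ∃ Φ : Eucl d × Eucl d → ℂ, ContDiff ℝ (⊤ : ℕ∞) Φ ∧ (∀ w, ‖w‖ ≤ 1 → Φ w = 1) ∧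
      (∃ q : ℕ, ∀ w, 2 ^ q ≤ ‖w‖ → Φ w = 0) ∧ (∀ w, ‖Φ w‖ ≤ 1) ∧
      ∃ V, Adm ω ρ V ∧ ∀ k w, ‖iteratedFDeriv ℝ k Φ w‖ ≤ V k := by
  set ℓ : Fin d ⊕ Fin d → (Eucl d × Eucl d) →L[ℝ] ℝ := Sum.elim
    (fun i => (EuclideanSpace.proj i).comp (ContinuousLinearMap.fst ℝ _ _))
    (fun i => (EuclideanSpace.proj i).comp (ContinuousLinearMap.snd ℝ _ _)) with hℓ
  have hle : ∀ (x : Eucl d) i, |x i| ≤ ‖x‖ := fun x i => PiLp.norm_apply_le x i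
  have hb : ∀ i w, |ℓ i w| ≤ ‖w‖ := by
    rintro (i | i) w
    · exact (hle w.1 i).trans (norm_fst_le w)
    · exact (hle w.2 i).trans (norm_snd_le w)
  obtain ⟨Φ, h1, h2, h3, h4, h5⟩ := exists_tensor_bump hω hσ hρ hωσ Finset.univ ℓ fun i =>
    ContinuousLinearMap.opNorm_le_bound _ zero_le_one fun w => by
      rw [one_mul]; exact hb i w
  -- A vector whose coordinates are all below 2 has norm at most 2√d; a power of two fits the dyadic
  -- scales used later.
  obtain ⟨q, hq⟩ := pow_unbounded_of_one_lt (2 * Real.sqrt d) (one_lt_two (α := ℝ))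
  refine ⟨Φ, h1, fun w hw => h2 w fun i _ => (hb i w).trans hw, ⟨q, fun w hw => h3 w ?_⟩, h4, h5⟩
  have key : ∀ x : Eucl d, (∀ i, |x i| < 2) → ‖x‖ ≤ 2 * Real.sqrt d := fun x hx => by
    rw [EuclideanSpace.norm_eq, show (2 : ℝ) * Real.sqrt d = Real.sqrt (d * 4) by
      rw [Real.sqrt_mul (by positivity), show (4 : ℝ) = 2 ^ 2 by norm_num,
        Real.sqrt_sq zero_le_two, mul_comm]]
    refine Real.sqrt_le_sqrt ?_
    calc ∑ i, ‖x i‖ ^ 2 ≤ ∑ _i : Fin d, (4 : ℝ) := Finset.sum_le_sum fun i _ => by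
          have := hx i; rw [Real.norm_eq_abs]; nlinarith [abs_nonneg (x i)]
      _ = _ := by simp
  by_contra! hcon
  have k1 := key w.1 fun i => hcon (Sum.inl i) (Finset.mem_univ _)
  have k2 := key w.2 fun i => hcon (Sum.inr i) (Finset.mem_univ _)
  have : ‖w‖ ≤ 2 * Real.sqrt d := max_le k1 k2
  linarith

/-! ### Multi-index derivatives and iterated Fréchet derivatives -/

section
variable {F : Type*} [NormedAddCommGroup F] [NormedSpace ℝ F]

/-- Successive directional derivatives along the vectors of a list. -/
def wordDeriv (l : List F) (f : F → ℂ) : F → ℂ := l.foldr dirDeriv f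

lemma nat_le_infty (k : ℕ) : (k : WithTop ℕ∞) ≤ ((⊤ : ℕ∞) : WithTop ℕ∞) := by
  exact_mod_cast le_top

lemma ContDiff.dirDeriv' {f : F → ℂ} (hf : ContDiff ℝ (⊤ : ℕ∞) f) (v : F) :
    ContDiff ℝ (⊤ : ℕ∞) (dirDeriv v f) :=
  (hf.fderiv_right (m := (⊤ : ℕ∞)) (by simp)).clm_apply contDiff_const

lemma ContDiff.wordDeriv {f : F → ℂ} (hf : ContDiff ℝ (⊤ : ℕ∞) f) (l : List F) :
    ContDiff ℝ (⊤ : ℕ∞) (wordDeriv l f) := by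
  induction l with
  | nil => exact hf
  | cons v l ih => exact ih.dirDeriv' v

lemma norm_iteratedFDeriv_dirDeriv_le {f : F → ℂ} (hf : ContDiff ℝ (⊤ : ℕ∞) f) {v : F}
    (hv : ‖v‖ ≤ 1) (k : ℕ) (z : F) :
    ‖iteratedFDeriv ℝ k (dirDeriv v f) z‖ ≤ ‖iteratedFDeriv ℝ (k + 1) f z‖ := by
  refine (norm_iteratedFDeriv_clm_apply_const (N := (⊤ : ℕ∞))
    (hf.fderiv_right (m := (⊤ : ℕ∞)) (by simp)).contDiffAt (nat_le_infty k)).trans ?_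
  rw [norm_iteratedFDeriv_fderiv]
  exact mul_le_of_le_one_left (norm_nonneg _) hv

lemma norm_iteratedFDeriv_wordDeriv_le {f : F → ℂ} (hf : ContDiff ℝ (⊤ : ℕ∞) f) {l : List F}
    (hl : ∀ v ∈ l, ‖v‖ ≤ 1) (k : ℕ) (z : F) :
    ‖iteratedFDeriv ℝ k (wordDeriv l f) z‖ ≤ ‖iteratedFDeriv ℝ (k + l.length) f z‖ := by
  induction l generalizing k with
  | nil => exact le_rfl
  | cons v l ih =>
    refine (norm_iteratedFDeriv_dirDeriv_le (hf.wordDeriv l) (hl v (by simp)) k z).trans ?_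
    refine (ih (fun v hv => hl v (by simp [hv])) (k + 1)).trans (le_of_eq ?_)
    rw [List.length_cons, add_right_comm, add_assoc]

lemma norm_wordDeriv_le {f : F → ℂ} (hf : ContDiff ℝ (⊤ : ℕ∞) f) {l : List F}
    (hl : ∀ v ∈ l, ‖v‖ ≤ 1) (z : F) : ‖wordDeriv l f z‖ ≤ ‖iteratedFDeriv ℝ l.length f z‖ := by
  have := norm_iteratedFDeriv_wordDeriv_le hf hl 0 z
  rwa [norm_iteratedFDeriv_zero, zero_add] at this

lemma dirDeriv_comm {f : F → ℂ} (hf : ContDiff ℝ (⊤ : ℕ∞) f) (v w : F) :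
    dirDeriv v (dirDeriv w f) = dirDeriv w (dirDeriv v f) := by
  have hd : Differentiable ℝ (fderiv ℝ f) :=
    (hf.fderiv_right (m := (⊤ : ℕ∞)) (by simp)).differentiable (by simp)
  have key : ∀ v w z, dirDeriv v (dirDeriv w f) z = fderiv ℝ (fderiv ℝ f) z v w := by
    intro v w z
    change fderiv ℝ (fun y => fderiv ℝ f y w) z v = _
    rw [fderiv_clm_apply (hd z) (differentiableAt_const _)]
    simp
  ext z
  rw [key, key]
  exact ((hf.contDiffAt (x := z)).isSymmSndFDerivAt
    (by rw [minSmoothness_of_isRCLikeNormedField]; exact nat_le_infty 2)).eq v w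

lemma wordDeriv_perm {f : F → ℂ} (hf : ContDiff ℝ (⊤ : ℕ∞) f) {l l' : List F} (h : l.Perm l') :
    wordDeriv l f = wordDeriv l' f := by
  induction h with
  | nil => rfl
  | cons v _ ih => exact congrArg (dirDeriv v) ih
  | swap v w l => exact dirDeriv_comm (hf.wordDeriv l) w v
  | trans _ _ h1 h2 => exact h1.trans h2

lemma wordDeriv_append (l l' : List F) (f : F → ℂ) :
    wordDeriv (l ++ l') f = wordDeriv l (wordDeriv l' f) := List.foldr_append

lemma wordDeriv_replicate (n : ℕ) (v : F) (f : F → ℂ) :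
    wordDeriv (List.replicate n v) f = (dirDeriv v)^[n] f := by
  induction n with
  | zero => rfl
  | succ n ih => rw [Function.iterate_succ_apply', ← ih]; rfl

/-- The list of directions of a multi-index derivative. -/
def multiWord {n : ℕ} {X : Type*} (v : Fin n → X) (α : Fin n → ℕ) : List X :=
  (List.finRange n).flatMap fun i => List.replicate (α i) (v i)

lemma multiDeriv_eq_wordDeriv {n : ℕ} (v : Fin n → F) (α : Fin n → ℕ) (f : F → ℂ) :
    multiDeriv v α f = wordDeriv (multiWord v α) f := by
  rw [multiDeriv, multiWord]
  induction List.finRange n with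
  | nil => rfl
  | cons i l ih =>
    rw [List.foldr_cons, ih, List.flatMap_cons, wordDeriv_append, wordDeriv_replicate]

lemma length_multiWord {n : ℕ} {X : Type*} (v : Fin n → X) (α : Fin n → ℕ) :
    (multiWord v α).length = mlen α := by
  rw [multiWord, List.length_flatMap, mlen, ← List.ofFn_eq_map, List.sum_ofFn]
  simp

lemma mem_multiWord {n : ℕ} {X : Type*} {v : Fin n → X} {α : Fin n → ℕ} {x : X}
    (h : x ∈ multiWord v α) : ∃ i, x = v i := by
  obtain ⟨i, -, hi⟩ := List.mem_flatMap.1 h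
  exact ⟨i, List.eq_of_mem_replicate hi⟩

lemma map_multiWord {n : ℕ} {X Y : Type*} (g : X → Y) (v : Fin n → X) (α : Fin n → ℕ) :
    (multiWord v α).map g = multiWord (fun i => g (v i)) α := by
  simp [multiWord, List.map_flatMap]

lemma count_multiWord {n : ℕ} {X : Type*} [BEq X] [LawfulBEq X] {v : Fin n → X}
    (hv : Function.Injective v) (α : Fin n → ℕ) (j : Fin n) :
    (multiWord v α).count (v j) = α j := by
  rw [multiWord, List.count_flatMap, ← List.ofFn_eq_map, List.sum_ofFn]
  rw [Finset.sum_eq_single j]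
  · simp
  · intro i _ hi
    simp [List.count_replicate, hv.eq_iff, hi]
  · simp

lemma count_multiWord_of_ne {n : ℕ} {X : Type*} [BEq X] [LawfulBEq X] {v : Fin n → X} (α : Fin n → ℕ)
    {x : X} (h : ∀ i, v i ≠ x) : (multiWord v α).count x = 0 := by
  rw [List.count_eq_zero]
  intro hx
  obtain ⟨i, hi⟩ := mem_multiWord hx
  exact h i hi.symm

/-- The iterated derivative is controlled by the derivatives along the words in a basis. -/
lemma norm_iteratedFDeriv_le_of_wordDeriv {ι : Type*} [Fintype ι] (b : ι → F) (c : ι → F →L[ℝ] ℝ)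
    (hc : ∀ i, ‖c i‖ ≤ 1) (hb : ∀ v, v = ∑ i, c i v • b i) {f : F → ℂ}
    (hf : ContDiff ℝ (⊤ : ℕ∞) f) (z : F) (k : ℕ) {M : ℝ}
    (hM : ∀ w : List ι, w.length = k → ‖wordDeriv (w.map b) f z‖ ≤ M) :
    ‖iteratedFDeriv ℝ k f z‖ ≤ (Fintype.card ι : ℝ) ^ k * M := by
  induction k generalizing f with
  | zero => simpa [wordDeriv] using hM [] rfl
  | succ k ih =>
    -- The derivative is a sum of c_i ⊗ ∂_{b_i} f over i, so each order contributes one factor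
    -- `Fintype.card ι`.
    have e : fderiv ℝ f = fun y => ∑ i, ContinuousLinearMap.smulRightL ℝ F ℂ (c i)
        (dirDeriv (b i) f y) := by
      ext y v
      conv_lhs => rw [hb v]
      simp [dirDeriv]
    have hs : ∀ i, ContDiff ℝ (⊤ : ℕ∞) fun y => ContinuousLinearMap.smulRightL ℝ F ℂ (c i)
        (dirDeriv (b i) f y) := fun i =>
      (ContinuousLinearMap.contDiff _).comp (hf.dirDeriv' (b i))
    have hle : ∀ i, ‖iteratedFDeriv ℝ k (fun y => ContinuousLinearMap.smulRightL ℝ F ℂ (c i)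
        (dirDeriv (b i) f y)) z‖ ≤ (Fintype.card ι : ℝ) ^ k * M := by
      intro i
      refine (ContinuousLinearMap.norm_iteratedFDeriv_comp_left _
        (hf.dirDeriv' (b i)).contDiffAt (nat_le_infty k)).trans ?_
      have h1 : ‖ContinuousLinearMap.smulRightL ℝ F ℂ (c i)‖ ≤ 1 :=
        ContinuousLinearMap.opNorm_le_bound _ zero_le_one fun x => by
          change ‖(c i).smulRight x‖ ≤ _
          rw [ContinuousLinearMap.norm_smulRight_apply]
          exact mul_le_mul_of_nonneg_right (hc i) (norm_nonneg _)
      refine (mul_le_of_le_one_left (norm_nonneg _) h1).trans ?_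
      refine ih (hf.dirDeriv' (b i)) fun w hw => ?_
      have := hM (w ++ [i]) (by simp [hw])
      rwa [List.map_append, wordDeriv_append] at this
    rw [← norm_iteratedFDeriv_fderiv, e]
    have h2 : iteratedFDeriv ℝ k (fun y => ∑ i, ContinuousLinearMap.smulRightL ℝ F ℂ (c i)
        (dirDeriv (b i) f y)) z = ∑ i, iteratedFDeriv ℝ k (fun y =>
          ContinuousLinearMap.smulRightL ℝ F ℂ (c i) (dirDeriv (b i) f y)) z :=
      iteratedFDeriv_fun_sum_apply fun i _ => ((hs i).of_le (nat_le_infty k)).contDiffAt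
    rw [h2]
    calc _ ≤ ∑ i : ι, (Fintype.card ι : ℝ) ^ k * M :=
          (norm_sum_le _ _).trans (Finset.sum_le_sum fun i _ => hle i)
      _ = _ := by
          rw [Finset.sum_const, Finset.card_univ, nsmul_eq_mul, pow_succ]; ring

end

section
variable {d : ℕ}

lemma norm_stdVec (i : Fin d) : ‖stdVec d i‖ = 1 := by
  simp [stdVec]

lemma norm_symDeriv_le {p : Eucl d × Eucl d → ℂ} (hp : ContDiff ℝ (⊤ : ℕ∞) p) (α β : Fin d → ℕ)
    (z : Eucl d × Eucl d) : ‖symDeriv α β p z‖ ≤ ‖iteratedFDeriv ℝ (mlen (α + β)) p z‖ := by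
  rw [symDeriv, multiDeriv_eq_wordDeriv, multiDeriv_eq_wordDeriv, ← wordDeriv_append]
  have e : mlen (α + β) = mlen α + mlen β := Finset.sum_add_distrib
  rw [e, ← length_multiWord (fun i => ((stdVec d i, 0) : Eucl d × Eucl d)) α,
    ← length_multiWord (fun i => ((0, stdVec d i) : Eucl d × Eucl d)) β, ← List.length_append]
  refine norm_wordDeriv_le hp (fun v hv => ?_) z
  rcases List.mem_append.1 hv with h | h <;> obtain ⟨i, rfl⟩ := mem_multiWord h <;>
    simp [Prod.norm_def, norm_stdVec]

lemma ampDeriv_eq_wordDeriv (α β γ : Fin d → ℕ) (a : Eucl d × Eucl d × Eucl d → ℂ) :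
    ampDeriv α β γ a = wordDeriv (multiWord (fun i => (stdVec d i, 0, 0)) α ++
      (multiWord (fun i => (0, stdVec d i, 0)) β ++ multiWord (fun i => (0, 0, stdVec d i)) γ)) a := by
  rw [ampDeriv, multiDeriv_eq_wordDeriv, multiDeriv_eq_wordDeriv, multiDeriv_eq_wordDeriv,
    ← wordDeriv_append, ← wordDeriv_append, List.append_assoc]

lemma norm_ampDeriv_le {a : Eucl d × Eucl d × Eucl d → ℂ} (ha : ContDiff ℝ (⊤ : ℕ∞) a)
    (α β γ : Fin d → ℕ) (z : Eucl d × Eucl d × Eucl d) :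
    ‖ampDeriv α β γ a z‖ ≤ ‖iteratedFDeriv ℝ (mlen (α + β + γ)) a z‖ := by
  rw [ampDeriv_eq_wordDeriv]
  have e : mlen (α + β + γ) = mlen α + (mlen β + mlen γ) := by
    rw [← add_assoc]; simp only [mlen, Pi.add_apply, Finset.sum_add_distrib]
  rw [e, ← length_multiWord (fun i => ((stdVec d i, 0, 0) : Eucl d × Eucl d × Eucl d)) α,
    ← length_multiWord (fun i => ((0, stdVec d i, 0) : Eucl d × Eucl d × Eucl d)) β,
    ← length_multiWord (fun i => ((0, 0, stdVec d i) : Eucl d × Eucl d × Eucl d)) γ,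
    ← List.length_append, ← List.length_append]
  refine norm_wordDeriv_le ha (fun v hv => ?_) z
  rcases List.mem_append.1 hv with h | h
  · obtain ⟨i, rfl⟩ := mem_multiWord h
    simp [Prod.norm_def, norm_stdVec]
  · rcases List.mem_append.1 h with h | h <;> obtain ⟨i, rfl⟩ := mem_multiWord h <;>
    simp [Prod.norm_def, norm_stdVec]

/-- Reverse estimate: the iterated derivative is controlled by the multi-index derivatives. -/
lemma norm_iteratedFDeriv_le_of_ampDeriv {a : Eucl d × Eucl d × Eucl d → ℂ}
    (ha : ContDiff ℝ (⊤ : ℕ∞) a) (z : Eucl d × Eucl d × Eucl d) (k : ℕ) {M : ℝ}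
    (hM : ∀ α β γ : Fin d → ℕ, mlen (α + β + γ) = k → ‖ampDeriv α β γ a z‖ ≤ M) :
    ‖iteratedFDeriv ℝ k a z‖ ≤ ((3 * d : ℕ) : ℝ) ^ k * M := by
  set b : Fin 3 × Fin d → Eucl d × Eucl d × Eucl d := fun p =>
    ![(stdVec d p.2, 0, 0), (0, stdVec d p.2, 0), (0, 0, stdVec d p.2)] p.1 with hb
  set P : Fin 3 → (Eucl d × Eucl d × Eucl d) →L[ℝ] Eucl d :=
    ![ContinuousLinearMap.fst ℝ _ _,
      (ContinuousLinearMap.fst ℝ _ _).comp (ContinuousLinearMap.snd ℝ _ _),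
      (ContinuousLinearMap.snd ℝ _ _).comp (ContinuousLinearMap.snd ℝ _ _)] with hP
  set c : Fin 3 × Fin d → (Eucl d × Eucl d × Eucl d) →L[ℝ] ℝ :=
    fun p => (EuclideanSpace.proj p.2).comp (P p.1) with hc
  have hle : ∀ (x : Eucl d) i, |x i| ≤ ‖x‖ := fun x i => PiLp.norm_apply_le x i
  have hexp : ∀ x : Eucl d, ∑ i, x i • stdVec d i = x := by
    intro x
    ext j
    simp [stdVec, Pi.single_apply]
  have h := norm_iteratedFDeriv_le_of_wordDeriv b c ?_ ?_ ha z k (M := M) ?_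
  · simpa using h
  · rintro ⟨j, i⟩
    refine ContinuousLinearMap.opNorm_le_bound _ zero_le_one fun w => ?_
    rw [one_mul]
    refine (hle (P j w) i).trans ?_
    fin_cases j
    · exact norm_fst_le w
    · exact (norm_fst_le w.2).trans (norm_snd_le w)
    · exact (norm_snd_le w.2).trans (norm_snd_le w)
  · rintro ⟨x, y, ξ⟩
    simp [hb, hc, hP, Fintype.sum_prod_type, Fin.sum_univ_three, Prod.ext_iff, Prod.fst_sum,
      Prod.snd_sum, hexp]
  · intro w hw
    set n : Fin 3 → Fin d → ℕ := fun j i => w.count (j, i) with hn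
    set α := n 0
    set β := n 1
    set γ := n 2
    set w' : List (Fin 3 × Fin d) := multiWord (fun i => (0, i)) α ++
      (multiWord (fun i => (1, i)) β ++ multiWord (fun i => (2, i)) γ)
      with hw'
    -- Partial derivatives commute, so only the multiplicities of the letters matter; sorting the
    -- word turns it into a triple of multi-indices.
    have hperm : w.Perm w' := by
      rw [List.perm_iff_count]
      have inj : ∀ j : Fin 3, Function.Injective fun i : Fin d => (j, i) := fun j i i' h =>
        (Prod.ext_iff.1 h).2
      rintro ⟨j, i⟩
      rw [hw', List.count_append, List.count_append]
      fin_cases j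
      · have := count_multiWord (inj 0) α i
        simp only [Fin.zero_eta, Fin.isValue] at this ⊢
        rw [this, count_multiWord_of_ne, count_multiWord_of_ne] <;> simp [α, hn]
      · have := count_multiWord (inj 1) β i
        simp only [Fin.mk_one, Fin.isValue] at this ⊢
        rw [this, count_multiWord_of_ne, count_multiWord_of_ne] <;> simp [β, hn]
      · have := count_multiWord (inj 2) γ i
        simp only [Fin.reduceFinMk, Fin.isValue] at this ⊢
        rw [this, count_multiWord_of_ne, count_multiWord_of_ne] <;> simp [γ, hn]
    have hlen : mlen (α + β + γ) = k := by
      rw [← hw, hperm.length_eq, hw', List.length_append, List.length_append, length_multiWord,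
        length_multiWord, length_multiWord, ← add_assoc]
      simp only [mlen, Pi.add_apply, Finset.sum_add_distrib]
    refine le_trans (le_of_eq ?_) (hM α β γ hlen)
    rw [wordDeriv_perm ha (hperm.map b), hw', List.map_append, List.map_append, map_multiWord,
      map_multiWord, map_multiWord, ampDeriv_eq_wordDeriv]
    rfl

end

/-! ### Amplitude and symbol estimates with one sequence of constants -/

section
variable {ω : ℝ → ℝ} (hω : IsWeightFunction ω) {r : ℝ} (hr : 0 < r)
include hω hr

omit hω hr in
/-- A family of sets bounded by all the sequences `C wt ω r n` is bounded by one admissible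
sequence. -/
lemma Adm.exists_of_sets {S : ℕ → Set ℝ}
    (h : ∀ n : ℕ, 0 < n → ∃ C : ℝ, 0 < C ∧ ∀ k, ∀ s ∈ S k, s ≤ C * wt ω r n k) :
    ∃ V, Adm ω r V ∧ ∀ k, ∀ s ∈ S k, s ≤ V k := by
  have hb : ∀ k, BddAbove (S k) := fun k => by
    obtain ⟨C, -, hC⟩ := h 1 one_pos
    exact ⟨_, fun s hs => hC k s hs⟩
  refine ⟨fun k => max 0 (sSup (S k)), ⟨fun k => le_max_left _ _, fun n hn => ?_⟩,
    fun k s hs => (le_csSup (hb k) hs).trans (le_max_right _ _)⟩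
  obtain ⟨C, hC0, hC⟩ := h n hn
  refine ⟨C, hC0, fun k => max_le (mul_pos hC0 (wt_pos ω r n k)).le ?_⟩
  exact Real.sSup_le (fun s hs => hC k s hs) (mul_pos hC0 (wt_pos ω r n k)).le

end

section
variable {d : ℕ}

lemma one_le_jap (x : Eucl d) : 1 ≤ jap x := by
  rw [jap, Real.one_le_sqrt]; nlinarith [sq_nonneg ‖x‖]

lemma one_le_jap2 (x ξ : Eucl d) : 1 ≤ jap2 x ξ := by
  rw [jap2, Real.one_le_sqrt]; nlinarith [sq_nonneg ‖x‖, sq_nonneg ‖ξ‖]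

lemma one_le_jap3 (x y ξ : Eucl d) : 1 ≤ jap3 x y ξ := by
  rw [jap3, Real.one_le_sqrt]; nlinarith [sq_nonneg ‖x‖, sq_nonneg ‖ξ‖, sq_nonneg ‖y‖]

/-- The quotient `⟨x - y⟩ / ⟨(x, y, ξ)⟩`. -/
def japRatio (w : Eucl d × Eucl d × Eucl d) : ℝ := jap (w.1 - w.2.1) / jap3 w.1 w.2.1 w.2.2

lemma japRatio_pos (w : Eucl d × Eucl d × Eucl d) : 0 < japRatio w :=
  div_pos (zero_lt_one.trans_le (one_le_jap _)) (zero_lt_one.trans_le (one_le_jap3 _ _ _))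

/-- The sum `ω(x) + ω(y) + ω(ξ)`. -/
def ampWeight (ω : ℝ → ℝ) (w : Eucl d × Eucl d × Eucl d) : ℝ :=
  ω ‖w.1‖ + ω ‖w.2.1‖ + ω ‖w.2.2‖

/-- Amplitude estimates with a single sequence of constants. -/
def AmpBound (ω : ℝ → ℝ) (m ρ : ℝ) (V : ℕ → ℝ) (a : Eucl d × Eucl d × Eucl d → ℂ) : Prop :=
  ∀ k w, ‖iteratedFDeriv ℝ k a w‖ ≤ V k * japRatio w ^ (ρ * k) * Real.exp (m * ampWeight ω w)

variable {ω : ℝ → ℝ} (hω : IsWeightFunction ω) {m ρ : ℝ} (hρ : 0 < ρ)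

include hω hρ in
lemma IsAmplitude.exists_ampBound {a : Eucl d × Eucl d × Eucl d → ℂ} (ha : IsAmplitude ω m ρ a) :
    ∃ V, Adm ω ρ V ∧ AmpBound ω m ρ V a := by
  obtain ⟨hs, ha⟩ := ha
  -- The best constants of each order k form one admissible sequence; passing to the full derivative
  -- then costs (3d)^k, a geometric factor.
  obtain ⟨V, hV, h⟩ := Adm.exists_of_sets (S := fun k => {s | ∃ (α β γ : Fin d → ℕ)
    (w : Eucl d × Eucl d × Eucl d), mlen (α + β + γ) = k ∧ s = ‖ampDeriv α β γ a w‖ /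
      (japRatio w ^ (ρ * k) * Real.exp (m * ampWeight ω w))}) (by
    intro n hn
    obtain ⟨C, hC, h⟩ := ha n hn
    refine ⟨C, hC, ?_⟩
    rintro k _ ⟨α, β, γ, w, rfl, rfl⟩
    have hp : 0 < japRatio w ^ (ρ * (mlen (α + β + γ) : ℝ)) * Real.exp (m * ampWeight ω w) :=
      mul_pos (Real.rpow_pos_of_pos (japRatio_pos w) _) (Real.exp_pos _)
    rw [div_le_iff₀ hp]
    refine (h α β γ w.1 w.2.1 w.2.2).trans (le_of_eq ?_)
    rw [japRatio, Real.div_rpow (zero_le_one.trans (one_le_jap _))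
      (zero_le_one.trans (one_le_jap3 _ _ _)), wt, ampWeight]
    ring)
  refine ⟨_, hV.pow_mul hω hρ (B := ((3 * d : ℕ) : ℝ)) (Nat.cast_nonneg _), fun k w => ?_⟩
  refine (norm_iteratedFDeriv_le_of_ampDeriv hs w k
    (M := V k * (japRatio w ^ (ρ * k) * Real.exp (m * ampWeight ω w)))
    fun α β γ hk => ?_).trans (le_of_eq (by ring))
  have hp : 0 < japRatio w ^ (ρ * (k : ℝ)) * Real.exp (m * ampWeight ω w) :=
      mul_pos (Real.rpow_pos_of_pos (japRatio_pos w) _) (Real.exp_pos _)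
  rw [← div_le_iff₀ hp]
  exact h k _ ⟨α, β, γ, w, hk, rfl⟩

lemma AmpBound.isAmplitude {a : Eucl d × Eucl d × Eucl d → ℂ} (hs : ContDiff ℝ (⊤ : ℕ∞) a)
    {V : ℕ → ℝ} (hV : Adm ω ρ V) (h : AmpBound ω m ρ V a) : IsAmplitude ω m ρ a := by
  refine ⟨hs, fun n hn => ?_⟩
  obtain ⟨C, hC, hCV⟩ := hV.2 n hn
  refine ⟨C, hC, fun α β γ x y ξ => ((norm_ampDeriv_le hs α β γ _).trans (h _ _)).trans ?_⟩
  set k := mlen (α + β + γ)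
  have e : japRatio (x, y, ξ) ^ (ρ * (k : ℝ)) = jap (x - y) ^ (ρ * (k : ℝ)) /
      jap3 x y ξ ^ (ρ * (k : ℝ)) := by
    rw [japRatio, Real.div_rpow (zero_le_one.trans (one_le_jap _))
      (zero_le_one.trans (one_le_jap3 _ _ _))]
  rw [← e]
  refine (mul_le_mul_of_nonneg_right (mul_le_mul_of_nonneg_right (hCV k)
    (Real.rpow_nonneg (japRatio_pos _).le _)) (Real.exp_pos _).le).trans (le_of_eq ?_)
  rw [wt, ampWeight]
  ring

/-- Symbol estimates with a single sequence of constants. -/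
def SymBound (ω : ℝ → ℝ) (m ρ : ℝ) (V : ℕ → ℝ) (p : Eucl d × Eucl d → ℂ) : Prop :=
  ∀ k w, ‖iteratedFDeriv ℝ k p w‖ ≤ V k * (1 / jap2 w.1 w.2) ^ (ρ * k) *
    Real.exp (m * ω ‖w.1‖) * Real.exp (m * ω ‖w.2‖)

lemma SymBound.isSymbol {p : Eucl d × Eucl d → ℂ} (hs : ContDiff ℝ (⊤ : ℕ∞) p)
    {V : ℕ → ℝ} (hV : Adm ω ρ V) (h : SymBound ω m ρ V p) : IsSymbol ω m ρ p := by
  refine ⟨hs, fun n hn => ?_⟩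
  obtain ⟨C, hC, hCV⟩ := hV.2 n hn
  refine ⟨C, hC, fun α β x ξ => ((norm_symDeriv_le hs α β _).trans (h _ _)).trans ?_⟩
  set k := mlen (α + β)
  have e : (1 / jap2 x ξ) ^ (ρ * (k : ℝ)) = 1 / jap2 x ξ ^ (ρ * (k : ℝ)) := by
    rw [Real.div_rpow zero_le_one (zero_le_one.trans (one_le_jap2 _ _)), Real.one_rpow]
  rw [← e]
  have := hCV k
  rw [wt] at this
  have h0 : 0 ≤ (1 / jap2 x ξ) ^ (ρ * (k : ℝ)) :=
    Real.rpow_nonneg (div_nonneg zero_le_one (zero_le_one.trans (one_le_jap2 _ _))) _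
  calc _ ≤ (C * Real.exp (n * ρ * youngConj ω (k / n))) * (1 / jap2 x ξ) ^ (ρ * (k : ℝ)) *
        Real.exp (m * ω ‖x‖) * Real.exp (m * ω ‖ξ‖) := by gcongr
    _ = _ := by ring

/-! ### The terms of the expansion as powers of one operator -/

/-- The operator `∑ D_{ξ_i} ∂_{y_i}`. -/
def mixedDeriv (f : Eucl d × Eucl d × Eucl d → ℂ) : Eucl d × Eucl d × Eucl d → ℂ :=
  fun w => ∑ i, (-Complex.I) • dirDeriv (0, 0, stdVec d i) (dirDeriv (0, stdVec d i, 0) f) w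

lemma ContDiff.mixedDeriv {f : Eucl d × Eucl d × Eucl d → ℂ} (hf : ContDiff ℝ (⊤ : ℕ∞) f) :
    ContDiff ℝ (⊤ : ℕ∞) (mixedDeriv f) := by
  unfold _root_.mixedDeriv
  exact ContDiff.sum fun i _ => ((hf.dirDeriv' _).dirDeriv' _).const_smul (-Complex.I)

lemma ContDiff.iterate_mixedDeriv {f : Eucl d × Eucl d × Eucl d → ℂ}
    (hf : ContDiff ℝ (⊤ : ℕ∞) f) (j : ℕ) : ContDiff ℝ (⊤ : ℕ∞) (_root_.mixedDeriv^[j] f) := by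
  induction j with
  | zero => exact hf
  | succ j ih => rw [Function.iterate_succ_apply']; exact ih.mixedDeriv

lemma norm_iteratedFDeriv_mixedDeriv_le {f : Eucl d × Eucl d × Eucl d → ℂ}
    (hf : ContDiff ℝ (⊤ : ℕ∞) f) (k : ℕ) (w) :
    ‖iteratedFDeriv ℝ k (mixedDeriv f) w‖ ≤ d * ‖iteratedFDeriv ℝ (k + 2) f w‖ := by
  have hs : ∀ i, ContDiff ℝ (⊤ : ℕ∞)
      (dirDeriv ((0, 0, stdVec d i) : Eucl d × Eucl d × Eucl d) (dirDeriv (0, stdVec d i, 0) f)) :=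
    fun i => (hf.dirDeriv' _).dirDeriv' _
  unfold mixedDeriv
  rw [iteratedFDeriv_fun_sum_apply fun i _ =>
    (((hs i).const_smul (-Complex.I)).of_le (nat_le_infty k)).contDiffAt]
  calc _ ≤ ∑ _i : Fin d, ‖iteratedFDeriv ℝ (k + 2) f w‖ := by
        refine (norm_sum_le _ _).trans (Finset.sum_le_sum fun i _ => ?_)
        rw [iteratedFDeriv_const_smul_apply' ((hs i).of_le (nat_le_infty k)).contDiffAt, norm_smul,
          norm_neg, Complex.norm_I, one_mul]
        refine (norm_iteratedFDeriv_dirDeriv_le (hf.dirDeriv' _) ?_ k w).trans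
          (norm_iteratedFDeriv_dirDeriv_le hf ?_ (k + 1) w) <;>
        simp [Prod.norm_def, norm_stdVec]
    _ = _ := by simp

lemma norm_iteratedFDeriv_iterate_mixedDeriv_le {f : Eucl d × Eucl d × Eucl d → ℂ}
    (hf : ContDiff ℝ (⊤ : ℕ∞) f) (j k : ℕ) (w) :
    ‖iteratedFDeriv ℝ k (mixedDeriv^[j] f) w‖ ≤ d ^ j * ‖iteratedFDeriv ℝ (k + 2 * j) f w‖ := by
  induction j generalizing k with
  | zero => simp
  | succ j ih =>
    rw [Function.iterate_succ_apply']
    refine (norm_iteratedFDeriv_mixedDeriv_le (hf.iterate_mixedDeriv j) k w).trans ?_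
    refine (mul_le_mul_of_nonneg_left (ih (k + 2)) (Nat.cast_nonneg d)).trans (le_of_eq ?_)
    rw [pow_succ, show k + 2 + 2 * j = k + 2 * (j + 1) by ring]
    ring

/-- The space of smooth functions. -/
def smoothFun (F : Type*) [NormedAddCommGroup F] [NormedSpace ℝ F] : Submodule ℂ (F → ℂ) where
  carrier := {f | ContDiff ℝ (⊤ : ℕ∞) f}
  zero_mem' := by
    rw [Set.mem_ofPred_eq]
    exact contDiff_const (c := (0 : ℂ))
  add_mem' {f g} hf hg := by
    rw [Set.mem_ofPred_eq] at *
    exact hf.add hg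
  smul_mem' c f hf := by
    rw [Set.mem_ofPred_eq] at *
    exact hf.const_smul c

lemma contDiff_smoothFun {F : Type*} [NormedAddCommGroup F] [NormedSpace ℝ F] (f : smoothFun F) :
    ContDiff ℝ (⊤ : ℕ∞) f.1 := by
  obtain ⟨f, h⟩ := f
  rwa [smoothFun, Submodule.mem_mk, AddSubmonoid.mem_mk, AddSubsemigroup.mem_mk,
    Set.mem_ofPred_eq] at h

lemma mem_smoothFun {F : Type*} [NormedAddCommGroup F] [NormedSpace ℝ F] {f : F → ℂ}
    (hf : ContDiff ℝ (⊤ : ℕ∞) f) : f ∈ smoothFun F := by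
  rwa [smoothFun, Submodule.mem_mk, AddSubmonoid.mem_mk, AddSubsemigroup.mem_mk,
    Set.mem_ofPred_eq]

/-- Directional derivatives of smooth functions. -/
def dirDerivEnd {F : Type*} [NormedAddCommGroup F] [NormedSpace ℝ F] (v : F) :
    Module.End ℂ (smoothFun F) where
  toFun f := ⟨dirDeriv v f, mem_smoothFun ((contDiff_smoothFun f).dirDeriv' v)⟩
  map_add' f g := by
    ext z
    change fderiv ℝ (fun y => f.1 y + g.1 y) z v = _
    rw [fderiv_fun_add ((contDiff_smoothFun f).differentiable (by simp) z) ((contDiff_smoothFun g).differentiable (by simp) z)]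
    rfl
  map_smul' c f := by
    ext z
    change fderiv ℝ (fun y => c • f.1 y) z v = _
    rw [fderiv_fun_const_smul ((contDiff_smoothFun f).differentiable (by simp) z)]
    rfl

lemma commute_dirDerivEnd {F : Type*} [NormedAddCommGroup F] [NormedSpace ℝ F] (v w : F) :
    Commute (dirDerivEnd v) (dirDerivEnd w) := by
  ext f : 2
  exact dirDeriv_comm (contDiff_smoothFun f) v w

lemma coe_dirDerivEnd_pow {F : Type*} [NormedAddCommGroup F] [NormedSpace ℝ F] (v : F) (n : ℕ)
    (f : smoothFun F) : (((dirDerivEnd v ^ n) f : smoothFun F) : F → ℂ) = (dirDeriv v)^[n] f := by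
  induction n with
  | zero => rfl
  | succ n ih => rw [pow_succ', Function.iterate_succ_apply', ← ih]; rfl

lemma coe_iterate_mixedDeriv (f : smoothFun (Eucl d × Eucl d × Eucl d)) (j : ℕ) :
    (((∑ i : Fin d, (-Complex.I) • (dirDerivEnd ((0, 0, stdVec d i) : Eucl d × Eucl d × Eucl d) *
      dirDerivEnd (0, stdVec d i, 0)) : Module.End ℂ (smoothFun (Eucl d × Eucl d × Eucl d))) ^ j) f :
      smoothFun _).1 = mixedDeriv^[j] f.1 := by
  induction j with
  | zero => rfl
  | succ j ih =>
    rw [pow_succ', Function.iterate_succ_apply', ← ih, Module.End.mul_apply]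
    generalize ((∑ i : Fin d, (-Complex.I) • (dirDerivEnd
      ((0, 0, stdVec d i) : Eucl d × Eucl d × Eucl d) * dirDerivEnd (0, stdVec d i, 0)) :
      Module.End ℂ (smoothFun (Eucl d × Eucl d × Eucl d))) ^ j) f = g
    ext w
    rw [LinearMap.sum_apply, mixedDeriv, Submodule.coe_sum, Finset.sum_apply]
    rfl

/-- The multinomial theorem for the commuting operators D_{ξ_i}∂_{y_i}, taken in the endomorphism
ring of the space of smooth functions. -/
lemma iterate_mixedDeriv_eq_sum {f : Eucl d × Eucl d × Eucl d → ℂ}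
    (hf : ContDiff ℝ (⊤ : ℕ∞) f) (j : ℕ) (w) :
    mixedDeriv^[j] f w = ∑ α ∈ (Finset.univ : Finset (Fin d)).piAntidiag j,
      (Nat.multinomial Finset.univ α : ℂ) * ((-Complex.I) ^ mlen α * ampDeriv 0 α α f w) := by
  set T : Fin d → Module.End ℂ (smoothFun (Eucl d × Eucl d × Eucl d)) := fun i =>
    (-Complex.I) • (dirDerivEnd (0, 0, stdVec d i) * dirDerivEnd (0, stdVec d i, 0)) with hT
  have hcm : ∀ i j, Commute (T i) (T j) := fun i j => by
    refine (Commute.smul_right ?_ _).smul_left _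
    exact ((commute_dirDerivEnd _ _).mul_right (commute_dirDerivEnd _ _)).mul_left
      ((commute_dirDerivEnd _ _).mul_right (commute_dirDerivEnd _ _))
  have key : ∀ (α : Fin d → ℕ) (h), ((Finset.univ.noncommProd (fun i => T i ^ α i) h)
      ⟨f, mem_smoothFun hf⟩ : smoothFun _).1 = (-Complex.I) ^ mlen α • ampDeriv 0 α α f := by
    intro α h
    have e1 : Finset.univ.noncommProd (fun i => T i ^ α i) h =
        ((List.finRange d).map fun i => T i ^ α i).prod := by
      have := Finset.noncommProd_toFinset (List.finRange d) (fun i => T i ^ α i)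
        (fun x _ y _ _ => (hcm x y).pow_pow _ _) (List.nodup_finRange d)
      rw [← this]
      exact Finset.noncommProd_congr (by ext; simp) (fun _ _ => rfl) _
    have e2 : ∀ l : List (Fin d), ((l.map fun i => T i ^ α i).prod ⟨f, mem_smoothFun hf⟩ : smoothFun _).1 =
        (-Complex.I) ^ (l.map α).sum •
          wordDeriv ((l.flatMap fun i => List.replicate (α i) (0, stdVec d i, 0)) ++
            l.flatMap fun i => List.replicate (α i) (0, 0, stdVec d i)) f := by
      intro l
      induction l with
      | nil => simp [wordDeriv]
      | cons i l ih =>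
        rw [List.map_cons, List.prod_cons, Module.End.mul_apply]
        set g := ((l.map fun i => T i ^ α i).prod ⟨f, mem_smoothFun hf⟩ : smoothFun _) with hg
        have hgs : g = (-Complex.I) ^ (l.map α).sum • (⟨_, mem_smoothFun <| hf.wordDeriv
          ((l.flatMap fun i => List.replicate (α i) (0, stdVec d i, 0)) ++
            l.flatMap fun i => List.replicate (α i) (0, 0, stdVec d i))⟩ : smoothFun _) :=
          Subtype.ext ih
        rw [hgs, map_smul, hT]
        simp only [smul_pow, (commute_dirDerivEnd _ _).mul_pow]
        rw [LinearMap.smul_apply, smul_smul, ← pow_add, Module.End.mul_apply, Submodule.coe_smul,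
          coe_dirDerivEnd_pow, coe_dirDerivEnd_pow, List.map_cons, List.sum_cons,
          add_comm (α i), ← wordDeriv_replicate, ← wordDeriv_replicate, ← wordDeriv_append,
          ← wordDeriv_append]
        congr 1
        apply wordDeriv_perm hf
        rw [List.flatMap_cons, List.flatMap_cons, List.perm_iff_count]
        intro x
        simp only [List.count_append]
        ring
    have e3 : ((List.finRange d).map α).sum = mlen α := by
      rw [← List.ofFn_eq_map, List.sum_ofFn, mlen]
    have e4 : multiWord (fun i => ((stdVec d i, 0, 0) : Eucl d × Eucl d × Eucl d)) 0 = [] := by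
      simp [multiWord]
    rw [e1, e2, e3, ampDeriv_eq_wordDeriv, e4]
    rfl
  have h := coe_iterate_mixedDeriv ⟨f, mem_smoothFun hf⟩ j
  have hpair : ((Finset.univ : Finset (Fin d)) : Set (Fin d)).Pairwise (Function.onFun Commute T) :=
    fun i _ j _ _ => hcm i j
  rw [Finset.sum_pow_eq_sum_piAntidiag_of_commute _ T hpair] at h
  rw [← congrFun h w, LinearMap.sum_apply, Submodule.coe_sum, Finset.sum_apply]
  refine Finset.sum_congr rfl fun α _ => ?_
  rw [Module.End.mul_apply, Module.End.natCast_apply, Submodule.coe_smul_of_tower, Pi.smul_apply]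
  refine (congrArg (_ • ·) (congrFun (key α _) w)).trans ?_
  simp

/-- Since j!/α! is the multinomial coefficient, p_j is the j-th Taylor coefficient, on the diagonal,
for the single operator Σ D_{ξ_i}∂_{y_i}; a one-variable Taylor formula can then be used. -/
lemma diagTerm_eq {a : Eucl d × Eucl d × Eucl d → ℂ} (ha : ContDiff ℝ (⊤ : ℕ∞) a) (j : ℕ) (z) :
    diagTerm a j z = (1 / (j.factorial : ℂ)) * mixedDeriv^[j] a (z.1, z.1, z.2) := by
  rw [diagTerm, iterate_mixedDeriv_eq_sum ha, Finset.mul_sum]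
  refine Finset.sum_congr rfl fun α hα => ?_
  have h1 : mfact α * Nat.multinomial Finset.univ α = j.factorial := by
    rw [mfact, Nat.multinomial_spec, (Finset.mem_piAntidiag.1 hα).1]
  have h2 : (j.factorial : ℂ) ≠ 0 := Nat.cast_ne_zero.2 (Nat.factorial_ne_zero j)
  have h3 : (mfact α : ℂ) ≠ 0 := fun h => by
    rw [← h1, Nat.cast_mul, h, zero_mul] at h2; exact h2 rfl
  rw [← mul_assoc (1 / (j.factorial : ℂ))]
  congr 1
  rw [← h1, Nat.cast_mul] at *
  have h4 := right_ne_zero_of_mul h2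
  field_simp

end

/-! ### Integrals depending on parameters and Taylor's formula -/

open MeasureTheory

section
variable {X P : Type} [NormedAddCommGroup X] [NormedSpace ℝ X]
  [NormedAddCommGroup P] [NormedSpace ℝ P]

lemma fderiv_slice {G : Type} [NormedAddCommGroup G] [NormedSpace ℝ G] {H : X × P → G}
    (hH : ContDiff ℝ (⊤ : ℕ∞) H) (p : P) : fderiv ℝ (fun x => H (x, p)) =
      fun x => (fderiv ℝ H (x, p)).comp (ContinuousLinearMap.inl ℝ X P) := by
  ext1 x
  exact (((hH.differentiable (by simp)) (x, p)).hasFDerivAt.comp x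
    (hasFDerivAt_prodMk_left x p)).fderiv

lemma contDiff_fderiv_inl {G : Type} [NormedAddCommGroup G] [NormedSpace ℝ G] {H : X × P → G}
    (hH : ContDiff ℝ (⊤ : ℕ∞) H) : ContDiff ℝ (⊤ : ℕ∞) fun z =>
      (fderiv ℝ H z).comp (ContinuousLinearMap.inl ℝ X P) :=
  (hH.fderiv_right (m := (⊤ : ℕ∞)) (by simp)).clm_comp contDiff_const

variable [ProperSpace X] [MeasurableSpace P] [BorelSpace P] (μ : Measure P) [IsFiniteMeasureOnCompacts μ]

lemma hasFDerivAt_setIntegral_compact {G : Type} [NormedAddCommGroup G] [NormedSpace ℝ G]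
    {K : Set P} (hK : IsCompact K) {H : X × P → G} (hH : ContDiff ℝ (⊤ : ℕ∞) H) (x : X) :
    HasFDerivAt (fun x => ∫ p in K, H (x, p) ∂μ)
      (∫ p in K, (fderiv ℝ H (x, p)).comp (ContinuousLinearMap.inl ℝ X P) ∂μ) x := by
  have hH' : Continuous fun z : X × P =>
      (fderiv ℝ H z).comp (ContinuousLinearMap.inl ℝ X P) :=
    (hH.continuous_fderiv (by simp)).clm_comp continuous_const
  obtain ⟨C, hC⟩ := ((isCompact_closedBall x 1).prod hK).exists_bound_of_continuousOn
    hH'.continuousOn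
  have hmeas : ∀ x, AEStronglyMeasurable (fun p => H (x, p)) (μ.restrict K) := fun x =>
    (hH.continuous.comp (Continuous.prodMk_right x)).continuousOn.aestronglyMeasurable_of_isCompact
      hK hK.measurableSet
  refine hasFDerivAt_integral_of_dominated_of_fderiv_le (𝕜 := ℝ) (bound := fun _ => C)
    (Metric.closedBall_mem_nhds x one_pos) (Filter.Eventually.of_forall hmeas)
    (F' := fun x p => (fderiv ℝ H (x, p)).comp (ContinuousLinearMap.inl ℝ X P)) ?_ ?_ ?_ ?_ ?_
  · exact (hH.continuous.comp (Continuous.prodMk_right x)).continuousOn.integrableOn_compact hK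
  · exact (hH'.comp (Continuous.prodMk_right x)).continuousOn.aestronglyMeasurable_of_isCompact
      hK hK.measurableSet
  · filter_upwards [ae_restrict_mem hK.measurableSet] with p hp y hy
    exact hC (y, p) ⟨hy, hp⟩
  · exact (continuous_const (y := C)).continuousOn.integrableOn_compact hK
  · refine Filter.Eventually.of_forall fun p y _ => ?_
    exact ((hH.differentiable (by simp)) (y, p)).hasFDerivAt.comp y (hasFDerivAt_prodMk_left y p)

/-- Integrals of smooth functions over compact sets of parameters are smooth. -/
lemma contDiff_setIntegral_compact {G : Type} [NormedAddCommGroup G] [NormedSpace ℝ G]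
    {K : Set P} (hK : IsCompact K) {H : X × P → G} (hH : ContDiff ℝ (⊤ : ℕ∞) H) :
    ContDiff ℝ (⊤ : ℕ∞) fun x => ∫ p in K, H (x, p) ∂μ := by
  rw [contDiff_infty]
  intro k
  induction k generalizing G with
  | zero =>
    rw [Nat.cast_zero, contDiff_zero]
    exact continuous_iff_continuousAt.2 fun x =>
      (hasFDerivAt_setIntegral_compact μ hK hH x).continuousAt
  | succ k ih =>
    rw [Nat.cast_succ, contDiff_succ_iff_fderiv]
    refine ⟨fun x => (hasFDerivAt_setIntegral_compact μ hK hH x).differentiableAt, by simp, ?_⟩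
    rw [funext fun x => (hasFDerivAt_setIntegral_compact μ hK hH x).fderiv]
    exact ih (contDiff_fderiv_inl hH)

/-- Induction on the order: the derivative is an integral of the same type with values in X →L[ℝ] G,
and for this reason the target space is arbitrary. -/
lemma norm_iteratedFDeriv_setIntegral_compact_le {G : Type} [NormedAddCommGroup G]
    [NormedSpace ℝ G] {K : Set P} (hK : IsCompact K) {H : X × P → G}
    (hH : ContDiff ℝ (⊤ : ℕ∞) H) (k : ℕ) (x : X) {B : ℝ}
    (hB : ∀ p ∈ K, ‖iteratedFDeriv ℝ k (fun x => H (x, p)) x‖ ≤ B) :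
    ‖iteratedFDeriv ℝ k (fun x => ∫ p in K, H (x, p) ∂μ) x‖ ≤ B * μ.real K := by
  induction k generalizing G with
  | zero =>
    rw [norm_iteratedFDeriv_zero]
    refine norm_setIntegral_le_of_norm_le_const hK.measure_lt_top fun p hp => ?_
    have := hB p hp
    rwa [norm_iteratedFDeriv_zero] at this
  | succ k ih =>
    rw [← norm_iteratedFDeriv_fderiv,
      funext fun x => (hasFDerivAt_setIntegral_compact μ hK hH x).fderiv]
    refine ih (G := X →L[ℝ] G) (H := fun z =>
      (fderiv ℝ H z).comp (ContinuousLinearMap.inl ℝ X P)) (contDiff_fderiv_inl hH) fun p hp => ?_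
    have := hB p hp
    rw [← norm_iteratedFDeriv_fderiv, fderiv_slice hH] at this
    exact this

end

section

lemma norm_iteratedFDeriv_comp_clm_le {X Y G : Type*} [NormedAddCommGroup X] [NormedSpace ℝ X]
    [NormedAddCommGroup Y] [NormedSpace ℝ Y] [NormedAddCommGroup G] [NormedSpace ℝ G]
    {f : Y → G} (hf : ContDiff ℝ (⊤ : ℕ∞) f) (A : X →L[ℝ] Y) (hA : ‖A‖ ≤ 1) (c : Y) (k : ℕ) (x : X) :
    ‖iteratedFDeriv ℝ k (fun x => f (A x + c)) x‖ ≤ ‖iteratedFDeriv ℝ k f (A x + c)‖ := by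
  have hf' : ContDiff ℝ (⊤ : ℕ∞) fun y => f (y + c) := hf.comp (contDiff_id.add contDiff_const)
  have := A.iteratedFDeriv_comp_right hf' x (nat_le_infty k)
  rw [show (fun x => f (A x + c)) = (fun y => f (y + c)) ∘ A from rfl, this,
    iteratedFDeriv_comp_add_right]
  refine (ContinuousMultilinearMap.norm_compContinuousLinearMap_le _ _).trans ?_
  exact mul_le_of_le_one_right (norm_nonneg _) (Finset.prod_le_one (fun _ _ => norm_nonneg _)
    fun _ _ => hA)

/-- Derivatives of an exponential of a linear form. -/
lemma norm_iteratedFDeriv_cexp_le {X : Type*} [NormedAddCommGroup X] [NormedSpace ℝ X]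
    (l : X →L[ℝ] ℝ) (k : ℕ) (x : X) :
    ‖iteratedFDeriv ℝ k (fun x => Complex.exp (Complex.I * (l x : ℂ))) x‖ ≤ ‖l‖ ^ k := by
  set L : X →L[ℝ] ℂ := Complex.I • Complex.ofRealCLM.comp l with hL
  have hLn : ‖L‖ ≤ ‖l‖ := by
    refine ContinuousLinearMap.opNorm_le_bound _ (norm_nonneg _) fun v => ?_
    simp only [hL, smul_apply, norm_smul, Complex.norm_I, one_mul,
      ContinuousLinearMap.comp_apply, Complex.ofRealCLM_apply, Complex.norm_real]
    exact l.le_opNorm v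
  have hf : ContDiff ℝ (⊤ : ℕ∞) fun x => Complex.exp (L x) := L.contDiff.cexp
  change ‖iteratedFDeriv ℝ k (fun x => Complex.exp (L x)) x‖ ≤ _
  have hd : fderiv ℝ (fun x => Complex.exp (L x)) =
      fun x => ContinuousLinearMap.smulRightL ℝ X ℂ l (Complex.I * Complex.exp (L x)) := by
    ext x v
    rw [(L.hasFDerivAt.cexp).fderiv]
    simp [hL]
    ring
  induction k with
  | zero =>
    rw [norm_iteratedFDeriv_zero, Complex.norm_exp]
    simp [hL]
  | succ k ih =>
    rw [← norm_iteratedFDeriv_fderiv, hd]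
    have hf' : ContDiff ℝ (⊤ : ℕ∞) fun x => Complex.I * Complex.exp (L x) :=
      contDiff_const.mul hf
    refine (ContinuousLinearMap.norm_iteratedFDeriv_comp_left _
        hf'.contDiffAt (nat_le_infty k)).trans ?_
    have h1 : ‖ContinuousLinearMap.smulRightL ℝ X ℂ l‖ ≤ ‖l‖ :=
      ContinuousLinearMap.opNorm_le_bound _ (norm_nonneg _) fun x => by
        change ‖l.smulRight x‖ ≤ _
        rw [ContinuousLinearMap.norm_smulRight_apply]
    have h2 : ‖iteratedFDeriv ℝ k (fun x => Complex.I * Complex.exp (L x)) x‖ ≤ ‖l‖ ^ k := by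
      have := iteratedFDeriv_const_smul_apply' (a := Complex.I) (x := x) (i := k)
        ((hf.of_le (nat_le_infty k)).contDiffAt)
      simp only [smul_eq_mul] at this
      rw [this, norm_smul, Complex.norm_I, one_mul]
      exact ih
    rw [pow_succ']
    exact mul_le_mul h1 h2 (norm_nonneg _) (norm_nonneg _)

/-- Each integration by parts raises the order by one. The formulation by a chain of functions suits
oscillating integrals, whose derivatives in t are oscillating integrals of other amplitudes. -/
lemma taylor_remainder {g : ℕ → ℝ → ℂ} (hg : ∀ j t, HasDerivAt (g j) (g (j + 1) t) t) (N : ℕ) :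
    g 0 1 = ∑ j ∈ Finset.range (N + 1), (1 / (j.factorial : ℂ)) * g j 0 +
      ∫ t in (0 : ℝ)..1, (((1 - t) ^ N / N.factorial : ℝ) : ℂ) * g (N + 1) t := by
  have hc : ∀ j, Continuous (g j) := fun j =>
    continuous_iff_continuousAt.2 fun t => (hg j t).continuousAt
  induction N with
  | zero =>
    have := intervalIntegral.integral_eq_sub_of_hasDerivAt (a := 0) (b := 1)
      (fun t _ => hg 0 t) ((hc 1).intervalIntegrable _ _)
    simp [this]
  | succ N ih =>
    rw [ih, Finset.sum_range_succ _ (N + 1), add_assoc]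
    congr 1
    have hu : ∀ t : ℝ, HasDerivAt (fun t : ℝ => ((-(1 - t) ^ (N + 1) / (N + 1).factorial : ℝ) : ℂ))
        (((1 - t) ^ N / N.factorial : ℝ) : ℂ) t := by
      intro t
      have h1 : HasDerivAt (fun t : ℝ => -(1 - t) ^ (N + 1) / (N + 1).factorial)
          ((1 - t) ^ N / N.factorial) t := by
        have := ((((hasDerivAt_id t).const_sub 1).pow (N + 1)).neg).div_const
          ((N + 1).factorial : ℝ)
        refine this.congr_deriv ?_
        rw [Nat.factorial_succ]
        have h3 : (N.factorial : ℝ) ≠ 0 := Nat.cast_ne_zero.2 (Nat.factorial_ne_zero N)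
        have h4 : ((N : ℝ) + 1) ≠ 0 := by positivity
        push_cast
        simp
        field_simp
      exact h1.ofReal_comp
    have hcu : Continuous fun t : ℝ => (((1 - t) ^ N / N.factorial : ℝ) : ℂ) := by fun_prop
    rw [intervalIntegral.integral_congr (g := fun t => g (N + 1) t *
      (((1 - t) ^ N / N.factorial : ℝ) : ℂ)) fun t _ => mul_comm _ _]
    rw [intervalIntegral.integral_mul_deriv_eq_deriv_mul (fun t _ => hg (N + 1) t)
      (fun t _ => hu t) ((hc _).intervalIntegrable _ _) (hcu.intervalIntegrable _ _)]
    rw [sub_eq_add_neg, ← intervalIntegral.integral_neg]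
    congr 1
    · simp
      ring
    · refine intervalIntegral.integral_congr fun t _ => ?_
      push_cast
      ring

end

section
variable {X G : Type*} [NormedAddCommGroup X] [NormedSpace ℝ X] [NormedAddCommGroup G]
  [NormedSpace ℝ G]

lemma iteratedFDeriv_eq_zero_of_isOpen {U : Set X} (hU : IsOpen U) {f : X → G}
    (h : ∀ w ∈ U, f w = 0) (k : ℕ) {w : X} (hw : w ∈ U) : iteratedFDeriv ℝ k f w = 0 := by
  have : f =ᶠ[nhds w] fun _ => 0 := Filter.eventually_of_mem (hU.mem_nhds hw) h
  rw [(this.iteratedFDeriv ℝ k).eq_of_nhds]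
  exact congrFun iteratedFDeriv_fun_zero w

lemma dirDeriv_iterate_eq_zero_of_isOpen {U : Set X} (hU : IsOpen U) {f : X → ℂ}
    (h : ∀ w ∈ U, f w = 0) (v : X) (N : ℕ) : ∀ w ∈ U, (dirDeriv v)^[N] f w = 0 := by
  induction N with
  | zero => exact h
  | succ N ih =>
    intro w hw
    rw [Function.iterate_succ_apply']
    have : (dirDeriv v)^[N] f =ᶠ[nhds w] fun _ => 0 := Filter.eventually_of_mem (hU.mem_nhds hw) ih
    rw [dirDeriv, this.fderiv_eq]
    simp

lemma ContDiff.iterate_dirDeriv {f : X → ℂ} (hf : ContDiff ℝ (⊤ : ℕ∞) f) (v : X) (N : ℕ) :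
    ContDiff ℝ (⊤ : ℕ∞) ((dirDeriv v)^[N] f) := by
  rw [← wordDeriv_replicate]
  exact hf.wordDeriv _

lemma norm_iteratedFDeriv_iterate_dirDeriv_le {f : X → ℂ} (hf : ContDiff ℝ (⊤ : ℕ∞) f) {v : X}
    (hv : ‖v‖ ≤ 1) (N k : ℕ) (w : X) :
    ‖iteratedFDeriv ℝ k ((dirDeriv v)^[N] f) w‖ ≤ ‖iteratedFDeriv ℝ (k + N) f w‖ := by
  rw [← wordDeriv_replicate]
  refine (norm_iteratedFDeriv_wordDeriv_le hf (fun u hu => ?_) k w).trans ?_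
  · rwa [List.eq_of_mem_replicate hu]
  · rw [List.length_replicate]

end

/-! ### Oscillating integrals and their expansion along the diagonal -/

section
variable {d : ℕ}

/-- The exponential `e^{i⟨z,ξ⟩}`. -/
def phase (z ξ : Eucl d) : ℂ := Complex.exp (Complex.I * ((inner ℝ z ξ : ℝ) : ℂ))

lemma norm_phase (z ξ : Eucl d) : ‖phase z ξ‖ = 1 := by
  rw [phase, mul_comm, Complex.norm_exp_ofReal_mul_I]

lemma contDiff_phase : ContDiff ℝ (⊤ : ℕ∞) fun p : Eucl d × Eucl d => phase p.1 p.2 :=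
  (contDiff_const.mul (Complex.ofRealCLM.contDiff.comp (contDiff_fst.inner ℝ contDiff_snd))).cexp

lemma hasFDerivAt_phase (z ξ : Eucl d) : HasFDerivAt (phase z)
    ((innerSL ℝ z).smulRight (Complex.I * phase z ξ)) ξ := by
  have h1 : HasFDerivAt (fun ξ => Complex.I * ((inner ℝ z ξ : ℝ) : ℂ))
      (Complex.I • (Complex.ofRealCLM.comp (innerSL ℝ z))) ξ :=
    ((Complex.ofRealCLM.comp (innerSL ℝ z)).hasFDerivAt).const_mul Complex.I
  refine h1.cexp.congr_fderiv ?_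
  ext v
  simp [phase]
  ring

lemma integrable_of_eq_zero {g : Eucl d → ℂ} (hg : Continuous g) {s : ℝ}
    (h : ∀ ξ, s < ‖ξ‖ → g ξ = 0) : Integrable g :=
  hg.integrable_of_hasCompactSupport <|
    HasCompactSupport.intro (isCompact_closedBall (0 : Eucl d) s) fun ξ hξ =>
      h ξ (by simpa using hξ)

/-- Integration by parts for oscillating integrals. -/
lemma integral_inner_mul_phase {h : Eucl d → ℂ} (hh : ContDiff ℝ (⊤ : ℕ∞) h) {s : ℝ}
    (hs : ∀ ξ, s < ‖ξ‖ → h ξ = 0) (z v : Eucl d) :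
    (inner ℝ z v : ℝ) * ∫ ξ, phase z ξ * h ξ = ∫ ξ, phase z ξ * (Complex.I * dirDeriv v h ξ) := by
  have hU : IsOpen {ξ : Eucl d | s < ‖ξ‖} := isOpen_lt continuous_const continuous_norm
  have hd : ∀ ξ, s < ‖ξ‖ → fderiv ℝ h ξ v = 0 := fun ξ hξ =>
    dirDeriv_iterate_eq_zero_of_isOpen hU hs v 1 ξ hξ
  have hp : Continuous (phase z) := contDiff_phase.continuous.comp (Continuous.prodMk_right z)
  have hfp : ∀ ξ, fderiv ℝ (phase z) ξ v = (inner ℝ z v : ℝ) * (Complex.I * phase z ξ) := by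
    intro ξ
    rw [(hasFDerivAt_phase z ξ).fderiv]
    simp
  have key := integral_mul_fderiv_eq_neg_fderiv_mul_of_integrable (μ := volume) (f := h)
    (g := phase z) (v := v)
    (integrable_of_eq_zero (((hh.dirDeriv' v).continuous).mul hp) (s := s) fun ξ hξ => by
      rw [hd ξ hξ, zero_mul])
    (by
      simp_rw [hfp]
      exact integrable_of_eq_zero (hh.continuous.mul (continuous_const.mul
        (continuous_const.mul hp))) (s := s) fun ξ hξ => by rw [hs ξ hξ, zero_mul])
    (integrable_of_eq_zero (hh.continuous.mul hp) (s := s) fun ξ hξ => by rw [hs ξ hξ, zero_mul])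
    (fun ξ _ => hh.differentiable (by simp) ξ) (fun ξ _ => (hasFDerivAt_phase z ξ).differentiableAt)
  simp_rw [hfp] at key
  have e1 : ∫ ξ, h ξ * ((inner ℝ z v : ℝ) * (Complex.I * phase z ξ)) =
      Complex.I * ((inner ℝ z v : ℝ) * ∫ ξ, phase z ξ * h ξ) := by
    rw [← integral_const_mul, ← integral_const_mul]
    congr 1 with ξ
    ring
  have e2 : ∫ ξ, phase z ξ * (Complex.I * dirDeriv v h ξ) =
      Complex.I * ∫ ξ, fderiv ℝ h ξ v * phase z ξ := by
    rw [← integral_const_mul]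
    congr 1 with ξ
    rw [dirDeriv]
    ring
  rw [e1] at key
  rw [e2]
  have h3 := congrArg (fun t => -Complex.I * t) key
  simp only [← mul_assoc, neg_mul, Complex.I_mul_I, neg_neg, one_mul, mul_neg] at h3
  exact h3

lemma inner_pow_mul_integral_phase {h : Eucl d → ℂ} (hh : ContDiff ℝ (⊤ : ℕ∞) h) {s : ℝ}
    (hs : ∀ ξ, s < ‖ξ‖ → h ξ = 0) (z v : Eucl d) (N : ℕ) :
    ((inner ℝ z v : ℝ) : ℂ) ^ N * ∫ ξ, phase z ξ * h ξ =
      Complex.I ^ N * ∫ ξ, phase z ξ * (dirDeriv v)^[N] h ξ := by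
  have hU : IsOpen {ξ : Eucl d | s < ‖ξ‖} := isOpen_lt continuous_const continuous_norm
  induction N with
  | zero => simp
  | succ N ih =>
    rw [pow_succ', mul_assoc, ih, mul_left_comm, integral_inner_mul_phase (hh.iterate_dirDeriv v N)
      (fun ξ hξ => dirDeriv_iterate_eq_zero_of_isOpen hU hs v N ξ hξ), pow_succ, mul_assoc]
    congr 1
    rw [← integral_const_mul]
    congr 1 with ξ
    rw [Function.iterate_succ_apply']
    ring

lemma dirDeriv_iterate_slice {f : Eucl d × Eucl d × Eucl d → ℂ} (hf : ContDiff ℝ (⊤ : ℕ∞) f)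
    (x y v : Eucl d) (N : ℕ) : (dirDeriv v)^[N] (fun ξ => f (x, y, ξ)) =
      fun ξ => (dirDeriv (0, 0, v))^[N] f (x, y, ξ) := by
  induction N with
  | zero => rfl
  | succ N ih =>
    ext ξ
    rw [Function.iterate_succ_apply', ih, Function.iterate_succ_apply', dirDeriv, dirDeriv]
    have h1 := ((hf.iterate_dirDeriv (0, 0, v) N).differentiable (by simp)) (x, y, ξ)
    have h2 : HasFDerivAt (fun ξ : Eucl d => (x, y, ξ))
        ((ContinuousLinearMap.inr ℝ (Eucl d) (Eucl d × Eucl d)).comp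
          (ContinuousLinearMap.inr ℝ (Eucl d) (Eucl d))) ξ :=
      (hasFDerivAt_prodMk_right x (y, ξ)).comp ξ (hasFDerivAt_prodMk_right y ξ)
    have h3 := (h1.hasFDerivAt.comp ξ h2).fderiv
    rw [Function.comp_def] at h3
    rw [h3]
    simp

/-- The function `∫ e^{i⟨x-y,ξ⟩} f(x,y,ξ) dξ` of `(x, y)`. -/
def osc (f : Eucl d × Eucl d × Eucl d → ℂ) (X : Eucl d × Eucl d) : ℂ :=
  ∫ ξ, phase (X.1 - X.2) ξ * f (X.1, X.2, ξ)

lemma osc_eq_setIntegral {f : Eucl d × Eucl d × Eucl d → ℂ} {s : ℝ}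
    (hs : ∀ w, s < ‖w.2.2‖ → f w = 0) : osc f = fun X =>
      ∫ ξ in Metric.closedBall 0 s, phase (X.1 - X.2) ξ * f (X.1, X.2, ξ) := by
  ext X
  refine (setIntegral_eq_integral_of_forall_compl_eq_zero fun ξ hξ => ?_).symm
  rw [hs _ (by simpa using hξ), mul_zero]

lemma contDiff_oscIntegrand {f : Eucl d × Eucl d × Eucl d → ℂ} (hf : ContDiff ℝ (⊤ : ℕ∞) f) :
    ContDiff ℝ (⊤ : ℕ∞) fun z : (Eucl d × Eucl d) × Eucl d =>
      phase (z.1.1 - z.1.2) z.2 * f (z.1.1, z.1.2, z.2) := by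
  have h1 : ContDiff ℝ (⊤ : ℕ∞) fun z : (Eucl d × Eucl d) × Eucl d => (z.1.1 - z.1.2, z.2) := by
    fun_prop
  have h2 : ContDiff ℝ (⊤ : ℕ∞) fun z : (Eucl d × Eucl d) × Eucl d => (z.1.1, z.1.2, z.2) := by
    fun_prop
  exact (contDiff_phase.comp h1).mul (hf.comp h2)

lemma contDiff_osc {f : Eucl d × Eucl d × Eucl d → ℂ} (hf : ContDiff ℝ (⊤ : ℕ∞) f) {s : ℝ}
    (hs : ∀ w, s < ‖w.2.2‖ → f w = 0) : ContDiff ℝ (⊤ : ℕ∞) (osc f) := by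
  rw [osc_eq_setIntegral hs]
  exact contDiff_setIntegral_compact volume (isCompact_closedBall (0 : Eucl d) s)
    (contDiff_oscIntegrand hf)

lemma norm_iteratedFDeriv_phase_le {s : ℝ} {ξ : Eucl d} (hξ : ‖ξ‖ ≤ s) (X : Eucl d × Eucl d)
    (k : ℕ) : ‖iteratedFDeriv ℝ k (fun X : Eucl d × Eucl d => phase (X.1 - X.2) ξ) X‖ ≤
      (2 * s) ^ k := by
  set l : (Eucl d × Eucl d) →L[ℝ] ℝ := (innerSL ℝ ξ).comp
    (ContinuousLinearMap.fst ℝ (Eucl d) (Eucl d) - ContinuousLinearMap.snd ℝ (Eucl d) (Eucl d))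
    with hl
  have hs0 : 0 ≤ s := (norm_nonneg _).trans hξ
  have hln : ‖l‖ ≤ 2 * s := by
    refine ContinuousLinearMap.opNorm_le_bound _ (by positivity) fun v => ?_
    have h1 : ‖v.1 - v.2‖ ≤ 2 * ‖v‖ := by
      have := norm_sub_le v.1 v.2
      have := norm_fst_le v
      have := norm_snd_le v
      linarith
    calc _ ≤ ‖ξ‖ * ‖v.1 - v.2‖ := norm_inner_le_norm ξ _
      _ ≤ s * (2 * ‖v‖) := by gcongr
      _ = _ := by ring
  have hph : (fun X : Eucl d × Eucl d => phase (X.1 - X.2) ξ) =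
      fun X => Complex.exp (Complex.I * (l X : ℂ)) := by
    ext X
    rw [phase, real_inner_comm]
    rfl
  rw [hph]
  exact (norm_iteratedFDeriv_cexp_le l k X).trans (pow_le_pow_left₀ (norm_nonneg _) hln k)

lemma norm_iteratedFDeriv_slice_le {f : Eucl d × Eucl d × Eucl d → ℂ}
    (hf : ContDiff ℝ (⊤ : ℕ∞) f) (ξ : Eucl d) (X : Eucl d × Eucl d) (k : ℕ) :
    ‖iteratedFDeriv ℝ k (fun X : Eucl d × Eucl d => f (X.1, X.2, ξ)) X‖ ≤
      ‖iteratedFDeriv ℝ k f (X.1, X.2, ξ)‖ := by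
  set A : (Eucl d × Eucl d) →L[ℝ] Eucl d × Eucl d × Eucl d :=
    (ContinuousLinearMap.fst ℝ (Eucl d) (Eucl d)).prod
      ((ContinuousLinearMap.snd ℝ (Eucl d) (Eucl d)).prod 0) with hA
  have hAe : ∀ X : Eucl d × Eucl d, A X + (0, 0, ξ) = (X.1, X.2, ξ) := fun X =>
    Prod.ext (add_zero _) (Prod.ext (add_zero _) (zero_add _))
  have hAn : ‖A‖ ≤ 1 := by
    refine ContinuousLinearMap.opNorm_le_bound _ zero_le_one fun v => ?_
    rw [one_mul]
    refine max_le (norm_fst_le v) (max_le (norm_snd_le v) ?_)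
    change ‖(0 : Eucl d)‖ ≤ _
    rw [norm_zero]
    exact norm_nonneg v
  have := norm_iteratedFDeriv_comp_clm_le hf A hAn (0, 0, ξ) k X
  simp only [hAe] at this
  exact this

lemma norm_iteratedFDeriv_oscIntegrand_le {f : Eucl d × Eucl d × Eucl d → ℂ}
    (hf : ContDiff ℝ (⊤ : ℕ∞) f) {s : ℝ} {ξ : Eucl d} (hξ : ‖ξ‖ ≤ s) (X : Eucl d × Eucl d)
    {B : ℕ → ℝ} (k : ℕ)
    (hB : ∀ j ≤ k, ‖iteratedFDeriv ℝ j f (X.1, X.2, ξ)‖ ≤ B j) :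
    ‖iteratedFDeriv ℝ k (fun X : Eucl d × Eucl d =>
      phase (X.1 - X.2) ξ * f (X.1, X.2, ξ)) X‖ ≤
      ∑ i ∈ Finset.range (k + 1), (k.choose i : ℝ) * (2 * s) ^ i * B (k - i) := by
  have hs0 : 0 ≤ s := (norm_nonneg _).trans hξ
  have hsm : ContDiff ℝ (⊤ : ℕ∞) fun X : Eucl d × Eucl d => phase (X.1 - X.2) ξ :=
    contDiff_phase.comp ((contDiff_fst.sub contDiff_snd).prodMk contDiff_const)
  have hfs : ContDiff ℝ (⊤ : ℕ∞) fun X : Eucl d × Eucl d => f (X.1, X.2, ξ) :=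
    hf.comp (contDiff_fst.prodMk (contDiff_snd.prodMk contDiff_const))
  refine (norm_iteratedFDeriv_mul_le hsm hfs X (nat_le_infty k)).trans
    (Finset.sum_le_sum fun i hi => ?_)
  exact mul_le_mul (mul_le_mul_of_nonneg_left (norm_iteratedFDeriv_phase_le hξ X i)
    (Nat.cast_nonneg _)) ((norm_iteratedFDeriv_slice_le hf ξ X _).trans (hB _ (Nat.sub_le _ _)))
    (norm_nonneg _) (by positivity)

/-- Leibniz's rule under the integral: a derivative that falls on the phase costs at most 2s since
|ξ| ≤ s, and the volume is that of the domain of integration. -/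
lemma norm_iteratedFDeriv_osc_le {f : Eucl d × Eucl d × Eucl d → ℂ} (hf : ContDiff ℝ (⊤ : ℕ∞) f)
    {s : ℝ} (hs : ∀ w, s < ‖w.2.2‖ → f w = 0) (X : Eucl d × Eucl d) {B : ℕ → ℝ} (k : ℕ)
    (hB : ∀ j ≤ k, ∀ ξ, ‖ξ‖ ≤ s → ‖iteratedFDeriv ℝ j f (X.1, X.2, ξ)‖ ≤ B j) :
    ‖iteratedFDeriv ℝ k (osc f) X‖ ≤
      (∑ i ∈ Finset.range (k + 1), (k.choose i : ℝ) * (2 * s) ^ i * B (k - i)) *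
        volume.real (Metric.closedBall (0 : Eucl d) s) := by
  rw [osc_eq_setIntegral hs]
  refine norm_iteratedFDeriv_setIntegral_compact_le volume (isCompact_closedBall (0 : Eucl d) s)
    (contDiff_oscIntegrand hf) k X fun ξ hξ => ?_
  have hξ' : ‖ξ‖ ≤ s := by simpa using hξ
  exact norm_iteratedFDeriv_oscIntegrand_le hf hξ' X k fun j hj => hB j hj ξ hξ'

end

section
variable {d : ℕ} {f : Eucl d × Eucl d × Eucl d → ℂ} (hf : ContDiff ℝ (⊤ : ℕ∞) f) {s : ℝ}
  (hs : ∀ w, s < ‖w.2.2‖ → f w = 0)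

lemma isOpen_lt_norm_snd_snd (s : ℝ) : IsOpen {w : Eucl d × Eucl d × Eucl d | s < ‖w.2.2‖} :=
  isOpen_lt continuous_const (continuous_snd.comp continuous_snd).norm

include hf hs in
lemma iterate_mixedDeriv_eq_zero (j : ℕ) (w : Eucl d × Eucl d × Eucl d) (hw : s < ‖w.2.2‖) :
    mixedDeriv^[j] f w = 0 := by
  have := norm_iteratedFDeriv_iterate_mixedDeriv_le hf j 0 w
  rw [iteratedFDeriv_eq_zero_of_isOpen (isOpen_lt_norm_snd_snd s) hs _ hw, norm_zero, mul_zero,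
    norm_iteratedFDeriv_zero] at this
  exact norm_le_zero_iff.1 this

include hf hs in
-- The components of z multiplying the phase are derivatives of the phase in ξ; integration by parts
-- moves them onto f as D_{ξ_i}.
lemma integral_phase_mul_dirDeriv (x y z : Eucl d) :
    ∫ ξ, phase z ξ * dirDeriv (0, -z, 0) f (x, y, ξ) =
      ∫ ξ, phase z ξ * mixedDeriv f (x, y, ξ) := by
  have hz : z = ∑ i, z i • stdVec d i := by
    ext j
    simp [stdVec, Pi.single_apply]
  have hg : ∀ i, ContDiff ℝ (⊤ : ℕ∞) fun ξ =>
      dirDeriv ((0, stdVec d i, 0) : Eucl d × Eucl d × Eucl d) f (x, y, ξ) := fun i =>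
    (hf.dirDeriv' _).comp (contDiff_const.prodMk (contDiff_const.prodMk contDiff_id))
  have hsl : ∀ i ξ, dirDeriv (stdVec d i) (fun ξ => dirDeriv ((0, stdVec d i, 0) :
      Eucl d × Eucl d × Eucl d) f (x, y, ξ)) ξ =
      dirDeriv (0, 0, stdVec d i) (dirDeriv (0, stdVec d i, 0) f) (x, y, ξ) := fun i ξ =>
    congrFun (dirDeriv_iterate_slice (hf.dirDeriv' _) x y (stdVec d i) 1) ξ
  have hg0 : ∀ i (ξ : Eucl d), s < ‖ξ‖ →
      dirDeriv ((0, stdVec d i, 0) : Eucl d × Eucl d × Eucl d) f (x, y, ξ) = 0 := fun i ξ hξ =>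
    dirDeriv_iterate_eq_zero_of_isOpen (isOpen_lt_norm_snd_snd s) hs _ 1 (x, y, ξ) hξ
  have hg1 : ∀ i (ξ : Eucl d), s < ‖ξ‖ → dirDeriv ((0, 0, stdVec d i) : Eucl d × Eucl d × Eucl d)
      (dirDeriv (0, stdVec d i, 0) f) (x, y, ξ) = 0 := fun i ξ hξ =>
    dirDeriv_iterate_eq_zero_of_isOpen (isOpen_lt_norm_snd_snd s)
      (dirDeriv_iterate_eq_zero_of_isOpen (isOpen_lt_norm_snd_snd s) hs _ 1) _ 1 (x, y, ξ) hξ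
  have hph : Continuous (phase z) := contDiff_phase.continuous.comp (Continuous.prodMk_right z)
  have e1 : ∀ ξ, phase z ξ * dirDeriv (0, -z, 0) f (x, y, ξ) =
      ∑ i, -((inner ℝ z (stdVec d i) : ℝ) : ℂ) * (phase z ξ *
        dirDeriv (0, stdVec d i, 0) f (x, y, ξ)) := by
    intro ξ
    have : ((0, -z, 0) : Eucl d × Eucl d × Eucl d) = ∑ i, (-z i) • (0, stdVec d i, 0) := by
      refine Prod.ext ?_ (Prod.ext ?_ ?_)
      · simp [Prod.fst_sum]
      · conv_lhs => rw [hz]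
        simp [Prod.fst_sum, Prod.snd_sum]
      · simp [Prod.snd_sum]
    rw [dirDeriv, this, map_sum, Finset.mul_sum]
    refine Finset.sum_congr rfl fun i _ => ?_
    rw [map_smul, dirDeriv, stdVec, EuclideanSpace.inner_single_right]
    simp
    ring
  simp_rw [e1]
  rw [integral_finsetSum _ fun i _ => ?_]
  · have e2 : ∀ ξ, phase z ξ * mixedDeriv f (x, y, ξ) = ∑ i, phase z ξ * (-Complex.I *
        dirDeriv (0, 0, stdVec d i) (dirDeriv (0, stdVec d i, 0) f) (x, y, ξ)) := by
      intro ξ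
      rw [mixedDeriv, Finset.mul_sum]
      simp only [smul_eq_mul]
    simp_rw [e2]
    rw [integral_finsetSum _ fun i _ => ?_]
    · refine Finset.sum_congr rfl fun i _ => ?_
      rw [integral_const_mul, neg_mul, integral_inner_mul_phase (hg i) (hg0 i), ← integral_neg]
      simp_rw [hsl]
      congr 1 with ξ
      ring
    · refine integrable_of_eq_zero (hph.mul (continuous_const.mul ?_)) (s := s) fun ξ hξ => ?_
      · exact ((hf.dirDeriv' _).dirDeriv' _).continuous.comp (by fun_prop)
      · rw [hg1 i ξ hξ, mul_zero, mul_zero]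
  · refine (integrable_of_eq_zero (hph.mul (hg i).continuous) (s := s) fun ξ hξ => ?_).const_mul _
    rw [Pi.mul_apply, hg0 i ξ hξ, mul_zero]

/-- The integral `∫ e^{i⟨x-y,ξ⟩} f(x, x + t(y-x), ξ) dξ`. -/
def oscSeg (f : Eucl d × Eucl d × Eucl d → ℂ) (t : ℝ) (X : Eucl d × Eucl d) : ℂ :=
  osc (fun w => f (w.1, w.1 + t • (w.2.1 - w.1), w.2.2)) X

lemma oscSeg_eq (t : ℝ) (X : Eucl d × Eucl d) : oscSeg f t X =
    ∫ ξ, phase (X.1 - X.2) ξ * f (X.1, X.1 + t • (X.2 - X.1), ξ) := rfl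

include hf in
lemma contDiff_oscSegIntegrand : ContDiff ℝ (⊤ : ℕ∞) fun z : ((Eucl d × Eucl d) × ℝ) × Eucl d =>
    phase (z.1.1.1 - z.1.1.2) z.2 * f (z.1.1.1, z.1.1.1 + z.1.2 • (z.1.1.2 - z.1.1.1), z.2) := by
  have h1 : ContDiff ℝ (⊤ : ℕ∞) fun z : ((Eucl d × Eucl d) × ℝ) × Eucl d =>
      (z.1.1.1 - z.1.1.2, z.2) := by fun_prop
  have h2 : ContDiff ℝ (⊤ : ℕ∞) fun z : ((Eucl d × Eucl d) × ℝ) × Eucl d =>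
      (z.1.1.1, z.1.1.1 + z.1.2 • (z.1.1.2 - z.1.1.1), z.2) := by fun_prop
  exact (contDiff_phase.comp h1).mul (hf.comp h2)

include hs in
lemma oscSeg_eq_setIntegral (t : ℝ) (X : Eucl d × Eucl d) : oscSeg f t X =
    ∫ ξ in Metric.closedBall 0 s, phase (X.1 - X.2) ξ * f (X.1, X.1 + t • (X.2 - X.1), ξ) := by
  rw [oscSeg_eq]
  refine (setIntegral_eq_integral_of_forall_compl_eq_zero fun ξ hξ => ?_).symm
  rw [hs _ (by simpa using hξ), mul_zero]

include hf hs in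
lemma contDiff_oscSeg : ContDiff ℝ (⊤ : ℕ∞) fun z : (Eucl d × Eucl d) × ℝ => oscSeg f z.2 z.1 := by
  simp_rw [oscSeg_eq_setIntegral hs]
  exact contDiff_setIntegral_compact volume (isCompact_closedBall (0 : Eucl d) s)
    (contDiff_oscSegIntegrand hf)

include hf hs in
-- Only the argument of the amplitude moves along the segment, while the phase is kept at x - y. The
-- derivative in t is (y - x)·∂_y f, and the factor y - x is traded for D_ξ.
lemma hasDerivAt_oscSeg (X : Eucl d × Eucl d) (t : ℝ) :
    HasDerivAt (fun t => oscSeg f t X) (oscSeg (mixedDeriv f) t X) t := by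
  obtain ⟨x, y⟩ := X
  have hs' : ∀ w : Eucl d × Eucl d × Eucl d, s < ‖w.2.2‖ → mixedDeriv f w = 0 :=
    iterate_mixedDeriv_eq_zero hf hs 1
  set H : ℝ × Eucl d → ℂ := fun z => phase (x - y) z.2 * f (x, x + z.1 • (y - x), z.2) with hH
  have hHs : ContDiff ℝ (⊤ : ℕ∞) H := by
    have h1 : ContDiff ℝ (⊤ : ℕ∞) fun z : ℝ × Eucl d => (x - y, z.2) := by fun_prop
    have h2 : ContDiff ℝ (⊤ : ℕ∞) fun z : ℝ × Eucl d => (x, x + z.1 • (y - x), z.2) := by fun_prop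
    exact (contDiff_phase.comp h1).mul (hf.comp h2)
  have key := (hasFDerivAt_setIntegral_compact volume (isCompact_closedBall (0 : Eucl d) s)
    hHs t).hasDerivAt
  have e1 : ∀ ξ, (fderiv ℝ H (t, ξ)).comp (ContinuousLinearMap.inl ℝ ℝ (Eucl d)) 1 =
      phase (x - y) ξ * dirDeriv (0, -(x - y), 0) f (x, x + t • (y - x), ξ) := by
    intro ξ
    rw [← congrFun (fderiv_slice hHs ξ) t, fderiv_apply_one_eq_deriv]
    have h1 : HasDerivAt (fun t : ℝ => (x, x + t • (y - x), ξ)) (0, -(x - y), 0) t := by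
      refine (hasDerivAt_const t x).prodMk (HasDerivAt.prodMk ?_ (hasDerivAt_const t ξ))
      have := ((hasDerivAt_id t).smul_const (y - x)).const_add x
      rw [one_smul] at this
      rw [neg_sub]
      exact this
    have h2 := ((hf.differentiable (by simp) (x, x + t • (y - x), ξ)).hasFDerivAt.comp_hasDerivAt
      t h1).const_mul (phase (x - y) ξ)
    exact h2.deriv
  have hint : IntegrableOn (fun ξ => (fderiv ℝ H (t, ξ)).comp
      (ContinuousLinearMap.inl ℝ ℝ (Eucl d))) (Metric.closedBall (0 : Eucl d) s) volume :=
    (((contDiff_fderiv_inl hHs).continuous.comp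
      (Continuous.prodMk_right t)).continuousOn).integrableOn_compact (isCompact_closedBall _ _)
  rw [ContinuousLinearMap.integral_apply hint] at key
  simp_rw [e1] at key
  have e2 : ∫ ξ in Metric.closedBall (0 : Eucl d) s, phase (x - y) ξ *
      dirDeriv (0, -(x - y), 0) f (x, x + t • (y - x), ξ) = oscSeg (mixedDeriv f) t (x, y) := by
    rw [oscSeg_eq, ← integral_phase_mul_dirDeriv hf hs]
    refine setIntegral_eq_integral_of_forall_compl_eq_zero fun ξ hξ => ?_
    have h0 : dirDeriv (0, -(x - y), 0) f (x, x + t • (y - x), ξ) = 0 :=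
      dirDeriv_iterate_eq_zero_of_isOpen (isOpen_lt_norm_snd_snd s) hs _ 1
        (x, x + t • (y - x), ξ) (by simpa using hξ)
    rw [h0, mul_zero]
  rw [e2] at key
  refine key.congr_of_eventuallyEq (Filter.Eventually.of_forall fun t => ?_)
  exact oscSeg_eq_setIntegral hs t (x, y)

include hf hs in
/-- Taylor expansion of an oscillating integral along the diagonal. -/
lemma osc_taylor (N : ℕ) (X : Eucl d × Eucl d) :
    osc f X = ∑ j ∈ Finset.range (N + 1), (1 / (j.factorial : ℂ)) *
        (∫ ξ, phase (X.1 - X.2) ξ * mixedDeriv^[j] f (X.1, X.1, ξ)) +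
      ∫ t in (0 : ℝ)..1, (((1 - t) ^ N / N.factorial : ℝ) : ℂ) *
        oscSeg (mixedDeriv^[N + 1] f) t X := by
  have := taylor_remainder (g := fun j t => oscSeg (mixedDeriv^[j] f) t X) (fun j t => by
    rw [Function.iterate_succ_apply']
    exact hasDerivAt_oscSeg (hf.iterate_mixedDeriv j) (iterate_mixedDeriv_eq_zero hf hs j) X t) N
  simp only [Function.iterate_zero_apply, oscSeg_eq, one_smul, zero_smul, add_zero,
    add_sub_cancel] at this
  exact this

/-- The linear map `(x, y, ξ) ↦ (x, x + t(y - x), ξ)` has norm at most one. -/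
lemma norm_iteratedFDeriv_seg_le {f : Eucl d × Eucl d × Eucl d → ℂ} (hf : ContDiff ℝ (⊤ : ℕ∞) f)
    {t : ℝ} (ht : t ∈ Set.Icc (0 : ℝ) 1) (k : ℕ) (w : Eucl d × Eucl d × Eucl d) :
    ‖iteratedFDeriv ℝ k (fun w : Eucl d × Eucl d × Eucl d =>
        f (w.1, w.1 + t • (w.2.1 - w.1), w.2.2)) w‖ ≤
      ‖iteratedFDeriv ℝ k f (w.1, w.1 + t • (w.2.1 - w.1), w.2.2)‖ := by
  set P1 := ContinuousLinearMap.fst ℝ (Eucl d) (Eucl d × Eucl d)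
  set P2 := (ContinuousLinearMap.fst ℝ (Eucl d) (Eucl d)).comp
    (ContinuousLinearMap.snd ℝ (Eucl d) (Eucl d × Eucl d))
  set P3 := (ContinuousLinearMap.snd ℝ (Eucl d) (Eucl d)).comp
    (ContinuousLinearMap.snd ℝ (Eucl d) (Eucl d × Eucl d))
  set A : (Eucl d × Eucl d × Eucl d) →L[ℝ] Eucl d × Eucl d × Eucl d :=
    P1.prod ((P1 + t • (P2 - P1)).prod P3) with hA
  have hAe : ∀ w : Eucl d × Eucl d × Eucl d, A w + 0 = (w.1, w.1 + t • (w.2.1 - w.1), w.2.2) :=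
    fun w => add_zero _
  have hAn : ‖A‖ ≤ 1 := by
    refine ContinuousLinearMap.opNorm_le_bound _ zero_le_one fun v => ?_
    rw [one_mul]
    refine max_le (norm_fst_le v) (max_le ?_ ((norm_snd_le v.2).trans (norm_snd_le v)))
    change ‖v.1 + t • (v.2.1 - v.1)‖ ≤ _
    have e : v.1 + t • (v.2.1 - v.1) = (1 - t) • v.1 + t • v.2.1 := by
      rw [smul_sub, sub_smul, one_smul]; abel
    have h1 := norm_fst_le v
    have h2 := (norm_fst_le v.2).trans (norm_snd_le v)
    rw [e]
    refine (norm_add_le _ _).trans ?_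
    rw [norm_smul, norm_smul, Real.norm_of_nonneg ht.1, Real.norm_of_nonneg (sub_nonneg.2 ht.2)]
    nlinarith [ht.1, ht.2, mul_le_mul_of_nonneg_left h1 (sub_nonneg.2 ht.2),
      mul_le_mul_of_nonneg_left h2 ht.1]
  have := norm_iteratedFDeriv_comp_clm_le hf A hAn 0 k w
  simp only [hAe] at this
  exact this

include hf hs in
lemma contDiff_taylorIntegrand (N : ℕ) : ContDiff ℝ (⊤ : ℕ∞) fun z : (Eucl d × Eucl d) × ℝ =>
    (((1 - z.2) ^ N / N.factorial : ℝ) : ℂ) * oscSeg f z.2 z.1 := by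
  refine ContDiff.mul ?_ (contDiff_oscSeg hf hs)
  exact Complex.ofRealCLM.contDiff.comp
    (f := fun z : (Eucl d × Eucl d) × ℝ => (1 - z.2) ^ N / (N.factorial : ℝ)) (by fun_prop)

include hf hs in
/-- Derivatives of the remainder in the Taylor expansion. -/
lemma norm_iteratedFDeriv_taylor_le (N k : ℕ) (X : Eucl d × Eucl d) {B : ℕ → ℝ}
    (hB : ∀ j ≤ k, ∀ t ∈ Set.Icc (0 : ℝ) 1, ∀ ξ, ‖ξ‖ ≤ s →
      ‖iteratedFDeriv ℝ j f (X.1, X.1 + t • (X.2 - X.1), ξ)‖ ≤ B j) :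
    ‖iteratedFDeriv ℝ k (fun X => ∫ t in (0 : ℝ)..1, (((1 - t) ^ N / N.factorial : ℝ) : ℂ) *
        oscSeg f t X) X‖ ≤
      (∑ i ∈ Finset.range (k + 1), (k.choose i : ℝ) * (2 * s) ^ i * B (k - i)) *
        volume.real (Metric.closedBall (0 : Eucl d) s) := by
  have e : (fun X => ∫ t in (0 : ℝ)..1, (((1 - t) ^ N / N.factorial : ℝ) : ℂ) * oscSeg f t X) =
      fun X => ∫ t in Set.Icc (0 : ℝ) 1, (((1 - t) ^ N / N.factorial : ℝ) : ℂ) * oscSeg f t X := by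
    ext X
    rw [intervalIntegral.integral_of_le zero_le_one, integral_Icc_eq_integral_Ioc]
  rw [e]
  refine (norm_iteratedFDeriv_setIntegral_compact_le volume (isCompact_Icc (a := (0 : ℝ)) (b := 1))
    (contDiff_taylorIntegrand hf hs N) k X
    (B := (∑ i ∈ Finset.range (k + 1), (k.choose i : ℝ) * (2 * s) ^ i * B (k - i)) *
        volume.real (Metric.closedBall (0 : Eucl d) s)) fun t ht => ?_).trans (le_of_eq ?_)
  · have hts : ContDiff ℝ (⊤ : ℕ∞) fun w : Eucl d × Eucl d × Eucl d =>
        f (w.1, w.1 + t • (w.2.1 - w.1), w.2.2) := hf.comp (by fun_prop)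
    have h0 : ∀ w : Eucl d × Eucl d × Eucl d, s < ‖w.2.2‖ →
        f (w.1, w.1 + t • (w.2.1 - w.1), w.2.2) = 0 := fun w hw => hs _ hw
    have h1 : ‖iteratedFDeriv ℝ k (oscSeg f t) X‖ ≤
        (∑ i ∈ Finset.range (k + 1), (k.choose i : ℝ) * (2 * s) ^ i * B (k - i)) *
        volume.real (Metric.closedBall (0 : Eucl d) s) :=
      norm_iteratedFDeriv_osc_le hts h0 X k fun j hj ξ hξ =>
        (norm_iteratedFDeriv_seg_le hf ht j _).trans (hB j hj t ht ξ hξ)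
    have h2 := iteratedFDeriv_const_smul_apply' (a := (((1 - t) ^ N / N.factorial : ℝ) : ℂ))
      (x := X) (i := k) (f := oscSeg f t) (𝕜 := ℝ)
        (((contDiff_osc hts h0).of_le (nat_le_infty k)).contDiffAt)
    simp only [smul_eq_mul] at h2
    rw [h2, norm_smul, Complex.norm_real, Real.norm_of_nonneg
      (div_nonneg (pow_nonneg (sub_nonneg.2 ht.2) _) (Nat.cast_nonneg _))]
    refine (mul_le_of_le_one_left (norm_nonneg _) ?_).trans h1
    refine div_le_one_of_le₀ ?_ (Nat.cast_nonneg _)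
    refine (pow_le_one₀ (sub_nonneg.2 ht.2) (sub_le_self _ ht.1)).trans ?_
    exact_mod_cast Nat.factorial_pos N
  · simp

end

/-! ### Oscillating integrals away from the diagonal -/

section

/-- N(N+1)⋯(N+l-1) is l! times a binomial coefficient, at most l! 2^{N+l}. Thus N enters only
geometrically, which matters because N will be chosen depending on the point. -/
lemma norm_iteratedFDeriv_inv_pow_le (N l : ℕ) {t : ℝ} :
    ‖iteratedFDeriv ℝ l (fun t : ℝ => (t ^ N)⁻¹) t‖ ≤ l.factorial * 2 ^ (N + l) * (|t| ^ (N + l))⁻¹ := by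
  have e : (fun t : ℝ => (t ^ N)⁻¹) = fun t => t ^ (-(N : ℤ)) := by
    ext t
    rw [zpow_neg, zpow_natCast]
  rw [norm_iteratedFDeriv_eq_norm_iteratedDeriv, iteratedDeriv_eq_iterate, e, iter_deriv_zpow,
    norm_mul, show (-(N : ℤ) - l) = -((N + l : ℕ) : ℤ) by push_cast; ring, zpow_neg, zpow_natCast,
    norm_inv, norm_pow, Real.norm_eq_abs t]
  refine mul_le_mul_of_nonneg_right ?_ (by positivity)
  have h1 : ‖∏ i ∈ Finset.range l, (((-(N : ℤ) : ℤ) : ℝ) - i)‖ = (N.ascFactorial l : ℝ) := by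
    rw [Nat.ascFactorial_eq_prod_range, norm_prod, Nat.cast_prod]
    refine Finset.prod_congr rfl fun i _ => ?_
    rw [Real.norm_eq_abs, ← abs_neg]
    push_cast
    rw [abs_of_nonneg] <;> [ring; (rw [neg_sub, sub_neg_eq_add]; positivity)]
  rw [h1, Nat.ascFactorial_eq_factorial_mul_choose']
  push_cast
  refine mul_le_mul_of_nonneg_left ?_ (Nat.cast_nonneg _)
  refine le_trans (b := (2 : ℝ) ^ (N + l - 1)) ?_ (pow_le_pow_right₀ one_le_two (Nat.sub_le _ _))
  exact_mod_cast Nat.choose_le_two_pow _ _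

variable {d : ℕ}

/-- The linear form `(x, y) ↦ x_i - y_i`. -/
def subCoord (i : Fin d) : (Eucl d × Eucl d) →L[ℝ] ℝ :=
  (EuclideanSpace.proj i).comp
    (ContinuousLinearMap.fst ℝ (Eucl d) (Eucl d) - ContinuousLinearMap.snd ℝ (Eucl d) (Eucl d))

lemma subCoord_apply (i : Fin d) (X : Eucl d × Eucl d) : subCoord i X = (X.1 - X.2) i := rfl

lemma norm_subCoord_le (i : Fin d) : ‖(subCoord i : (Eucl d × Eucl d) →L[ℝ] ℝ)‖ ≤ 2 := by
  refine ContinuousLinearMap.opNorm_le_bound _ zero_le_two fun v => ?_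
  rw [subCoord_apply]
  have h0 : ‖(v.1 - v.2) i‖ ≤ ‖v.1 - v.2‖ := PiLp.norm_apply_le _ i
  have := norm_sub_le v.1 v.2
  have := norm_fst_le v
  have := norm_snd_le v
  linarith

lemma norm_iteratedFDerivWithin_inv_subCoord_le (i : Fin d) (N l : ℕ) {X : Eucl d × Eucl d}
    (hX : subCoord i X ≠ 0) :
    ‖iteratedFDerivWithin ℝ l (fun X : Eucl d × Eucl d => (subCoord i X ^ N)⁻¹)
      (subCoord i ⁻¹' {0}ᶜ) X‖ ≤
      l.factorial * 2 ^ (N + l) * (|subCoord i X| ^ (N + l))⁻¹ * 2 ^ l := by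
  have ho : IsOpen ({0}ᶜ : Set ℝ) := isOpen_compl_singleton
  have hs : ContDiffOn ℝ (⊤ : ℕ∞) (fun t : ℝ => (t ^ N)⁻¹) ({0}ᶜ : Set ℝ) :=
    (contDiff_id.pow N).contDiffOn.inv fun t ht => pow_ne_zero _ ht
  have := (subCoord i).iteratedFDerivWithin_comp_right hs ho.uniqueDiffOn
    (ho.preimage (subCoord i).continuous).uniqueDiffOn hX (nat_le_infty l)
  rw [show (fun X : Eucl d × Eucl d => (subCoord i X ^ N)⁻¹) = (fun t : ℝ => (t ^ N)⁻¹) ∘ subCoord i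
    from rfl, this, iteratedFDerivWithin_of_isOpen l ho hX]
  refine (ContinuousMultilinearMap.norm_compContinuousLinearMap_le _ _).trans ?_
  refine mul_le_mul (norm_iteratedFDeriv_inv_pow_le N l) ?_ (Finset.prod_nonneg fun _ _ =>
    norm_nonneg _) (by positivity)
  rw [Finset.prod_const, Finset.card_univ, Fintype.card_fin]
  exact pow_le_pow_left₀ (norm_nonneg _) (norm_subCoord_le i) l

variable {f : Eucl d × Eucl d × Eucl d → ℂ} (hf : ContDiff ℝ (⊤ : ℕ∞) f) {s : ℝ}
  (hs : ∀ w, s < ‖w.2.2‖ → f w = 0)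

include hf hs in
lemma osc_eq_inv_mul (i : Fin d) (N : ℕ) {X : Eucl d × Eucl d} (hX : subCoord i X ≠ 0) :
    osc f X = (subCoord i X ^ N)⁻¹ •
      (Complex.I ^ N • osc ((dirDeriv (0, 0, stdVec d i))^[N] f) X) := by
  have hh : ContDiff ℝ (⊤ : ℕ∞) fun ξ => f (X.1, X.2, ξ) := hf.comp (by fun_prop)
  have := inner_pow_mul_integral_phase hh (fun ξ hξ => hs (X.1, X.2, ξ) hξ) (X.1 - X.2)
    (stdVec d i) N
  have e : (inner ℝ (X.1 - X.2) (stdVec d i) : ℝ) = subCoord i X := by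
    rw [stdVec, EuclideanSpace.inner_single_right, subCoord_apply]
    simp
  rw [e, dirDeriv_iterate_slice hf] at this
  rw [smul_eq_mul, osc, osc, ← this, ← smul_eq_mul (a := (_ : ℂ) ^ N), ← Complex.ofReal_pow,
    Complex.coe_smul, smul_smul, inv_mul_cancel₀ (pow_ne_zero N hX), one_smul]

include hf hs in
/-- Derivatives of an oscillating integral off the diagonal. -/
lemma norm_iteratedFDeriv_osc_le_of_ne (i : Fin d) (N k : ℕ) {X : Eucl d × Eucl d}
    (hX : subCoord i X ≠ 0) {B : ℕ → ℝ}
    (hB : ∀ j ≤ k, ∀ ξ, ‖ξ‖ ≤ s → ‖iteratedFDeriv ℝ (j + N) f (X.1, X.2, ξ)‖ ≤ B j) :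
    ‖iteratedFDeriv ℝ k (osc f) X‖ ≤ ∑ l ∈ Finset.range (k + 1), (k.choose l : ℝ) *
      (l.factorial * 2 ^ (N + l) * (|subCoord i X| ^ (N + l))⁻¹ * 2 ^ l) *
      ((∑ j ∈ Finset.range (k - l + 1), ((k - l).choose j : ℝ) * (2 * s) ^ j * B (k - l - j)) *
        volume.real (Metric.closedBall (0 : Eucl d) s)) := by
  set g := (dirDeriv ((0, 0, stdVec d i) : Eucl d × Eucl d × Eucl d))^[N] f with hg
  have hgs : ContDiff ℝ (⊤ : ℕ∞) g := hf.iterate_dirDeriv _ N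
  have hg0 : ∀ w : Eucl d × Eucl d × Eucl d, s < ‖w.2.2‖ → g w = 0 :=
    dirDeriv_iterate_eq_zero_of_isOpen (isOpen_lt_norm_snd_snd s) hs _ N
  have hU : IsOpen (subCoord i ⁻¹' {0}ᶜ : Set (Eucl d × Eucl d)) :=
    isOpen_compl_singleton.preimage (subCoord i).continuous
  have hinv : ContDiffOn ℝ (⊤ : ℕ∞) (fun X : Eucl d × Eucl d => (subCoord i X ^ N)⁻¹)
      (subCoord i ⁻¹' {0}ᶜ) :=
    ((subCoord i).contDiff.pow N).contDiffOn.inv fun X hX => pow_ne_zero _ hX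
  have hosc : ContDiff ℝ (⊤ : ℕ∞) fun X => Complex.I ^ N • osc g X :=
    (contDiff_osc hgs hg0).const_smul _
  have e : osc f =ᶠ[nhds X] fun X => (subCoord i X ^ N)⁻¹ • (Complex.I ^ N • osc g X) :=
    Filter.eventually_of_mem (hU.mem_nhds hX) fun Y hY => osc_eq_inv_mul hf hs i N hY
  rw [(e.iteratedFDeriv ℝ k).eq_of_nhds, ← iteratedFDerivWithin_of_isOpen k hU hX]
  refine (norm_iteratedFDerivWithin_smul_le hinv hosc.contDiffOn hU.uniqueDiffOn hX
    (nat_le_infty k)).trans (Finset.sum_le_sum fun l _ => ?_)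
  refine mul_le_mul (mul_le_mul_of_nonneg_left
    (norm_iteratedFDerivWithin_inv_subCoord_le i N l hX) (Nat.cast_nonneg _)) ?_
    (norm_nonneg _) (by positivity)
  rw [iteratedFDerivWithin_of_isOpen _ hU hX, iteratedFDeriv_const_smul_apply'
    ((contDiff_osc hgs hg0).of_le (nat_le_infty _)).contDiffAt, norm_smul, norm_pow, Complex.norm_I,
    one_pow, one_mul]
  refine norm_iteratedFDeriv_osc_le hgs hg0 X (k - l) fun j hj ξ hξ => ?_
  refine (norm_iteratedFDeriv_iterate_dirDeriv_le hf ?_ N j _).trans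
    (hB j (hj.trans (Nat.sub_le _ _)) ξ hξ)
  simp [Prod.norm_def, norm_stdVec]

end

/-! ### Comparison of brackets and restriction to the diagonal -/

section
variable {d : ℕ}

lemma jap2_pos (x ξ : Eucl d) : 0 < jap2 x ξ := zero_lt_one.trans_le (one_le_jap2 x ξ)

lemma norm_le_jap2 (w : Eucl d × Eucl d) : ‖w‖ ≤ jap2 w.1 w.2 := by
  refine max_le ?_ ?_ <;> refine Real.le_sqrt_of_sq_le ?_ <;> nlinarith [sq_nonneg ‖w.1‖, sq_nonneg ‖w.2‖]

lemma jap2_le (w : Eucl d × Eucl d) : jap2 w.1 w.2 ≤ 1 + 2 * ‖w‖ := by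
  refine Real.sqrt_le_iff.2 ⟨by positivity, ?_⟩
  have h1 := norm_fst_le w
  have h2 := norm_snd_le w
  nlinarith [norm_nonneg w.1, norm_nonneg w.2, norm_nonneg w]

/-- From ‖y‖ ≤ ‖x‖ + ‖x-y‖ one gets ⟨(x,y,ξ)⟩ ≤ 2⟨(x,ξ)⟩⟨x-y⟩. Consequently symbol estimates in
(x,ξ) are amplitude estimates, up to 2^k. -/
lemma inv_jap2_le_japRatio (w : Eucl d × Eucl d × Eucl d) :
    1 / jap2 w.1 w.2.2 ≤ 2 * japRatio w := by
  obtain ⟨x, y, ξ⟩ := w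
  have h3 := one_le_jap3 x y ξ
  rw [japRatio, ← mul_div_assoc, div_le_div_iff₀ (jap2_pos x ξ) (by simpa using zero_lt_one.trans_le h3), one_mul]
  have hy : ‖y‖ ≤ ‖x‖ + ‖x - y‖ := by
    have := norm_sub_le x (x - y)
    rwa [sub_sub_cancel] at this
  simp only [jap, jap2, jap3]
  rw [show (2 : ℝ) = Real.sqrt 4 by rw [show (4 : ℝ) = 2 ^ 2 by norm_num, Real.sqrt_sq zero_le_two],
    ← Real.sqrt_mul (by norm_num), ← Real.sqrt_mul (by positivity)]
  refine Real.sqrt_le_sqrt ?_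
  nlinarith [norm_nonneg y, norm_nonneg x, norm_nonneg (x - y), sq_nonneg (‖x‖ - ‖x - y‖),
    mul_nonneg (sq_nonneg ‖x‖) (sq_nonneg ‖x - y‖), mul_nonneg (sq_nonneg ‖ξ‖) (sq_nonneg ‖x - y‖),
    mul_self_le_mul_self (norm_nonneg y) hy]

lemma japRatio_diag_le (x ξ : Eucl d) : japRatio (x, x, ξ) ≤ 1 / jap2 x ξ := by
  simp only [japRatio, sub_self, jap]
  rw [norm_zero, zero_pow two_ne_zero, add_zero, Real.sqrt_one]
  refine one_div_le_one_div_of_le (jap2_pos x ξ) ?_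
  refine Real.sqrt_le_sqrt ?_
  nlinarith [sq_nonneg ‖x‖]

lemma inv_jap2_mem (x ξ : Eucl d) : 0 < 1 / jap2 x ξ ∧ 1 / jap2 x ξ ≤ 1 :=
  ⟨one_div_pos.2 (jap2_pos x ξ), (div_le_one (jap2_pos x ξ)).2 (one_le_jap2 x ξ)⟩

lemma inv_jap2_rpow_le {ρ : ℝ} (hρ : 0 < ρ) (hρ1 : ρ ≤ 1) (w : Eucl d × Eucl d × Eucl d) (k : ℕ) :
    (1 / jap2 w.1 w.2.2) ^ (ρ * k) ≤ 2 ^ k * japRatio w ^ (ρ * k) := by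
  have hk : 0 ≤ ρ * k := by positivity
  refine (Real.rpow_le_rpow (inv_jap2_mem _ _).1.le (inv_jap2_le_japRatio w) hk).trans ?_
  rw [Real.mul_rpow zero_le_two (japRatio_pos w).le, ← Real.rpow_natCast 2 k]
  refine mul_le_mul_of_nonneg_right ?_ (Real.rpow_nonneg (japRatio_pos w).le _)
  refine Real.rpow_le_rpow_of_exponent_le one_le_two ?_
  nlinarith [Nat.cast_nonneg (α := ℝ) k]

/-- Functions of `(x, ξ)` as functions of `(x, y, ξ)`. -/
lemma norm_iteratedFDeriv_symAmp_le {χ : Eucl d × Eucl d → ℂ} (hχ : ContDiff ℝ (⊤ : ℕ∞) χ) (k : ℕ)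
    (w : Eucl d × Eucl d × Eucl d) :
    ‖iteratedFDeriv ℝ k (fun w : Eucl d × Eucl d × Eucl d => χ (w.1, w.2.2)) w‖ ≤
      ‖iteratedFDeriv ℝ k χ (w.1, w.2.2)‖ := by
  set A : (Eucl d × Eucl d × Eucl d) →L[ℝ] Eucl d × Eucl d :=
    (ContinuousLinearMap.fst ℝ (Eucl d) (Eucl d × Eucl d)).prod
      ((ContinuousLinearMap.snd ℝ (Eucl d) (Eucl d)).comp
        (ContinuousLinearMap.snd ℝ (Eucl d) (Eucl d × Eucl d)))
  have hAe : ∀ w : Eucl d × Eucl d × Eucl d, A w + 0 = (w.1, w.2.2) := fun w => add_zero _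
  have hAn : ‖A‖ ≤ 1 := by
    refine ContinuousLinearMap.opNorm_le_bound _ zero_le_one fun v => ?_
    rw [one_mul]
    exact max_le (norm_fst_le v) ((norm_snd_le v.2).trans (norm_snd_le v))
  have := norm_iteratedFDeriv_comp_clm_le hχ A hAn 0 k w
  simp only [hAe] at this
  exact this

/-- Restriction to the diagonal. -/
lemma norm_iteratedFDeriv_diag_le {f : Eucl d × Eucl d × Eucl d → ℂ} (hf : ContDiff ℝ (⊤ : ℕ∞) f)
    (k : ℕ) (z : Eucl d × Eucl d) :
    ‖iteratedFDeriv ℝ k (fun z : Eucl d × Eucl d => f (z.1, z.1, z.2)) z‖ ≤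
      ‖iteratedFDeriv ℝ k f (z.1, z.1, z.2)‖ := by
  set A : (Eucl d × Eucl d) →L[ℝ] Eucl d × Eucl d × Eucl d :=
    (ContinuousLinearMap.fst ℝ (Eucl d) (Eucl d)).prod
      ((ContinuousLinearMap.fst ℝ (Eucl d) (Eucl d)).prod
        (ContinuousLinearMap.snd ℝ (Eucl d) (Eucl d)))
  have hAe : ∀ w : Eucl d × Eucl d, A w + 0 = (w.1, w.1, w.2) := fun w => add_zero _
  have hAn : ‖A‖ ≤ 1 := by
    refine ContinuousLinearMap.opNorm_le_bound _ zero_le_one fun v => ?_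
    rw [one_mul]
    exact max_le (norm_fst_le v) (max_le (norm_fst_le v) (norm_snd_le v))
  have := norm_iteratedFDeriv_comp_clm_le hf A hAn 0 k z
  simp only [hAe] at this
  exact this

lemma diagTerm_eq_fun {a : Eucl d × Eucl d × Eucl d → ℂ} (ha : ContDiff ℝ (⊤ : ℕ∞) a) (j : ℕ) :
    diagTerm a j = fun z => (1 / (j.factorial : ℂ)) • mixedDeriv^[j] a (z.1, z.1, z.2) :=
  funext fun z => diagTerm_eq ha j z

lemma contDiff_diagTerm {a : Eucl d × Eucl d × Eucl d → ℂ} (ha : ContDiff ℝ (⊤ : ℕ∞) a) (j : ℕ) :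
    ContDiff ℝ (⊤ : ℕ∞) (diagTerm a j) := by
  rw [diagTerm_eq_fun ha]
  exact ((ha.iterate_mixedDeriv j).comp (contDiff_fst.prodMk (contDiff_fst.prodMk
    contDiff_snd))).const_smul _

lemma norm_iteratedFDeriv_diagTerm_le {a : Eucl d × Eucl d × Eucl d → ℂ}
    (ha : ContDiff ℝ (⊤ : ℕ∞) a) (j k : ℕ) (z : Eucl d × Eucl d) :
    ‖iteratedFDeriv ℝ k (diagTerm a j) z‖ ≤
      d ^ j * ‖iteratedFDeriv ℝ (k + 2 * j) a (z.1, z.1, z.2)‖ := by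
  have hs : ContDiff ℝ (⊤ : ℕ∞) fun z : Eucl d × Eucl d => mixedDeriv^[j] a (z.1, z.1, z.2) :=
    (ha.iterate_mixedDeriv j).comp (contDiff_fst.prodMk (contDiff_fst.prodMk contDiff_snd))
  rw [diagTerm_eq_fun ha, iteratedFDeriv_const_smul_apply' (hs.of_le (nat_le_infty k)).contDiffAt,
    norm_smul]
  refine (mul_le_of_le_one_left (norm_nonneg _) ?_).trans
    ((norm_iteratedFDeriv_diag_le (ha.iterate_mixedDeriv j) k z).trans
      (norm_iteratedFDeriv_iterate_mixedDeriv_le ha j k _))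
  rw [norm_div, norm_one, Complex.norm_natCast]
  exact div_le_one_of_le₀ (by exact_mod_cast Nat.factorial_pos j) (Nat.cast_nonneg _)

lemma diagTerm_congr {a b : Eucl d × Eucl d × Eucl d → ℂ} {z : Eucl d × Eucl d}
    (h : a =ᶠ[nhds (z.1, z.1, z.2)] b) (j : ℕ) : diagTerm a j z = diagTerm b j z := by
  rw [diagTerm, diagTerm]
  refine Finset.sum_congr rfl fun α _ => ?_
  rw [ampDeriv_eq_wordDeriv]
  congr 2
  have key : ∀ l : List (Eucl d × Eucl d × Eucl d), wordDeriv l a =ᶠ[nhds (z.1, z.1, z.2)]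
      wordDeriv l b := by
    intro l
    induction l with
    | nil => exact h
    | cons v l ih => exact ih.fderiv.mono fun w hw => DFunLike.congr_fun hw v
  rw [(key _).eq_of_nhds, ← ampDeriv_eq_wordDeriv]

lemma diagTerm_sum {ι : Type*} (s : Finset ι) {f : ι → Eucl d × Eucl d × Eucl d → ℂ}
    (hf : ∀ i, ContDiff ℝ (⊤ : ℕ∞) (f i)) (j : ℕ) (z : Eucl d × Eucl d) :
    diagTerm (fun w => ∑ i ∈ s, f i w) j z = ∑ i ∈ s, diagTerm (f i) j z := by
  have key : ∀ l : List (Eucl d × Eucl d × Eucl d), wordDeriv l (fun w => ∑ i ∈ s, f i w) =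
      fun w => ∑ i ∈ s, wordDeriv l (f i) w := by
    intro l
    induction l with
    | nil => rfl
    | cons v l ih =>
      change dirDeriv v (wordDeriv l _) = _
      rw [ih]
      ext w
      rw [dirDeriv, fderiv_fun_sum fun i _ => ((hf i).wordDeriv l).differentiable (by simp) w,
        sum_apply]
      rfl
  simp only [diagTerm, ampDeriv_eq_wordDeriv, key, Finset.mul_sum]
  rw [Finset.sum_comm]

end

section
variable {d : ℕ} {ω : ℝ → ℝ} {m ρ : ℝ} (hρ : 0 < ρ) (hρ1 : ρ ≤ 1)

include hρ hρ1 in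
lemma SymBound.mul_ampBound {χ : Eucl d × Eucl d → ℂ} {a : Eucl d × Eucl d × Eucl d → ℂ}
    (hχs : ContDiff ℝ (⊤ : ℕ∞) χ) (has : ContDiff ℝ (⊤ : ℕ∞) a) {V V' : ℕ → ℝ}
    (hV : ∀ k, 0 ≤ V k) (hχ : SymBound ω 0 ρ V χ) (ha : AmpBound ω m ρ V' a) :
    AmpBound ω m ρ (fun k => ∑ i ∈ Finset.range (k + 1), k.choose i * (2 ^ i * V i) * V' (k - i))
      fun w => χ (w.1, w.2.2) * a w := by
  intro k w
  have hs : ContDiff ℝ (⊤ : ℕ∞) fun w : Eucl d × Eucl d × Eucl d => χ (w.1, w.2.2) :=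
    hχs.comp (by fun_prop)
  refine (norm_iteratedFDeriv_mul_le hs has w (nat_le_infty k)).trans ?_
  rw [Finset.sum_mul, Finset.sum_mul]
  refine Finset.sum_le_sum fun i hi => ?_
  have hik : i ≤ k := Nat.lt_succ_iff.1 (Finset.mem_range.1 hi)
  have h1 : ‖iteratedFDeriv ℝ i (fun w : Eucl d × Eucl d × Eucl d => χ (w.1, w.2.2)) w‖ ≤
      2 ^ i * V i * japRatio w ^ (ρ * i) := by
    refine (norm_iteratedFDeriv_symAmp_le hχs i w).trans ((hχ i _).trans ?_)
    simp only [zero_mul, Real.exp_zero, mul_one]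
    refine (mul_le_mul_of_nonneg_left (inv_jap2_rpow_le hρ hρ1 w i) (hV i)).trans (le_of_eq ?_)
    ring
  have h2 := ha (k - i) w
  refine (mul_le_mul (mul_le_mul_of_nonneg_left h1 (Nat.cast_nonneg _)) h2 (norm_nonneg _)
    ?_).trans (le_of_eq ?_)
  · have := hV i
    have := Real.rpow_nonneg (japRatio_pos w).le (ρ * i)
    positivity
  · have e : japRatio w ^ (ρ * k) = japRatio w ^ (ρ * i) * japRatio w ^ (ρ * ((k - i : ℕ) : ℝ)) := by
      rw [← Real.rpow_add (japRatio_pos w), Nat.cast_sub hik]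
      congr 1
      ring
    rw [e]
    ring

include hρ hρ1 in
lemma SymBound.ampBound (hω : IsWeightFunction ω) {p : Eucl d × Eucl d → ℂ}
    (hp : ContDiff ℝ (⊤ : ℕ∞) p) {V : ℕ → ℝ} (hV : ∀ k, 0 ≤ V k) {m' : ℝ} (hm : m ≤ m')
    (hm' : 0 ≤ m') (h : SymBound ω m ρ V p) :
    AmpBound ω m' ρ (fun k => 2 ^ k * V k) fun w => p (w.1, w.2.2) := by
  intro k w
  refine (norm_iteratedFDeriv_symAmp_le hp k w).trans ((h k _).trans ?_)
  have h0 := Real.rpow_nonneg (inv_jap2_mem w.1 w.2.2).1.le (ρ * k)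
  have h1 := hω.nonneg (norm_nonneg w.1)
  have h2 := hω.nonneg (norm_nonneg w.2.1)
  have h3 := hω.nonneg (norm_nonneg w.2.2)
  rw [mul_assoc (_ * _), ← Real.exp_add]
  refine mul_le_mul ?_ (Real.exp_le_exp.2 ?_) (Real.exp_pos _).le ?_
  · refine (mul_le_mul_of_nonneg_left (inv_jap2_rpow_le hρ hρ1 w k) (hV k)).trans (le_of_eq ?_)
    ring
  · rw [ampWeight]
    nlinarith [mul_le_mul_of_nonneg_right hm h1, mul_le_mul_of_nonneg_right hm h3,
      mul_nonneg hm' h2]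
  · have := hV k
    have := Real.rpow_nonneg (japRatio_pos w).le (ρ * k)
    positivity

end

/-! ### The dyadic partition of unity -/

/-- Smooth cutoff functions with controlled derivatives. -/
structure IsCutoff {d : ℕ} (ω : ℝ → ℝ) (ρ : ℝ) (Φ : Eucl d × Eucl d → ℂ) (q : ℕ) (V : ℕ → ℝ) :
    Prop where
  smooth : ContDiff ℝ (⊤ : ℕ∞) Φ
  one : ∀ w, ‖w‖ ≤ 1 → Φ w = 1
  zero : ∀ w, (2 : ℝ) ^ q ≤ ‖w‖ → Φ w = 0
  norm_le : ∀ w, ‖Φ w‖ ≤ 1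
  adm : Adm ω ρ V
  bound : ∀ k w, ‖iteratedFDeriv ℝ k Φ w‖ ≤ V k

/-- The dyadic partition of unity generated by a cutoff function. -/
def dyadic {d : ℕ} (Φ : Eucl d × Eucl d → ℂ) : ℕ → Eucl d × Eucl d → ℂ
  | 0 => Φ
  | ν + 1 => fun w => Φ (((2 : ℝ) ^ (ν + 1))⁻¹ • w) - Φ (((2 : ℝ) ^ ν)⁻¹ • w)

lemma sum_dyadic {d : ℕ} (Φ : Eucl d × Eucl d → ℂ) (T : ℕ) (w : Eucl d × Eucl d) :
    ∑ ν ∈ Finset.range (T + 1), dyadic Φ ν w = Φ (((2 : ℝ) ^ T)⁻¹ • w) := by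
  induction T with
  | zero => simp [dyadic]
  | succ T ih => rw [Finset.sum_range_succ, ih, dyadic]; ring

namespace IsCutoff
variable {d : ℕ} {ω : ℝ → ℝ} {ρ : ℝ} {Φ : Eucl d × Eucl d → ℂ} {q : ℕ} {V : ℕ → ℝ}
  (h : IsCutoff ω ρ Φ q V)
include h

lemma contDiff_scale (c : ℝ) : ContDiff ℝ (⊤ : ℕ∞) fun w => Φ (c • w) :=
  h.smooth.comp (contDiff_id.const_smul c)

lemma contDiff_dyadic (ν : ℕ) : ContDiff ℝ (⊤ : ℕ∞) (dyadic Φ ν) := by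
  cases ν with
  | zero => exact h.smooth
  | succ ν => exact (h.contDiff_scale _).sub (h.contDiff_scale _)

lemma iteratedFDeriv_scale (c : ℝ) (k : ℕ) (w : Eucl d × Eucl d) :
    iteratedFDeriv ℝ k (fun w => Φ (c • w)) w = c ^ k • iteratedFDeriv ℝ k Φ (c • w) := by
  exact congrFun (iteratedFDeriv_comp_const_smul c (h.smooth.of_le (nat_le_infty k))) w

lemma iteratedFDeriv_eq_zero_of_lt (k : ℕ) {w : Eucl d × Eucl d} (hw : (2 : ℝ) ^ q < ‖w‖) :
    iteratedFDeriv ℝ k Φ w = 0 :=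
  iteratedFDeriv_eq_zero_of_isOpen (U := {w | (2 : ℝ) ^ q < ‖w‖})
    (isOpen_lt continuous_const continuous_norm) (fun _ hw => h.zero _ hw.le) k hw

/-- On the support of the dilated cutoff c⟨w⟩ ≤ 2^{q+2}, so each derivative gains a factor of order
1/⟨w⟩, which is better than needed as ρ ≤ 1. The bound does not depend on c. -/
lemma symBound_scale (hρ1 : ρ ≤ 1) {c : ℝ} (hc : 0 < c) (hc1 : c ≤ 1) :
    SymBound ω 0 ρ (fun k => ((2 : ℝ) ^ (q + 2)) ^ k * V k) fun w => Φ (c • w) := by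
  intro k w
  simp only [zero_mul, Real.exp_zero, mul_one]
  rw [h.iteratedFDeriv_scale, norm_smul, norm_pow, Real.norm_of_nonneg hc.le]
  have hj := inv_jap2_mem w.1 w.2
  have hV := h.adm.nonneg k
  have hr := Real.rpow_nonneg hj.1.le (ρ * k)
  by_cases hw : (2 : ℝ) ^ q < ‖c • w‖
  · rw [h.iteratedFDeriv_eq_zero_of_lt k hw, norm_zero, mul_zero]
    positivity
  · have h1 : c ≤ 2 ^ (q + 2) * (1 / jap2 w.1 w.2) := by
      rw [mul_one_div, le_div_iff₀ (jap2_pos _ _)]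
      have h2 := jap2_le w
      rw [not_lt, norm_smul, Real.norm_of_nonneg hc.le] at hw
      have h3 : (1 : ℝ) ≤ 2 ^ q := one_le_pow₀ one_le_two
      rw [pow_add]
      nlinarith
    have h2 : (1 / jap2 w.1 w.2) ^ k ≤ (1 / jap2 w.1 w.2) ^ (ρ * k) := by
      rw [← Real.rpow_natCast]
      refine Real.rpow_le_rpow_of_exponent_ge hj.1 hj.2 ?_
      nlinarith [Nat.cast_nonneg (α := ℝ) k]
    calc c ^ k * ‖iteratedFDeriv ℝ k Φ (c • w)‖
        ≤ (2 ^ (q + 2) * (1 / jap2 w.1 w.2)) ^ k * V k :=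
          mul_le_mul (pow_le_pow_left₀ hc.le h1 k) (h.bound k _) (norm_nonneg _)
            (pow_nonneg (by have := hj.1.le; positivity) _)
      _ = (2 ^ (q + 2)) ^ k * V k * (1 / jap2 w.1 w.2) ^ k := by rw [mul_pow]; ring
      _ ≤ _ := by gcongr

lemma symBound_dyadic (hρ1 : ρ ≤ 1) (ν : ℕ) :
    SymBound ω 0 ρ (fun k => 2 * (((2 : ℝ) ^ (q + 2)) ^ k * V k)) (dyadic Φ ν) := by
  intro k w
  have hle : ∀ μ : ℕ, ((2 : ℝ) ^ μ)⁻¹ ≤ 1 := fun μ => inv_le_one_of_one_le₀ (one_le_pow₀ one_le_two)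
  cases ν with
  | zero =>
    have := h.symBound_scale hρ1 one_pos le_rfl k w
    simp only [one_smul] at this
    refine this.trans ?_
    simp only [zero_mul, Real.exp_zero, mul_one]
    have := Real.rpow_nonneg (inv_jap2_mem w.1 w.2).1.le (ρ * k)
    have hV := h.adm.nonneg k
    rw [mul_assoc 2]
    exact le_mul_of_one_le_left (by positivity) one_le_two
  | succ ν =>
    have h1 := h.symBound_scale hρ1 (c := ((2 : ℝ) ^ (ν + 1))⁻¹) (by positivity) (hle _) k w
    have h2 := h.symBound_scale hρ1 (c := ((2 : ℝ) ^ ν)⁻¹) (by positivity) (hle _) k w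
    have e : iteratedFDeriv ℝ k (dyadic Φ (ν + 1)) w =
        iteratedFDeriv ℝ k (fun w => Φ (((2 : ℝ) ^ (ν + 1))⁻¹ • w)) w -
          iteratedFDeriv ℝ k (fun w => Φ (((2 : ℝ) ^ ν)⁻¹ • w)) w := by
      exact iteratedFDeriv_sub_apply ((h.contDiff_scale _).of_le (nat_le_infty k)).contDiffAt
        ((h.contDiff_scale _).of_le (nat_le_infty k)).contDiffAt
    rw [e]
    refine (norm_sub_le _ _).trans ((add_le_add h1 h2).trans (le_of_eq (by ring)))

lemma dyadic_eq_zero_of_le (ν : ℕ) {w : Eucl d × Eucl d} (hw : (2 : ℝ) ^ (ν + q) ≤ ‖w‖) :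
    dyadic Φ ν w = 0 := by
  have key : ∀ μ ≤ ν, Φ (((2 : ℝ) ^ μ)⁻¹ • w) = 0 := by
    intro μ hμ
    refine h.zero _ ?_
    rw [norm_smul, norm_inv, norm_pow, Real.norm_two, ← div_eq_inv_mul, le_div_iff₀ (by positivity),
      ← pow_add]
    exact (pow_le_pow_right₀ one_le_two (by omega)).trans hw
  cases ν with
  | zero => simpa [dyadic] using key 0 le_rfl
  | succ ν => simp only [dyadic]; rw [key _ le_rfl, key _ (Nat.le_succ ν), sub_zero]

lemma dyadic_eq_zero_of_norm_le (ν : ℕ) {w : Eucl d × Eucl d} (hw : ‖w‖ ≤ 2 ^ ν) :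
    dyadic Φ (ν + 1) w = 0 := by
  have key : ∀ μ, ν ≤ μ → Φ (((2 : ℝ) ^ μ)⁻¹ • w) = 1 := by
    intro μ hμ
    refine h.one _ ?_
    rw [norm_smul, norm_inv, norm_pow, Real.norm_two, ← div_eq_inv_mul, div_le_one (by positivity)]
    exact hw.trans (pow_le_pow_right₀ one_le_two hμ)
  simp only [dyadic]
  rw [key _ le_rfl, key _ (Nat.le_succ ν), sub_self]

end IsCutoff

/-- The region where the dyadic function of index `ν` may be nonzero. -/
def IsActive {d : ℕ} (q ν : ℕ) (w : Eucl d × Eucl d) : Prop :=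
  ‖w‖ ≤ 2 ^ (ν + q) ∧ 2 ^ ν ≤ 2 * jap2 w.1 w.2

lemma IsCutoff.eventually_dyadic_eq_zero {d : ℕ} {ω : ℝ → ℝ} {ρ : ℝ} {Φ : Eucl d × Eucl d → ℂ}
    {q : ℕ} {V : ℕ → ℝ} (h : IsCutoff ω ρ Φ q V) {ν : ℕ} {w : Eucl d × Eucl d}
    (hw : ¬ IsActive q ν w) : ∃ U : Set (Eucl d × Eucl d), IsOpen U ∧ w ∈ U ∧
      ∀ z ∈ U, dyadic Φ ν z = 0 := by
  rw [IsActive, not_and_or, not_le, not_le] at hw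
  rcases hw with hw | hw
  · exact ⟨{z | (2 : ℝ) ^ (ν + q) < ‖z‖}, isOpen_lt continuous_const continuous_norm, hw,
      fun z hz => h.dyadic_eq_zero_of_le ν (le_of_lt hz)⟩
  · have h1 := one_le_jap2 w.1 w.2
    cases ν with
    | zero => norm_num at hw; linarith
    | succ ν =>
      refine ⟨{z | ‖z‖ < (2 : ℝ) ^ ν}, isOpen_lt continuous_norm continuous_const, ?_,
        fun z hz => h.dyadic_eq_zero_of_norm_le ν (le_of_lt hz)⟩
      rw [pow_succ] at hw
      have := norm_le_jap2 w
      exact lt_of_le_of_lt this (by linarith)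

/-- At most `q + 4` indices are active at a point. -/
lemma card_active_le {d : ℕ} (q : ℕ) (w : Eucl d × Eucl d) (s : Finset ℕ)
    (hs : ∀ ν ∈ s, IsActive q ν w) : s.card ≤ q + 4 := by
  rcases s.eq_empty_or_nonempty with rfl | hne
  · simp
  · set a := s.min' hne
    have ha := hs a (s.min'_mem hne)
    have hsub : s ⊆ Finset.Ico a (a + (q + 4)) := by
      intro ν hν
      rw [Finset.mem_Ico]
      refine ⟨s.min'_le ν hν, ?_⟩
      have h1 := (hs ν hν).2
      have h2 := jap2_le w
      have h3 : (1 : ℝ) ≤ 2 ^ (a + q) := one_le_pow₀ one_le_two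
      have h4 : (2 : ℝ) ^ ν < 2 ^ (a + (q + 4)) := by
        rw [show a + (q + 4) = a + q + 4 by ring, pow_add 2 (a + q)]
        have := ha.1
        linarith
      exact (pow_lt_pow_iff_right₀ one_lt_two).1 h4
    simpa using Finset.card_le_card hsub

/-! ### Construction of the symbol -/

/-- The dyadic pieces of an amplitude. -/
def piece {d : ℕ} (Φ : Eucl d × Eucl d → ℂ) (a : Eucl d × Eucl d × Eucl d → ℂ) (ν : ℕ) :
    Eucl d × Eucl d × Eucl d → ℂ := fun w => dyadic Φ ν (w.1, w.2.2) * a w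

/-- An amplitude with a cutoff function, estimates for its dyadic pieces, and the numbers `N ν` of
terms of the asymptotic expansion to be used in each dyadic region. -/
structure ExpansionData {d : ℕ} (ω : ℝ → ℝ) (m ρ : ℝ) (a : Eucl d × Eucl d × Eucl d → ℂ)
    (Φ : Eucl d × Eucl d → ℂ) (q : ℕ) (VΦ V U : ℕ → ℝ) (N : ℕ → ℕ) : Prop where
  weight : IsWeightFunction ω
  rho_pos : 0 < ρ
  rho_le : ρ ≤ 1
  cut : IsCutoff ω ρ Φ q VΦ
  smooth : ContDiff ℝ (⊤ : ℕ∞) a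
  adm : Adm ω ρ V
  amp : AmpBound ω m ρ V a
  amp_piece : ∀ ν, AmpBound ω m ρ V (piece Φ a ν)
  amp_scale : ∀ T : ℕ, AmpBound ω m ρ V fun w => Φ (((2 : ℝ) ^ T)⁻¹ • (w.1, w.2.2)) * a w
  admU : Adm ω ρ U
  one_le : ∀ k, 1 ≤ U k
  split : ∀ k l, V (k + l) ≤ U k * U l
  one_le_N : ∀ ν, 1 ≤ N ν
  scale_le : ∀ ν j i, j < N ν → 1 ≤ i → i ≤ 2 * j →
    (8 * (d + 1) : ℝ) ^ i * U i ≤ ((2 : ℝ) ^ ν) ^ (ρ * i)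
  scale_decay : ∀ n : ℕ, ∃ C : ℝ, 0 < C ∧ ∀ ν, (8 * (d + 1) : ℝ) ^ (2 * N ν) * U (2 * N ν) ≤
    C * Real.exp (-(n * ω (2 ^ ν))) * ((2 : ℝ) ^ ν) ^ (ρ * (2 * N ν : ℕ))
  region : ∃ R : ℝ, 1 ≤ R ∧ ∀ n : ℕ, 0 < n → ∃ N₀ : ℕ, 0 < N₀ ∧ ∀ M, N₀ ≤ M → ∀ ν : ℕ,
    (n : ℝ) / M * youngConj ω ((M : ℝ) / n) ≤ Real.log (2 ^ ν / R) → M < N ν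

lemma IsAmplitude.exists_expansionData {d : ℕ} {ω σ : ℝ → ℝ} {m ρ : ℝ} (hω : IsWeightFunction ω)
    (hσ : IsWeightFunction σ) (hρ : 0 < ρ) (hρ1 : ρ ≤ 1)
    (hωσ : (fun t : ℝ => ω (t ^ (1 / ρ))) =O[Filter.atTop] σ)
    {a : Eucl d × Eucl d × Eucl d → ℂ} (ha : IsAmplitude ω m ρ a) :
    ∃ Φ q VΦ V U N, ExpansionData ω m ρ a Φ q VΦ V U N := by
  obtain ⟨Φ, h1, h2, ⟨q, h3⟩, h4, VΦ, h5, h6⟩ := exists_cutoff hω hσ hρ hωσ d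
  have hΦ : IsCutoff ω ρ Φ q VΦ := ⟨h1, h2, h3, h4, h5, h6⟩
  obtain ⟨Va, hVa, hab⟩ := ha.exists_ampBound hω hρ
  have hA : Adm ω ρ fun k => ((2 : ℝ) ^ (q + 2)) ^ k * VΦ k :=
    h5.pow_mul hω hρ (by positivity)
  have hA2 : Adm ω ρ fun k => 2 * (((2 : ℝ) ^ (q + 2)) ^ k * VΦ k) := hA.const_mul zero_le_two
  have hL1 := (hA.pow_mul hω hρ zero_le_two).leibniz hω hρ hVa
  have hL2 := (hA2.pow_mul hω hρ zero_le_two).leibniz hω hρ hVa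
  -- A single sequence serves the amplitude, all its dyadic pieces and all their partial sums; the
  -- later summation and dominated convergence need this uniformity.
  have hV := (hVa.add hL1).add hL2
  have hmono : ∀ {W W' : ℕ → ℝ} {f : Eucl d × Eucl d × Eucl d → ℂ}, AmpBound ω m ρ W f →
      (∀ k, W k ≤ W' k) → AmpBound ω m ρ W' f := fun {W W' f} h hW k w => by
    refine (h k w).trans ?_
    have := Real.rpow_nonneg (japRatio_pos w).le (ρ * k)
    have := hW k
    gcongr
  obtain ⟨U, hU, hU1, hUV⟩ := hV.exists_split hω hρ
  -- The base 8(d+1) collects geometric losses: d + 1 for the sum over coordinates in the mixed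
  -- derivative, 2 for the bound ⟨w⟩ ≥ 2^ν/2 on active regions, and a spare 4 that makes the terms
  -- summable.
  obtain ⟨N, hN1, hS1, hS2, hR⟩ := (hU.pow_mul hω hρ (B := 8 * (d + 1))
    (by positivity)).exists_scale hω hρ
  refine ⟨Φ, q, VΦ, _, U, N, ⟨hω, hρ, hρ1, hΦ, ha.1, hV, ?_, ?_, ?_, hU, hU1, hUV, hN1, hS1, hS2, hR⟩⟩
  · refine hmono hab fun k => ?_
    have := hL1.nonneg k
    have := hL2.nonneg k
    linarith
  · intro ν
    refine hmono (SymBound.mul_ampBound hρ hρ1 (hΦ.contDiff_dyadic ν) ha.1 hA2.nonneg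
      (hΦ.symBound_dyadic hρ1 ν) hab) fun k => ?_
    have := hL1.nonneg k
    have := hVa.nonneg k
    linarith
  · intro T
    refine hmono (SymBound.mul_ampBound hρ hρ1 (hΦ.contDiff_scale _) ha.1 hA.nonneg
      (hΦ.symBound_scale hρ1 (by positivity) (inv_le_one_of_one_le₀ (one_le_pow₀ one_le_two)))
        hab) fun k => ?_
    have := hL2.nonneg k
    have := hVa.nonneg k
    linarith

/-- The truncated expansion of a dyadic piece. -/
def symPiece {d : ℕ} (Φ : Eucl d × Eucl d → ℂ) (a : Eucl d × Eucl d × Eucl d → ℂ) (N : ℕ → ℕ)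
    (ν : ℕ) : Eucl d × Eucl d → ℂ :=
  fun z => ∑ j ∈ Finset.range (N ν), diagTerm (piece Φ a ν) j z

/-- The symbol obtained by summing the truncated expansions. -/
def symSeries {d : ℕ} (Φ : Eucl d × Eucl d → ℂ) (a : Eucl d × Eucl d × Eucl d → ℂ) (N : ℕ → ℕ) :
    Eucl d × Eucl d → ℂ := fun z => ∑' ν, symPiece Φ a N ν z

namespace ExpansionData
variable {d : ℕ} {ω : ℝ → ℝ} {m ρ : ℝ} {a : Eucl d × Eucl d × Eucl d → ℂ}
  {Φ : Eucl d × Eucl d → ℂ} {q : ℕ} {VΦ V U : ℕ → ℝ} {N : ℕ → ℕ}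
  (h : ExpansionData ω m ρ a Φ q VΦ V U N)
include h

lemma contDiff_piece (ν : ℕ) : ContDiff ℝ (⊤ : ℕ∞) (piece Φ a ν) := by
  have h1 : ContDiff ℝ (⊤ : ℕ∞) fun w : Eucl d × Eucl d × Eucl d => (w.1, w.2.2) := by fun_prop
  exact ((h.cut.contDiff_dyadic ν).comp h1).mul h.smooth

lemma contDiff_diagTerm_piece (ν j : ℕ) : ContDiff ℝ (⊤ : ℕ∞) (diagTerm (piece Φ a ν) j) :=
  contDiff_diagTerm (h.contDiff_piece ν) j

lemma contDiff_symPiece (ν : ℕ) : ContDiff ℝ (⊤ : ℕ∞) (symPiece Φ a N ν) :=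
  ContDiff.sum fun j _ => h.contDiff_diagTerm_piece ν j

lemma iteratedFDeriv_piece_eq_zero {ν : ℕ} {w : Eucl d × Eucl d × Eucl d}
    (hw : ¬ IsActive q ν (w.1, w.2.2)) (k : ℕ) : iteratedFDeriv ℝ k (piece Φ a ν) w = 0 := by
  obtain ⟨O, hO, hwO, hz⟩ := h.cut.eventually_dyadic_eq_zero hw
  have hc : Continuous fun w : Eucl d × Eucl d × Eucl d => (w.1, w.2.2) := by fun_prop
  refine iteratedFDeriv_eq_zero_of_isOpen (hO.preimage hc) (fun z hz' => ?_) k hwO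
  rw [piece, hz _ hz', zero_mul]

lemma iteratedFDeriv_diagTerm_eq_zero {ν : ℕ} {z : Eucl d × Eucl d} (hz : ¬ IsActive q ν z)
    (j k : ℕ) : iteratedFDeriv ℝ k (diagTerm (piece Φ a ν) j) z = 0 := by
  have e : iteratedFDeriv ℝ (k + 2 * j) (piece Φ a ν) (z.1, z.1, z.2) = 0 :=
    h.iteratedFDeriv_piece_eq_zero (w := (z.1, z.1, z.2)) hz (k + 2 * j)
  have h1 := norm_iteratedFDeriv_diagTerm_le (h.contDiff_piece ν) j k z
  rw [e, norm_zero, mul_zero] at h1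
  exact norm_le_zero_iff.1 h1

lemma diagTerm_eq_zero {ν : ℕ} {z : Eucl d × Eucl d} (hz : ¬ IsActive q ν z) (j : ℕ) :
    diagTerm (piece Φ a ν) j z = 0 := by
  have := congrArg norm (h.iteratedFDeriv_diagTerm_eq_zero hz j 0)
  rwa [norm_iteratedFDeriv_zero, norm_zero, norm_eq_zero] at this

lemma symPiece_eq_zero {ν : ℕ} {z : Eucl d × Eucl d} (hz : ¬ IsActive q ν z) :
    symPiece Φ a N ν z = 0 :=
  Finset.sum_eq_zero fun j _ => h.diagTerm_eq_zero hz j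

omit h in
lemma not_isActive_of_lt {z : Eucl d × Eucl d} {T ν : ℕ} (hz : 2 + 4 * ‖z‖ < 2 ^ T) (hν : T ≤ ν) :
    ¬ IsActive q ν z := fun hA => by
  have h1 := jap2_le z
  have h2 := hA.2
  have h3 : (2 : ℝ) ^ T ≤ 2 ^ ν := pow_le_pow_right₀ one_le_two hν
  linarith

/-- The condition on z is open and leaves only indices ν < T active, so the series is locally
finite. -/
lemma symSeries_eq_sum {z : Eucl d × Eucl d} {T : ℕ} (hz : 2 + 4 * ‖z‖ < 2 ^ T) :
    symSeries Φ a N z = ∑ ν ∈ Finset.range T, symPiece Φ a N ν z :=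
  tsum_eq_sum fun _ hν => h.symPiece_eq_zero
    (not_isActive_of_lt hz (not_lt.1 fun h' => hν (Finset.mem_range.2 h')))

omit h in
lemma exists_lt_two_pow (x : ℝ) : ∃ T : ℕ, x < 2 ^ T := pow_unbounded_of_one_lt x one_lt_two

omit h in
lemma isOpen_norm_lt (T : ℕ) : IsOpen {z : Eucl d × Eucl d | 2 + 4 * ‖z‖ < 2 ^ T} :=
  isOpen_lt (by fun_prop) continuous_const

lemma symSeries_eventuallyEq {z : Eucl d × Eucl d} {T : ℕ} (hz : 2 + 4 * ‖z‖ < 2 ^ T) :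
    symSeries Φ a N =ᶠ[nhds z] fun z => ∑ ν ∈ Finset.range T, symPiece Φ a N ν z :=
  Filter.eventually_of_mem ((isOpen_norm_lt T).mem_nhds hz) fun _ hz => h.symSeries_eq_sum hz

lemma sum_piece_eq {w : Eucl d × Eucl d × Eucl d} {T : ℕ} (hw : 2 + 4 * ‖(w.1, w.2.2)‖ < 2 ^ T) :
    ∑ ν ∈ Finset.range T, piece Φ a ν w = a w := by
  cases T with
  | zero =>
    have := norm_nonneg (w.1, w.2.2)
    rw [pow_zero] at hw
    linarith
  | succ T =>
    simp only [piece]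
    rw [← Finset.sum_mul, sum_dyadic, h.cut.one, one_mul]
    rw [norm_smul, norm_inv, norm_pow, Real.norm_two, ← div_eq_inv_mul, div_le_one (by positivity)]
    rw [pow_succ] at hw
    have := norm_nonneg (w.1, w.2.2)
    linarith

lemma diagTerm_eq_sum {z : Eucl d × Eucl d} {T : ℕ} (hz : 2 + 4 * ‖z‖ < 2 ^ T) (j : ℕ) :
    diagTerm a j z = ∑ ν ∈ Finset.range T, diagTerm (piece Φ a ν) j z := by
  rw [← diagTerm_sum _ h.contDiff_piece]
  refine diagTerm_congr ?_ j
  have hc : Continuous fun w : Eucl d × Eucl d × Eucl d => (w.1, w.2.2) := by fun_prop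
  exact Filter.eventually_of_mem (((isOpen_norm_lt T).preimage hc).mem_nhds hz)
    fun w hw => (h.sum_piece_eq hw).symm

lemma contDiff_symSeries : ContDiff ℝ (⊤ : ℕ∞) (symSeries Φ a N) := by
  rw [contDiff_iff_contDiffAt]
  intro z
  obtain ⟨T, hT⟩ := exists_lt_two_pow (2 + 4 * ‖z‖)
  exact (ContDiff.sum fun ν _ => h.contDiff_symPiece ν).contDiffAt.congr_of_eventuallyEq
    (h.symSeries_eventuallyEq hT)

omit h in
/-- Sums over the dyadic pieces: only boundedly many of them are active at each point. -/
lemma norm_sum_le_of_active {G : Type*} [NormedAddCommGroup G] (q T : ℕ) (z : Eucl d × Eucl d)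
    {f : ℕ → G} {B : ℝ} (hB : 0 ≤ B) (h0 : ∀ ν, ¬ IsActive q ν z → f ν = 0)
    (h1 : ∀ ν, IsActive q ν z → ‖f ν‖ ≤ B) :
    ‖∑ ν ∈ Finset.range T, f ν‖ ≤ (q + 4) * B := by
  classical
  rw [← Finset.sum_filter_of_ne (p := fun ν => IsActive q ν z) fun ν _ hν => by
    by_contra hc
    exact hν (h0 ν hc)]
  refine (norm_sum_le_of_le _ fun ν hν => h1 ν (Finset.mem_filter.1 hν).2).trans ?_
  rw [Finset.sum_const, nsmul_eq_mul]
  refine mul_le_mul_of_nonneg_right ?_ hB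
  exact_mod_cast card_active_le q z _ fun ν hν => (Finset.mem_filter.1 hν).2

omit h in
-- On the diagonal the weight is m(2ω(x) + ω(ξ)): order 2m in x and m in ξ. The maximum dominates
-- both, whatever the sign of m.
lemma exp_weight_le (hω : IsWeightFunction ω) (m : ℝ) (z : Eucl d × Eucl d) :
    Real.exp (m * ampWeight ω (z.1, z.1, z.2)) ≤
      Real.exp (max m (2 * m) * ω ‖z.1‖) * Real.exp (max m (2 * m) * ω ‖z.2‖) := by
  rw [← Real.exp_add]
  refine Real.exp_le_exp.2 ?_
  simp only [ampWeight]
  have h1 := mul_le_mul_of_nonneg_right (le_max_right m (2 * m)) (hω.nonneg (norm_nonneg z.1))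
  have h2 := mul_le_mul_of_nonneg_right (le_max_left m (2 * m)) (hω.nonneg (norm_nonneg z.2))
  linarith

/-- The bound for the terms of the expansion of an amplitude. -/
lemma norm_diagTerm_le {b : Eucl d × Eucl d × Eucl d → ℂ} (hb : ContDiff ℝ (⊤ : ℕ∞) b)
    (hbV : AmpBound ω m ρ V b) (j : ℕ) {k l i : ℕ} (hkl : k + 2 * j = l + i)
    (z : Eucl d × Eucl d) :
    ‖iteratedFDeriv ℝ k (diagTerm b j) z‖ ≤ d ^ j * (U i * (1 / jap2 z.1 z.2) ^ (ρ * i)) *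
      (U l * (1 / jap2 z.1 z.2) ^ (ρ * l) * Real.exp (max m (2 * m) * ω ‖z.1‖) *
        Real.exp (max m (2 * m) * ω ‖z.2‖)) := by
  have hρ := h.rho_pos
  refine (norm_iteratedFDeriv_diagTerm_le hb j k z).trans ?_
  rw [mul_assoc ((d : ℝ) ^ j)]
  refine mul_le_mul_of_nonneg_left ?_ (by positivity)
  refine (hbV _ _).trans ?_
  rw [hkl]
  have hJ := inv_jap2_mem z.1 z.2
  have hr : japRatio (z.1, z.1, z.2) ^ (ρ * ((l + i : ℕ) : ℝ)) ≤
      (1 / jap2 z.1 z.2) ^ (ρ * i) * (1 / jap2 z.1 z.2) ^ (ρ * l) := by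
    rw [← Real.rpow_add hJ.1]
    refine (Real.rpow_le_rpow (japRatio_pos _).le (japRatio_diag_le _ _) (by positivity)).trans ?_
    rw [Nat.cast_add, mul_add, add_comm]
  have hU0 : ∀ k, 0 ≤ U k := fun k => zero_le_one.trans (h.one_le k)
  calc _ ≤ (U l * U i) * ((1 / jap2 z.1 z.2) ^ (ρ * i) * (1 / jap2 z.1 z.2) ^ (ρ * l)) *
        (Real.exp (max m (2 * m) * ω ‖z.1‖) * Real.exp (max m (2 * m) * ω ‖z.2‖)) := by
        have := Real.rpow_nonneg (japRatio_pos (z.1, z.1, z.2)).le (ρ * ((l + i : ℕ) : ℝ))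
        exact mul_le_mul (mul_le_mul (h.split l i) hr this
          (mul_nonneg (hU0 l) (hU0 i))) (exp_weight_le h.weight m z) (Real.exp_pos _).le
          (by have := hU0 l; have := hU0 i; have := hJ.1.le; positivity)
    _ = _ := by ring

/-- Main estimate for the terms of the expansion of a dyadic piece. -/
lemma norm_diagTerm_piece_le {ν j k l i : ℕ} (hj : j < N ν) (hi : 1 ≤ i) (hji : j ≤ i)
    (hij : i ≤ 2 * j) (hkl : k + 2 * j = l + i) (z : Eucl d × Eucl d) :
    ‖iteratedFDeriv ℝ k (diagTerm (piece Φ a ν) j) z‖ ≤ (1 / 2) ^ j *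
      (U l * (1 / jap2 z.1 z.2) ^ (ρ * l) * Real.exp (max m (2 * m) * ω ‖z.1‖) *
        Real.exp (max m (2 * m) * ω ‖z.2‖)) := by
  have hρ := h.rho_pos
  have hJ := inv_jap2_mem z.1 z.2
  have hU0 : ∀ k, 0 ≤ U k := fun k => zero_le_one.trans (h.one_le k)
  have hE : 0 ≤ U l * (1 / jap2 z.1 z.2) ^ (ρ * l) * Real.exp (max m (2 * m) * ω ‖z.1‖) *
        Real.exp (max m (2 * m) * ω ‖z.2‖) := by
    have := hU0 l; have := hJ.1.le; positivity
  by_cases hz : IsActive q ν z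
  swap
  · rw [h.iteratedFDeriv_diagTerm_eq_zero hz, norm_zero]
    positivity
  refine (h.norm_diagTerm_le (h.contDiff_piece ν) (h.amp_piece ν) j hkl z).trans ?_
  refine mul_le_mul_of_nonneg_right ?_ hE
  have h2ν : (0 : ℝ) < 2 ^ ν := by positivity
  -- Of the k + 2j derivatives, i are weighed against the scale 2^ν and become the factor 2^{-j};
  -- the other l keep their power of ⟨z⟩. The choice i = 2j yields the symbol estimates, i = 2j - M
  -- the expansion.
  have h1 : 1 / jap2 z.1 z.2 ≤ 2 * (2 ^ ν : ℝ)⁻¹ := by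
    rw [← div_eq_mul_inv, div_le_div_iff₀ (jap2_pos _ _) h2ν, one_mul]
    exact hz.2
  have h2 : (1 / jap2 z.1 z.2) ^ (ρ * i) ≤ 2 ^ i * ((2 ^ ν : ℝ) ^ (ρ * i))⁻¹ := by
    refine (Real.rpow_le_rpow hJ.1.le h1 (by positivity)).trans ?_
    rw [Real.mul_rpow zero_le_two (by positivity), Real.inv_rpow h2ν.le]
    refine mul_le_mul_of_nonneg_right ?_ (by positivity)
    rw [← Real.rpow_natCast]
    refine Real.rpow_le_rpow_of_exponent_le one_le_two ?_
    nlinarith [h.rho_le, Nat.cast_nonneg (α := ℝ) i]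
  have h3 := h.scale_le ν j i hj hi hij
  have h4 : (d : ℝ) ^ j ≤ (d + 1) ^ i :=
    (pow_le_pow_left₀ (Nat.cast_nonneg d) (by linarith) j).trans
      (pow_le_pow_right₀ (by linarith [Nat.cast_nonneg (α := ℝ) d]) hji)
  have hX : 0 < (2 ^ ν : ℝ) ^ (ρ * i) := by positivity
  have h5 : ((d : ℝ) + 1) ^ i * (U i * (2 ^ i * ((2 ^ ν : ℝ) ^ (ρ * i))⁻¹)) ≤ (1 / 4) ^ i := by
    rw [mul_pow] at h3
    rw [show ((d : ℝ) + 1) ^ i * (U i * (2 ^ i * ((2 ^ ν : ℝ) ^ (ρ * i))⁻¹)) =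
      ((d + 1) ^ i * U i * 2 ^ i) / (2 ^ ν : ℝ) ^ (ρ * i) by ring, div_le_iff₀ hX]
    have e8 : (8 : ℝ) ^ i = 2 ^ i * 4 ^ i := by rw [← mul_pow]; norm_num
    rw [one_div, inv_pow, inv_mul_eq_div, le_div_iff₀ (by positivity)]
    rw [e8] at h3
    linarith
  calc _ ≤ ((d : ℝ) + 1) ^ i * (U i * (2 ^ i * ((2 ^ ν : ℝ) ^ (ρ * i))⁻¹)) := by
        have := hU0 i; have := hJ.1.le; gcongr
    _ ≤ (1 / 4) ^ i := h5
    _ ≤ (1 / 2) ^ i := by gcongr; norm_num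
    _ ≤ (1 / 2) ^ j := pow_le_pow_of_le_one (by norm_num) (by norm_num) hji

lemma symBound_symPiece (ν : ℕ) :
    SymBound ω (max m (2 * m)) ρ (fun k => (U 0 + 2) * U k) (symPiece Φ a N ν) := by
  intro k z
  have hJ := inv_jap2_mem z.1 z.2
  have hU0 : ∀ k, 0 ≤ U k := fun k => zero_le_one.trans (h.one_le k)
  set E := U k * (1 / jap2 z.1 z.2) ^ (ρ * k) * Real.exp (max m (2 * m) * ω ‖z.1‖) *
        Real.exp (max m (2 * m) * ω ‖z.2‖) with hE
  have hE0 : 0 ≤ E := by have := hU0 k; have := hJ.1.le; positivity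
  -- The term j = 0 has no spare derivatives and is estimated directly; for j ≥ 1 the choice i = 2j
  -- gives a geometric series.
  have key : ∀ j ∈ Finset.range (N ν), ‖iteratedFDeriv ℝ k (diagTerm (piece Φ a ν) j) z‖ ≤
      (if j = 0 then U 0 * E else 0) + (1 / 2) ^ j * E := by
    intro j hj
    rcases Nat.eq_zero_or_pos j with rfl | hj0
    · have := h.norm_diagTerm_le (h.contDiff_piece ν) (h.amp_piece ν) 0 (l := k) (i := 0)
        (k := k) rfl z
      rw [if_pos rfl]
      refine this.trans ?_
      rw [← hE]
      simp only [pow_zero, Nat.cast_zero, mul_zero, Real.rpow_zero, mul_one, one_mul]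
      linarith
    · rw [if_neg hj0.ne', zero_add]
      exact h.norm_diagTerm_piece_le (Finset.mem_range.1 hj) (by omega) (by omega) le_rfl rfl z
  have e : iteratedFDeriv ℝ k (symPiece Φ a N ν) z = ∑ j ∈ Finset.range (N ν),
      iteratedFDeriv ℝ k (diagTerm (piece Φ a ν) j) z :=
    iteratedFDeriv_fun_sum_apply fun j _ =>
      ((h.contDiff_diagTerm_piece ν j).of_le (nat_le_infty k)).contDiffAt
  rw [e]
  refine (norm_sum_le_of_le _ key).trans ?_
  rw [Finset.sum_add_distrib, ← Finset.sum_mul]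
  have h1 : ∑ j ∈ Finset.range (N ν), (if j = 0 then U 0 * E else 0) ≤ U 0 * E := by
    rw [Finset.sum_ite_eq']
    split_ifs
    · exact le_rfl
    · exact mul_nonneg (hU0 0) hE0
  have h2 : ∑ j ∈ Finset.range (N ν), ((1 : ℝ) / 2) ^ j ≤ 2 := sum_geometric_two_le _
  have h3 := mul_le_mul_of_nonneg_right h2 hE0
  calc _ ≤ U 0 * E + 2 * E := add_le_add h1 h3
    _ = _ := by rw [hE]; ring

lemma symBound_sum_symPiece (T : ℕ) : SymBound ω (max m (2 * m)) ρ
    (fun k => (q + 4) * ((U 0 + 2) * U k)) fun z => ∑ ν ∈ Finset.range T, symPiece Φ a N ν z := by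
  intro k z
  have hJ := inv_jap2_mem z.1 z.2
  have hU0 : ∀ k, 0 ≤ U k := fun k => zero_le_one.trans (h.one_le k)
  rw [iteratedFDeriv_fun_sum_apply fun ν _ =>
      ((h.contDiff_symPiece ν).of_le (nat_le_infty k)).contDiffAt]
  have hB : 0 ≤ (U 0 + 2) * U k * (1 / jap2 z.1 z.2) ^ (ρ * k) *
      Real.exp (max m (2 * m) * ω ‖z.1‖) * Real.exp (max m (2 * m) * ω ‖z.2‖) := by
    have := hU0 k; have := hU0 0; have := hJ.1.le; positivity
  refine (norm_sum_le_of_active q T z hB (fun ν hν => ?_)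
    fun ν _ => h.symBound_symPiece ν k z).trans (le_of_eq (by ring))
  have e : iteratedFDeriv ℝ k (symPiece Φ a N ν) z = ∑ j ∈ Finset.range (N ν),
      iteratedFDeriv ℝ k (diagTerm (piece Φ a ν) j) z :=
    iteratedFDeriv_fun_sum_apply fun j _ =>
      ((h.contDiff_diagTerm_piece ν j).of_le (nat_le_infty k)).contDiffAt
  rw [e]
  exact Finset.sum_eq_zero fun j _ => h.iteratedFDeriv_diagTerm_eq_zero hν j k

lemma adm_symBound : Adm ω ρ fun k => ((q : ℝ) + 4) * ((U 0 + 2) * U k) :=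
  (h.admU.const_mul (by linarith [h.one_le 0])).const_mul (by positivity)

lemma symBound_symSeries : SymBound ω (max m (2 * m)) ρ (fun k => (q + 4) * ((U 0 + 2) * U k))
    (symSeries Φ a N) := by
  intro k z
  obtain ⟨T, hT⟩ := exists_lt_two_pow (2 + 4 * ‖z‖)
  rw [((h.symSeries_eventuallyEq hT).iteratedFDeriv ℝ k).eq_of_nhds]
  exact h.symBound_sum_symPiece T k z

lemma isSymbol_symSeries : IsSymbol ω (max m (2 * m)) ρ (symSeries Φ a N) :=
  h.symBound_symSeries.isSymbol h.contDiff_symSeries h.adm_symBound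

end ExpansionData

/-! ### The asymptotic expansion -/

section
variable {d : ℕ} {ω : ℝ → ℝ} {m ρ : ℝ}

lemma IsSymbol.isFormalSum_symbolSum {p : Eucl d × Eucl d → ℂ} (hp : IsSymbol ω m ρ p) :
    IsFormalSum ω m ρ (symbolSum p) := by
  refine ⟨fun j => ?_, 1, le_rfl, fun n hn => ?_⟩
  · rw [symbolSum]
    split_ifs
    · exact hp.1
    · exact contDiff_const (c := (0 : ℂ))
  · obtain ⟨C, hC, h⟩ := hp.2 n hn
    refine ⟨C, hC, fun j α β x ξ _ => ?_⟩
    have hJ := inv_jap2_mem x ξ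
    rcases Nat.eq_zero_or_pos j with rfl | hj
    · rw [symbolSum, if_pos rfl, Nat.cast_zero, add_zero]
      refine (h α β x ξ).trans (le_of_eq ?_)
      rw [Real.div_rpow zero_le_one (jap2_pos x ξ).le, Real.one_rpow]
    · rw [symbolSum, if_neg hj.ne']
      have h0 := norm_symDeriv_le (p := (0 : Eucl d × Eucl d → ℂ)) (contDiff_const (c := (0 : ℂ)))
        α β (x, ξ)
      have e : iteratedFDeriv ℝ (mlen (α + β)) (0 : Eucl d × Eucl d → ℂ) (x, ξ) = 0 :=
        iteratedFDeriv_eq_zero_of_isOpen isOpen_univ (fun _ _ => rfl) _ (Set.mem_univ _)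
      rw [e, norm_zero] at h0
      refine h0.trans ?_
      have := Real.rpow_nonneg hJ.1.le (ρ * ((mlen (α + β) : ℝ) + j))
      positivity

end

namespace ExpansionData
variable {d : ℕ} {ω : ℝ → ℝ} {m ρ : ℝ} {a : Eucl d × Eucl d × Eucl d → ℂ}
  {Φ : Eucl d × Eucl d → ℂ} {q : ℕ} {VΦ V U : ℕ → ℝ} {N : ℕ → ℕ}
  (h : ExpansionData ω m ρ a Φ q VΦ V U N)
include h

/-- The j-th term involves k + 2j derivatives of the amplitude and the class allows for k + j. The
other j are absorbed because the region condition with R = 1 amounts to e^{nρφ*(j/n)} ≤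
⟨(x,ξ)⟩^{ρj}. -/
lemma isFormalSum_diagTerm : IsFormalSum ω (max m (2 * m)) ρ (diagTerm a) := by
  refine ⟨contDiff_diagTerm h.smooth, 1, le_rfl, fun n hn => ?_⟩
  have hρ := h.rho_pos
  have hω := h.weight
  obtain ⟨C, hC, hCU⟩ := h.admU.2 n hn
  obtain ⟨C', hC', hCU'⟩ := (h.admU.pow_mul hω hρ (B := (d : ℝ)) (Nat.cast_nonneg d)).2 n hn
  refine ⟨C' * C, by positivity, fun j α β x ξ hreg => ?_⟩
  have hJ := inv_jap2_mem x ξ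
  refine (norm_symDeriv_le (contDiff_diagTerm h.smooth j) α β _).trans ?_
  set k := mlen (α + β)
  refine (h.norm_diagTerm_le h.smooth h.amp j (l := k + j) (i := j) (by ring) (x, ξ)).trans ?_
  simp only
  have hU0 : ∀ k, 0 ≤ U k := fun k => zero_le_one.trans (h.one_le k)
  have hJr := Real.rpow_pos_of_pos hJ.1 (ρ * (j : ℝ))
  have h1 : (d : ℝ) ^ j * (U j * (1 / jap2 x ξ) ^ (ρ * (j : ℝ))) ≤ C' := by
    rw [← mul_assoc]
    have h2 : wt ω ρ n j ≤ (jap2 x ξ) ^ (ρ * (j : ℝ)) := by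
      have h3 : (n : ℝ) * youngConj ω ((j : ℝ) / n) ≤ j * Real.log (jap2 x ξ) := by
        rcases Nat.eq_zero_or_pos j with rfl | hj
        · simp [hω.youngConj_zero]
        · rw [InRegion, div_one] at hreg
          have hj' : (0 : ℝ) < j := Nat.cast_pos.2 hj
          rw [div_mul_eq_mul_div, div_le_iff₀ hj'] at hreg
          linarith
      refine (wt_le_rpow hρ h3).trans (le_of_eq ?_)
      rw [Real.rpow_def_of_pos (jap2_pos x ξ)]
      congr 1
      ring
    calc _ ≤ C' * wt ω ρ n j * (1 / jap2 x ξ) ^ (ρ * (j : ℝ)) :=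
          mul_le_mul_of_nonneg_right (hCU' j) hJr.le
      _ ≤ C' * jap2 x ξ ^ (ρ * (j : ℝ)) * (1 / jap2 x ξ) ^ (ρ * (j : ℝ)) := by gcongr
      _ = C' := by
        rw [mul_assoc, ← Real.mul_rpow (jap2_pos x ξ).le hJ.1.le, mul_one_div_cancel
          (jap2_pos x ξ).ne', Real.one_rpow, mul_one]
  have h4 := hCU (k + j)
  rw [wt, Nat.cast_add] at h4
  have hJr' := Real.rpow_pos_of_pos hJ.1 (ρ * ((k : ℝ) + j))
  rw [Nat.cast_add]
  calc _ ≤ C' * (C * Real.exp (n * ρ * youngConj ω (((k : ℝ) + j) / n)) *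
        (1 / jap2 x ξ) ^ (ρ * ((k : ℝ) + j)) * Real.exp (max m (2 * m) * ω ‖x‖) *
        Real.exp (max m (2 * m) * ω ‖ξ‖)) := by
        have := hU0 (k + j)
        refine mul_le_mul h1 ?_ (by positivity) hC'.le
        gcongr
    _ = _ := by ring

/-- The difference of the truncated expansions of a piece with two different lengths. -/
lemma norm_truncation_diff_le {ν M : ℕ} (hM : 1 ≤ M) (k : ℕ) (z : Eucl d × Eucl d)
    (hν : IsActive q ν z → M ≤ N ν) :
    ‖iteratedFDeriv ℝ k (fun z => symPiece Φ a N ν z -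
        ∑ j ∈ Finset.range M, diagTerm (piece Φ a ν) j z) z‖ ≤
      2 * (U (k + M) * (1 / jap2 z.1 z.2) ^ (ρ * (k + M : ℕ)) *
        Real.exp (max m (2 * m) * ω ‖z.1‖) * Real.exp (max m (2 * m) * ω ‖z.2‖)) ∧
    (¬ IsActive q ν z → iteratedFDeriv ℝ k (fun z => symPiece Φ a N ν z -
        ∑ j ∈ Finset.range M, diagTerm (piece Φ a ν) j z) z = 0) := by
  have hs : ∀ j, ContDiffAt ℝ k (diagTerm (piece Φ a ν) j) z := fun j =>
    ((h.contDiff_diagTerm_piece ν j).of_le (nat_le_infty k)).contDiffAt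
  have hsum : ∀ L : ℕ, ContDiffAt ℝ k (fun z => ∑ j ∈ Finset.range L,
      diagTerm (piece Φ a ν) j z) z := fun L => ContDiffAt.sum fun j _ => hs j
  have e : iteratedFDeriv ℝ k (fun z => symPiece Φ a N ν z -
        ∑ j ∈ Finset.range M, diagTerm (piece Φ a ν) j z) z =
      ∑ j ∈ Finset.range (N ν), iteratedFDeriv ℝ k (diagTerm (piece Φ a ν) j) z -
        ∑ j ∈ Finset.range M, iteratedFDeriv ℝ k (diagTerm (piece Φ a ν) j) z := by
    have e1 := iteratedFDeriv_sub_apply (hsum (N ν)) (hsum M)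
    have e2 : ∀ L, iteratedFDeriv ℝ k (fun z => ∑ j ∈ Finset.range L,
        diagTerm (piece Φ a ν) j z) z = ∑ j ∈ Finset.range L,
          iteratedFDeriv ℝ k (diagTerm (piece Φ a ν) j) z := fun L =>
      iteratedFDeriv_fun_sum_apply fun j _ => hs j
    rw [e2, e2] at e1
    exact e1
  have hJ := inv_jap2_mem z.1 z.2
  have hU0 : 0 ≤ U (k + M) := zero_le_one.trans (h.one_le _)
  set E := U (k + M) * (1 / jap2 z.1 z.2) ^ (ρ * (k + M : ℕ)) *
        Real.exp (max m (2 * m) * ω ‖z.1‖) * Real.exp (max m (2 * m) * ω ‖z.2‖)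
  have hE0 : 0 ≤ E := by have := hJ.1.le; positivity
  by_cases hz : IsActive q ν z
  · refine ⟨?_, fun h' => absurd hz h'⟩
    rw [e, ← Finset.sum_Ico_eq_sub _ (hν hz)]
    refine (norm_sum_le_of_le _ (f := fun j => iteratedFDeriv ℝ k (diagTerm (piece Φ a ν) j) z)
      (n := fun j => (1 / 2) ^ j * E) fun j hj => ?_).trans ?_
    · have hj' := Finset.mem_Ico.1 hj
      -- Only terms with M ≤ j < N ν remain, so M of the 2j derivatives can be given to the order of
      -- the remainder while i = 2j - M ≥ j.
      exact h.norm_diagTerm_piece_le (l := k + M) (i := 2 * j - M) hj'.2 (by omega) (by omega)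
        (by omega) (by omega) z
    · rw [← Finset.sum_mul]
      refine mul_le_mul_of_nonneg_right ?_ hE0
      refine le_trans (Finset.sum_le_sum_of_subset_of_nonneg (t := Finset.range (N ν)) ?_ ?_)
        (sum_geometric_two_le (N ν))
      · intro j hj
        exact Finset.mem_range.2 (Finset.mem_Ico.1 hj).2
      · intro j _ _
        positivity
  · have e0 : iteratedFDeriv ℝ k (fun z => symPiece Φ a N ν z -
        ∑ j ∈ Finset.range M, diagTerm (piece Φ a ν) j z) z = 0 := by
      rw [e, Finset.sum_eq_zero fun j _ => h.iteratedFDeriv_diagTerm_eq_zero hz j k,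
        Finset.sum_eq_zero fun j _ => h.iteratedFDeriv_diagTerm_eq_zero hz j k, sub_zero]
    refine ⟨?_, fun _ => e0⟩
    rw [e0, norm_zero]
    positivity

/-- The symbol has the expected asymptotic expansion. -/
lemma formalEquiv : FormalEquiv ω (max m (2 * m)) ρ (symbolSum (symSeries Φ a N)) (diagTerm a) := by
  refine ⟨h.isSymbol_symSeries.isFormalSum_symbolSum, h.isFormalSum_diagTerm, ?_⟩
  obtain ⟨R, hR, hreg⟩ := h.region
  -- Where index ν is active, ⟨(x,ξ)⟩ ≤ 2^{ν+q+2}; the enlarged R turns the condition on ⟨(x,ξ)⟩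
  -- into the one on 2^ν that guarantees M < N ν.
  refine ⟨R * 2 ^ (q + 2), one_le_mul_of_one_le_of_one_le hR (one_le_pow₀ one_le_two),
    fun n hn => ?_⟩
  obtain ⟨N₀, hN₀, hN⟩ := hreg n hn
  obtain ⟨C, hC, hCU⟩ := h.admU.2 n hn
  refine ⟨(q + 4) * (2 * C), N₀, by positivity, hN₀, fun M hM α β x ξ hin => ?_⟩
  have hM1 : 1 ≤ M := hN₀.trans_le hM
  have hdiag : ∀ j, ContDiff ℝ (⊤ : ℕ∞) (diagTerm a j) := contDiff_diagTerm h.smooth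
  have e1 : (fun z => ∑ j ∈ Finset.range M, (symbolSum (symSeries Φ a N) j z - diagTerm a j z)) =
      fun z => symSeries Φ a N z - ∑ j ∈ Finset.range M, diagTerm a j z := by
    ext z
    rw [Finset.sum_sub_distrib]
    congr 1
    rw [Finset.sum_eq_single_of_mem 0 (Finset.mem_range.2 hM1) fun j _ hj => by
      rw [symbolSum, if_neg hj]; rfl]
    rw [symbolSum, if_pos rfl]
  have hs : ContDiff ℝ (⊤ : ℕ∞) fun z => symSeries Φ a N z - ∑ j ∈ Finset.range M, diagTerm a j z :=
    h.contDiff_symSeries.sub (ContDiff.sum fun j _ => hdiag j)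
  rw [e1]
  refine (norm_symDeriv_le hs α β _).trans ?_
  set k := mlen (α + β)
  obtain ⟨T, hT⟩ := exists_lt_two_pow (2 + 4 * ‖((x, ξ) : Eucl d × Eucl d)‖)
  have e2 : (fun z => symSeries Φ a N z - ∑ j ∈ Finset.range M, diagTerm a j z) =ᶠ[nhds (x, ξ)]
      fun z => ∑ ν ∈ Finset.range T, (symPiece Φ a N ν z -
        ∑ j ∈ Finset.range M, diagTerm (piece Φ a ν) j z) := by
    refine Filter.eventually_of_mem ((isOpen_norm_lt T).mem_nhds hT) fun z hz => ?_
    simp only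
    rw [h.symSeries_eq_sum hz, Finset.sum_sub_distrib]
    congr 1
    rw [Finset.sum_comm]
    exact Finset.sum_congr rfl fun j _ => h.diagTerm_eq_sum hz j
  have hsν : ∀ ν, ContDiffAt ℝ k (fun z => symPiece Φ a N ν z -
        ∑ j ∈ Finset.range M, diagTerm (piece Φ a ν) j z) (x, ξ) := fun ν =>
    (((h.contDiff_symPiece ν).sub (ContDiff.sum fun j _ =>
      h.contDiff_diagTerm_piece ν j)).of_le (nat_le_infty k)).contDiffAt
  rw [(e2.iteratedFDeriv ℝ k).eq_of_nhds, iteratedFDeriv_fun_sum_apply fun ν _ => hsν ν]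
  have hact : ∀ ν, IsActive q ν ((x, ξ) : Eucl d × Eucl d) → M ≤ N ν := by
    intro ν hν
    refine (hN M hM ν (le_trans hin ?_)).le
    have hJ := jap2_pos x ξ
    refine Real.log_le_log (by positivity) ?_
    rw [div_le_div_iff₀ (by positivity) (by positivity)]
    have h1 := jap2_le ((x, ξ) : Eucl d × Eucl d)
    have h2 := hν.1
    have h3 : (1 : ℝ) ≤ 2 ^ (ν + q) := one_le_pow₀ one_le_two
    have h4 : jap2 x ξ ≤ 2 ^ ν * 2 ^ (q + 2) := by
      rw [← pow_add, ← add_assoc, pow_add 2 (ν + q)]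
      simp only at h1
      linarith
    calc jap2 x ξ * R ≤ 2 ^ ν * 2 ^ (q + 2) * R := by gcongr
      _ = _ := by ring
  have hJ := inv_jap2_mem x ξ
  have hU0 : 0 ≤ U (k + M) := zero_le_one.trans (h.one_le _)
  refine (norm_sum_le_of_active q T (x, ξ)
    (B := 2 * (U (k + M) * (1 / jap2 x ξ) ^ (ρ * (k + M : ℕ)) *
        Real.exp (max m (2 * m) * ω ‖x‖) * Real.exp (max m (2 * m) * ω ‖ξ‖)))
    (by have := hJ.1.le; positivity)
    (fun ν hν => (h.norm_truncation_diff_le hM1 k (x, ξ) (hact ν)).2 hν)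
    fun ν _ => (h.norm_truncation_diff_le hM1 k (x, ξ) (hact ν)).1).trans ?_
  have h4 := hCU (k + M)
  rw [wt, Nat.cast_add] at h4
  have hJr' := Real.rpow_pos_of_pos hJ.1 (ρ * ((k : ℝ) + M))
  rw [Nat.cast_add]
  calc _ ≤ ((q : ℝ) + 4) * (2 * (C * Real.exp (n * ρ * youngConj ω (((k : ℝ) + M) / n)) *
        (1 / jap2 x ξ) ^ (ρ * ((k : ℝ) + M)) * Real.exp (max m (2 * m) * ω ‖x‖) *
        Real.exp (max m (2 * m) * ω ‖ξ‖))) := by gcongr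
    _ = _ := by ring

end ExpansionData

/-! ### Estimates of the kernels of the remainders -/

section
variable {ω : ℝ → ℝ} (hω : IsWeightFunction ω) {r : ℝ} (hr : 0 < r)

include hω hr in
/-- Binomial convolutions of sequences bounded by a weight sequence. -/
lemma sum_choose_mul_le_wt {n : ℕ} (hn : 0 < n) {A B : ℕ → ℝ} {C C' : ℝ} (hC : 0 ≤ C)
    (hB0 : ∀ k, 0 ≤ B k) (hA : ∀ k, A k ≤ C * wt ω r n k) (hB : ∀ k, B k ≤ C' * wt ω r n k)
    (k : ℕ) : ∑ i ∈ Finset.range (k + 1), (k.choose i : ℝ) * A i * B (k - i) ≤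
      C * C' * (2 ^ k * wt ω r n k) := by
  calc _ ≤ ∑ i ∈ Finset.range (k + 1), (k.choose i : ℝ) * (C * C' * wt ω r n k) := by
        refine Finset.sum_le_sum fun i hi => ?_
        have hik : i ≤ k := Nat.lt_succ_iff.1 (Finset.mem_range.1 hi)
        rw [mul_assoc]
        refine mul_le_mul_of_nonneg_left ?_ (Nat.cast_nonneg _)
        have hw := wt_mul_le hω hr hn i (k - i)
        rw [Nat.add_sub_cancel' hik] at hw
        have hp := wt_pos ω r n i
        have hC' : 0 ≤ C' := by
          have h1 := (hB0 0).trans (hB 0)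
          exact nonneg_of_mul_nonneg_left h1 (wt_pos ω r n 0)
        calc A i * B (k - i) ≤ (C * wt ω r n i) * (C' * wt ω r n (k - i)) :=
              mul_le_mul (hA i) (hB _) (hB0 _) (by positivity)
          _ = C * C' * (wt ω r n i * wt ω r n (k - i)) := by ring
          _ ≤ _ := by gcongr
    _ = _ := by
        rw [← Finset.sum_mul, ← Nat.cast_sum, Nat.sum_range_choose]
        push_cast
        ring

include hω in
/-- A large multiple of the weight absorbs a smaller one and powers. -/
lemma exists_absorb (A : ℕ) (c : ℝ) : ∃ n : ℕ, ∃ C : ℝ, 0 < C ∧ ∀ τ : ℝ, ∀ ν : ℕ,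
    2 ^ ν ≤ τ → Real.exp (-(n * ω τ)) * Real.exp (c * (ω τ + 1)) * (2 ^ ν) ^ A ≤ C * (1 / 2) ^ ν := by
  obtain ⟨C, hC, h⟩ := hω.mul_log_le (A + 1)
  -- The multiple ⌈c⌉ pays for e^{cω}. The last unit of ω pays for the power A + 1 of 2^ν, one more
  -- than required, whence the factor 2^{-ν}.
  refine ⟨⌈c⌉₊ + 1, Real.exp (c + C), Real.exp_pos _, fun τ ν hτ => ?_⟩
  have h1 : (1 : ℝ) ≤ 2 ^ ν := one_le_pow₀ one_le_two
  have hτ1 : 1 ≤ τ := h1.trans hτ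
  have h2 : (2 ^ ν : ℝ) ^ (A + 1) ≤ Real.exp (ω τ + C) := by
    refine (pow_le_pow_left₀ (by positivity) hτ _).trans ?_
    rw [← Real.exp_log (pow_pos (zero_lt_one.trans_le hτ1) (A + 1)), Real.log_pow]
    refine Real.exp_le_exp.2 ?_
    have := h τ hτ1
    exact_mod_cast this
  have h3 : (1 / 2 : ℝ) ^ ν * 2 ^ ν = 1 := by rw [← mul_pow]; norm_num
  have hw := hω.nonneg (zero_le_one.trans hτ1)
  calc _ = Real.exp (-((⌈c⌉₊ + 1 : ℕ) * ω τ)) * Real.exp (c * (ω τ + 1)) *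
        (2 ^ ν : ℝ) ^ (A + 1) * (1 / 2) ^ ν := by
        rw [pow_succ, mul_assoc _ (_ * _), mul_assoc ((2 ^ ν : ℝ) ^ A), mul_comm (2 ^ ν : ℝ), h3,
          mul_one]
    _ ≤ Real.exp (-((⌈c⌉₊ + 1 : ℕ) * ω τ)) * Real.exp (c * (ω τ + 1)) *
        Real.exp (ω τ + C) * (1 / 2) ^ ν := by gcongr
    _ ≤ Real.exp (c + C) * (1 / 2) ^ ν := by
        refine mul_le_mul_of_nonneg_right ?_ (by positivity)
        rw [← Real.exp_add, ← Real.exp_add]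
        refine Real.exp_le_exp.2 ?_
        have := mul_le_mul_of_nonneg_right (Nat.le_ceil c) hw
        push_cast
        linarith

end

section
variable {d : ℕ}

lemma japRatio_le_two (w : Eucl d × Eucl d × Eucl d) : japRatio w ≤ 2 := by
  rw [japRatio, div_le_iff₀ (zero_lt_one.trans_le (one_le_jap3 _ _ _)), jap, jap3,
    show (2 : ℝ) = Real.sqrt 4 by rw [show (4 : ℝ) = 2 ^ 2 by norm_num, Real.sqrt_sq zero_le_two],
    ← Real.sqrt_mul (by norm_num)]
  refine Real.sqrt_le_sqrt ?_
  have h1 := norm_sub_le w.1 w.2.1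
  nlinarith [norm_nonneg w.1, norm_nonneg w.2.1, norm_nonneg (w.1 - w.2.1), norm_nonneg w.2.2,
    sq_nonneg (‖w.1‖ - ‖w.2.1‖), mul_self_le_mul_self (norm_nonneg _) h1]

lemma jap2_le_jap3 (x y ξ : Eucl d) : jap2 x ξ ≤ jap3 x y ξ :=
  Real.sqrt_le_sqrt (by nlinarith [sq_nonneg ‖y‖])

lemma norm_le_jap3 (x y ξ : Eucl d) : ‖y‖ ≤ jap3 x y ξ :=
  Real.le_sqrt_of_sq_le (by nlinarith [sq_nonneg ‖x‖, sq_nonneg ‖ξ‖])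

lemma jap_le_of_norm_le {z : Eucl d} {c : ℝ} (hc : 1 ≤ c) (hz : ‖z‖ ≤ c) : jap z ≤ 2 * c := by
  refine Real.sqrt_le_iff.2 ⟨by linarith, ?_⟩
  nlinarith [norm_nonneg z]

lemma volume_closedBall_eq (d : ℕ) {s : ℝ} (hs : 0 ≤ s) :
    volume.real (Metric.closedBall (0 : Eucl d) s) =
      s ^ d * volume.real (Metric.closedBall (0 : Eucl d) 1) := by
  rw [measureReal_def, Measure.addHaar_closedBall' _ _ hs, ENNReal.toReal_mul,
    ENNReal.toReal_ofReal (by positivity), finrank_euclideanSpace_fin, measureReal_def]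

variable {ω : ℝ → ℝ} {m ρ : ℝ}

lemma AmpBound.mono_exp (hω : IsWeightFunction ω) {V : ℕ → ℝ} (hV : ∀ k, 0 ≤ V k)
    {a : Eucl d × Eucl d × Eucl d → ℂ} (h : AmpBound ω m ρ V a) {m' : ℝ} (hm : m ≤ m') :
    AmpBound ω m' ρ V a := fun k w => by
  refine (h k w).trans ?_
  have h0 : 0 ≤ ampWeight ω w := add_nonneg (add_nonneg (hω.nonneg (norm_nonneg _))
    (hω.nonneg (norm_nonneg _))) (hω.nonneg (norm_nonneg _))
  have := Real.rpow_nonneg (japRatio_pos w).le (ρ * k)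
  have := hV k
  gcongr

lemma AmpBound.sub {V V' : ℕ → ℝ} {a b : Eucl d × Eucl d × Eucl d → ℂ}
    (has : ContDiff ℝ (⊤ : ℕ∞) a) (hbs : ContDiff ℝ (⊤ : ℕ∞) b)
    (ha : AmpBound ω m ρ V a) (hb : AmpBound ω m ρ V' b) :
    AmpBound ω m ρ (fun k => V k + V' k) fun w => a w - b w := fun k w => by
  have e : iteratedFDeriv ℝ k (fun w => a w - b w) w =
      iteratedFDeriv ℝ k a w - iteratedFDeriv ℝ k b w :=
    iteratedFDeriv_sub_apply (has.of_le (nat_le_infty k)).contDiffAt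
      (hbs.of_le (nat_le_infty k)).contDiffAt
  rw [e]
  refine (norm_sub_le _ _).trans ((add_le_add (ha k w) (hb k w)).trans (le_of_eq (by ring)))

end

lemma continuous_phase {d : ℕ} (z : Eucl d) : Continuous (phase z) :=
  contDiff_phase.continuous.comp (Continuous.prodMk_right z)

/-- The remainder of a dyadic piece of an amplitude after subtraction of its symbol. -/
def remPiece {d : ℕ} (Φ : Eucl d × Eucl d → ℂ) (a : Eucl d × Eucl d × Eucl d → ℂ) (N : ℕ → ℕ)
    (ν : ℕ) : Eucl d × Eucl d × Eucl d → ℂ :=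
  fun w => piece Φ a ν w - symPiece Φ a N ν (w.1, w.2.2)

namespace ExpansionData
variable {d : ℕ} {ω : ℝ → ℝ} {m ρ : ℝ} {a : Eucl d × Eucl d × Eucl d → ℂ}
  {Φ : Eucl d × Eucl d → ℂ} {q : ℕ} {VΦ V U : ℕ → ℝ} {N : ℕ → ℕ}
  (h : ExpansionData ω m ρ a Φ q VΦ V U N)
include h

lemma contDiff_symPiece_amp (ν : ℕ) : ContDiff ℝ (⊤ : ℕ∞)
    fun w : Eucl d × Eucl d × Eucl d => symPiece Φ a N ν (w.1, w.2.2) := by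
  have h1 : ContDiff ℝ (⊤ : ℕ∞) fun w : Eucl d × Eucl d × Eucl d => (w.1, w.2.2) := by fun_prop
  exact (h.contDiff_symPiece ν).comp h1

lemma contDiff_remPiece (ν : ℕ) : ContDiff ℝ (⊤ : ℕ∞) (remPiece Φ a N ν) :=
  (h.contDiff_piece ν).sub (h.contDiff_symPiece_amp ν)

lemma piece_eq_zero {ν : ℕ} {w : Eucl d × Eucl d × Eucl d} (hw : ¬ IsActive q ν (w.1, w.2.2)) :
    piece Φ a ν w = 0 := by
  have := congrArg norm (h.iteratedFDeriv_piece_eq_zero hw 0)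
  rwa [norm_iteratedFDeriv_zero, norm_zero, norm_eq_zero] at this

omit h in
lemma not_isActive_of_snd {ν : ℕ} {x ξ : Eucl d} (hξ : (2 : ℝ) ^ (ν + q) < ‖ξ‖) :
    ¬ IsActive q ν (x, ξ) := fun hA => (hξ.trans_le (norm_snd_le (x, ξ))).not_ge hA.1

omit h in
lemma not_isActive_of_fst {ν : ℕ} {x ξ : Eucl d} (hx : (2 : ℝ) ^ (ν + q) < ‖x‖) :
    ¬ IsActive q ν (x, ξ) := fun hA => (hx.trans_le (norm_fst_le (x, ξ))).not_ge hA.1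

lemma remPiece_eq_zero {ν : ℕ} {w : Eucl d × Eucl d × Eucl d}
    (hw : ¬ IsActive q ν (w.1, w.2.2)) : remPiece Φ a N ν w = 0 := by
  rw [remPiece, h.piece_eq_zero hw, h.symPiece_eq_zero hw, sub_zero]

lemma iteratedFDeriv_remPiece_eq_zero {ν : ℕ} {w : Eucl d × Eucl d × Eucl d}
    (hw : ¬ IsActive q ν (w.1, w.2.2)) (k : ℕ) : iteratedFDeriv ℝ k (remPiece Φ a N ν) w = 0 := by
  have hc : Continuous fun w : Eucl d × Eucl d × Eucl d => (w.1, w.2.2) := by fun_prop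
  have hcl : IsClosed {z : Eucl d × Eucl d | IsActive q ν z} := by
    have hj : Continuous fun z : Eucl d × Eucl d => jap2 z.1 z.2 := by unfold jap2; fun_prop
    exact (isClosed_le continuous_norm continuous_const).inter
      (isClosed_le continuous_const (continuous_const.mul hj))
  exact iteratedFDeriv_eq_zero_of_isOpen (hcl.isOpen_compl.preimage hc)
    (fun z hz => h.remPiece_eq_zero hz) k hw

lemma contDiff_osc_remPiece (ν : ℕ) : ContDiff ℝ (⊤ : ℕ∞) (osc (remPiece Φ a N ν)) :=
  contDiff_osc (h.contDiff_remPiece ν) fun _ hw => h.remPiece_eq_zero (not_isActive_of_snd hw)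

lemma iteratedFDeriv_osc_remPiece_eq_zero {ν : ℕ} {X : Eucl d × Eucl d}
    (hX : (2 : ℝ) ^ (ν + q) < ‖X.1‖) (k : ℕ) :
    iteratedFDeriv ℝ k (osc (remPiece Φ a N ν)) X = 0 := by
  have hU : IsOpen {X : Eucl d × Eucl d | (2 : ℝ) ^ (ν + q) < ‖X.1‖} :=
    isOpen_lt continuous_const (continuous_norm.comp continuous_fst)
  have h0 : ∀ Y : Eucl d × Eucl d, (2 : ℝ) ^ (ν + q) < ‖Y.1‖ →
      osc (remPiece Φ a N ν) Y = 0 := fun Y hY => by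
    have h1 : ∀ ξ, phase (Y.1 - Y.2) ξ * remPiece Φ a N ν (Y.1, Y.2, ξ) = 0 := fun ξ => by
      have : remPiece Φ a N ν (Y.1, Y.2, ξ) = 0 :=
        h.remPiece_eq_zero (w := (Y.1, Y.2, ξ)) (not_isActive_of_fst hY)
      rw [this, mul_zero]
    rw [osc, integral_congr_ae (Filter.Eventually.of_forall h1), integral_zero]
  exact iteratedFDeriv_eq_zero_of_isOpen hU h0 k hX

/-- The kernels are the remainders of Taylor expansions along the diagonal. -/
lemma osc_remPiece_eq (ν : ℕ) : osc (remPiece Φ a N ν) = fun X => ∫ t in (0 : ℝ)..1,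
    (((1 - t) ^ (N ν - 1) / (N ν - 1).factorial : ℝ) : ℂ) *
      oscSeg (mixedDeriv^[N ν] (piece Φ a ν)) t X := by
  ext X
  have hs : ∀ w : Eucl d × Eucl d × Eucl d, (2 : ℝ) ^ (ν + q) < ‖w.2.2‖ → piece Φ a ν w = 0 :=
    fun w hw => h.piece_eq_zero (not_isActive_of_snd hw)
  have hT := osc_taylor (h.contDiff_piece ν) hs (N ν - 1) X
  rw [Nat.sub_add_cancel (h.one_le_N ν)] at hT
  have hph := continuous_phase (X.1 - X.2)
  have hc1 : Continuous fun ξ : Eucl d => (X.1, X.2, ξ) := by fun_prop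
  have hc2 : Continuous fun ξ : Eucl d => (X.1, ξ) := by fun_prop
  have hi1 : Integrable fun ξ => phase (X.1 - X.2) ξ * piece Φ a ν (X.1, X.2, ξ) := by
    have hc := hph.mul ((h.contDiff_piece ν).continuous.comp hc1)
    refine integrable_of_eq_zero hc (s := 2 ^ (ν + q)) fun ξ hξ => ?_
    exact mul_eq_zero_of_right _ (hs (X.1, X.2, ξ) hξ)
  have hi2 : ∀ j, Integrable fun ξ =>
      phase (X.1 - X.2) ξ * diagTerm (piece Φ a ν) j (X.1, ξ) := fun j => by
    have hc := hph.mul ((h.contDiff_diagTerm_piece ν j).continuous.comp hc2)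
    refine integrable_of_eq_zero hc (s := 2 ^ (ν + q)) fun ξ hξ => ?_
    exact mul_eq_zero_of_right _ (h.diagTerm_eq_zero (not_isActive_of_snd hξ) j)
  have e1 : osc (remPiece Φ a N ν) X = osc (piece Φ a ν) X - ∑ j ∈ Finset.range (N ν),
      ∫ ξ, phase (X.1 - X.2) ξ * diagTerm (piece Φ a ν) j (X.1, ξ) := by
    have e0 : ∀ ξ, phase (X.1 - X.2) ξ * remPiece Φ a N ν (X.1, X.2, ξ) =
        phase (X.1 - X.2) ξ * piece Φ a ν (X.1, X.2, ξ) - ∑ j ∈ Finset.range (N ν),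
          phase (X.1 - X.2) ξ * diagTerm (piece Φ a ν) j (X.1, ξ) := fun ξ => by
      rw [remPiece, mul_sub, symPiece, Finset.mul_sum]
    rw [osc, integral_congr_ae (Filter.Eventually.of_forall e0),
      integral_sub hi1 (integrable_finsetSum _ fun j _ => hi2 j),
      integral_finsetSum _ fun j _ => hi2 j]
    rfl
  have e2 : ∀ j, (1 / (j.factorial : ℂ)) *
      (∫ ξ, phase (X.1 - X.2) ξ * mixedDeriv^[j] (piece Φ a ν) (X.1, X.1, ξ)) =
      ∫ ξ, phase (X.1 - X.2) ξ * diagTerm (piece Φ a ν) j (X.1, ξ) := fun j => by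
    rw [← integral_const_mul]
    refine integral_congr_ae (Filter.Eventually.of_forall fun ξ => ?_)
    simp only
    rw [diagTerm_eq (h.contDiff_piece ν)]
    ring
  rw [Finset.sum_congr rfl fun j _ => e2 j] at hT
  rw [e1, hT, add_sub_cancel_left]

/-- The order 2|m| is a common bound for m and max(m, 2m); being nonnegative, it allows a symbol,
which does not depend on y, to be given a weight in y. -/
lemma ampBound_remPiece (ν : ℕ) : AmpBound ω (2 * |m|) ρ
    (fun k => V k + 2 ^ k * ((U 0 + 2) * U k)) (remPiece Φ a N ν) := by
  have hU0 : ∀ k, 0 ≤ U k := fun k => zero_le_one.trans (h.one_le k)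
  have h1 : m ≤ 2 * |m| := by have := le_abs_self m; have := abs_nonneg m; linarith
  have h2 : max m (2 * m) ≤ 2 * |m| := max_le h1 (by have := le_abs_self m; linarith)
  refine AmpBound.sub (h.contDiff_piece ν) (h.contDiff_symPiece_amp ν)
    ((h.amp_piece ν).mono_exp h.weight h.adm.nonneg h1) ?_
  exact SymBound.ampBound h.rho_pos h.rho_le h.weight (h.contDiff_symPiece ν)
    (fun k => by have := hU0 k; have := hU0 0; positivity) h2 (by positivity)
    (h.symBound_symPiece ν)

end ExpansionData

namespace ExpansionData
variable {d : ℕ} {ω : ℝ → ℝ} {m ρ : ℝ} {a : Eucl d × Eucl d × Eucl d → ℂ}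
  {Φ : Eucl d × Eucl d → ℂ} {q : ℕ} {VΦ V U : ℕ → ℝ} {N : ℕ → ℕ}
  (h : ExpansionData ω m ρ a Φ q VΦ V U N)
include h

/-- Estimates of the derivatives of the integrand near the diagonal. -/
lemma exists_norm_mixedDeriv_piece_le (n : ℕ) : ∃ C : ℝ, 0 < C ∧ ∀ (ν j : ℕ) (x y ξ : Eucl d)
    (E : ℝ), 0 ≤ E → ‖x - y‖ ≤ 1 →
    (IsActive q ν (x, ξ) → Real.exp (m * ampWeight ω (x, y, ξ)) ≤ E) →
    ‖iteratedFDeriv ℝ j (mixedDeriv^[N ν] (piece Φ a ν)) (x, y, ξ)‖ ≤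
      C * Real.exp (-(n * ω (2 ^ ν))) * (2 ^ j * U j) * E := by
  obtain ⟨C, hC, hS⟩ := h.scale_decay n
  have hρ := h.rho_pos
  have hρ1 := h.rho_le
  have hU0 : ∀ k, 0 ≤ U k := fun k => zero_le_one.trans (h.one_le k)
  refine ⟨C, hC, fun ν j x y ξ E hE0 hxy hE => ?_⟩
  refine (norm_iteratedFDeriv_iterate_mixedDeriv_le (h.contDiff_piece ν) (N ν) j _).trans ?_
  by_cases hA : IsActive q ν (x, ξ)
  swap
  · rw [h.iteratedFDeriv_piece_eq_zero (w := (x, y, ξ)) hA, norm_zero, mul_zero]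
    have := hU0 j
    positivity
  specialize hE hA
  set K := N ν
  set W := japRatio (x, y, ξ) with hW
  have hW0 : 0 < W := japRatio_pos _
  have h2ν : (0 : ℝ) < 2 ^ ν := by positivity
  -- Near the diagonal ⟨x-y⟩ ≤ 2, and on the active region ⟨(x,y,ξ)⟩ ≥ 2^ν/2. So the 2N_ν
  -- derivatives of the Taylor remainder gain the full power of 2^ν, and `scale_decay` applies.
  have hW1 : W ≤ 4 * (2 ^ ν)⁻¹ := by
    rw [hW, japRatio, ← div_eq_mul_inv, div_le_div_iff₀ (zero_lt_one.trans_le (one_le_jap3 _ _ _)) h2ν]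
    have h1 : jap (x - y) ≤ 2 * 1 := jap_le_of_norm_le le_rfl hxy
    have h2 := hA.2
    have h3 := jap2_le_jap3 x y ξ
    simp only at h2 ⊢
    nlinarith
  have hW2 : W ^ (ρ * j) ≤ 2 ^ j := by
    rw [← Real.rpow_natCast 2 j]
    refine (Real.rpow_le_rpow hW0.le (japRatio_le_two _) (by positivity)).trans ?_
    refine Real.rpow_le_rpow_of_exponent_le one_le_two ?_
    nlinarith [Nat.cast_nonneg (α := ℝ) j]
  have hW3 : W ^ (ρ * (2 * K : ℕ)) ≤ 4 ^ (2 * K) * ((2 ^ ν : ℝ) ^ (ρ * (2 * K : ℕ)))⁻¹ := by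
    refine (Real.rpow_le_rpow hW0.le hW1 (by positivity)).trans ?_
    rw [Real.mul_rpow (by norm_num) (by positivity), Real.inv_rpow h2ν.le]
    refine mul_le_mul_of_nonneg_right ?_ (by positivity)
    rw [← Real.rpow_natCast]
    refine Real.rpow_le_rpow_of_exponent_le (by norm_num) ?_
    nlinarith [Nat.cast_nonneg (α := ℝ) (2 * K)]
  have hX : 0 < (2 ^ ν : ℝ) ^ (ρ * (2 * K : ℕ)) := by positivity
  have hd : (d : ℝ) ^ K * 4 ^ (2 * K) ≤ (8 * (d + 1)) ^ (2 * K) := by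
    rw [mul_pow]
    have h1 : (4 : ℝ) ^ (2 * K) ≤ 8 ^ (2 * K) := by gcongr; norm_num
    have h2 : (d : ℝ) ^ K ≤ (d + 1) ^ (2 * K) :=
      (pow_le_pow_left₀ (Nat.cast_nonneg d) (by linarith) K).trans
        (pow_le_pow_right₀ (by linarith [Nat.cast_nonneg (α := ℝ) d]) (by omega))
    rw [mul_comm]
    exact mul_le_mul h1 h2 (by positivity) (by positivity)
  have key : (d : ℝ) ^ K * (4 ^ (2 * K) * ((2 ^ ν : ℝ) ^ (ρ * (2 * K : ℕ)))⁻¹) * U (2 * K) ≤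
      C * Real.exp (-(n * ω (2 ^ ν))) := by
    have h1 := hS ν
    calc _ = ((d : ℝ) ^ K * 4 ^ (2 * K) * U (2 * K)) / (2 ^ ν : ℝ) ^ (ρ * (2 * K : ℕ)) := by ring
      _ ≤ ((8 * (d + 1)) ^ (2 * K) * U (2 * K)) / (2 ^ ν : ℝ) ^ (ρ * (2 * K : ℕ)) := by
          have := hU0 (2 * K); gcongr
      _ ≤ _ := by rw [div_le_iff₀ hX]; exact h1
  have hV := h.amp_piece ν (j + 2 * K) (x, y, ξ)
  have hWs : W ^ (ρ * ((j + 2 * K : ℕ) : ℝ)) = W ^ (ρ * j) * W ^ (ρ * (2 * K : ℕ)) := by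
    rw [← Real.rpow_add hW0, Nat.cast_add, mul_add]
  have hVs := h.split j (2 * K)
  have hV0 := h.adm.nonneg (j + 2 * K)
  have hUj := hU0 j
  have hUK := hU0 (2 * K)
  have hWj := Real.rpow_pos_of_pos hW0 (ρ * j)
  have hWK := Real.rpow_pos_of_pos hW0 (ρ * (2 * K : ℕ))
  calc _ ≤ (d : ℝ) ^ K * (V (j + 2 * K) * (W ^ (ρ * j) * W ^ (ρ * (2 * K : ℕ))) *
        Real.exp (m * ampWeight ω (x, y, ξ))) := by
        rw [← hWs]
        exact mul_le_mul_of_nonneg_left hV (by positivity)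
    _ ≤ (d : ℝ) ^ K * ((U j * U (2 * K)) * (2 ^ j *
          (4 ^ (2 * K) * ((2 ^ ν : ℝ) ^ (ρ * (2 * K : ℕ)))⁻¹)) *
            Real.exp (m * ampWeight ω (x, y, ξ))) := by gcongr
    _ = ((d : ℝ) ^ K * (4 ^ (2 * K) * ((2 ^ ν : ℝ) ^ (ρ * (2 * K : ℕ)))⁻¹) * U (2 * K)) *
          (2 ^ j * U j) * Real.exp (m * ampWeight ω (x, y, ξ)) := by ring
    _ ≤ _ := by gcongr ?_ * ?_ * ?_

omit h in
lemma ampWeight_le (hω : IsWeightFunction ω) {w : Eucl d × Eucl d × Eucl d} {Λ c : ℝ}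
    (hΛ : ∀ u, 0 ≤ u → u ≤ c → ω u ≤ Λ) (h1 : ‖w.1‖ ≤ c) (h2 : ‖w.2.1‖ ≤ c) (h3 : ‖w.2.2‖ ≤ c)
    {m m' : ℝ} (hm : m ≤ m') (hm' : 0 ≤ m') : m * ampWeight ω w ≤ 3 * m' * Λ := by
  have e1 := hΛ _ (norm_nonneg _) h1
  have e2 := hΛ _ (norm_nonneg _) h2
  have e3 := hΛ _ (norm_nonneg _) h3
  have h0 : 0 ≤ ampWeight ω w := add_nonneg (add_nonneg (hω.nonneg (norm_nonneg _))
    (hω.nonneg (norm_nonneg _))) (hω.nonneg (norm_nonneg _))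
  calc m * ampWeight ω w ≤ m' * ampWeight ω w := by gcongr
    _ ≤ m' * (3 * Λ) := by
        refine mul_le_mul_of_nonneg_left ?_ hm'
        rw [ampWeight]; linarith
    _ = _ := by ring

/-- The kernels near the diagonal. -/
lemma exists_norm_osc_le_near (n : ℕ) (hn : 0 < n) : ∃ C : ℝ, 0 < C ∧ ∀ (ν k : ℕ) (X : Eucl d × Eucl d),
    ‖X.1‖ ≤ 2 ^ (ν + q) → ‖X.1 - X.2‖ ≤ 1 →
    ‖iteratedFDeriv ℝ k (osc (remPiece Φ a N ν)) X‖ ≤ C * (1 / 2) ^ ν * wt ω 1 n k *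
      Real.exp (-(n * ω ‖X.1‖)) * Real.exp (-(n * ω ‖X.2‖)) := by
  have hω := h.weight
  have hρ := h.rho_pos
  have hU0 : ∀ k, 0 ≤ U k := fun k => zero_le_one.trans (h.one_le k)
  obtain ⟨n', hn', C₁, hC₁, h₁⟩ := pow_mul_wt_le hω one_pos 2 zero_le_two hn
  obtain ⟨L, hL1, hL⟩ := hω.scale (B := 2 ^ (q + 2)) (by positivity)
  obtain ⟨C₂, hC₂, h₂⟩ := ((h.admU.of_le_one hω h.rho_le).pow_mul hω one_pos zero_le_two).2 n' hn'
  -- The decay at 2^ν pays for everything else: n' for derivatives of the phase, 3|m| for the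
  -- amplitude weight, 2n for the decay in x and y, and the power d for the volume in ξ. The factor
  -- L compares ω at points of size 2^{ν+q+1} with ω(2^ν).
  obtain ⟨n'', C₃, hC₃, h₃⟩ := exists_absorb hω d ((n' + 3 * |m| + 2 * n) * L)
  obtain ⟨C₄, hC₄, h₄⟩ := h.exists_norm_mixedDeriv_piece_le n''
  set v := volume.real (Metric.closedBall (0 : Eucl d) 1)
  have hv : 0 ≤ v := measureReal_nonneg
  refine ⟨C₂ * C₄ * C₁ * C₃ * (((2 : ℝ) ^ q) ^ d * v + 1), by positivity, fun ν k X hX hxy => ?_⟩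
  set s : ℝ := 2 ^ (ν + q) with hs
  set τ : ℝ := 2 ^ ν with hτ
  have hτ1 : 1 ≤ τ := one_le_pow₀ one_le_two
  have hsτ : s = 2 ^ q * τ := by rw [hs, pow_add, mul_comm]
  have hs1 : 1 ≤ s := one_le_pow₀ one_le_two
  set Λ := L * (ω τ + 1) with hΛ
  have hΛle : ∀ u, 0 ≤ u → u ≤ 2 * s → ω u ≤ Λ := fun u hu hus =>
    (hω.le_of_le hu (hus.trans (by rw [hsτ, pow_add]; nlinarith [pow_pos (zero_lt_two (α := ℝ)) q]))).trans
      (hL τ (by linarith))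
  have hs0 : ∀ w : Eucl d × Eucl d × Eucl d, s < ‖w.2.2‖ → piece Φ a ν w = 0 :=
    fun w hw => h.piece_eq_zero (not_isActive_of_snd hw)
  have hE0 : ∀ j, 0 ≤ C₄ * Real.exp (-(n'' * ω τ)) * (2 ^ j * U j) * Real.exp (3 * |m| * Λ) :=
    fun j => by have := hU0 j; positivity
  have hΛ0 : 0 ≤ Λ := (hω.nonneg zero_le_one).trans (hΛle 1 zero_le_one (by linarith))
  have hB : ∀ j ≤ k, ∀ t ∈ Set.Icc (0 : ℝ) 1, ∀ ξ, ‖ξ‖ ≤ s →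
      ‖iteratedFDeriv ℝ j (mixedDeriv^[N ν] (piece Φ a ν)) (X.1, X.1 + t • (X.2 - X.1), ξ)‖ ≤
        C₄ * Real.exp (-(n'' * ω τ)) * (2 ^ j * U j) * Real.exp (3 * |m| * Λ) := by
    intro j _ t ht ξ hξ
    have hdist : ‖X.1 - (X.1 + t • (X.2 - X.1))‖ ≤ 1 := by
      rw [sub_add_cancel_left, norm_neg, norm_smul, Real.norm_of_nonneg ht.1, norm_sub_rev]
      exact mul_le_one₀ ht.2 (norm_nonneg _) hxy
    refine h₄ ν j _ _ ξ _ (Real.exp_pos _).le hdist fun hA => ?_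
    · refine Real.exp_le_exp.2 (ampWeight_le hω (c := 2 * s) hΛle ?_ ?_ ?_ (le_abs_self m)
        (abs_nonneg m))
      · simp only; linarith
      · have h5 := norm_sub_le X.1 (X.1 - (X.1 + t • (X.2 - X.1)))
        rw [sub_sub_cancel] at h5
        simp only
        linarith
      · simp only; linarith
  have main := norm_iteratedFDeriv_taylor_le (h.contDiff_piece ν |>.iterate_mixedDeriv (N ν))
    (fun w hw => iterate_mixedDeriv_eq_zero (h.contDiff_piece ν) hs0 (N ν) w hw) (N ν - 1) k X hB
  rw [h.osc_remPiece_eq]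
  refine main.trans ?_
  have hconv := sum_choose_mul_le_wt hω one_pos hn' (A := fun i => (2 * s) ^ i)
    (B := fun j => C₄ * Real.exp (-(n'' * ω τ)) * (2 ^ j * U j) * Real.exp (3 * |m| * Λ))
    (C := Real.exp (n' * Λ)) (C' := C₄ * Real.exp (-(n'' * ω τ)) * C₂ * Real.exp (3 * |m| * Λ))
    (Real.exp_pos _).le hE0 (fun i => by
      refine (pow_le_wt hω hn' i (by linarith)).trans ?_
      rw [mul_comm]
      have := hΛle (2 * s) (by linarith) le_rfl
      have := wt_pos ω 1 n' i
      gcongr) (fun j => by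
      have := h₂ j
      calc _ ≤ C₄ * Real.exp (-(n'' * ω τ)) * (C₂ * wt ω 1 n' j) * Real.exp (3 * |m| * Λ) := by
            gcongr
        _ = _ := by ring) k
  have hvol : volume.real (Metric.closedBall (0 : Eucl d) s) ≤ τ ^ d * ((2 ^ q) ^ d * v + 1) := by
    rw [volume_closedBall_eq d (by linarith), hsτ, mul_pow]
    have : 0 ≤ τ ^ d := by positivity
    calc _ = τ ^ d * ((2 ^ q) ^ d * v) := by ring
      _ ≤ _ := by gcongr; linarith
  have hx : Real.exp (n * Λ) * Real.exp (-(n * ω ‖X.1‖)) ≥ 1 := by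
    rw [← Real.exp_add]
    refine Real.one_le_exp ?_
    have := mul_le_mul_of_nonneg_left (hΛle ‖X.1‖ (norm_nonneg _) (by linarith)) (Nat.cast_nonneg (α := ℝ) n)
    linarith
  have hy : Real.exp (n * Λ) * Real.exp (-(n * ω ‖X.2‖)) ≥ 1 := by
    rw [← Real.exp_add]
    refine Real.one_le_exp ?_
    have h5 := norm_sub_le X.1 (X.1 - X.2)
    rw [sub_sub_cancel] at h5
    have := mul_le_mul_of_nonneg_left (hΛle ‖X.2‖ (norm_nonneg _) (by linarith)) (Nat.cast_nonneg (α := ℝ) n)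
    linarith
  have hab := h₃ τ ν le_rfl
  have hexp : Real.exp ((n' + 3 * |m| + 2 * n) * L * (ω τ + 1)) = Real.exp (n' * Λ) *
      Real.exp (3 * |m| * Λ) * (Real.exp (n * Λ) * Real.exp (n * Λ)) := by
    rw [← Real.exp_add, ← Real.exp_add, ← Real.exp_add, hΛ]
    congr 1
    ring
  rw [hexp] at hab
  have hwk := h₁ k
  have hwp := wt_pos ω 1 n' k
  have hwp' := wt_pos ω 1 n k
  set e1 := Real.exp (-(n * ω ‖X.1‖))
  set e2 := Real.exp (-(n * ω ‖X.2‖))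
  set G := Real.exp (n * Λ)
  have he1 : 0 < e1 := Real.exp_pos _
  have he2 : 0 < e2 := Real.exp_pos _
  calc _ ≤ (Real.exp (n' * Λ) * (C₄ * Real.exp (-(n'' * ω τ)) * C₂ * Real.exp (3 * |m| * Λ)) *
        (2 ^ k * wt ω 1 n' k)) * (τ ^ d * ((2 ^ q) ^ d * v + 1)) := by gcongr
    _ ≤ (Real.exp (n' * Λ) * (C₄ * Real.exp (-(n'' * ω τ)) * C₂ * Real.exp (3 * |m| * Λ)) *
        (C₁ * wt ω 1 n k)) * (τ ^ d * ((2 ^ q) ^ d * v + 1)) * ((G * e1) * (G * e2)) := by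
        refine (le_mul_of_one_le_right (by positivity) (one_le_mul_of_one_le_of_one_le hx hy)).trans ?_
        gcongr
    _ = C₄ * C₂ * C₁ * wt ω 1 n k * ((2 ^ q) ^ d * v + 1) * e1 * e2 *
        (Real.exp (-(n'' * ω τ)) * (Real.exp (n' * Λ) * Real.exp (3 * |m| * Λ) * (G * G)) * τ ^ d) := by
        ring
    _ ≤ C₄ * C₂ * C₁ * wt ω 1 n k * ((2 ^ q) ^ d * v + 1) * e1 * e2 * (C₃ * (1 / 2) ^ ν) := by gcongr
    _ = _ := by ring

end ExpansionData

/-- The largest coordinate of a vector. -/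
lemma exists_norm_le_mul_coord {d : ℕ} {z : Eucl d} (hz : z ≠ 0) :
    ∃ i, ‖z‖ ≤ (d + 1) * |z i| := by
  by_contra! hc
  have h1 : ‖z‖ ≤ ∑ i, |z i| := by
    have h0 : z = ∑ i, z i • stdVec d i := by
      have := (EuclideanSpace.basisFun (Fin d) ℝ).sum_repr z
      simpa [stdVec] using this.symm
    calc ‖z‖ = ‖∑ i, z i • stdVec d i‖ := by rw [← h0]
      _ ≤ ∑ i, ‖z i • stdVec d i‖ := norm_sum_le _ _
      _ = _ := by simp [norm_smul, stdVec]
  have h2 : ∑ i, (d + 1) * |z i| ≤ ∑ _i : Fin d, ‖z‖ := Finset.sum_le_sum fun i _ => (hc i).le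
  rw [← Finset.mul_sum, Finset.sum_const, Finset.card_univ, Fintype.card_fin, nsmul_eq_mul] at h2
  have h3 := norm_pos_iff.2 hz
  nlinarith [Nat.cast_nonneg (α := ℝ) d]

namespace ExpansionData
variable {d : ℕ} {ω : ℝ → ℝ} {m ρ : ℝ} {a : Eucl d × Eucl d × Eucl d → ℂ}
  {Φ : Eucl d × Eucl d → ℂ} {q : ℕ} {VΦ V U : ℕ → ℝ} {N : ℕ → ℕ}
  (h : ExpansionData ω m ρ a Φ q VΦ V U N)
include h

/-- Estimates of the derivatives of the remainders away from the diagonal. -/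
lemma norm_iteratedFDeriv_remPiece_le {P : ℕ → ℝ} (hP1 : ∀ k, 1 ≤ P k)
    (hP : ∀ k l, V (k + l) + 2 ^ (k + l) * ((U 0 + 2) * U (k + l)) ≤ P k * P l)
    (ν j M : ℕ) {x y ξ : Eucl d} {τ E : ℝ} (hxy : 1 ≤ ‖x - y‖) (hτ0 : 0 < τ)
    (hτ : τ = 2 ^ ν ∨ τ = ‖y‖) (hE0 : 0 ≤ E)
    (hE : IsActive q ν (x, ξ) → Real.exp (2 * |m| * ampWeight ω (x, y, ξ)) ≤ E) :
    ‖iteratedFDeriv ℝ (j + M) (remPiece Φ a N ν) (x, y, ξ)‖ ≤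
      2 ^ j * P j * (P M * ((4 * ‖x - y‖) ^ M * (τ ^ (ρ * M))⁻¹) * E) := by
  have hρ := h.rho_pos
  have hρ1 := h.rho_le
  have hPj := zero_le_one.trans (hP1 j)
  have hPM := zero_le_one.trans (hP1 M)
  have hz0 : 0 ≤ 4 * ‖x - y‖ := by positivity
  by_cases hA : IsActive q ν (x, ξ)
  swap
  · rw [h.iteratedFDeriv_remPiece_eq_zero (w := (x, y, ξ)) hA, norm_zero]
    positivity
  specialize hE hA
  have hV := h.ampBound_remPiece ν (j + M) (x, y, ξ)
  set W := japRatio (x, y, ξ) with hW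
  have hW0 : 0 < W := japRatio_pos _
  -- The bracket ⟨(x,y,ξ)⟩ dominates |y| and, on the active region, 2^ν/2; so either choice of τ is
  -- allowed.
  have hW1 : W ≤ (4 * ‖x - y‖) * τ⁻¹ := by
    rw [hW, japRatio, ← div_eq_mul_inv, div_le_div_iff₀ (zero_lt_one.trans_le (one_le_jap3 _ _ _)) hτ0]
    have h1 : jap (x - y) ≤ 2 * ‖x - y‖ := jap_le_of_norm_le hxy le_rfl
    have h2 := hA.2
    have h3 := jap2_le_jap3 x y ξ
    have h4 := norm_le_jap3 x y ξ
    have h5 : τ ≤ 2 * jap3 x y ξ := by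
      rcases hτ with rfl | rfl
      · simp only at h2; linarith
      · linarith [norm_nonneg y]
    simp only
    calc jap (x - y) * τ ≤ (2 * ‖x - y‖) * (2 * jap3 x y ξ) :=
          mul_le_mul h1 h5 hτ0.le (by positivity)
      _ = _ := by ring
  have hW2 : W ^ (ρ * j) ≤ 2 ^ j := by
    rw [← Real.rpow_natCast 2 j]
    refine (Real.rpow_le_rpow hW0.le (japRatio_le_two _) (by positivity)).trans ?_
    refine Real.rpow_le_rpow_of_exponent_le one_le_two ?_
    nlinarith [Nat.cast_nonneg (α := ℝ) j]
  have hW3 : W ^ (ρ * M) ≤ (4 * ‖x - y‖) ^ M * (τ ^ (ρ * M))⁻¹ := by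
    refine (Real.rpow_le_rpow hW0.le hW1 (by positivity)).trans ?_
    rw [Real.mul_rpow hz0 (by positivity), Real.inv_rpow hτ0.le]
    refine mul_le_mul_of_nonneg_right ?_ (by positivity)
    rw [← Real.rpow_natCast]
    refine Real.rpow_le_rpow_of_exponent_le (by linarith) ?_
    nlinarith [Nat.cast_nonneg (α := ℝ) M]
  have hWs : W ^ (ρ * ((j + M : ℕ) : ℝ)) = W ^ (ρ * j) * W ^ (ρ * M) := by
    rw [← Real.rpow_add hW0, Nat.cast_add, mul_add]
  rw [hWs] at hV
  have hWj := Real.rpow_pos_of_pos hW0 (ρ * j)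
  have hWM := Real.rpow_pos_of_pos hW0 (ρ * M)
  refine hV.trans ?_
  calc _ ≤ (P j * P M) * (2 ^ j * ((4 * ‖x - y‖) ^ M * (τ ^ (ρ * M))⁻¹)) * E := by
        gcongr
        exact hP j M
    _ = _ := by ring

set_option maxHeartbeats 800000 in
/-- The kernels away from the diagonal. -/
lemma exists_norm_osc_le_far (n : ℕ) (hn : 0 < n) : ∃ C : ℝ, 0 < C ∧ ∀ (ν k : ℕ) (X : Eucl d × Eucl d),
    ‖X.1‖ ≤ 2 ^ (ν + q) → 1 ≤ ‖X.1 - X.2‖ →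
    ‖iteratedFDeriv ℝ k (osc (remPiece Φ a N ν)) X‖ ≤ C * (1 / 2) ^ ν * wt ω 1 n k *
      Real.exp (-(n * ω ‖X.1‖)) * Real.exp (-(n * ω ‖X.2‖)) := by
  have hω := h.weight
  have hρ := h.rho_pos
  have hWadm : Adm ω ρ fun k => V k + 2 ^ k * ((U 0 + 2) * U k) :=
    h.adm.add ((h.admU.const_mul (by linarith [h.one_le 0])).pow_mul hω hρ zero_le_two)
  obtain ⟨P, hPadm, hP1, hP⟩ := hWadm.exists_split hω hρ
  have hP0 : ∀ k, 0 < P k := fun k => zero_lt_one.trans_le (hP1 k)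
  -- Two nested Leibniz sums occur, one for the quotient and one for the phase, each costing 2^k;
  -- hence the two changes of index from n to n₁ to n₂.
  obtain ⟨n₁, hn₁, C₀, hC₀, h₀⟩ := pow_mul_wt_le hω one_pos 2 zero_le_two hn
  obtain ⟨n₂, hn₂, C₁, hC₁, h₁⟩ := pow_mul_wt_le hω one_pos 2 zero_le_two hn₁
  obtain ⟨C₂, hC₂, h₂⟩ := ((hPadm.of_le_one hω h.rho_le).pow_mul hω one_pos zero_le_two).2 n₂ hn₂
  obtain ⟨C₃, hC₃, h₃⟩ := ((Adm.factorial hω).pow_mul hω one_pos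
    (B := 4 * (d + 1)) (by positivity)).2 n₁ hn₁
  obtain ⟨L, hL1, hL⟩ := hω.scale (B := 2 ^ (q + 2)) (by positivity)
  obtain ⟨n'', C₅, hC₅, h₅⟩ := exists_absorb hω d ((n₂ + 6 * |m| + 2 * n) * L)
  obtain ⟨C₄, hC₄, h₄⟩ := (hPadm.pow_mul hω hρ (B := 8 * (d + 1)) (by positivity)).decay hω hρ n''
  set v := volume.real (Metric.closedBall (0 : Eucl d) 1)
  have hv : 0 ≤ v := measureReal_nonneg
  refine ⟨C₀ * C₁ * C₂ * C₃ * C₄ * C₅ * (((2 : ℝ) ^ q) ^ d * v + 1), by positivity,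
    fun ν k X hX hxy => ?_⟩
  obtain ⟨x, y⟩ := X
  simp only at hX hxy ⊢
  set s : ℝ := 2 ^ (ν + q) with hs
  -- Off the diagonal y is not controlled by the scale 2^ν, and decay in y is needed too: the scale
  -- becomes max(2^ν, |y|).
  obtain ⟨τ, hτ, hτν, hτy⟩ : ∃ τ : ℝ, (τ = 2 ^ ν ∨ τ = ‖y‖) ∧ 2 ^ ν ≤ τ ∧ ‖y‖ ≤ τ :=
    ⟨max (2 ^ ν) ‖y‖, max_choice _ _, le_max_left _ _, le_max_right _ _⟩
  have hν1 : (1 : ℝ) ≤ 2 ^ ν := one_le_pow₀ one_le_two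
  have hτ1 : 1 ≤ τ := hν1.trans hτν
  have hsτ : s = 2 ^ q * 2 ^ ν := by rw [hs, pow_add, mul_comm]
  have hs1 : 1 ≤ s := one_le_pow₀ one_le_two
  have hq1 : (1 : ℝ) ≤ 2 ^ q := one_le_pow₀ one_le_two
  set Λ := L * (ω τ + 1) with hΛ
  have hsτ' : s ≤ 2 ^ q * τ := by rw [hsτ]; gcongr
  have hΛle : ∀ u, 0 ≤ u → u ≤ 2 ^ (q + 2) * τ → ω u ≤ Λ := fun u hu hus =>
    (hω.le_of_le hu hus).trans (hL τ (by linarith))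
  have h2s : 2 * s ≤ 2 ^ (q + 2) * τ := by rw [pow_add]; nlinarith
  have hyc : ‖y‖ ≤ 2 ^ (q + 2) * τ := by rw [pow_add]; nlinarith
  have hxc : ‖x‖ ≤ 2 ^ (q + 2) * τ := by linarith
  have hz0 : x - y ≠ 0 := norm_pos_iff.1 (by linarith)
  obtain ⟨i, hi⟩ := exists_norm_le_mul_coord hz0
  have hzi : 0 < |(x - y) i| := by
    by_contra hc
    have : |(x - y) i| = 0 := le_antisymm (not_lt.1 hc) (abs_nonneg _)
    rw [this, mul_zero] at hi
    linarith
  obtain ⟨M, hM⟩ := h₄ τ hτ1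
  set Q := P M * ((4 * ‖x - y‖) ^ M * (τ ^ (ρ * M))⁻¹) with hQ
  set S := (2 * (d + 1) : ℝ) ^ M * (‖x - y‖ ^ M)⁻¹ with hS
  set E := Real.exp (6 * |m| * Λ) with hE
  have hτM : 0 < τ ^ (ρ * M) := Real.rpow_pos_of_pos (by linarith) _
  have hPM := hP0 M
  have hz : 0 < ‖x - y‖ := by linarith
  have hQ0 : 0 < Q := by positivity
  have hS0 : 0 < S := by positivity
  -- M integrations by parts gain |x-y|^{-M} while M derivatives of the amplitude cost (4|x-y|)^M
  -- τ^{-ρM}. The powers of |x-y| cancel, and M was chosen to make the rest decay in τ.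
  have hSQ : S * Q ≤ C₄ * Real.exp (-(n'' * ω τ)) := by
    have e : S * Q = ((8 * (d + 1) : ℝ) ^ M * P M) / τ ^ (ρ * M) := by
      rw [hS, hQ, mul_pow 4, show (8 * (d + 1) : ℝ) = 4 * (2 * (d + 1)) by ring, mul_pow 4]
      field_simp
    rw [e, div_le_iff₀ hτM]
    exact hM
  have hB : ∀ j ≤ k, ∀ ξ, ‖ξ‖ ≤ s →
      ‖iteratedFDeriv ℝ (j + M) (remPiece Φ a N ν) (x, y, ξ)‖ ≤ 2 ^ j * P j * (Q * E) := by
    intro j _ ξ hξ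
    refine h.norm_iteratedFDeriv_remPiece_le hP1 hP ν j M hxy (by linarith) hτ (Real.exp_pos _).le ?_
    intro _
    have hm0 : (0 : ℝ) ≤ 2 * |m| := by positivity
    have hξc : ‖ξ‖ ≤ 2 ^ (q + 2) * τ := by linarith
    have hw : 2 * |m| * ampWeight ω (x, y, ξ) ≤ 3 * (2 * |m|) * Λ :=
      ampWeight_le hω (w := (x, y, ξ)) hΛle hxc hyc hξc le_rfl hm0
    exact Real.exp_le_exp.2 (by linarith)
  have main := norm_iteratedFDeriv_osc_le_of_ne (h.contDiff_remPiece ν)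
    (fun w hw => h.remPiece_eq_zero (not_isActive_of_snd hw)) i M k (X := (x, y))
    (by rw [subCoord_apply]; exact abs_pos.1 hzi) hB
  refine main.trans ?_
  have hvol0 : 0 ≤ volume.real (Metric.closedBall (0 : Eucl d) s) := measureReal_nonneg
  have hinner : ∀ k', (∑ j ∈ Finset.range (k' + 1), (k'.choose j : ℝ) * (2 * s) ^ j *
      (2 ^ (k' - j) * P (k' - j) * (Q * E))) * volume.real (Metric.closedBall (0 : Eucl d) s) ≤
      (Real.exp (n₂ * Λ) * (C₂ * (Q * E)) * C₁ * volume.real (Metric.closedBall (0 : Eucl d) s)) *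
        wt ω 1 n₁ k' := fun k' => by
    have hc := sum_choose_mul_le_wt hω one_pos hn₂ (A := fun i => (2 * s) ^ i)
      (B := fun j => 2 ^ j * P j * (Q * E)) (C := Real.exp (n₂ * Λ)) (C' := C₂ * (Q * E))
      (Real.exp_pos _).le (fun j => by have := hP0 j; positivity) (fun i => by
        refine (pow_le_wt hω hn₂ i (by linarith)).trans ?_
        rw [mul_comm]
        have := hΛle (2 * s) (by linarith) h2s
        have := wt_pos ω 1 n₂ i
        gcongr) (fun j => by
        have := h₂ j
        calc _ ≤ C₂ * wt ω 1 n₂ j * (Q * E) := by gcongr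
          _ = _ := by ring) k'
    have h1k := h₁ k'
    calc _ ≤ Real.exp (n₂ * Λ) * (C₂ * (Q * E)) * (2 ^ k' * wt ω 1 n₂ k') *
          volume.real (Metric.closedBall (0 : Eucl d) s) := by gcongr
      _ ≤ Real.exp (n₂ * Λ) * (C₂ * (Q * E)) * (C₁ * wt ω 1 n₁ k') *
          volume.real (Metric.closedBall (0 : Eucl d) s) := by gcongr
      _ = _ := by ring
  have hAl : ∀ l : ℕ, l.factorial * 2 ^ (M + l) * (|subCoord i (x, y)| ^ (M + l))⁻¹ * 2 ^ l ≤
      (S * C₃) * wt ω 1 n₁ l := fun l => by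
    have h3 := h₃ l
    have e1 : (|subCoord i (x, y)| ^ (M + l))⁻¹ ≤ (d + 1 : ℝ) ^ (M + l) * (‖x - y‖ ^ M)⁻¹ := by
      rw [subCoord_apply, ← div_eq_mul_inv, inv_eq_one_div, div_le_div_iff₀ (by positivity)
        (by positivity), one_mul, ← mul_pow]
      calc ‖x - y‖ ^ M ≤ ‖x - y‖ ^ (M + l) := pow_le_pow_right₀ hxy (by omega)
        _ ≤ _ := pow_le_pow_left₀ (norm_nonneg _) hi _
    calc _ ≤ l.factorial * 2 ^ (M + l) * ((d + 1 : ℝ) ^ (M + l) * (‖x - y‖ ^ M)⁻¹) * 2 ^ l := by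
          gcongr
      _ = S * ((4 * (d + 1) : ℝ) ^ l * l.factorial) := by
          rw [hS, show (4 * (d + 1) : ℝ) = 2 * (2 * (d + 1)) by ring, mul_pow 2, mul_pow 2,
            mul_pow 2, pow_add, pow_add]
          ring
      _ ≤ S * (C₃ * wt ω 1 n₁ l) := by gcongr
      _ = _ := by ring
  have hconv := sum_choose_mul_le_wt hω one_pos hn₁
    (A := fun l => l.factorial * 2 ^ (M + l) * (|subCoord i (x, y)| ^ (M + l))⁻¹ * 2 ^ l)
    (B := fun k' => (∑ j ∈ Finset.range (k' + 1), (k'.choose j : ℝ) * (2 * s) ^ j *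
      (2 ^ (k' - j) * P (k' - j) * (Q * E))) * volume.real (Metric.closedBall (0 : Eucl d) s))
    (by positivity) (fun k' => mul_nonneg (Finset.sum_nonneg fun j _ => by
      have := hP0 (k' - j); positivity) hvol0) hAl hinner k
  refine hconv.trans ?_
  have hvol : volume.real (Metric.closedBall (0 : Eucl d) s) ≤
      (2 ^ ν) ^ d * ((2 ^ q) ^ d * v + 1) := by
    rw [volume_closedBall_eq d (by linarith), hsτ, mul_pow]
    have : (0 : ℝ) ≤ (2 ^ ν) ^ d := by positivity
    calc _ = (2 ^ ν) ^ d * ((2 ^ q) ^ d * v) := by ring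
      _ ≤ _ := by gcongr; linarith
  have hx : Real.exp (n * Λ) * Real.exp (-(n * ω ‖x‖)) ≥ 1 := by
    rw [← Real.exp_add]
    refine Real.one_le_exp ?_
    have := mul_le_mul_of_nonneg_left (hΛle ‖x‖ (norm_nonneg _) hxc) (Nat.cast_nonneg (α := ℝ) n)
    linarith
  have hy : Real.exp (n * Λ) * Real.exp (-(n * ω ‖y‖)) ≥ 1 := by
    rw [← Real.exp_add]
    refine Real.one_le_exp ?_
    have := mul_le_mul_of_nonneg_left (hΛle ‖y‖ (norm_nonneg _) hyc) (Nat.cast_nonneg (α := ℝ) n)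
    linarith
  have hab := h₅ τ ν hτν
  have hexp : Real.exp ((n₂ + 6 * |m| + 2 * n) * L * (ω τ + 1)) = Real.exp (n₂ * Λ) *
      E * (Real.exp (n * Λ) * Real.exp (n * Λ)) := by
    rw [hE, ← Real.exp_add, ← Real.exp_add, ← Real.exp_add, hΛ]
    congr 1
    ring
  rw [hexp] at hab
  have hwk := h₀ k
  have hwp := wt_pos ω 1 n₁ k
  have hwp' := wt_pos ω 1 n k
  set e1 := Real.exp (-(n * ω ‖x‖))
  set e2 := Real.exp (-(n * ω ‖y‖))
  set G := Real.exp (n * Λ)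
  set vs := volume.real (Metric.closedBall (0 : Eucl d) s)
  have he1 : 0 < e1 := Real.exp_pos _
  have he2 : 0 < e2 := Real.exp_pos _
  have hE0 : 0 < E := Real.exp_pos _
  calc _ = S * Q * C₃ * C₂ * C₁ * Real.exp (n₂ * Λ) * E * vs * (2 ^ k * wt ω 1 n₁ k) := by ring
    _ ≤ S * Q * C₃ * C₂ * C₁ * Real.exp (n₂ * Λ) * E * vs * (2 ^ k * wt ω 1 n₁ k) *
        ((G * e1) * (G * e2)) :=
        le_mul_of_one_le_right (by positivity) (one_le_mul_of_one_le_of_one_le hx hy)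
    _ ≤ (C₄ * Real.exp (-(n'' * ω τ))) * C₃ * C₂ * C₁ * Real.exp (n₂ * Λ) * E *
        ((2 ^ ν) ^ d * ((2 ^ q) ^ d * v + 1)) * (C₀ * wt ω 1 n k) * ((G * e1) * (G * e2)) := by
        gcongr
    _ = C₄ * C₃ * C₂ * C₁ * C₀ * wt ω 1 n k * ((2 ^ q) ^ d * v + 1) * e1 * e2 *
        (Real.exp (-(n'' * ω τ)) * (Real.exp (n₂ * Λ) * E * (G * G)) * (2 ^ ν) ^ d) := by
        ring
    _ ≤ C₄ * C₃ * C₂ * C₁ * C₀ * wt ω 1 n k * ((2 ^ q) ^ d * v + 1) * e1 * e2 *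
        (C₅ * (1 / 2) ^ ν) := by gcongr
    _ = _ := by ring

/-- The kernels of the remainders are summable in `S_ω`. -/
lemma exists_norm_osc_le (n : ℕ) (hn : 0 < n) : ∃ C : ℝ, 0 < C ∧ ∀ (ν k : ℕ) (X : Eucl d × Eucl d),
    ‖iteratedFDeriv ℝ k (osc (remPiece Φ a N ν)) X‖ ≤ C * (1 / 2) ^ ν * wt ω 1 n k *
      Real.exp (-(n * ω ‖X.1‖)) * Real.exp (-(n * ω ‖X.2‖)) := by
  obtain ⟨C, hC, h1⟩ := h.exists_norm_osc_le_near n hn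
  obtain ⟨C', hC', h2⟩ := h.exists_norm_osc_le_far n hn
  refine ⟨C + C', by positivity, fun ν k X => ?_⟩
  have hwp := wt_pos ω 1 n k
  rcases lt_or_ge ((2 : ℝ) ^ (ν + q)) ‖X.1‖ with hX | hX
  · rw [h.iteratedFDeriv_osc_remPiece_eq_zero hX, norm_zero]
    positivity
  rcases le_total ‖X.1 - X.2‖ 1 with hxy | hxy
  · refine (h1 ν k X hX hxy).trans ?_
    gcongr
    linarith
  · refine (h2 ν k X hX hxy).trans ?_
    gcongr
    linarith

end ExpansionData

/-! ### Membership in S_ω and decay of Fourier transforms -/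

open FourierTransform

section
variable {ω : ℝ → ℝ} (hω : IsWeightFunction ω)
include hω

lemma IsWeightFunction.continuous_comp_norm {E : Type*} [NormedAddCommGroup E] :
    Continuous fun x : E => ω ‖x‖ :=
  hω.cont.comp_continuous continuous_norm fun x => norm_nonneg x

/-- The exponential of the weight dominates powers. -/
lemma IsWeightFunction.pow_mul_exp_neg_le (j : ℕ) :
    ∃ C : ℝ, 0 < C ∧ ∀ t, 0 ≤ t → (1 + t) ^ j * Real.exp (-ω t) ≤ C := by
  obtain ⟨C, hC, h⟩ := hω.mul_log_le j
  refine ⟨2 ^ j * Real.exp C, by positivity, fun t ht => ?_⟩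
  have h0 := hω.nonneg ht
  rcases le_total t 1 with h1 | h1
  · refine mul_le_mul (pow_le_pow_left₀ (by linarith) (by linarith) j) ?_ (Real.exp_pos _).le
      (by positivity)
    exact Real.exp_le_exp.2 (by linarith)
  · have h2 : t ^ j ≤ Real.exp (ω t + C) := by
      rw [← Real.exp_log (pow_pos (zero_lt_one.trans_le h1) j), Real.log_pow]
      exact Real.exp_le_exp.2 (h t h1)
    calc (1 + t) ^ j * Real.exp (-ω t) ≤ (2 * t) ^ j * Real.exp (-ω t) := by gcongr; linarith
      _ = 2 ^ j * t ^ j * Real.exp (-ω t) := by rw [mul_pow]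
      _ ≤ 2 ^ j * Real.exp (ω t + C) * Real.exp (-ω t) := by gcongr
      _ = _ := by rw [mul_assoc, ← Real.exp_add]; ring_nf

lemma IsWeightFunction.integrable_pow_mul_exp_neg (n j : ℕ) :
    Integrable fun x : Eucl n => ‖x‖ ^ j * Real.exp (-ω ‖x‖) := by
  obtain ⟨C, hC, h⟩ := hω.pow_mul_exp_neg_le (j + (n + 1))
  have hi : Integrable fun x : Eucl n => C * (1 + ‖x‖) ^ (-((n + 1 : ℕ) : ℝ)) :=
    (integrable_one_add_norm (by rw [finrank_euclideanSpace_fin]; push_cast; linarith)).const_mul C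
  refine hi.mono' ?_ (Filter.Eventually.of_forall fun x => ?_)
  · exact ((continuous_norm.pow j).mul (Real.continuous_exp.comp
      hω.continuous_comp_norm.neg)).aestronglyMeasurable
  · have hx := norm_nonneg x
    rw [Real.norm_of_nonneg (by positivity), Real.rpow_neg (by positivity), Real.rpow_natCast,
      ← div_eq_mul_inv, le_div_iff₀ (by positivity)]
    refine le_trans ?_ (h ‖x‖ hx)
    rw [pow_add _ j, mul_right_comm]
    refine mul_le_mul_of_nonneg_right (mul_le_mul_of_nonneg_right ?_ (by positivity))
      (Real.exp_pos _).le
    exact pow_le_pow_left₀ hx (by linarith) j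

end

lemma fourierHat_eq {n : ℕ} (u : Eucl n → ℂ) (ξ : Eucl n) :
    fourierHat u ξ = 𝓕 u ((2 * Real.pi)⁻¹ • ξ) := by
  rw [Real.fourier_eq', fourierHat]
  congr 1
  ext x
  rw [smul_eq_mul, mul_comm, inner_smul_right]
  congr 2
  have : Real.pi ≠ 0 := Real.pi_ne_zero
  rw [show -2 * Real.pi * ((2 * Real.pi)⁻¹ * inner ℝ x ξ) = -inner ℝ x ξ by field_simp]
  push_cast
  ring

lemma norm_multiDeriv_le {n : ℕ} {u : Eucl n → ℂ} (hu : ContDiff ℝ (⊤ : ℕ∞) u) (α : Fin n → ℕ)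
    (x : Eucl n) : ‖multiDeriv (stdVec n) α u x‖ ≤ ‖iteratedFDeriv ℝ (mlen α) u x‖ := by
  rw [multiDeriv_eq_wordDeriv, ← length_multiWord (stdVec n) α]
  refine norm_wordDeriv_le hu (fun v hv => ?_) x
  obtain ⟨i, rfl⟩ := mem_multiWord hv
  exact (norm_stdVec i).le

section
variable {ω : ℝ → ℝ} (hω : IsWeightFunction ω) {n M : ℕ} {u : Eucl n → ℂ} {C : ℝ}
  (hu : ContDiff ℝ (⊤ : ℕ∞) u)
include hω hu

lemma integrable_pow_mul_norm_iteratedFDeriv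
    (hc : ∀ k x, ‖iteratedFDeriv ℝ k u x‖ ≤ C * wt ω 1 M k * Real.exp (-ω ‖x‖)) (j k : ℕ) :
    Integrable fun x => ‖x‖ ^ j * ‖iteratedFDeriv ℝ k u x‖ := by
  refine ((hω.integrable_pow_mul_exp_neg n j).const_mul (C * wt ω 1 M k)).mono' ?_
    (Filter.Eventually.of_forall fun x => ?_)
  · exact ((continuous_norm.pow j).mul
      (hu.continuous_iteratedFDeriv (by exact_mod_cast le_top)).norm).aestronglyMeasurable
  · rw [Real.norm_of_nonneg (by positivity)]
    calc _ ≤ ‖x‖ ^ j * (C * wt ω 1 M k * Real.exp (-ω ‖x‖)) := by gcongr; exact hc k x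
      _ = _ := by ring

/-- Decay of Fourier transforms in terms of weight sequences. -/
lemma pow_mul_norm_iteratedFDeriv_fourier_le (hC : 0 ≤ C)
    (hc : ∀ k x, ‖iteratedFDeriv ℝ k u x‖ ≤ C * wt ω 1 M k * Real.exp (-ω ‖x‖)) (j k : ℕ)
    (w : Eucl n) : ‖w‖ ^ j * ‖iteratedFDeriv ℝ k (𝓕 u) w‖ ≤ (2 * Real.pi) ^ k * (2 * k + 2) ^ j *
      (2 ^ j * (C * wt ω 1 M j *
        ∑ i ∈ Finset.range (k + 1), ∫ x : Eucl n, ‖x‖ ^ i * Real.exp (-ω ‖x‖))) := by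
  have hint := integrable_pow_mul_norm_iteratedFDeriv hω hu hc
  have e3 := Real.pow_mul_norm_iteratedFDeriv_fourier_le (K := ⊤) (N := ⊤) (f := u) hu
    (fun i l _ _ => hint i l) le_top le_top (n := j) (k := k) w
  refine e3.trans (mul_le_mul_of_nonneg_left ?_ (by positivity))
  have hwp := wt_pos ω 1 M j
  rw [Finset.sum_product_right, Finset.mul_sum]
  have key : ∀ l ∈ Finset.range (j + 1), ∑ i ∈ Finset.range (k + 1),
      ∫ v, ‖v‖ ^ i * ‖iteratedFDeriv ℝ l u v‖ ≤ ∑ i ∈ Finset.range (k + 1),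
        C * wt ω 1 M j * ∫ x : Eucl n, ‖x‖ ^ i * Real.exp (-ω ‖x‖) := fun l hl => by
    refine Finset.sum_le_sum fun i _ => ?_
    rw [← integral_const_mul]
    refine integral_mono (hint i l) ((hω.integrable_pow_mul_exp_neg n i).const_mul _) fun v => ?_
    have hm := wt_mono_right hω one_pos M (Nat.lt_succ_iff.1 (Finset.mem_range.1 hl))
    have h1 : ‖iteratedFDeriv ℝ l u v‖ ≤ C * wt ω 1 M j * Real.exp (-ω ‖v‖) :=
      (hc l v).trans (by gcongr)
    calc _ ≤ ‖v‖ ^ i * (C * wt ω 1 M j * Real.exp (-ω ‖v‖)) :=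
          mul_le_mul_of_nonneg_left h1 (by positivity)
      _ = _ := by ring
  refine (Finset.sum_le_sum key).trans ?_
  rw [Finset.sum_const, Finset.card_range, nsmul_eq_mul]
  refine mul_le_mul_of_nonneg_right ?_ (Finset.sum_nonneg fun i _ => ?_)
  · exact_mod_cast Nat.lt_two_pow_self
  · exact mul_nonneg (by positivity) (integral_nonneg fun x => by positivity)

end

/-- A criterion for membership in `S_ω`. -/
lemma mem_SOmega {ω : ℝ → ℝ} (hω : IsWeightFunction ω) {n : ℕ} {u : Eucl n → ℂ}
    (hu : ContDiff ℝ (⊤ : ℕ∞) u)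
    (h : ∀ N : ℕ, 0 < N → ∃ C : ℝ, 0 < C ∧ ∀ k x,
      ‖iteratedFDeriv ℝ k u x‖ ≤ C * wt ω 1 N k * Real.exp (-(N * ω ‖x‖))) : u ∈ SOmega ω n := by
  have hw0 : ∀ x : Eucl n, 0 ≤ ω ‖x‖ := fun x => hω.nonneg (norm_nonneg x)
  have h' : ∀ N : ℕ, 0 < N → ∃ C : ℝ, 0 < C ∧ ∀ k x,
      ‖iteratedFDeriv ℝ k u x‖ ≤ C * wt ω 1 N k * Real.exp (-ω ‖x‖) := fun N hN => by
    obtain ⟨C, hC, hc⟩ := h N hN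
    refine ⟨C, hC, fun k x => (hc k x).trans ?_⟩
    have := wt_pos ω 1 N k
    refine mul_le_mul_of_nonneg_left (Real.exp_le_exp.2 ?_) (by positivity)
    have hN1 : (1 : ℝ) ≤ N := by exact_mod_cast hN
    nlinarith [hw0 x]
  have hint : ∀ j k : ℕ, Integrable fun x => ‖x‖ ^ j * ‖iteratedFDeriv ℝ k u x‖ := by
    obtain ⟨C, hC, hc⟩ := h' 1 one_pos
    exact integrable_pow_mul_norm_iteratedFDeriv hω hu hc
  have hui : Integrable u := by
    have := hint 0 0
    simp only [pow_zero, one_mul, norm_iteratedFDeriv_zero] at this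
    exact (integrable_norm_iff hu.continuous.aestronglyMeasurable).1 this
  have hF : ContDiff ℝ (⊤ : ℕ∞) (𝓕 u) := by
    refine Real.contDiff_fourier fun k _ => ?_
    simpa [norm_iteratedFDeriv_zero] using hint k 0
  set A : Eucl n →L[ℝ] Eucl n := (2 * Real.pi)⁻¹ • ContinuousLinearMap.id ℝ (Eucl n) with hA
  have hpi : 1 ≤ 2 * Real.pi := by linarith [Real.two_le_pi]
  have hA1 : ‖A‖ ≤ 1 := by
    refine (norm_smul_le (2 * Real.pi)⁻¹ (ContinuousLinearMap.id ℝ (Eucl n))).trans ?_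
    rw [Real.norm_of_nonneg (by positivity)]
    exact mul_le_one₀ (inv_le_one_of_one_le₀ hpi) (norm_nonneg _) ContinuousLinearMap.norm_id_le
  have hFe : fourierHat u = fun ξ => 𝓕 u (A ξ + 0) := by
    ext ξ
    rw [fourierHat_eq, add_zero, hA]
    rfl
  have hFs : ContDiff ℝ (⊤ : ℕ∞) (fourierHat u) := by
    rw [hFe]
    exact hF.comp (A.contDiff.add contDiff_const)
  refine ⟨hui, hu, hFs, fun l _ α => ?_, fun l hl α => ?_⟩
  · obtain ⟨N, hN⟩ := exists_nat_ge l
    obtain ⟨C, hC, hc⟩ := h (N + 1) N.succ_pos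
    refine ⟨C * wt ω 1 (N + 1) (mlen α), fun x => ?_⟩
    have hw := wt_pos ω 1 (N + 1) (mlen α)
    calc _ ≤ Real.exp ((N + 1 : ℕ) * ω ‖x‖) *
          (C * wt ω 1 (N + 1) (mlen α) * Real.exp (-((N + 1 : ℕ) * ω ‖x‖))) := by
          refine mul_le_mul (Real.exp_le_exp.2 ?_) ((norm_multiDeriv_le hu α x).trans (hc _ x))
            (norm_nonneg _) (Real.exp_pos _).le
          refine mul_le_mul_of_nonneg_right ?_ (hw0 x)
          push_cast
          linarith
      _ = C * wt ω 1 (N + 1) (mlen α) * (Real.exp ((N + 1 : ℕ) * ω ‖x‖) *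
          Real.exp (-((N + 1 : ℕ) * ω ‖x‖))) := by ring
      _ = _ := by rw [← Real.exp_add, add_neg_cancel, Real.exp_zero, mul_one]
  · set k := mlen α with hk
    obtain ⟨N, hN⟩ := exists_nat_ge l
    -- For a fixed order k of differentiation, the quantities |ξ|^j |∂^k û(ξ)| are bounded by an
    -- admissible sequence in j; the optimal j at each ξ then gives the weighted decay.
    obtain ⟨V, hV, hVs⟩ := Adm.exists_of_sets (ω := ω) (r := 1)
        (S := fun j => {s | ∃ ξ : Eucl n, s = ‖ξ‖ ^ j * ‖iteratedFDeriv ℝ k (fourierHat u) ξ‖})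
        fun M hM => by
      obtain ⟨M₁, hM₁, C₁, hC₁, h₁⟩ := pow_mul_wt_le hω one_pos
        (2 * (2 * Real.pi) * (2 * k + 2)) (by positivity) hM
      obtain ⟨C₂, hC₂, h₂⟩ := h' M₁ hM₁
      obtain ⟨I, hI⟩ : ∃ I : ℝ, I = ∑ i ∈ Finset.range (k + 1),
        ∫ x : Eucl n, ‖x‖ ^ i * Real.exp (-ω ‖x‖) := ⟨_, rfl⟩
      have hI0 : 0 ≤ I := hI ▸ Finset.sum_nonneg fun i _ => integral_nonneg fun x => by positivity
      refine ⟨(2 * Real.pi) ^ k * C₁ * C₂ * (I + 1), by positivity, ?_⟩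
      rintro j _ ⟨ξ, rfl⟩
      have e1 : ‖iteratedFDeriv ℝ k (fourierHat u) ξ‖ ≤ ‖iteratedFDeriv ℝ k (𝓕 u) (A ξ)‖ := by
        rw [hFe]
        have := norm_iteratedFDeriv_comp_clm_le hF A hA1 0 k ξ
        rwa [add_zero] at this
      have e2 : ‖ξ‖ = 2 * Real.pi * ‖A ξ‖ := by
        have : A ξ = (2 * Real.pi)⁻¹ • ξ := by rw [hA]; rfl
        rw [this, norm_smul, Real.norm_of_nonneg (by positivity), ← mul_assoc,
          mul_inv_cancel₀ (by positivity), one_mul]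
      have e3 := pow_mul_norm_iteratedFDeriv_fourier_le hω hu hC₂.le h₂ j k (A ξ)
      rw [← hI] at e3
      have h1j := h₁ j
      have hwp := wt_pos ω 1 M₁ j
      calc _ ≤ (2 * Real.pi * ‖A ξ‖) ^ j * ‖iteratedFDeriv ℝ k (𝓕 u) (A ξ)‖ := by rw [e2]; gcongr
        _ = (2 * Real.pi) ^ j * (‖A ξ‖ ^ j * ‖iteratedFDeriv ℝ k (𝓕 u) (A ξ)‖) := by
            rw [mul_pow]; ring
        _ ≤ (2 * Real.pi) ^ j * ((2 * Real.pi) ^ k * (2 * k + 2) ^ j *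
            (2 ^ j * (C₂ * wt ω 1 M₁ j * I))) := by
            exact mul_le_mul_of_nonneg_left e3 (by positivity)
        _ = (2 * Real.pi) ^ k * C₂ * I * ((2 * (2 * Real.pi) * (2 * k + 2)) ^ j * wt ω 1 M₁ j) := by
            rw [mul_pow (2 * (2 * Real.pi)), mul_pow 2 (2 * Real.pi)]
            ring
        _ ≤ (2 * Real.pi) ^ k * C₂ * (I + 1) * (C₁ * wt ω 1 M j) := by
            refine mul_le_mul ?_ h1j (by positivity) (by positivity)
            exact mul_le_mul_of_nonneg_left (by linarith) (by positivity)
        _ = _ := by ring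
    obtain ⟨C, hC, hc⟩ := hV.decay hω one_pos N
    refine ⟨C + V 0, fun ξ => ?_⟩
    have hm := norm_multiDeriv_le hFs α ξ
    rw [← hk] at hm
    have hV0 := hV.nonneg 0
    rcases lt_or_ge ‖ξ‖ 1 with hξ | hξ
    · rw [hω.zero_of_le_one _ (norm_nonneg _) hξ.le, mul_zero, Real.exp_zero, one_mul]
      have := hVs 0 _ ⟨ξ, rfl⟩
      rw [pow_zero, one_mul] at this
      linarith
    · obtain ⟨j, hj⟩ := hc ‖ξ‖ hξ
      have h1 := (hVs j _ ⟨ξ, rfl⟩).trans hj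
      rw [one_mul, Real.rpow_natCast, mul_comm] at h1
      have h2 := le_of_mul_le_mul_right h1 (by positivity)
      calc _ ≤ Real.exp (N * ω ‖ξ‖) * (C * Real.exp (-(N * ω ‖ξ‖))) := by
            refine mul_le_mul (Real.exp_le_exp.2 ?_) (hm.trans h2) (norm_nonneg _) (Real.exp_pos _).le
            exact mul_le_mul_of_nonneg_right hN (hw0 ξ)
        _ = C * (Real.exp (N * ω ‖ξ‖) * Real.exp (-(N * ω ‖ξ‖))) := by ring
        _ = C := by rw [← Real.exp_add, add_neg_cancel, Real.exp_zero, mul_one]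
        _ ≤ _ := by linarith

/-! ### The kernel of the remainder on ℝ^{2d} -/

section
variable {d : ℕ}

/-- The components of a point of `ℝ^{2d}`. -/
def unpair : Eucl (d + d) →L[ℝ] Eucl d × Eucl d :=
  LinearMap.toContinuousLinearMap
    { toFun := fun z => (WithLp.toLp 2 fun i => z (Fin.castAdd d i),
        WithLp.toLp 2 fun i => z (Fin.natAdd d i))
      map_add' := fun _ _ => rfl
      map_smul' := fun _ _ => rfl }

lemma unpair_pairVec (x y : Eucl d) : unpair (pairVec x y) = (x, y) := by
  refine Prod.ext ?_ ?_
  · ext i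
    exact Fin.append_left (fun i => x i) (fun i => y i) i
  · ext i
    exact Fin.append_right (fun i => x i) (fun i => y i) i

lemma norm_sq_eq_unpair (z : Eucl (d + d)) :
    ‖z‖ ^ 2 = ‖(unpair z).1‖ ^ 2 + ‖(unpair z).2‖ ^ 2 := by
  rw [EuclideanSpace.norm_sq_eq, EuclideanSpace.norm_sq_eq, EuclideanSpace.norm_sq_eq,
    Fin.sum_univ_add]
  rfl

lemma norm_unpair_le : ‖(unpair : Eucl (d + d) →L[ℝ] Eucl d × Eucl d)‖ ≤ 1 := by
  refine ContinuousLinearMap.opNorm_le_bound _ zero_le_one fun z => ?_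
  have h := norm_sq_eq_unpair z
  rw [one_mul, Prod.norm_def]
  refine max_le ?_ ?_ <;> refine le_of_sq_le_sq ?_ (norm_nonneg _) <;> rw [h]
  · nlinarith [sq_nonneg ‖(unpair z).2‖]
  · nlinarith [sq_nonneg ‖(unpair z).1‖]

/-- The norm of z is at most twice the larger of the norms of its two components, so one doubling
compares the weights. -/
lemma exp_neg_weight_unpair_le {ω : ℝ → ℝ} (hω : IsWeightFunction ω) {L : ℝ} (hL1 : 0 ≤ L)
    (hL : ∀ t, 0 ≤ t → ω (2 * t) ≤ L * (ω t + 1)) (z : Eucl (d + d)) :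
    ω ‖z‖ ≤ L * (ω ‖(unpair z).1‖ + ω ‖(unpair z).2‖ + 1) := by
  have h := norm_sq_eq_unpair z
  set s := ‖(unpair z).1‖
  set t := ‖(unpair z).2‖
  have hs : 0 ≤ s := norm_nonneg _
  have ht : 0 ≤ t := norm_nonneg _
  have key : ∀ r, 0 ≤ r → s ≤ r → t ≤ r → ω ‖z‖ ≤ L * (ω r + 1) := fun r hr h1 h2 => by
    refine (hω.le_of_le (norm_nonneg z) ?_).trans (hL r hr)
    refine le_of_sq_le_sq ?_ (by linarith)
    rw [h]
    nlinarith
  have hs' := hω.nonneg hs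
  have ht' := hω.nonneg ht
  rcases le_total s t with h1 | h1
  · exact (key t ht h1 le_rfl).trans (by nlinarith)
  · exact (key s hs le_rfl h1).trans (by nlinarith)

end

/-- The kernel of the remainder. -/
def remKernel {d : ℕ} (Φ : Eucl d × Eucl d → ℂ) (a : Eucl d × Eucl d × Eucl d → ℂ) (N : ℕ → ℕ)
    (z : Eucl (d + d)) : ℂ :=
  ∑' ν, osc (remPiece Φ a N ν) (unpair z)

namespace ExpansionData
variable {d : ℕ} {ω : ℝ → ℝ} {m ρ : ℝ} {a : Eucl d × Eucl d × Eucl d → ℂ}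
  {Φ : Eucl d × Eucl d → ℂ} {q : ℕ} {VΦ V U : ℕ → ℝ} {N : ℕ → ℕ}
  (h : ExpansionData ω m ρ a Φ q VΦ V U N)
include h

/-- The factor 2^{-ν} in the kernel estimates permits termwise differentiation. An index n ≥ ML pays
for the passage from ω(x) + ω(y) to the weight of the point (x,y). -/
lemma remKernel_mem_SOmega : remKernel Φ a N ∈ SOmega ω (d + d) := by
  have hω := h.weight
  have hsm : ∀ ν, ContDiff ℝ (⊤ : ℕ∞) fun z : Eucl (d + d) => osc (remPiece Φ a N ν) (unpair z) :=
    fun ν => (h.contDiff_osc_remPiece ν).comp unpair.contDiff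
  have hD : ∀ ν k (z : Eucl (d + d)),
      ‖iteratedFDeriv ℝ k (fun z => osc (remPiece Φ a N ν) (unpair z)) z‖ ≤
        ‖iteratedFDeriv ℝ k (osc (remPiece Φ a N ν)) (unpair z)‖ := fun ν k z => by
    have := norm_iteratedFDeriv_comp_clm_le (h.contDiff_osc_remPiece ν) unpair norm_unpair_le 0 k z
    simpa only [add_zero] using this
  have hgeo : Summable fun ν : ℕ => (1 / 2 : ℝ) ^ ν := summable_geometric_two
  have hw0 : ∀ x : Eucl d, 0 ≤ ω ‖x‖ := fun x => hω.nonneg (norm_nonneg x)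
  have hbd : ∀ n : ℕ, 0 < n → ∃ C : ℝ, 0 < C ∧ ∀ ν k (z : Eucl (d + d)),
      ‖iteratedFDeriv ℝ k (fun z => osc (remPiece Φ a N ν) (unpair z)) z‖ ≤
        C * wt ω 1 n k * (Real.exp (-(n * ω ‖(unpair z).1‖)) *
          Real.exp (-(n * ω ‖(unpair z).2‖))) * (1 / 2) ^ ν := fun n hn => by
    obtain ⟨C, hC, hc⟩ := h.exists_norm_osc_le n hn
    exact ⟨C, hC, fun ν k z => (hD ν k z).trans ((hc ν k _).trans (le_of_eq (by ring)))⟩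
  have hbd1 : ∃ v : ℕ → ℕ → ℝ, (∀ k, Summable (v k)) ∧ ∀ k ν (z : Eucl (d + d)),
      ‖iteratedFDeriv ℝ k (fun z => osc (remPiece Φ a N ν) (unpair z)) z‖ ≤ v k ν := by
    obtain ⟨C, hC, hc⟩ := hbd 1 one_pos
    refine ⟨fun k ν => C * wt ω 1 1 k * (1 / 2) ^ ν, fun k => hgeo.mul_left _, fun k ν z => ?_⟩
    refine (hc ν k z).trans (mul_le_mul_of_nonneg_right ?_ (by positivity))
    have := wt_pos ω 1 1 k
    refine mul_le_of_le_one_right (by positivity) (mul_le_one₀ ?_ (Real.exp_pos _).le ?_)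
    · exact Real.exp_le_one_iff.2 (by have := hw0 (unpair z).1; push_cast; linarith)
    · exact Real.exp_le_one_iff.2 (by have := hw0 (unpair z).2; push_cast; linarith)
  obtain ⟨v, hv, hvb⟩ := hbd1
  have hK : ContDiff ℝ (⊤ : ℕ∞) (remKernel Φ a N) :=
    contDiff_tsum hsm (fun k _ => hv k) fun k ν z _ => hvb k ν z
  refine mem_SOmega hω hK fun M hM => ?_
  obtain ⟨L, hL1, hL⟩ := hω.doubling
  obtain ⟨n, hn⟩ := exists_nat_ge (M * L)
  have hMn : M ≤ n := by
    have : (M : ℝ) ≤ n := (le_mul_of_one_le_right (Nat.cast_nonneg M) hL1).trans hn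
    exact_mod_cast this
  obtain ⟨C, hC, hc⟩ := hbd n (hM.trans_le hMn)
  refine ⟨C * Real.exp n * 2, by positivity, fun k z => ?_⟩
  have hs : iteratedFDeriv ℝ k (remKernel Φ a N) z =
      ∑' ν, iteratedFDeriv ℝ k (fun z => osc (remPiece Φ a N ν) (unpair z)) z :=
    congrFun (iteratedFDeriv_tsum hsm (fun k _ => hv k) (fun k ν z _ => hvb k ν z)
      le_top) z
  set e := Real.exp (-(n * ω ‖(unpair z).1‖)) * Real.exp (-(n * ω ‖(unpair z).2‖)) with he
  have hsum : HasSum (fun ν : ℕ => C * wt ω 1 n k * e * (1 / 2) ^ ν) (C * wt ω 1 n k * e * 2) :=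
    hasSum_geometric_two.mul_left _
  have h1 : ‖iteratedFDeriv ℝ k (remKernel Φ a N) z‖ ≤ C * wt ω 1 n k * e * 2 := by
    rw [hs]
    exact tsum_of_norm_bounded hsum fun ν => hc ν k z
  have he2 : e ≤ Real.exp n * Real.exp (-(M * ω ‖z‖)) := by
    rw [he, ← Real.exp_add, ← Real.exp_add]
    refine Real.exp_le_exp.2 ?_
    have h2 := exp_neg_weight_unpair_le hω (by linarith) hL z
    have h3 := mul_le_mul_of_nonneg_left h2 (Nat.cast_nonneg (α := ℝ) M)
    have h4 := mul_le_mul_of_nonneg_right hn (show 0 ≤ ω ‖(unpair z).1‖ + ω ‖(unpair z).2‖ + 1 by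
      have := hw0 (unpair z).1; have := hw0 (unpair z).2; linarith)
    nlinarith
  have h5 := wt_anti_left hω one_pos hM hMn k
  have h6 := wt_pos ω 1 n k
  have h7 := wt_pos ω 1 M k
  calc _ ≤ C * wt ω 1 n k * e * 2 := h1
    _ ≤ C * wt ω 1 M k * (Real.exp n * Real.exp (-(M * ω ‖z‖))) * 2 := by gcongr
    _ = _ := by ring

end ExpansionData

/-! ### Functions in S_ω and decay of the inner integral -/

section
variable {ω : ℝ → ℝ} {n : ℕ} {f : Eucl n → ℂ}

lemma multiDeriv_zero {F : Type*} [NormedAddCommGroup F] [NormedSpace ℝ F] (v : Fin n → F)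
    (g : F → ℂ) : multiDeriv v 0 g = g := by
  rw [multiDeriv]
  induction List.finRange n with
  | nil => rfl
  | cons i l ih => rw [List.foldr_cons, ih]; rfl

lemma exists_norm_le_of_exp_mul {E : Type*} [NormedAddCommGroup E] {g : E → ℂ} {l C : ℝ}
    (h : ∀ x, Real.exp (l * ω ‖x‖) * ‖g x‖ ≤ C) :
    ∃ C : ℝ, 0 < C ∧ ∀ x, ‖g x‖ ≤ C * Real.exp (-(l * ω ‖x‖)) := by
  refine ⟨|C| + 1, by positivity, fun x => ?_⟩
  rw [Real.exp_neg, ← div_eq_mul_inv, le_div_iff₀ (Real.exp_pos _), mul_comm]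
  linarith [h x, le_abs_self C]

lemma exists_norm_le_of_mem_SOmega (hf : f ∈ SOmega ω n) {l : ℝ} (hl : 0 < l) :
    ∃ C : ℝ, 0 < C ∧ ∀ y, ‖f y‖ ≤ C * Real.exp (-(l * ω ‖y‖)) := by
  obtain ⟨C, hC⟩ := hf.2.2.2.1 l hl 0
  rw [multiDeriv_zero] at hC
  exact exists_norm_le_of_exp_mul hC

lemma exists_norm_fourierHat_le_of_mem_SOmega (hf : f ∈ SOmega ω n) {l : ℝ} (hl : 0 < l) :
    ∃ C : ℝ, 0 < C ∧ ∀ y, ‖fourierHat f y‖ ≤ C * Real.exp (-(l * ω ‖y‖)) := by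
  obtain ⟨C, hC⟩ := hf.2.2.2.2 l hl 0
  rw [multiDeriv_zero] at hC
  exact exists_norm_le_of_exp_mul hC

variable (hω : IsWeightFunction ω)
include hω

lemma integrable_exp_mul_norm_of_mem_SOmega (hf : f ∈ SOmega ω n) {c : ℝ} (hc : 0 ≤ c) :
    Integrable fun y => Real.exp (c * ω ‖y‖) * ‖f y‖ := by
  obtain ⟨C, hC, h⟩ := exists_norm_le_of_mem_SOmega hf (l := c + 1) (by linarith)
  refine ((hω.integrable_pow_mul_exp_neg n 0).const_mul C).mono' ?_
    (Filter.Eventually.of_forall fun y => ?_)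
  · exact ((Real.continuous_exp.comp (continuous_const.mul hω.continuous_comp_norm)).mul
      hf.2.1.continuous.norm).aestronglyMeasurable
  · rw [Real.norm_of_nonneg (by positivity), pow_zero, one_mul]
    calc _ ≤ Real.exp (c * ω ‖y‖) * (C * Real.exp (-((c + 1) * ω ‖y‖))) := by gcongr; exact h y
      _ = C * (Real.exp (c * ω ‖y‖) * Real.exp (-((c + 1) * ω ‖y‖))) := by ring
      _ = _ := by rw [← Real.exp_add]; ring_nf

/-- The derivatives of functions in `S_ω` satisfy ultradifferentiable estimates. -/
lemma exists_adm_of_mem_SOmega (hf : f ∈ SOmega ω n) :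
    ∃ V, Adm ω 1 V ∧ ∀ k y, ‖iteratedFDeriv ℝ k f y‖ ≤ V k := by
  have hpi : 1 ≤ 2 * Real.pi := by linarith [Real.two_le_pi]
  have hw0 : ∀ x : Eucl n, 0 ≤ ω ‖x‖ := fun x => hω.nonneg (norm_nonneg x)
  set g : Eucl n → ℂ := 𝓕 f with hg
  have hge : ∀ v, g v = fourierHat f ((2 * Real.pi) • v) := fun v => by
    rw [fourierHat_eq, smul_smul, inv_mul_cancel₀ (by positivity), one_smul]
  have hgc : Continuous g := by
    rw [funext hge]
    exact hf.2.2.1.continuous.comp (continuous_const_smul _)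
  have hgb : ∀ N : ℕ, ∃ C : ℝ, 0 < C ∧ ∀ v, ‖g v‖ ≤ C * Real.exp (-((N + 1) * ω ‖v‖)) := fun N => by
    obtain ⟨C, hC, h⟩ := exists_norm_fourierHat_le_of_mem_SOmega hf (l := N + 1) (by positivity)
    refine ⟨C, hC, fun v => ?_⟩
    rw [hge]
    refine (h _).trans (mul_le_mul_of_nonneg_left (Real.exp_le_exp.2 (neg_le_neg ?_)) hC.le)
    refine mul_le_mul_of_nonneg_left (hω.le_of_le (norm_nonneg _) ?_) (by positivity)
    rw [norm_smul, Real.norm_of_nonneg (by positivity)]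
    exact le_mul_of_one_le_left (norm_nonneg _) hpi
  have hint : ∀ i : ℕ, Integrable fun v => ‖v‖ ^ i * ‖g v‖ := fun i => by
    obtain ⟨C, hC, h⟩ := hgb 0
    refine ((hω.integrable_pow_mul_exp_neg n i).const_mul C).mono' ?_
      (Filter.Eventually.of_forall fun v => ?_)
    · exact ((continuous_norm.pow i).mul hgc.norm).aestronglyMeasurable
    · rw [Real.norm_of_nonneg (by positivity)]
      calc _ ≤ ‖v‖ ^ i * (C * Real.exp (-(((0 : ℕ) + 1) * ω ‖v‖))) := by gcongr; exact h v
        _ = _ := by push_cast; ring_nf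
  have hgi : Integrable g := by
    have := hint 0
    simp only [pow_zero, one_mul] at this
    exact (integrable_norm_iff hgc.aestronglyMeasurable).1 this
  set A : Eucl n →L[ℝ] Eucl n := -ContinuousLinearMap.id ℝ (Eucl n) with hA
  have hA1 : ‖A‖ ≤ 1 := by
    rw [hA, norm_neg]
    exact ContinuousLinearMap.norm_id_le
  have hfe : f = fun y => 𝓕 g (A y + 0) := by
    ext y
    rw [add_zero, show A y = -y from rfl, ← Real.fourierInv_eq_fourier_neg, hg,
      hf.2.1.continuous.fourierInv_fourier_eq hf.1 hgi]
  have hF : ContDiff ℝ (⊤ : ℕ∞) (𝓕 g) := Real.contDiff_fourier fun k _ => hint k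
  obtain ⟨V, hV, h⟩ := Adm.exists_of_sets (ω := ω) (r := 1)
      (S := fun k => {s | ∃ y : Eucl n, s = ‖iteratedFDeriv ℝ k f y‖}) fun N hN => by
    obtain ⟨N', hN', C₁, hC₁, h₁⟩ := pow_mul_wt_le hω one_pos (2 * (2 * Real.pi))
      (by positivity) hN
    obtain ⟨C₂, hC₂, h₂⟩ := hgb N'
    obtain ⟨I, hI⟩ : ∃ I : ℝ, I = ∫ v : Eucl n, ‖v‖ ^ 0 * Real.exp (-ω ‖v‖) := ⟨_, rfl⟩
    have hI0 : 0 ≤ I := hI ▸ integral_nonneg fun v => by positivity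
    refine ⟨C₁ * C₂ * (I + 1), by positivity, ?_⟩
    rintro k _ ⟨y, rfl⟩
    have hwp := wt_pos ω 1 N' k
    have e1 : ‖iteratedFDeriv ℝ k f y‖ ≤ ‖iteratedFDeriv ℝ k (𝓕 g) (A y)‖ := by
      have := norm_iteratedFDeriv_comp_clm_le hF A hA1 0 k y
      rw [← hfe] at this
      rwa [add_zero] at this
    have e2 := Real.pow_mul_norm_iteratedFDeriv_fourier_le (K := ⊤) (N := 0) (f := g)
      (contDiff_zero.2 hgc) (fun i l _ hl => by
        have hl0 : l = 0 := by simpa using hl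
        subst hl0
        simpa only [norm_iteratedFDeriv_zero] using hint i) le_top le_rfl (n := 0) (k := k) (A y)
    rw [pow_zero, one_mul, pow_zero, mul_one, Finset.sum_product_right, zero_add,
      Finset.sum_range_one] at e2
    have e3 : ∀ i ∈ Finset.range (k + 1), ∫ v, ‖v‖ ^ i * ‖iteratedFDeriv ℝ 0 g v‖ ≤
        C₂ * wt ω 1 N' k * I := fun i hi => by
      have hik : i ≤ k := Nat.lt_succ_iff.1 (Finset.mem_range.1 hi)
      rw [hI, ← integral_const_mul]
      simp only [norm_iteratedFDeriv_zero]
      refine integral_mono (hint i) ((hω.integrable_pow_mul_exp_neg n 0).const_mul _) fun v => ?_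
      -- Derivatives of f are bounded by moments of its Fourier transform. Young's inequality trades
      -- the power of |v| for e^{N'ω}, which the decay of the transform pays.
      have h3 : ‖v‖ ^ i ≤ wt ω 1 N' k * Real.exp (N' * ω ‖v‖) := by
        rcases le_total ‖v‖ 1 with hv | hv
        · rw [hω.zero_of_le_one _ (norm_nonneg _) hv, mul_zero, Real.exp_zero, mul_one]
          exact (pow_le_one₀ (norm_nonneg _) hv).trans (one_le_wt hω one_pos N' k)
        · exact (pow_le_pow_right₀ hv hik).trans (pow_le_wt hω hN' k hv)
      calc _ ≤ (wt ω 1 N' k * Real.exp (N' * ω ‖v‖)) * (C₂ * Real.exp (-((N' + 1) * ω ‖v‖))) :=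
            mul_le_mul h3 (h₂ v) (norm_nonneg _) (by positivity)
        _ = C₂ * wt ω 1 N' k * (Real.exp (N' * ω ‖v‖) * Real.exp (-((N' + 1) * ω ‖v‖))) := by ring
        _ = _ := by rw [← Real.exp_add, pow_zero, one_mul]; ring_nf
    have e4 := Finset.sum_le_sum e3
    rw [Finset.sum_const, Finset.card_range, nsmul_eq_mul] at e4
    have e5 : ((k + 1 : ℕ) : ℝ) ≤ 2 ^ k := by exact_mod_cast Nat.lt_two_pow_self
    have h1k := h₁ k
    calc _ ≤ (2 * Real.pi) ^ k * (2 ^ k * (C₂ * wt ω 1 N' k * I)) := by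
          refine e1.trans (e2.trans (mul_le_mul_of_nonneg_left (e4.trans ?_) (by positivity)))
          exact mul_le_mul_of_nonneg_right e5 (by positivity)
      _ = C₂ * I * ((2 * (2 * Real.pi)) ^ k * wt ω 1 N' k) := by
          rw [mul_pow 2 (2 * Real.pi)]; ring
      _ ≤ C₂ * (I + 1) * (C₁ * wt ω 1 N k) := by
          refine mul_le_mul ?_ h1k (by positivity) (by positivity)
          exact mul_le_mul_of_nonneg_left (by linarith) hC₂.le
      _ = _ := by ring
  exact ⟨V, hV, fun k y => h k _ ⟨y, rfl⟩⟩

end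

section
variable {d : ℕ}

lemma phase_sub (x y ξ : Eucl d) : phase (x - y) ξ = phase x ξ * phase (-ξ) y := by
  rw [phase, phase, phase, ← Complex.exp_add, inner_sub_left, inner_neg_left, real_inner_comm y ξ]
  congr 1
  push_cast
  ring

/-- Integration by parts for oscillatory integrals of compactly supported functions. -/
lemma abs_inner_pow_mul_norm_integral_phase_le {h : Eucl d → ℂ} (hh : ContDiff ℝ (⊤ : ℕ∞) h) {s B : ℝ}
    (hs : ∀ y, s < ‖y‖ → h y = 0) (z : Eucl d) {v : Eucl d} (hv : ‖v‖ ≤ 1) (N : ℕ)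
    (hB : ∀ y, ‖y‖ ≤ s → ‖iteratedFDeriv ℝ N h y‖ ≤ B) :
    |inner ℝ z v| ^ N * ‖∫ y, phase z y * h y‖ ≤
      B * volume.real (Metric.closedBall (0 : Eucl d) s) := by
  have e := congrArg norm (inner_pow_mul_integral_phase hh hs z v N)
  rw [norm_mul, norm_mul, norm_pow, norm_pow, Complex.norm_I, one_pow, one_mul, Complex.norm_real,
    Real.norm_eq_abs] at e
  rw [e]
  have hU : IsOpen {y : Eucl d | s < ‖y‖} := isOpen_lt continuous_const continuous_norm
  have h0 : ∀ y, y ∉ Metric.closedBall (0 : Eucl d) s →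
      phase z y * (dirDeriv v)^[N] h y = 0 := fun y hy => by
    have hy' : s < ‖y‖ := by simpa using hy
    have : (dirDeriv v)^[N] h y = 0 := dirDeriv_iterate_eq_zero_of_isOpen hU hs v N y hy'
    rw [this, mul_zero]
  rw [← setIntegral_eq_integral_of_forall_compl_eq_zero h0]
  refine norm_setIntegral_le_of_norm_le_const measure_closedBall_lt_top fun y hy => ?_
  have hy' : ‖y‖ ≤ s := by simpa using hy
  rw [norm_mul, norm_phase, one_mul]
  have h1 := norm_iteratedFDeriv_iterate_dirDeriv_le hh hv N 0 y
  rw [norm_iteratedFDeriv_zero, zero_add] at h1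
  exact h1.trans (hB y hy')

variable {ω : ℝ → ℝ} {m ρ : ℝ}

lemma AmpBound.norm_le {W : ℕ → ℝ} {b : Eucl d × Eucl d × Eucl d → ℂ} (hb : AmpBound ω m ρ W b)
    (x y ξ : Eucl d) :
    ‖b (x, y, ξ)‖ ≤ W 0 * (Real.exp (m * ω ‖x‖) * Real.exp (m * ω ‖y‖) * Real.exp (m * ω ‖ξ‖)) := by
  have := hb 0 (x, y, ξ)
  rw [norm_iteratedFDeriv_zero, Nat.cast_zero, mul_zero, Real.rpow_zero, mul_one] at this
  refine this.trans (le_of_eq ?_)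
  rw [← Real.exp_add, ← Real.exp_add, ampWeight]
  ring_nf

lemma AmpBound.norm_iteratedFDeriv_slice_le (hρ : 0 < ρ) (hρ1 : ρ ≤ 1) {W : ℕ → ℝ}
    (hW : ∀ k, 0 ≤ W k) {b : Eucl d × Eucl d × Eucl d → ℂ} (hbs : ContDiff ℝ (⊤ : ℕ∞) b)
    (hb : AmpBound ω m ρ W b) (k : ℕ) (x y ξ : Eucl d) :
    ‖iteratedFDeriv ℝ k (fun y => b (x, y, ξ)) y‖ ≤
      2 ^ k * W k * Real.exp (m * ampWeight ω (x, y, ξ)) := by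
  set A : Eucl d →L[ℝ] Eucl d × Eucl d × Eucl d :=
    (ContinuousLinearMap.inr ℝ (Eucl d) (Eucl d × Eucl d)).comp
      (ContinuousLinearMap.inl ℝ (Eucl d) (Eucl d)) with hA
  have hAe : ∀ y, A y + (x, 0, ξ) = (x, y, ξ) := fun y => by
    rw [hA]; simp
  have hA1 : ‖A‖ ≤ 1 := by
    refine ContinuousLinearMap.opNorm_le_bound _ zero_le_one fun y => ?_
    rw [hA]; simp
  have h1 := norm_iteratedFDeriv_comp_clm_le hbs A hA1 (x, 0, ξ) k y
  simp only [hAe] at h1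
  refine h1.trans ((hb k (x, y, ξ)).trans ?_)
  have h2 : japRatio (x, y, ξ) ^ (ρ * k) ≤ 2 ^ k := by
    rw [← Real.rpow_natCast 2 k]
    refine (Real.rpow_le_rpow (japRatio_pos _).le (japRatio_le_two _) (by positivity)).trans ?_
    refine Real.rpow_le_rpow_of_exponent_le one_le_two ?_
    nlinarith [Nat.cast_nonneg (α := ℝ) k]
  have := hW k
  calc _ ≤ W k * 2 ^ k * Real.exp (m * ampWeight ω (x, y, ξ)) := by gcongr
    _ = _ := by ring

/-- The Leibniz rule for iterated derivatives with majorants. -/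
lemma norm_iteratedFDeriv_mul_le_of_le {X : Type*} [NormedAddCommGroup X] [NormedSpace ℝ X]
    {f g : X → ℂ} (hf : ContDiff ℝ (⊤ : ℕ∞) f) (hg : ContDiff ℝ (⊤ : ℕ∞) g) {x : X} {F G : ℕ → ℝ}
    (hF : ∀ k, ‖iteratedFDeriv ℝ k f x‖ ≤ F k) (hG : ∀ k, ‖iteratedFDeriv ℝ k g x‖ ≤ G k) (k : ℕ) :
    ‖iteratedFDeriv ℝ k (fun x => f x * g x) x‖ ≤
      ∑ i ∈ Finset.range (k + 1), (k.choose i : ℝ) * F i * G (k - i) := by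
  refine (norm_iteratedFDeriv_mul_le hf hg x (nat_le_infty k)).trans ?_
  refine Finset.sum_le_sum fun i _ => ?_
  refine mul_le_mul (mul_le_mul_of_nonneg_left (hF i) (Nat.cast_nonneg _)) (hG _) (norm_nonneg _) ?_
  exact mul_nonneg (Nat.cast_nonneg _) ((norm_nonneg _).trans (hF i))

variable (hω : IsWeightFunction ω)
include hω

lemma integrable_amp_mul {f : Eucl d → ℂ} (hf : f ∈ SOmega ω d) (hm : 0 ≤ m) {W : ℕ → ℝ}
    {b : Eucl d × Eucl d × Eucl d → ℂ} (hbs : ContDiff ℝ (⊤ : ℕ∞) b)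
    (hb : AmpBound ω m ρ W b) (x ξ : Eucl d) :
    Integrable fun y => phase (x - y) ξ * b (x, y, ξ) * f y := by
  have hi := (integrable_exp_mul_norm_of_mem_SOmega hω hf hm).const_mul
    (W 0 * Real.exp (m * ω ‖x‖) * Real.exp (m * ω ‖ξ‖))
  refine hi.mono' ?_ (Filter.Eventually.of_forall fun y => ?_)
  · have hp : Continuous fun y : Eucl d => phase (x - y) ξ :=
      contDiff_phase.continuous.comp (by fun_prop : Continuous fun y : Eucl d => (x - y, ξ))
    have hc : Continuous fun y : Eucl d => b (x, y, ξ) :=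
      hbs.continuous.comp (by fun_prop : Continuous fun y : Eucl d => (x, y, ξ))
    exact ((hp.mul hc).mul hf.2.1.continuous).aestronglyMeasurable
  · rw [norm_mul, norm_mul, norm_phase, one_mul]
    refine (mul_le_mul_of_nonneg_right (hb.norm_le x y ξ) (norm_nonneg _)).trans (le_of_eq ?_)
    ring

end

section
variable {d : ℕ} {ω : ℝ → ℝ} {m ρ : ℝ}

/-- Uniform decay of the inner integral of the operator of an amplitude: nearby part. -/
lemma exists_norm_integral_cutoff_le (hω : IsWeightFunction ω) (hρ : 0 < ρ) (hρ1 : ρ ≤ 1) (hm : 0 ≤ m)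
    {Φ : Eucl d × Eucl d → ℂ} {q : ℕ} {VΦ W : ℕ → ℝ} (hc : IsCutoff ω ρ Φ q VΦ) (hW : Adm ω ρ W)
    {f : Eucl d → ℂ} (hf : f ∈ SOmega ω d) (x : Eucl d) :
    ∃ C : ℝ, 0 < C ∧ ∀ b : Eucl d × Eucl d × Eucl d → ℂ, ContDiff ℝ (⊤ : ℕ∞) b →
      AmpBound ω m ρ W b → ∀ ξ : Eucl d, 1 ≤ ‖ξ‖ →
      ‖∫ y, phase (-ξ) y * (b (x, y, ξ) * Φ (‖ξ‖⁻¹ • y, 0) * f y)‖ ≤ C * Real.exp (-ω ‖ξ‖) := by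
  obtain ⟨Vf, hVf, hVfb⟩ := exists_adm_of_mem_SOmega hω hf
  have hT := ((hW.of_le_one hω hρ1).pow_mul hω one_pos zero_le_two).leibniz hω one_pos
    (hc.adm.of_le_one hω hρ1) |>.leibniz hω one_pos hVf
  set T : ℕ → ℝ := fun k => ∑ i ∈ Finset.range (k + 1), (k.choose i : ℝ) *
    (∑ j ∈ Finset.range (i + 1), (i.choose j : ℝ) * (2 ^ j * W j) * VΦ (i - j)) * Vf (k - i) with hTdef
  have hT : Adm ω 1 T := hT
  obtain ⟨L, hL1, hL⟩ := hω.scale (B := 2 ^ q + ‖x‖) (by positivity)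
  obtain ⟨C₁, hC₁, h₁⟩ := hω.pow_mul_exp_neg_le d
  -- The multiple 3mL is spent on the amplitude weight, one unit of ω on the volume |ξ|^d, and one
  -- unit is left as the final decay.
  obtain ⟨n, hn⟩ := exists_nat_ge (2 + 3 * m * L)
  obtain ⟨C, hC, hCd⟩ := (hT.pow_mul hω one_pos (B := d + 1) (by positivity)).decay hω one_pos n
  set v := volume.real (Metric.closedBall (0 : Eucl d) 1)
  have hv : 0 ≤ v := measureReal_nonneg
  refine ⟨C * Real.exp (3 * m * L) * C₁ * ((2 ^ q) ^ d * v + 1), by positivity,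
    fun b hbs hb ξ hξ => ?_⟩
  obtain ⟨τ, hτ⟩ : ∃ τ, τ = ‖ξ‖ := ⟨_, rfl⟩
  rw [← hτ] at hξ ⊢
  have hτ0 : 0 < τ := by linarith
  set Λ := L * (ω τ + 1) with hΛ
  set E := Real.exp (3 * m * Λ) with hE
  have hq1 : (1 : ℝ) ≤ 2 ^ q := one_le_pow₀ one_le_two
  have hx0 := norm_nonneg x
  have hΛle : ∀ u, 0 ≤ u → u ≤ (2 ^ q + ‖x‖) * τ → ω u ≤ Λ := fun u hu hus =>
    (hω.le_of_le hu hus).trans (hL τ hτ0.le)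
  set A : Eucl d →L[ℝ] Eucl d × Eucl d :=
    (ContinuousLinearMap.inl ℝ (Eucl d) (Eucl d)).comp
      (τ⁻¹ • ContinuousLinearMap.id ℝ (Eucl d)) with hA
  have hAe : ∀ y, A y + 0 = (τ⁻¹ • y, 0) := fun y => by rw [hA]; simp
  have hA1 : ‖A‖ ≤ 1 := by
    refine ContinuousLinearMap.opNorm_le_bound _ zero_le_one fun y => ?_
    have e : ‖A y‖ = τ⁻¹ * ‖y‖ := by
      rw [← add_zero (A y), hAe, Prod.norm_def, norm_zero, norm_smul, Real.norm_of_nonneg (by positivity)]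
      exact max_eq_left (by positivity)
    rw [e]
    exact mul_le_mul_of_nonneg_right (inv_le_one_of_one_le₀ hξ) (norm_nonneg _)
  have hχs : ContDiff ℝ (⊤ : ℕ∞) fun y : Eucl d => Φ (τ⁻¹ • y, 0) := by
    have : ContDiff ℝ (⊤ : ℕ∞) fun y : Eucl d => (τ⁻¹ • y, (0 : Eucl d)) := by fun_prop
    exact hc.smooth.comp this
  have hχ : ∀ k y, ‖iteratedFDeriv ℝ k (fun y : Eucl d => Φ (τ⁻¹ • y, 0)) y‖ ≤ VΦ k := fun k y => by
    have h1 := norm_iteratedFDeriv_comp_clm_le hc.smooth A hA1 0 k y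
    simp only [hAe] at h1
    exact h1.trans (hc.bound k _)
  have hbs' : ContDiff ℝ (⊤ : ℕ∞) fun y : Eucl d => b (x, y, ξ) := by
    have : ContDiff ℝ (⊤ : ℕ∞) fun y : Eucl d => (x, y, ξ) := by fun_prop
    exact hbs.comp this
  have hhs : ContDiff ℝ (⊤ : ℕ∞) fun y : Eucl d => b (x, y, ξ) * Φ (τ⁻¹ • y, 0) * f y :=
    (hbs'.mul hχs).mul hf.2.1
  have hs : ∀ y : Eucl d, 2 ^ q * τ < ‖y‖ → b (x, y, ξ) * Φ (τ⁻¹ • y, 0) * f y = 0 := fun y hy => by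
    rw [hc.zero, mul_zero, zero_mul]
    refine le_trans ?_ (norm_fst_le (τ⁻¹ • y, (0 : Eucl d)))
    rw [norm_smul, Real.norm_of_nonneg (by positivity), inv_mul_eq_div, le_div_iff₀ hτ0]
    exact hy.le
  have hB : ∀ M, ∀ y : Eucl d, ‖y‖ ≤ 2 ^ q * τ →
      ‖iteratedFDeriv ℝ M (fun y : Eucl d => b (x, y, ξ) * Φ (τ⁻¹ • y, 0) * f y) y‖ ≤ T M * E := by
    intro M y hy
    have hxc : ‖x‖ ≤ (2 ^ q + ‖x‖) * τ := by nlinarith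
    have hyc : ‖y‖ ≤ (2 ^ q + ‖x‖) * τ := by nlinarith
    have hξc : ‖ξ‖ ≤ (2 ^ q + ‖x‖) * τ := by rw [← hτ]; nlinarith
    have hw : m * ampWeight ω (x, y, ξ) ≤ 3 * m * Λ :=
      ExpansionData.ampWeight_le hω (w := (x, y, ξ)) hΛle hxc hyc hξc le_rfl hm
    have h1 : ∀ k, ‖iteratedFDeriv ℝ k (fun y => b (x, y, ξ)) y‖ ≤ 2 ^ k * W k * E := fun k => by
      refine (hb.norm_iteratedFDeriv_slice_le hρ hρ1 hW.nonneg hbs k x y ξ).trans ?_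
      have := hW.nonneg k
      exact mul_le_mul_of_nonneg_left (Real.exp_le_exp.2 hw) (by positivity)
    have h2 := norm_iteratedFDeriv_mul_le_of_le hbs' hχs h1 fun k => hχ k y
    have h3 := norm_iteratedFDeriv_mul_le_of_le (hbs'.mul hχs) hf.2.1 h2 (fun k => hVfb k y) M
    refine h3.trans (le_of_eq ?_)
    rw [hTdef]
    simp only
    rw [Finset.sum_mul]
    refine Finset.sum_congr rfl fun i _ => ?_
    have e : ∑ j ∈ Finset.range (i + 1), (i.choose j : ℝ) * (2 ^ j * W j * E) * VΦ (i - j) =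
        (∑ j ∈ Finset.range (i + 1), (i.choose j : ℝ) * (2 ^ j * W j) * VΦ (i - j)) * E := by
      rw [Finset.sum_mul]
      exact Finset.sum_congr rfl fun j _ => by ring
    rw [e]
    ring
  have hξ0 : ξ ≠ 0 := norm_pos_iff.1 (by linarith)
  obtain ⟨i, hi⟩ := exists_norm_le_mul_coord hξ0
  -- The number of integrations by parts in y is optimized at |ξ|, against the admissible bounds for
  -- the product of the amplitude, the cutoff and f.
  obtain ⟨M, hM⟩ := hCd τ hξ
  rw [one_mul, Real.rpow_natCast] at hM
  have main := abs_inner_pow_mul_norm_integral_phase_le hhs hs (-ξ) (v := stdVec d i)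
    (norm_stdVec i).le M (hB M)
  have hin : |inner ℝ (-ξ) (stdVec d i)| = |ξ i| := by
    rw [inner_neg_left, abs_neg, stdVec, EuclideanSpace.inner_single_right]
    simp
  rw [hin] at main
  set I := ‖∫ y, phase (-ξ) y * (b (x, y, ξ) * Φ (τ⁻¹ • y, 0) * f y)‖
  have hI : 0 ≤ I := norm_nonneg _
  have hvol : volume.real (Metric.closedBall (0 : Eucl d) (2 ^ q * τ)) ≤
      τ ^ d * ((2 ^ q) ^ d * v + 1) := by
    rw [volume_closedBall_eq d (by positivity), mul_pow]
    have : 0 ≤ τ ^ d := by positivity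
    calc _ = τ ^ d * ((2 ^ q) ^ d * v) := by ring
      _ ≤ _ := by gcongr; linarith
  have hTM := hT.nonneg M
  have hE0 : 0 < E := Real.exp_pos _
  have h5 : τ ^ M * I ≤ τ ^ M * (C * Real.exp (-(n * ω τ)) * E *
      (τ ^ d * ((2 ^ q) ^ d * v + 1))) := by
    calc τ ^ M * I ≤ ((d + 1) * |ξ i|) ^ M * I := by rw [← hτ] at hi; gcongr
      _ = (d + 1) ^ M * (|ξ i| ^ M * I) := by rw [mul_pow, mul_assoc]
      _ ≤ (d + 1) ^ M * (T M * E * (τ ^ d * ((2 ^ q) ^ d * v + 1))) := by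
          refine mul_le_mul_of_nonneg_left (main.trans ?_) (by positivity)
          gcongr
      _ = ((d + 1) ^ M * T M) * E * (τ ^ d * ((2 ^ q) ^ d * v + 1)) := by ring
      _ ≤ (C * Real.exp (-(n * ω τ)) * τ ^ M) * E * (τ ^ d * ((2 ^ q) ^ d * v + 1)) := by gcongr
      _ = _ := by ring
  have h6 := le_of_mul_le_mul_left h5 (by positivity)
  have hω0 := hω.nonneg hτ0.le
  have h7 : τ ^ d ≤ C₁ * Real.exp (ω τ) := by
    have := h₁ τ hτ0.le
    rw [Real.exp_neg, ← div_eq_mul_inv, div_le_iff₀ (Real.exp_pos _)] at this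
    exact (pow_le_pow_left₀ hτ0.le (by linarith) d).trans this
  have h8 : Real.exp (-(n * ω τ)) * E * Real.exp (ω τ) ≤ Real.exp (3 * m * L) * Real.exp (-ω τ) := by
    rw [hE, ← Real.exp_add, ← Real.exp_add, ← Real.exp_add, hΛ]
    refine Real.exp_le_exp.2 ?_
    have := mul_le_mul_of_nonneg_right hn hω0
    linarith
  calc I ≤ _ := h6
    _ ≤ C * Real.exp (-(n * ω τ)) * E * ((C₁ * Real.exp (ω τ)) * ((2 ^ q) ^ d * v + 1)) := by gcongr
    _ = C * C₁ * ((2 ^ q) ^ d * v + 1) * (Real.exp (-(n * ω τ)) * E * Real.exp (ω τ)) := by ring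
    _ ≤ C * C₁ * ((2 ^ q) ^ d * v + 1) * (Real.exp (3 * m * L) * Real.exp (-ω τ)) := by gcongr
    _ = _ := by ring

/-- Uniform decay of the inner integral of the operator of an amplitude. -/
lemma exists_norm_integral_amp_le (hω : IsWeightFunction ω) (hρ : 0 < ρ) (hρ1 : ρ ≤ 1) (hm : 0 ≤ m)
    {Φ : Eucl d × Eucl d → ℂ} {q : ℕ} {VΦ W : ℕ → ℝ} (hc : IsCutoff ω ρ Φ q VΦ) (hW : Adm ω ρ W)
    {f : Eucl d → ℂ} (hf : f ∈ SOmega ω d) (x : Eucl d) :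
    ∃ C : ℝ, 0 < C ∧ ∀ b : Eucl d × Eucl d × Eucl d → ℂ, ContDiff ℝ (⊤ : ℕ∞) b →
      AmpBound ω m ρ W b → ∀ ξ : Eucl d,
      ‖∫ y, phase (x - y) ξ * b (x, y, ξ) * f y‖ ≤ C * Real.exp (-ω ‖ξ‖) := by
  obtain ⟨C₁, hC₁, h₁⟩ := exists_norm_integral_cutoff_le hω hρ hρ1 hm hc hW hf x
  -- Where |y| ≥ |ξ|, the factor e^{(2m+1)ω(y)} covers e^{mω(y)}, e^{mω(ξ)} and the desired gain
  -- e^{ω(ξ)}.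
  have hi := integrable_exp_mul_norm_of_mem_SOmega hω hf (c := 2 * m + 1) (by positivity)
  set J := ∫ y, Real.exp ((2 * m + 1) * ω ‖y‖) * ‖f y‖ with hJ
  have hJ0 : 0 ≤ J := integral_nonneg fun y => by positivity
  have hW0 := hW.nonneg 0
  have hw0 : ∀ x : Eucl d, 0 ≤ ω ‖x‖ := fun x => hω.nonneg (norm_nonneg x)
  refine ⟨C₁ + 2 * (W 0 * Real.exp (m * ω ‖x‖) * J), by positivity, fun b hbs hb ξ => ?_⟩
  rcases le_total ‖ξ‖ 1 with hξ | hξ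
  · have hξ0 := hω.zero_of_le_one _ (norm_nonneg ξ) hξ
    have : ‖∫ y, phase (x - y) ξ * b (x, y, ξ) * f y‖ ≤ W 0 * Real.exp (m * ω ‖x‖) * J := by
      rw [hJ, ← integral_const_mul]
      refine norm_integral_le_of_norm_le (hi.const_mul _) (Filter.Eventually.of_forall fun y => ?_)
      rw [norm_mul, norm_mul, norm_phase, one_mul]
      have h2 := hb.norm_le x y ξ
      rw [hξ0, mul_zero, Real.exp_zero, mul_one] at h2
      have h3 : Real.exp (m * ω ‖y‖) ≤ Real.exp ((2 * m + 1) * ω ‖y‖) :=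
        Real.exp_le_exp.2 (mul_le_mul_of_nonneg_right (by linarith) (hw0 y))
      calc _ ≤ W 0 * (Real.exp (m * ω ‖x‖) * Real.exp ((2 * m + 1) * ω ‖y‖)) * ‖f y‖ := by
            refine mul_le_mul_of_nonneg_right (h2.trans ?_) (norm_nonneg _)
            gcongr
        _ = _ := by ring
    rw [hξ0, neg_zero, Real.exp_zero, mul_one]
    have h4 : 0 ≤ W 0 * Real.exp (m * ω ‖x‖) * J := by positivity
    linarith
  · have hτ0 : 0 < ‖ξ‖ := by linarith
    have hI := integrable_amp_mul hω hf hm hbs hb x ξ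
    have hfun : Continuous fun y : Eucl d => (‖ξ‖⁻¹ • y, (0 : Eucl d)) := by fun_prop
    have hΦc : Continuous fun y : Eucl d => Φ (‖ξ‖⁻¹ • y, 0) := hc.smooth.continuous.comp hfun
    have hI1 : Integrable fun y => Φ (‖ξ‖⁻¹ • y, 0) * (phase (x - y) ξ * b (x, y, ξ) * f y) :=
      hI.bdd_mul hΦc.aestronglyMeasurable (c := 1) (Filter.Eventually.of_forall fun y => hc.norm_le _)
    -- The integral is split with a cutoff at |y| of size |ξ|: the near part oscillates and is
    -- integrated by parts, while the far part only sees |y| ≥ |ξ| and inherits decay in ξ from f.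
    have e0 : ∫ y, phase (x - y) ξ * b (x, y, ξ) * f y =
        phase x ξ * (∫ y, phase (-ξ) y * (b (x, y, ξ) * Φ (‖ξ‖⁻¹ • y, 0) * f y)) +
        ∫ y, (phase (x - y) ξ * b (x, y, ξ) * f y -
          Φ (‖ξ‖⁻¹ • y, 0) * (phase (x - y) ξ * b (x, y, ξ) * f y)) := by
      rw [integral_sub hI hI1, ← integral_const_mul, ← add_sub_assoc, eq_sub_iff_add_eq, add_comm]
      congr 1
      refine integral_congr_ae (Filter.Eventually.of_forall fun y => ?_)
      simp only
      rw [phase_sub]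
      ring
    rw [e0]
    refine (norm_add_le _ _).trans ?_
    rw [norm_mul, norm_phase, one_mul, add_mul]
    refine add_le_add (h₁ b hbs hb ξ hξ) ?_
    have hconst : 2 * (W 0 * Real.exp (m * ω ‖x‖) * J) * Real.exp (-ω ‖ξ‖) =
        ∫ y, 2 * (W 0 * Real.exp (m * ω ‖x‖)) * Real.exp (-ω ‖ξ‖) *
          (Real.exp ((2 * m + 1) * ω ‖y‖) * ‖f y‖) := by
      rw [integral_const_mul, ← hJ]
      ring
    rw [hconst]
    refine norm_integral_le_of_norm_le (hi.const_mul _) (Filter.Eventually.of_forall fun y => ?_)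
    rcases le_total ‖y‖ ‖ξ‖ with hy | hy
    · rw [hc.one, one_mul, sub_self, norm_zero]
      · positivity
      · rw [Prod.norm_def, norm_zero, norm_smul, norm_inv, norm_norm, inv_mul_eq_div]
        exact max_le ((div_le_one hτ0).2 hy) zero_le_one
    · have h2 := hb.norm_le x y ξ
      have hωle := hω.le_of_le hτ0.le hy
      have h3 : Real.exp (m * ω ‖y‖) * Real.exp (m * ω ‖ξ‖) ≤
          Real.exp (-ω ‖ξ‖) * Real.exp ((2 * m + 1) * ω ‖y‖) := by
        rw [← Real.exp_add, ← Real.exp_add]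
        refine Real.exp_le_exp.2 ?_
        nlinarith
      have h4 : ‖phase (x - y) ξ * b (x, y, ξ) * f y‖ ≤ W 0 * Real.exp (m * ω ‖x‖) *
          (Real.exp (-ω ‖ξ‖) * Real.exp ((2 * m + 1) * ω ‖y‖)) * ‖f y‖ := by
        rw [norm_mul, norm_mul, norm_phase, one_mul]
        refine mul_le_mul_of_nonneg_right (h2.trans ?_) (norm_nonneg _)
        rw [mul_assoc (Real.exp (m * ω ‖x‖)), ← mul_assoc]
        gcongr
      have h5 : ‖Φ (‖ξ‖⁻¹ • y, 0) * (phase (x - y) ξ * b (x, y, ξ) * f y)‖ ≤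
          ‖phase (x - y) ξ * b (x, y, ξ) * f y‖ := by
        rw [norm_mul]
        exact mul_le_of_le_one_left (norm_nonneg _) (hc.norm_le _)
      refine (norm_sub_le _ _).trans ?_
      calc _ ≤ 2 * (W 0 * Real.exp (m * ω ‖x‖) *
            (Real.exp (-ω ‖ξ‖) * Real.exp ((2 * m + 1) * ω ‖y‖)) * ‖f y‖) := by linarith
        _ = _ := by ring

end

/-! ### Fubini, summation of the pieces and conclusion -/

open Filter Topology

section
variable {d : ℕ} {ω : ℝ → ℝ} {m ρ : ℝ} {b : Eucl d × Eucl d × Eucl d → ℂ} {f : Eucl d → ℂ}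

lemma opAmp_eq (b : Eucl d × Eucl d × Eucl d → ℂ) (f : Eucl d → ℂ) (x : Eucl d) :
    opAmp b f x = ∫ ξ, ∫ y, phase (x - y) ξ * b (x, y, ξ) * f y := rfl

lemma continuous_amp_integrand (hbs : ContDiff ℝ (⊤ : ℕ∞) b) (hf : Continuous f) (x : Eucl d) :
    Continuous fun p : Eucl d × Eucl d => phase (x - p.2) p.1 * b (x, p.2, p.1) * f p.2 := by
  have h1 : Continuous fun p : Eucl d × Eucl d => phase (x - p.2) p.1 :=
    contDiff_phase.continuous.comp (by fun_prop : Continuous fun p : Eucl d × Eucl d => (x - p.2, p.1))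
  have h2 : Continuous fun p : Eucl d × Eucl d => b (x, p.2, p.1) :=
    hbs.continuous.comp (by fun_prop : Continuous fun p : Eucl d × Eucl d => (x, p.2, p.1))
  exact (h1.mul h2).mul (hf.comp continuous_snd)

lemma aestronglyMeasurable_integral_amp (hbs : ContDiff ℝ (⊤ : ℕ∞) b) (hf : Continuous f) (x : Eucl d) :
    AEStronglyMeasurable fun ξ => ∫ y, phase (x - y) ξ * b (x, y, ξ) * f y :=
  (StronglyMeasurable.integral_prod_right
    (f := fun ξ y => phase (x - y) ξ * b (x, y, ξ) * f y)
    (continuous_amp_integrand hbs hf x).stronglyMeasurable).aestronglyMeasurable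

lemma integrable_exp_neg_weight (hω : IsWeightFunction ω) (C : ℝ) :
    Integrable fun ξ : Eucl d => C * Real.exp (-ω ‖ξ‖) := by
  have := (hω.integrable_pow_mul_exp_neg d 0).const_mul C
  simpa only [pow_zero, one_mul] using this

/-- Fubini's theorem for amplitudes with compact support in the frequency variable. -/
lemma opAmp_eq_integral_osc (hω : IsWeightFunction ω) (hm : 0 ≤ m) {W : ℕ → ℝ} (hW : 0 ≤ W 0)
    (hbs : ContDiff ℝ (⊤ : ℕ∞) b) (hb : AmpBound ω m ρ W b) {s : ℝ}
    (hs : ∀ w : Eucl d × Eucl d × Eucl d, s < ‖w.2.2‖ → b w = 0) (hf : f ∈ SOmega ω d) (x : Eucl d) :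
    opAmp b f x = ∫ y, osc b (x, y) * f y := by
  rw [opAmp_eq]
  set G : Eucl d → ℝ := (Metric.closedBall (0 : Eucl d) s).indicator fun _ =>
    W 0 * Real.exp (m * ω ‖x‖) * Real.exp (m * ω s) with hG
  have hGi : Integrable G := by
    refine (integrable_indicator_iff measurableSet_closedBall).2 ?_
    exact integrableOn_const measure_closedBall_lt_top.ne
  have hi := hGi.mul_prod (integrable_exp_mul_norm_of_mem_SOmega hω hf hm)
  have hI : Integrable (Function.uncurry fun ξ y => phase (x - y) ξ * b (x, y, ξ) * f y)
      (volume.prod volume) := by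
    refine hi.mono' (continuous_amp_integrand hbs hf.2.1.continuous x).aestronglyMeasurable
      (Eventually.of_forall fun p => ?_)
    obtain ⟨ξ, y⟩ := p
    simp only [Function.uncurry_apply_pair]
    rw [norm_mul, norm_mul, norm_phase, one_mul]
    rcases lt_or_ge s ‖ξ‖ with hξ | hξ
    · have h0 : b (x, y, ξ) = 0 := hs (x, y, ξ) hξ
      rw [h0, norm_zero, zero_mul]
      refine mul_nonneg (Set.indicator_nonneg (fun _ _ => by positivity) _) (by positivity)
    · have hmem : ξ ∈ Metric.closedBall (0 : Eucl d) s := by simpa using hξ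
      rw [hG, Set.indicator_of_mem hmem]
      have h1 := hb.norm_le x y ξ
      have h2 := hω.le_of_le (norm_nonneg ξ) hξ
      calc _ ≤ W 0 * (Real.exp (m * ω ‖x‖) * Real.exp (m * ω ‖y‖) * Real.exp (m * ω s)) * ‖f y‖ := by
            refine mul_le_mul_of_nonneg_right (h1.trans ?_) (norm_nonneg _)
            gcongr
        _ = _ := by ring
  rw [integral_integral_swap hI]
  refine integral_congr_ae (Eventually.of_forall fun y => ?_)
  simp only
  rw [integral_mul_const]
  rfl

/-- The double integral need not converge absolutely, so linearity is used first in y and then in ξ;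
the second step requires integrability of the inner integrals. -/
lemma opAmp_sub {a : Eucl d × Eucl d × Eucl d → ℂ} (hω : IsWeightFunction ω) (hm : 0 ≤ m)
    (has : ContDiff ℝ (⊤ : ℕ∞) a) (hbs : ContDiff ℝ (⊤ : ℕ∞) b) {W W' : ℕ → ℝ}
    (ha : AmpBound ω m ρ W a) (hb : AmpBound ω m ρ W' b) (hf : f ∈ SOmega ω d) (x : Eucl d)
    (hia : Integrable fun ξ => ∫ y, phase (x - y) ξ * a (x, y, ξ) * f y)
    (hib : Integrable fun ξ => ∫ y, phase (x - y) ξ * b (x, y, ξ) * f y) :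
    opAmp (fun w => a w - b w) f x = opAmp a f x - opAmp b f x := by
  rw [opAmp_eq, opAmp_eq, opAmp_eq, ← integral_sub hia hib]
  refine integral_congr_ae (Eventually.of_forall fun ξ => ?_)
  simp only
  rw [← integral_sub (integrable_amp_mul hω hf hm has ha x ξ) (integrable_amp_mul hω hf hm hbs hb x ξ)]
  refine integral_congr_ae (Eventually.of_forall fun y => ?_)
  simp only
  ring

end

namespace ExpansionData
variable {d : ℕ} {ω : ℝ → ℝ} {m ρ : ℝ} {a : Eucl d × Eucl d × Eucl d → ℂ}
  {Φ : Eucl d × Eucl d → ℂ} {q : ℕ} {VΦ V U : ℕ → ℝ} {N : ℕ → ℕ}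
  (h : ExpansionData ω m ρ a Φ q VΦ V U N)
include h

lemma integrable_integral_amp {b : Eucl d × Eucl d × Eucl d → ℂ} {f : Eucl d → ℂ} {m' : ℝ}
    (hm : 0 ≤ m') {W : ℕ → ℝ} (hW : Adm ω ρ W) (hbs : ContDiff ℝ (⊤ : ℕ∞) b)
    (hb : AmpBound ω m' ρ W b) (hf : f ∈ SOmega ω d) (x : Eucl d) :
    Integrable fun ξ => ∫ y, phase (x - y) ξ * b (x, y, ξ) * f y := by
  obtain ⟨C, _, hC⟩ := exists_norm_integral_amp_le h.weight h.rho_pos h.rho_le hm h.cut hW hf x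
  exact (integrable_exp_neg_weight h.weight C).mono'
    (aestronglyMeasurable_integral_amp hbs hf.2.1.continuous x)
    (Eventually.of_forall fun ξ => hC b hbs hb ξ)

omit h in
lemma le_two_mul_abs : m ≤ 2 * |m| ∧ max m (2 * m) ≤ 2 * |m| := by
  have h1 := le_abs_self m
  have h2 := abs_nonneg m
  exact ⟨by linarith, max_le (by linarith) (by linarith)⟩

lemma contDiff_symSeries_amp : ContDiff ℝ (⊤ : ℕ∞)
    fun w : Eucl d × Eucl d × Eucl d => symSeries Φ a N (w.1, w.2.2) := by
  have h1 : ContDiff ℝ (⊤ : ℕ∞) fun w : Eucl d × Eucl d × Eucl d => (w.1, w.2.2) := by fun_prop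
  exact h.contDiff_symSeries.comp h1

lemma ampBound_of_symBound {p : Eucl d × Eucl d → ℂ} (hp : ContDiff ℝ (⊤ : ℕ∞) p)
    (hb : SymBound ω (max m (2 * m)) ρ (fun k => (q + 4) * ((U 0 + 2) * U k)) p) :
    AmpBound ω (2 * |m|) ρ (fun k => 2 ^ k * ((q + 4) * ((U 0 + 2) * U k)))
      fun w => p (w.1, w.2.2) :=
  SymBound.ampBound h.rho_pos h.rho_le h.weight hp h.adm_symBound.nonneg le_two_mul_abs.2
    (by positivity) hb

lemma adm_sub : Adm ω ρ fun k => V k + 2 ^ k * ((q + 4) * ((U 0 + 2) * U k)) :=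
  h.adm.add (h.adm_symBound.pow_mul h.weight h.rho_pos zero_le_two)

lemma ampBound_sub_symSeries : AmpBound ω (2 * |m|) ρ
    (fun k => V k + 2 ^ k * ((q + 4) * ((U 0 + 2) * U k)))
    fun w => a w - symSeries Φ a N (w.1, w.2.2) :=
  AmpBound.sub h.smooth h.contDiff_symSeries_amp
    (h.amp.mono_exp h.weight h.adm.nonneg le_two_mul_abs.1)
    (h.ampBound_of_symBound h.contDiff_symSeries h.symBound_symSeries)

/-- The partition telescopes: the pieces of the amplitude sum to one dilated cutoff times a, so the
constants do not grow with the number of pieces. -/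
lemma ampBound_sum_remPiece (T : ℕ) : AmpBound ω (2 * |m|) ρ
    (fun k => V k + 2 ^ k * ((q + 4) * ((U 0 + 2) * U k)))
    fun w => ∑ ν ∈ Finset.range (T + 1), remPiece Φ a N ν w := by
  have e : (fun w => ∑ ν ∈ Finset.range (T + 1), remPiece Φ a N ν w) = fun w =>
      Φ ((2 ^ T : ℝ)⁻¹ • (w.1, w.2.2)) * a w -
        ∑ ν ∈ Finset.range (T + 1), symPiece Φ a N ν (w.1, w.2.2) := by
    ext w
    simp only [remPiece, piece]
    rw [Finset.sum_sub_distrib, ← Finset.sum_mul, sum_dyadic]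
  rw [e]
  have hp : ContDiff ℝ (⊤ : ℕ∞) fun z => ∑ ν ∈ Finset.range (T + 1), symPiece Φ a N ν z :=
    ContDiff.sum fun ν _ => h.contDiff_symPiece ν
  have h1 : ContDiff ℝ (⊤ : ℕ∞) fun w : Eucl d × Eucl d × Eucl d => (w.1, w.2.2) := by fun_prop
  have h2 : ContDiff ℝ (⊤ : ℕ∞)
      fun w : Eucl d × Eucl d × Eucl d => (2 ^ T : ℝ)⁻¹ • (w.1, w.2.2) := by fun_prop
  have hs1 : ContDiff ℝ (⊤ : ℕ∞)
      fun w : Eucl d × Eucl d × Eucl d => Φ ((2 ^ T : ℝ)⁻¹ • (w.1, w.2.2)) * a w :=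
    (h.cut.smooth.comp h2).mul h.smooth
  have hs2 : ContDiff ℝ (⊤ : ℕ∞) fun w : Eucl d × Eucl d × Eucl d =>
      ∑ ν ∈ Finset.range (T + 1), symPiece Φ a N ν (w.1, w.2.2) := hp.comp h1
  have hb1 : AmpBound ω (2 * |m|) ρ V fun w => Φ ((2 ^ T : ℝ)⁻¹ • (w.1, w.2.2)) * a w :=
    (h.amp_scale T).mono_exp h.weight h.adm.nonneg le_two_mul_abs.1
  have hb2 := h.ampBound_of_symBound hp (h.symBound_sum_symPiece (T + 1))
  exact AmpBound.sub hs1 hs2 hb1 hb2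

/-- The operator of the remainder is the sum of the operators of its pieces. -/
lemma tendsto_opAmp_sum_remPiece {f : Eucl d → ℂ} (hf : f ∈ SOmega ω d) (x : Eucl d) :
    Tendsto (fun T => opAmp (fun w => ∑ ν ∈ Finset.range (T + 1), remPiece Φ a N ν w) f x) atTop
      (𝓝 (opAmp (fun w => a w - symSeries Φ a N (w.1, w.2.2)) f x)) := by
  have hm : (0 : ℝ) ≤ 2 * |m| := by positivity
  have hs : ∀ T, ContDiff ℝ (⊤ : ℕ∞)
      fun w => ∑ ν ∈ Finset.range (T + 1), remPiece Φ a N ν w := fun T =>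
    ContDiff.sum fun ν _ => h.contDiff_remPiece ν
  obtain ⟨C, _, hC⟩ := exists_norm_integral_amp_le h.weight h.rho_pos h.rho_le hm h.cut h.adm_sub hf x
  simp only [opAmp_eq]
  -- For fixed ξ the inner integrals are eventually constant in T; the majorant is the decay of
  -- inner integrals, uniform over amplitudes with the same constants.
  refine tendsto_integral_of_dominated_convergence (fun ξ => C * Real.exp (-ω ‖ξ‖))
    (fun T => aestronglyMeasurable_integral_amp (hs T) hf.2.1.continuous x)
    (integrable_exp_neg_weight h.weight C)
    (fun T => Eventually.of_forall fun ξ => hC _ (hs T) (h.ampBound_sum_remPiece T) ξ)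
    (Eventually.of_forall fun ξ => ?_)
  obtain ⟨T₀, hT₀⟩ := pow_unbounded_of_one_lt (2 + 4 * ‖(x, ξ)‖) (one_lt_two (α := ℝ))
  refine tendsto_const_nhds.congr' ((eventually_ge_atTop T₀).mono fun T hT => ?_)
  have hT' : 2 + 4 * ‖(x, ξ)‖ < 2 ^ (T + 1) :=
    hT₀.trans_le (pow_le_pow_right₀ one_le_two (by omega))
  refine integral_congr_ae (Eventually.of_forall fun y => ?_)
  simp only [remPiece]
  rw [Finset.sum_sub_distrib, h.sum_piece_eq (w := (x, y, ξ)) hT', ← h.symSeries_eq_sum (z := (x, ξ)) hT']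

lemma opAmp_sum_remPiece {f : Eucl d → ℂ} (hf : f ∈ SOmega ω d) (x : Eucl d) (T : ℕ) :
    opAmp (fun w => ∑ ν ∈ Finset.range T, remPiece Φ a N ν w) f x =
      ∑ ν ∈ Finset.range T, ∫ y, osc (remPiece Φ a N ν) (x, y) * f y := by
  have hm : (0 : ℝ) ≤ 2 * |m| := by positivity
  have hWadm : Adm ω ρ fun k => V k + 2 ^ k * ((U 0 + 2) * U k) :=
    h.adm.add ((h.admU.const_mul (by linarith [h.one_le 0])).pow_mul h.weight h.rho_pos zero_le_two)
  have e1 : ∀ ν, ∫ y, osc (remPiece Φ a N ν) (x, y) * f y =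
      ∫ ξ, ∫ y, phase (x - y) ξ * remPiece Φ a N ν (x, y, ξ) * f y := fun ν =>
    (opAmp_eq_integral_osc h.weight hm (hWadm.nonneg 0) (h.contDiff_remPiece ν) (h.ampBound_remPiece ν)
      (s := 2 ^ (ν + q)) (fun w hw => h.remPiece_eq_zero (not_isActive_of_snd hw)) hf x).symm
  rw [Finset.sum_congr rfl fun ν _ => e1 ν, ← integral_finsetSum _ fun ν _ =>
    h.integrable_integral_amp hm hWadm (h.contDiff_remPiece ν) (h.ampBound_remPiece ν) hf x, opAmp_eq]
  refine integral_congr_ae (Eventually.of_forall fun ξ => ?_)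
  simp only
  rw [← integral_finsetSum _ fun ν _ =>
    integrable_amp_mul h.weight hf hm (h.contDiff_remPiece ν) (h.ampBound_remPiece ν) x ξ]
  refine integral_congr_ae (Eventually.of_forall fun y => ?_)
  simp only
  rw [Finset.mul_sum, Finset.sum_mul]

lemma hasSum_integral_osc {f : Eucl d → ℂ} (hf : f ∈ SOmega ω d) (x : Eucl d) :
    HasSum (fun ν => ∫ y, osc (remPiece Φ a N ν) (x, y) * f y)
      (∫ y, remKernel Φ a N (pairVec x y) * f y) := by
  have hω := h.weight
  obtain ⟨C, hC, hb⟩ := h.exists_norm_osc_le 1 one_pos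
  have hb' : ∀ ν y, ‖osc (remPiece Φ a N ν) (x, y)‖ ≤ C * wt ω 1 1 0 * (1 / 2) ^ ν := fun ν y => by
    have h1 := hb ν 0 (x, y)
    rw [norm_iteratedFDeriv_zero] at h1
    refine h1.trans ?_
    have hw := wt_pos ω 1 1 0
    have e1 : Real.exp (-(((1 : ℕ) : ℝ) * ω ‖x‖)) ≤ 1 :=
      Real.exp_le_one_iff.2 (by have := hω.nonneg (norm_nonneg x); push_cast; linarith)
    have e2 : Real.exp (-(((1 : ℕ) : ℝ) * ω ‖y‖)) ≤ 1 :=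
      Real.exp_le_one_iff.2 (by have := hω.nonneg (norm_nonneg y); push_cast; linarith)
    calc _ ≤ C * (1 / 2) ^ ν * wt ω 1 1 0 * 1 * 1 := by gcongr
      _ = _ := by ring
  have hc : ∀ ν, Continuous fun y => osc (remPiece Φ a N ν) (x, y) := fun ν =>
    (h.contDiff_osc_remPiece ν).continuous.comp (Continuous.prodMk_right x)
  have hi : ∀ ν, Integrable fun y => osc (remPiece Φ a N ν) (x, y) * f y := fun ν =>
    hf.1.bdd_mul (hc ν).aestronglyMeasurable (Eventually.of_forall (hb' ν))
  have hsum : Summable fun ν => ∫ y, ‖osc (remPiece Φ a N ν) (x, y) * f y‖ := by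
    refine Summable.of_nonneg_of_le (fun ν => integral_nonneg fun y => norm_nonneg _) (fun ν => ?_)
      (summable_geometric_two.mul_left (C * wt ω 1 1 0 * ∫ y, ‖f y‖))
    have : ∫ y, ‖osc (remPiece Φ a N ν) (x, y) * f y‖ ≤ ∫ y, C * wt ω 1 1 0 * (1 / 2) ^ ν * ‖f y‖ := by
      refine integral_mono (hi ν).norm (hf.1.norm.const_mul _) fun y => ?_
      simp only
      rw [norm_mul]
      exact mul_le_mul_of_nonneg_right (hb' ν y) (norm_nonneg _)
    rw [integral_const_mul] at this
    linarith
  have key := hasSum_integral_of_summable_integral_norm hi hsum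
  have e : ∀ y, remKernel Φ a N (pairVec x y) * f y =
      ∑' ν, osc (remPiece Φ a N ν) (x, y) * f y := fun y => by
    rw [remKernel, unpair_pairVec, tsum_mul_right]
  simp only [e]
  exact key

/-- The remainder is an integral operator. -/
lemma opAmp_sub_symSeries {f : Eucl d → ℂ} (hf : f ∈ SOmega ω d) (x : Eucl d) :
    opAmp (fun w => a w - symSeries Φ a N (w.1, w.2.2)) f x =
      ∫ y, remKernel Φ a N (pairVec x y) * f y := by
  have h1 := h.tendsto_opAmp_sum_remPiece hf x
  simp only [h.opAmp_sum_remPiece hf x] at h1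
  exact tendsto_nhds_unique h1
    ((h.hasSum_integral_osc hf x).tendsto_sum_nat.comp (tendsto_add_atTop_nat 1))

end ExpansionData

theorem theorem5p5 (d : ℕ) (ω σ : ℝ → ℝ) (m ρ : ℝ)
    (hω : IsWeightFunction ω) (hρ0 : 0 < ρ) (hρ1 : ρ ≤ 1)
    (hσ : IsWeightFunction σ)
    (hωσ : (fun t : ℝ => ω (t ^ (1 / ρ))) =O[Filter.atTop] σ)
    (a : Eucl d × Eucl d × Eucl d → ℂ) (ha : IsAmplitude ω m ρ a) :
    ∃ (p : Eucl d × Eucl d → ℂ) (R : (Eucl d → ℂ) → Eucl d → ℂ),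
      IsSymbol ω (max m (2 * m)) ρ p ∧
      IsRegularizing ω ρ R ∧
      (∀ u ∈ SOmega ω d, ∀ x : Eucl d, opAmp a u x = opSymbol p u x + R u x) ∧
      FormalEquiv ω (max m (2 * m)) ρ (symbolSum p) (diagTerm a) := by
  obtain ⟨Φ, q, VΦ, V, U, N, h⟩ := IsAmplitude.exists_expansionData hω hσ hρ0 hρ1 hωσ ha
  have hm : (0 : ℝ) ≤ 2 * |m| := by positivity
  -- The remainder is defined as the operator of the amplitude a - p, of order 2|m|; it is thus
  -- pseudodifferential by construction, and the kernel formula makes it regularizing.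
  refine ⟨symSeries Φ a N, opAmp fun w => a w - symSeries Φ a N (w.1, w.2.2), h.isSymbol_symSeries,
    ⟨⟨2 * |m|, _, AmpBound.isAmplitude (h.smooth.sub h.contDiff_symSeries_amp) h.adm_sub
      h.ampBound_sub_symSeries, fun _ _ _ => rfl⟩, remKernel Φ a N, h.remKernel_mem_SOmega,
      fun f hf x => h.opAmp_sub_symSeries hf x⟩, fun u hu x => ?_, h.formalEquiv⟩
  have hA := h.amp.mono_exp h.weight h.adm.nonneg ExpansionData.le_two_mul_abs.1
  have hP := h.ampBound_of_symBound h.contDiff_symSeries h.symBound_symSeries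
  rw [opAmp_sub hω hm h.smooth h.contDiff_symSeries_amp hA hP hu x
    (h.integrable_integral_amp hm h.adm h.smooth hA hu x)
    (h.integrable_integral_amp hm (h.adm_symBound.pow_mul hω hρ0 zero_le_two)
      h.contDiff_symSeries_amp hP hu x), opSymbol, add_sub_cancel]

end
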